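/- Let $N\ge 2$, $\hbar>0$, $k,\mu,\tilde\mu,\delta\in\mathbb R$, and let $\Omega\subset\mathbb R^N\setminus\{0\}$ be a nonempty open set. On $C^\infty(\Omega)$ put $r=|x|$, $p_j=-i\hbar\partial_j$, $L_{ij}=x_ip_j-x_jp_i$, and for a set $S$ of indices $J_-^S=\sum_{i\in S}x_i^2$, $J_+^S=\sum_{i\in S}p_i^2$, $J_3^S=-i\hbar\sum_{i\in S}(x_i\partial_i+\tfrac12)$, $C^S=\tfrac12(J_+^SJ_-^S+J_-^SJ_+^S)-(J_3^S)^2$. Write $J_\pm,J_3,C$ when $S=\{1,\dots,N\}$, and $C^{(a)}$, $C_{(a)}$ for the Casimir operators $C^S$ of the first, respectively the last, $a$ coordinates. With $L^2:=C+\hbar^2$ let $$H_\beta=\frac{(1+k^2J_-)^2}{2}\Big(\frac1{J_-}(J_3+i\hbar)^2+\frac{L^2}{\beta^2J_-}\Big)-\frac{\mu}{\sqrt{J_-}}(1-k^2J_-),$$ $$\hat H_\beta=\frac{\sqrt{J_-}\,(1+k^2J_-)^2}{2(1-k^2J_--4\delta\sqrt{J_-})}\Big(\frac1{J_-}(J_3+i\hbar)^2+\frac{L^2}{\beta^2J_-}\Big)+\frac{\tilde\mu\sqrt{J_-}}{2(1-k^2J_--4\delta\sqrt{J_-})},$$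 where for $\hat H_\beta$ it is assumed that $1-k^2r^2-4\delta r\neq0$ on $\Omega$. Let $\gamma_1,\dots,\gamma_N$ be any Hermitian matrices of positive size with $\gamma_i\gamma_j+\gamma_j\gamma_i=2\delta_{ij}$. On vector-valued smooth functions put $L=-\tfrac i2\big(\sum_{i,j}\gamma_i\gamma_jL_{ij}+i\hbar(N-2)\big)$ (a square root of $C+\hbar^2$) and, for $1\le j\le N$, $$L_j^+=L\frac{x_j}{\sqrt{J_-}}+\frac{i}{\sqrt{J_-}}(x_jJ_3-J_-p_j),\qquad L_j^-=\frac{x_j}{\sqrt{J_-}}L-\frac{i}{\sqrt{J_-}}(x_jJ_3-J_-p_j+i\hbar x_j),$$ $$A_\beta(L)=\tfrac1{\sqrt2}\Big(-(\tfrac L\beta+\tfrac\hbar2)\tfrac{1+k^2J_-}{\sqrt{J_-}}(J_3+i\hbar)-i\tfrac L\beta(\tfrac L\beta+\tfrac\hbar2)\tfrac{1-k^2J_-}{\sqrt{J_-}}\Big)+\tfrac{i\mu}{\sqrt2},$$ $$A_\beta^\dagger(L)=\tfrac1{\sqrt2}\Big(-(\tfrac L\beta+\tfrac\hbar2)\tfrac{1+k^2J_-}{\sqrt{J_-}}(J_3+i\hbar)+i(\tfrac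 L\beta+\hbar)(\tfrac L\beta+\tfrac\hbar2)\tfrac{1-k^2J_-}{\sqrt{J_-}}\Big)-\tfrac{i\mu}{\sqrt2},$$ $(A_\beta)^n=A_\beta(L+(n-1)\hbar\beta)\cdots A_\beta(L+\hbar\beta)A_\beta(L)$ and $(A_\beta^\dagger)^n=A_\beta^\dagger(L)A_\beta^\dagger(L+\hbar\beta)\cdots A_\beta^\dagger(L+(n-1)\hbar\beta)$. The operators $\hat A_\beta(L)$ and $\hat A_\beta^\dagger(L)$ are obtained by replacing $\mu$ by $\hat H_\beta(L)$ in $A_\beta(L)$ and by $\hat H_\beta(L+\hbar\beta)$ in $A_\beta^\dagger(L)$, where $\hat H_\beta(\Lambda)$ is $\hat H_\beta$ with $L^2$ replaced by $\Lambda^2$; their shifted powers are defined in the same way. Operators $F_1,\dots,F_d$ are called algebraically independent if no nonzero polynomial in them, with every monomial completely symmetrized over the orderings of its factors, vanishes. Adjoints are formal adjoints on test functions in $\Omega$, for the weight $(1+k^2r^2)^{-2}dx$ in the case of $H_\beta$, and for the (signed) weight $(\tfrac1r-k^2r-4\delta)(1+k^2r^2)^{-2}dx$ in the case of $\hat H_\beta$.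 **(1)** Let $\beta=m/n$ with positive integers $m,n$, let $1\le j\le N$, and put $X=(L_j^+)^m(A_\beta)^n$, $Y=(A_\beta^\dagger)^n(L_j^-)^m$, $$R_{\beta,1}=\tfrac1{\sqrt2}(X+Y),\qquad R_{\beta,2}=\tfrac1{i\sqrt2}(X-Y).$$ Then $Y$ is the adjoint of $X$; $R_{\beta,1}$ and $R_{\beta,2}$ are symmetric differential operators of order exactly $m+2n$ that commute with $H_\beta$; the Casimir operators $C^{(a)},C_{(a)}$ $(2\le a\le N)$ commute with $H_\beta$; and $C^{(2)},\dots,C^{(N)},C_{(2)},\dots,C_{(N-1)}$ together with any two of $H_\beta,R_{\beta,1},R_{\beta,2}$ are $2N-1$ algebraically independent operators. Moreover $X=P+LQ$ and $Y=P'+Q'L$ with scalar differential operators $P,Q,P',Q'$ (not involving the $\gamma_i$) that commute with $H_\beta$, where $P,P'$ have order at most $m+2n$ and $Q,Q'$ have order exactly $m+2n-1$. **(2)** For every nonzero $\beta\in\mathbb Q$, the scalar operator $H_\beta$ on $C^\infty(\Omega)$ is maximally superintegrable: it belongs to a family of $2N-1$ algebraically independent symmetric scalar differential operators commuting with it, of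 which some $N$, $H_\beta$ among them, commute with each other. **(3)** Statements (1) and (2) also hold for $\hat H_\beta$, with $\hat A_\beta,\hat A_\beta^\dagger$ in the place of $A_\beta,A_\beta^\dagger$. -/

import Mathlib

open scoped ContDiff

noncomputable section

namespace CurvedCoulomb

/-! ### Function spaces and operators -/

/-- Euclidean space of dimension `N`; its norm is the radial coordinate `r`. -/
abbrev Space (N : ℕ) : Type := EuclideanSpace ℝ (Fin N)

/-- A nonempty open subset of `ℝ^N` that does not contain the origin. -/
structure Region (N : ℕ) where
  carrier : Set (Space N)
  isOpen : IsOpen carrier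
  nonempty : carrier.Nonempty
  zero_notMem : (0 : Space N) ∉ carrier

variable {N : ℕ}

/-- The complex vector space `C^∞(Ω, ℂ)`. A smooth function on `Ω` is represented by its extension
by zero to the whole space, so that equality in this space is equality on `Ω`. -/
def Smooth (Ω : Region N) : Submodule ℂ (Space N → ℂ) where
  carrier := {f | ContDiffOn ℝ ∞ f Ω.carrier ∧ ∀ x, x ∉ Ω.carrier → f x = 0}
  zero_mem' := ⟨contDiffOn_const, fun _ _ => rfl⟩
  add_mem' := fun ha hb => ⟨ha.1.add hb.1, fun x hx => by
    rw [Pi.add_apply, ha.2 x hx, hb.2 x hx, add_zero]⟩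
  smul_mem' := fun c _ ha => ⟨ha.1.const_smul c, fun x hx => by
    rw [Pi.smul_apply, ha.2 x hx, smul_zero]⟩

/-- The element of `C^∞(Ω, ℂ)` given by a function that is smooth on `Ω`. -/
def Smooth.of (Ω : Region N) (a : Space N → ℂ) (ha : ContDiffOn ℝ ∞ a Ω.carrier) : Smooth Ω :=
  ⟨Ω.carrier.indicator a,
    ha.congr fun _ hx => Set.indicator_of_mem hx a,
    fun _ hx => Set.indicator_of_notMem hx a⟩

/-- Linear operators on `C^∞(Ω, ℂ)`. -/
abbrev ScalarOp (Ω : Region N) : Type := Module.End ℂ (Smooth Ω)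

/-- Operators on the functions on `Ω` with values in `ℂ^ι`, as matrices of scalar operators. -/
abbrev SpinOp (Ω : Region N) (ι : Type*) := Matrix ι ι (ScalarOp Ω)

/-- Multiplication by a smooth function. -/
def mulOp {Ω : Region N} (a : Smooth Ω) : ScalarOp Ω where
  toFun f := ⟨fun x => (a : Space N → ℂ) x * (f : Space N → ℂ) x,
    a.2.1.mul f.2.1, fun x hx => by simp only [a.2.2 x hx, zero_mul]⟩
  map_add' f g := by
    ext x; simp only [Submodule.coe_add, Pi.add_apply, mul_add]
  map_smul' c f := by
    ext x
    simp only [Submodule.coe_smul, Pi.smul_apply, smul_eq_mul, RingHom.id_apply]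
    ring

/-- The position operator `x_j`. -/
def xOp (Ω : Region N) (j : Fin N) : ScalarOp Ω :=
  mulOp (Smooth.of Ω (fun x => ((x j : ℝ) : ℂ))
    (Complex.ofRealCLM.contDiff.comp_contDiffOn
      (EuclideanSpace.proj (𝕜 := ℝ) j).contDiff.contDiffOn))

theorem contDiffOn_norm (Ω : Region N) :
    ContDiffOn ℝ ∞ (fun x : Space N => ‖x‖) Ω.carrier :=
  fun x hx => (contDiffAt_norm ℝ fun h : x = 0 => Ω.zero_notMem (h ▸ hx)).contDiffWithinAt

/-- Multiplication by `r = |x|`. -/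
def rOp (Ω : Region N) : ScalarOp Ω :=
  mulOp (Smooth.of Ω (fun x => ((‖x‖ : ℝ) : ℂ))
    (Complex.ofRealCLM.contDiff.comp_contDiffOn (contDiffOn_norm Ω)))

/-- Multiplication by `1 / r`. -/
def rInvOp (Ω : Region N) : ScalarOp Ω :=
  mulOp (Smooth.of Ω (fun x => ((‖x‖⁻¹ : ℝ) : ℂ))
    (Complex.ofRealCLM.contDiff.comp_contDiffOn ((contDiffOn_norm Ω).inv
      fun _ hx h => Ω.zero_notMem (norm_eq_zero.mp h ▸ hx))))

/-- The momentum operator `p_j = -i ħ ∂_j`. -/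
def pOp (ħ : ℝ) (Ω : Region N) (j : Fin N) : ScalarOp Ω where
  toFun f := (-(Complex.I * (ħ : ℂ))) • Smooth.of Ω
    (fun x => fderiv ℝ (f : Space N → ℂ) x (EuclideanSpace.single j 1))
    ((f.2.1.fderiv_of_isOpen Ω.isOpen (by simp)).clm_apply contDiffOn_const)
  map_add' f g := by
    rw [← smul_add]
    congr 1
    ext x
    by_cases hx : x ∈ Ω.carrier
    · have hf := (f.2.1.contDiffAt (Ω.isOpen.mem_nhds hx)).differentiableAt (by simp)
      have hg := (g.2.1.contDiffAt (Ω.isOpen.mem_nhds hx)).differentiableAt (by simp)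
      simp [Smooth.of, hx, fderiv_add hf hg]
    · simp [Smooth.of, hx]
  map_smul' c f := by
    rw [RingHom.id_apply, smul_comm c]
    congr 1
    ext x
    by_cases hx : x ∈ Ω.carrier
    · have hf := (f.2.1.contDiffAt (Ω.isOpen.mem_nhds hx)).differentiableAt (by simp)
      simp [Smooth.of, hx, fderiv_const_smul hf]
    · simp [Smooth.of, hx]

/-- `P` is a linear differential operator with smooth coefficients, of order at most `d`:
iterated commutators with multiplication operators vanish after `d + 1` steps. -/
def HasOrderLE {Ω : Region N} : ℕ → ScalarOp Ω → Prop
  | 0, P => ∀ a : Smooth Ω, P * mulOp a - mulOp a * P = 0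
  | d + 1, P => ∀ a : Smooth Ω, HasOrderLE d (P * mulOp a - mulOp a * P)

/-- A matrix of operators has order at most `d` if all of its entries do. -/
def SpinHasOrderLE {Ω : Region N} {ι : Type*} (d : ℕ) (X : SpinOp Ω ι) : Prop :=
  ∀ a b, HasOrderLE d (X a b)

/-- `Q` is the formal adjoint of `P` with respect to the weight `w`:
`∫ conj(f) (P g) w dx = ∫ conj(Q f) g w dx` for all test functions `f, g` on `Ω`. -/
def IsFormalAdjoint {Ω : Region N} (w : Space N → ℝ) (P Q : ScalarOp Ω) : Prop :=
  ∀ f g : Smooth Ω,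
    HasCompactSupport (f : Space N → ℂ) → tsupport (f : Space N → ℂ) ⊆ Ω.carrier →
    HasCompactSupport (g : Space N → ℂ) → tsupport (g : Space N → ℂ) ⊆ Ω.carrier →
    ∫ x, (starRingEnd ℂ) ((f : Space N → ℂ) x) * ((P g : Smooth Ω) : Space N → ℂ) x * (w x : ℂ) =
      ∫ x, (starRingEnd ℂ) (((Q f : Smooth Ω) : Space N → ℂ) x) * (g : Space N → ℂ) x * (w x : ℂ)

/-- Formal adjointness of matrices of operators: entrywise after transposition, which is formal
adjointness for the pairing `∫ ∑ a, conj(f_a) g_a w dx` of vector valued test functions. -/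
def SpinIsFormalAdjoint {Ω : Region N} {ι : Type*} (w : Space N → ℝ) (X Y : SpinOp Ω ι) : Prop :=
  ∀ a b, IsFormalAdjoint w (X a b) (Y b a)

/-! ### Algebraic independence of operators -/

/-- The completely symmetrized product of the elements of a list: the mean of the products over all
orderings. -/
def symProd {B : Type*} [Ring B] [Algebra ℂ B] (l : List B) : B :=
  ((l.length.factorial : ℂ)⁻¹) • (l.permutations.map List.prod).sum

/-- The symmetrized monomial of multidegree `s` in the (possibly noncommuting) elements `F i`. -/
def symMonomial {σ B : Type*} [Ring B] [Algebra ℂ B] (F : σ → B) (s : σ →₀ ℕ) : B :=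
  symProd ((Finsupp.toMultiset s).toList.map F)

/-- Algebraic independence of possibly noncommuting operators: no nonzero symmetrized polynomial
in the `F i` vanishes. -/
def AlgIndep {σ B : Type*} [Ring B] [Algebra ℂ B] (F : σ → B) : Prop :=
  ∀ P : MvPolynomial σ ℂ, (∑ s ∈ P.support, P.coeff s • symMonomial F s) = 0 → P = 0

/-- `H`, symmetric for the weight `w`, is maximally superintegrable: it belongs to a family of
`2N - 1` algebraically independent symmetric differential operators that commute with it,
and `N` of these operators, `H` among them, commute with each other. -/
def IsMaximallySuperintegrable {Ω : Region N} (w : Space N → ℝ) (H : ScalarOp Ω) : Prop :=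
  ∃ F : Fin (2 * N - 1) → ScalarOp Ω,
    (∀ i, ∃ d, HasOrderLE d (F i)) ∧ (∀ i, IsFormalAdjoint w (F i) (F i)) ∧
    (∀ i, Commute (F i) H) ∧ AlgIndep F ∧
    ∃ S : Finset (Fin (2 * N - 1)), S.card = N ∧ (∃ i ∈ S, F i = H) ∧
      ∀ i ∈ S, ∀ j ∈ S, Commute (F i) (F j)

/-! ### The `sl(2)` generators and the Casimir operators -/

/-- `J_-` built from the coordinates in `S`. -/
def JMinus (Ω : Region N) (S : Finset (Fin N)) : ScalarOp Ω := ∑ i ∈ S, xOp Ω i ^ 2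

/-- `J_+` built from the coordinates in `S`. -/
def JPlus (ħ : ℝ) (Ω : Region N) (S : Finset (Fin N)) : ScalarOp Ω := ∑ i ∈ S, pOp ħ Ω i ^ 2

/-- `J_3 = -i ħ ∑ (x_i ∂_i + 1/2)` built from the coordinates in `S`. -/
def J3 (ħ : ℝ) (Ω : Region N) (S : Finset (Fin N)) : ScalarOp Ω :=
  ∑ i ∈ S, (xOp Ω i * pOp ħ Ω i - (Complex.I * ħ / 2) • 1)

/-- The Casimir operator `C = (J_+ J_- + J_- J_+) / 2 - J_3^2` of the coordinates in `S`. -/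
def casimir (ħ : ℝ) (Ω : Region N) (S : Finset (Fin N)) : ScalarOp Ω :=
  (1 / 2 : ℂ) • (JPlus ħ Ω S * JMinus Ω S + JMinus Ω S * JPlus ħ Ω S) - J3 ħ Ω S ^ 2

/-- `C^{(a)}`: the Casimir operator of the first `a` coordinates. -/
def casimirFirst (ħ : ℝ) (Ω : Region N) (a : ℕ) : ScalarOp Ω :=
  casimir ħ Ω {i | (i : ℕ) < a}

/-- `C_{(a)}`: the Casimir operator of the last `a` coordinates. -/
def casimirLast (ħ : ℝ) (Ω : Region N) (a : ℕ) : ScalarOp Ω :=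
  casimir ħ Ω {i | N ≤ (i : ℕ) + a}

/-- `L^2 = C + ħ^2`, as a scalar operator. -/
def LSq (ħ : ℝ) (Ω : Region N) : ScalarOp Ω := casimir ħ Ω Finset.univ + ((ħ : ℂ) ^ 2) • 1

/-- `1 + k^2 J_-`. -/
def onePlus (k : ℝ) (Ω : Region N) : ScalarOp Ω := 1 + ((k : ℂ) ^ 2) • JMinus Ω Finset.univ

/-- `1 - k^2 J_-`. -/
def oneMinus (k : ℝ) (Ω : Region N) : ScalarOp Ω := 1 - ((k : ℂ) ^ 2) • JMinus Ω Finset.univ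

/-- `J_3 + i ħ`. -/
def J3Shift (ħ : ℝ) (Ω : Region N) : ScalarOp Ω := J3 ħ Ω Finset.univ + (Complex.I * ħ) • 1

/-! ### The Hamiltonians -/

/-- `H_β = (1 + k² J_-)²/2 · ((J_3 + iħ)²/J_- + L²/(β² J_-)) - μ (1 - k² J_-)/√J_-`. -/
def hamiltonian (ħ k μ β : ℝ) (Ω : Region N) : ScalarOp Ω :=
  (1 / 2 : ℂ) • (onePlus k Ω ^ 2 *
    (rInvOp Ω ^ 2 * J3Shift ħ Ω ^ 2 + ((β : ℂ) ^ 2)⁻¹ • (rInvOp Ω ^ 2 * LSq ħ Ω)))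
  - (μ : ℂ) • (rInvOp Ω * oneMinus k Ω)

/-- `Ω` avoids the zeros of `1 - k² r² - 4 δ r`. -/
def Admissible (k δ : ℝ) (Ω : Region N) : Prop :=
  ∀ x ∈ Ω.carrier, 1 - k ^ 2 * ‖x‖ ^ 2 - 4 * δ * ‖x‖ ≠ 0

/-- Multiplication by `√J_- / (1 - k² J_- - 4 δ √J_-)`. -/
def vInvOp (k δ : ℝ) (Ω : Region N) (hΩ : Admissible k δ Ω) : ScalarOp Ω :=
  mulOp (Smooth.of Ω
    (fun x => ((‖x‖ * (1 - k ^ 2 * ‖x‖ ^ 2 - 4 * δ * ‖x‖)⁻¹ : ℝ) : ℂ))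
    (Complex.ofRealCLM.contDiff.comp_contDiffOn ((contDiffOn_norm Ω).mul
      (((contDiffOn_const.sub (contDiffOn_const.mul ((contDiffOn_norm Ω).pow 2))).sub
        (contDiffOn_const.mul (contDiffOn_norm Ω))).inv hΩ))))

/-- The coupling constant metamorphosis partner
`Ĥ_β = √J_- (1 + k² J_-)²/(2 (1 - k² J_- - 4δ√J_-)) · ((J_3 + iħ)²/J_- + L²/(β² J_-))
  + μ' √J_- / (2 (1 - k² J_- - 4δ√J_-))`. -/
def hatHamiltonian (ħ k μ' δ β : ℝ) (Ω : Region N) (hΩ : Admissible k δ Ω) : ScalarOp Ω :=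
  (1 / 2 : ℂ) • (vInvOp k δ Ω hΩ * onePlus k Ω ^ 2 *
    (rInvOp Ω ^ 2 * J3Shift ħ Ω ^ 2 + ((β : ℂ) ^ 2)⁻¹ • (rInvOp Ω ^ 2 * LSq ħ Ω)))
  + ((μ' : ℂ) / 2) • vInvOp k δ Ω hΩ

/-- The weight `(1 + k² r²)⁻²` for which `H_β` is symmetric. -/
def weight (k : ℝ) (x : Space N) : ℝ := ((1 + k ^ 2 * ‖x‖ ^ 2) ^ 2)⁻¹

/-- The weight `(1/r - k² r - 4δ) (1 + k² r²)⁻²` for which `Ĥ_β` is symmetric. -/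
def hatWeight (k δ : ℝ) (x : Space N) : ℝ := (‖x‖⁻¹ - k ^ 2 * ‖x‖ - 4 * δ) * weight k x

/-! ### The angular momentum `L`, its ladder operators, and the radial ladder operators -/

/-- Hermitian matrices `γ_1, …, γ_N` with `γ_i γ_j + γ_j γ_i = 2 δ_{ij}`. -/
structure GammaMatrices (N : ℕ) (ι : Type*) [Fintype ι] [DecidableEq ι] where
  mat : Fin N → Matrix ι ι ℂ
  isHermitian : ∀ i, (mat i).IsHermitian
  sq : ∀ i, mat i * mat i = 1
  anticomm : ∀ i j, i ≠ j → mat i * mat j + mat j * mat i = 0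

open scoped Kronecker in
/-- Gamma matrices exist in every dimension. -/
theorem GammaMatrices.exists (N : ℕ) : ∃ (d : ℕ), 0 < d ∧
    Nonempty (GammaMatrices N (Fin d)) := by
  suffices h : ∃ (ι : Type) (_ : Fintype ι) (_ : DecidableEq ι) (_ : Nonempty ι),
      Nonempty (GammaMatrices N ι) by
    obtain ⟨ι, _, _, _, ⟨γ⟩⟩ := h
    let e := Fintype.equivFin ι
    refine ⟨Fintype.card ι, Fintype.card_pos, ⟨⟨fun i => (γ.mat i).submatrix e.symm e.symm,
      fun i => (γ.isHermitian i).submatrix _, fun i => ?_, fun i j hij => ?_⟩⟩⟩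
    · rw [Matrix.submatrix_mul_equiv, γ.sq, Matrix.submatrix_one_equiv]
    · rw [Matrix.submatrix_mul_equiv, Matrix.submatrix_mul_equiv]
      ext a b
      exact congrFun (congrFun (γ.anticomm i j hij) (e.symm a)) (e.symm b)
  induction N with
  | zero => exact ⟨Unit, inferInstance, inferInstance, inferInstance,
      ⟨⟨fun i => i.elim0, fun i => i.elim0, fun i => i.elim0, fun i => i.elim0⟩⟩⟩
  | succ N ih =>
    obtain ⟨ι, _, _, _, ⟨γ⟩⟩ := ih
    let s1 : Matrix (Fin 2) (Fin 2) ℂ := !![0, 1; 1, 0]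
    let s3 : Matrix (Fin 2) (Fin 2) ℂ := !![1, 0; 0, -1]
    have h11 : s1 * s1 = 1 := by
      ext i j; fin_cases i <;> fin_cases j <;> simp [s1, Matrix.mul_apply]
    have h33 : s3 * s3 = 1 := by
      ext i j; fin_cases i <;> fin_cases j <;> simp [s3, Matrix.mul_apply]
    have h13 : s1 * s3 = -(s3 * s1) := by
      ext i j; fin_cases i <;> fin_cases j <;> simp [s1, s3, Matrix.mul_apply]
    have h1 : s1.conjTranspose = s1 := by
      ext i j; fin_cases i <;> fin_cases j <;> simp [s1]
    have h3 : s3.conjTranspose = s3 := by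
      ext i j; fin_cases i <;> fin_cases j <;> simp [s3]
    refine ⟨ι × Fin 2, inferInstance, inferInstance, inferInstance,
      ⟨⟨Fin.lastCases (1 ⊗ₖ s1) (fun i => γ.mat i ⊗ₖ s3), ?_, ?_, ?_⟩⟩⟩
    · intro i
      refine Fin.lastCases ?_ (fun i => ?_) i
      · rw [Fin.lastCases_last, Matrix.IsHermitian, Matrix.conjTranspose_kronecker, h1,
          Matrix.conjTranspose_one]
      · rw [Fin.lastCases_castSucc, Matrix.IsHermitian, Matrix.conjTranspose_kronecker, h3,
          (γ.isHermitian i).eq]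
    · intro i
      refine Fin.lastCases ?_ (fun i => ?_) i
      · rw [Fin.lastCases_last, ← Matrix.mul_kronecker_mul, h11, one_mul,
          Matrix.one_kronecker_one]
      · rw [Fin.lastCases_castSucc, ← Matrix.mul_kronecker_mul, h33, γ.sq,
          Matrix.one_kronecker_one]
    · intro i j
      refine Fin.lastCases ?_ (fun i => ?_) i <;> refine Fin.lastCases ?_ (fun j => ?_) j
      · exact fun h => (h rfl).elim
      · intro _
        rw [Fin.lastCases_last, Fin.lastCases_castSucc, ← Matrix.mul_kronecker_mul,
          ← Matrix.mul_kronecker_mul, h13, one_mul, mul_one]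
        ext a b
        simp [Matrix.kroneckerMap_apply]
      · intro _
        rw [Fin.lastCases_last, Fin.lastCases_castSucc, ← Matrix.mul_kronecker_mul,
          ← Matrix.mul_kronecker_mul, h13, one_mul, mul_one]
        ext a b
        simp [Matrix.kroneckerMap_apply]
      · intro hij
        rw [Fin.lastCases_castSucc, Fin.lastCases_castSucc, ← Matrix.mul_kronecker_mul,
          ← Matrix.mul_kronecker_mul, h33, ← Matrix.add_kronecker,
          γ.anticomm i j (fun h => hij (h ▸ rfl)), Matrix.zero_kronecker]

variable {ι : Type*} [Fintype ι] [DecidableEq ι]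

/-- A scalar operator, acting on every component. -/
abbrev scal {Ω : Region N} (ι : Type*) [Fintype ι] [DecidableEq ι] (P : ScalarOp Ω) : SpinOp Ω ι :=
  Matrix.scalar ι P

/-- `γ_j`, acting on functions with values in `ℂ^ι`. -/
def gammaOp (γ : GammaMatrices N ι) (Ω : Region N) (j : Fin N) : SpinOp Ω ι :=
  (γ.mat j).map (algebraMap ℂ (ScalarOp Ω))

/-- `L_{ij} = x_i p_j - x_j p_i`. -/
def rotOp (ħ : ℝ) (Ω : Region N) (i j : Fin N) : ScalarOp Ω :=
  xOp Ω i * pOp ħ Ω j - xOp Ω j * pOp ħ Ω i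

/-- `L = -(i/2) (∑_{i,j} γ_i γ_j L_{ij} + i ħ (N - 2))`. -/
def angL (ħ : ℝ) (γ : GammaMatrices N ι) (Ω : Region N) : SpinOp Ω ι :=
  (-(Complex.I / 2)) •
    (∑ i, ∑ j, gammaOp γ Ω i * gammaOp γ Ω j * scal ι (rotOp ħ Ω i j)
      + (Complex.I * ħ * ((N : ℂ) - 2)) • 1)

/-- `L_j^+ = L x_j/√J_- + (i/√J_-) (x_j J_3 - J_- p_j)`. -/
def ladPlus (ħ : ℝ) (γ : GammaMatrices N ι) (Ω : Region N) (j : Fin N) : SpinOp Ω ι :=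
  angL ħ γ Ω * scal ι (xOp Ω j * rInvOp Ω)
  + Complex.I • scal ι (rInvOp Ω *
      (xOp Ω j * J3 ħ Ω Finset.univ - JMinus Ω Finset.univ * pOp ħ Ω j))

/-- `L_j^- = (x_j/√J_-) L - (i/√J_-) (x_j J_3 - J_- p_j + i ħ x_j)`. -/
def ladMinus (ħ : ℝ) (γ : GammaMatrices N ι) (Ω : Region N) (j : Fin N) : SpinOp Ω ι :=
  scal ι (xOp Ω j * rInvOp Ω) * angL ħ γ Ω
  - Complex.I • scal ι (rInvOp Ω *
      (xOp Ω j * J3 ħ Ω Finset.univ - JMinus Ω Finset.univ * pOp ħ Ω j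
        + (Complex.I * ħ) • xOp Ω j))

/-- `(1/√2) (-(Λ/β + ħ/2) (1 + k²J_-)/√J_- (J_3 + iħ) - i (Λ/β)(Λ/β + ħ/2)(1 - k²J_-)/√J_-)
  + i M/√2`. With `M = μ` this is `A_β(Λ)`, with `M = Ĥ_β(Λ)` it is `Â_β(Λ)`. -/
def lowerForm (ħ k β : ℝ) (Ω : Region N) (Λ M : SpinOp Ω ι) : SpinOp Ω ι :=
  ((√2 : ℝ) : ℂ)⁻¹ •
    (-(((β : ℂ)⁻¹ • Λ + ((ħ : ℂ) / 2) • 1) *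
        scal ι (onePlus k Ω * rInvOp Ω * J3Shift ħ Ω))
      - Complex.I • (((β : ℂ)⁻¹ • Λ) * ((β : ℂ)⁻¹ • Λ + ((ħ : ℂ) / 2) • 1) *
        scal ι (rInvOp Ω * oneMinus k Ω))
      + Complex.I • M)

/-- `(1/√2) (-(Λ/β + ħ/2) (1 + k²J_-)/√J_- (J_3 + iħ) + i (Λ/β + ħ)(Λ/β + ħ/2)(1 - k²J_-)/√J_-)
  - i M/√2`. With `M = μ` this is `A_β†(Λ)`, with `M = Ĥ_β(Λ + ħβ)` it is `Â_β†(Λ)`. -/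
def raiseForm (ħ k β : ℝ) (Ω : Region N) (Λ M : SpinOp Ω ι) : SpinOp Ω ι :=
  ((√2 : ℝ) : ℂ)⁻¹ •
    (-(((β : ℂ)⁻¹ • Λ + ((ħ : ℂ) / 2) • 1) *
        scal ι (onePlus k Ω * rInvOp Ω * J3Shift ħ Ω))
      + Complex.I • (((β : ℂ)⁻¹ • Λ + (ħ : ℂ) • 1) * ((β : ℂ)⁻¹ • Λ + ((ħ : ℂ) / 2) • 1) *
        scal ι (rInvOp Ω * oneMinus k Ω))
      - Complex.I • M)

/-- `A_β(Λ)`. -/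
def ladA (ħ k μ β : ℝ) (Ω : Region N) (Λ : SpinOp Ω ι) : SpinOp Ω ι :=
  lowerForm ħ k β Ω Λ ((μ : ℂ) • 1)

/-- `A_β†(Λ)`. -/
def ladADag (ħ k μ β : ℝ) (Ω : Region N) (Λ : SpinOp Ω ι) : SpinOp Ω ι :=
  raiseForm ħ k β Ω Λ ((μ : ℂ) • 1)

/-- `Ĥ_β(Λ)`: the partner Hamiltonian with `Λ` in the place of `L`. -/
def hatHamiltonianAt (ħ k μ' δ β : ℝ) (Ω : Region N) (hΩ : Admissible k δ Ω)
    (Λ : SpinOp Ω ι) : SpinOp Ω ι :=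
  (1 / 2 : ℂ) • (scal ι (vInvOp k δ Ω hΩ * onePlus k Ω ^ 2) *
    (scal ι (rInvOp Ω ^ 2 * J3Shift ħ Ω ^ 2) + ((β : ℂ) ^ 2)⁻¹ • (scal ι (rInvOp Ω ^ 2) * Λ ^ 2)))
  + ((μ' : ℂ) / 2) • scal ι (vInvOp k δ Ω hΩ)

/-- `Â_β(Λ)`. -/
def hatLadA (ħ k μ' δ β : ℝ) (Ω : Region N) (hΩ : Admissible k δ Ω)
    (Λ : SpinOp Ω ι) : SpinOp Ω ι :=
  lowerForm ħ k β Ω Λ (hatHamiltonianAt ħ k μ' δ β Ω hΩ Λ)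

/-- `Â_β†(Λ)`. -/
def hatLadADag (ħ k μ' δ β : ℝ) (Ω : Region N) (hΩ : Admissible k δ Ω)
    (Λ : SpinOp Ω ι) : SpinOp Ω ι :=
  raiseForm ħ k β Ω Λ (hatHamiltonianAt ħ k μ' δ β Ω hΩ (Λ + ((ħ : ℂ) * β) • 1))

/-- `T(Λ + (n-1)c) ⋯ T(Λ + c) T(Λ)`. -/
def shiftPow {B : Type*} [Ring B] [Algebra ℂ B] (T : B → B) (c : ℂ) (Λ : B) : ℕ → B
  | 0 => 1
  | n + 1 => T (Λ + ((n : ℂ) * c) • 1) * shiftPow T c Λ n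

/-- `T(Λ) T(Λ + c) ⋯ T(Λ + (n-1)c)`. -/
def shiftPowRev {B : Type*} [Ring B] [Algebra ℂ B] (T : B → B) (c : ℂ) (Λ : B) : ℕ → B
  | 0 => 1
  | n + 1 => shiftPowRev T c Λ n * T (Λ + ((n : ℂ) * c) • 1)

/-! ### The integrals -/

/-- `(L_j^+)^m (A_β)^n` with `β = m/n`. -/
def raisingIntegral (ħ k μ : ℝ) (γ : GammaMatrices N ι) (Ω : Region N) (m n : ℕ) (j : Fin N) :
    SpinOp Ω ι :=
  ladPlus ħ γ Ω j ^ m *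
    shiftPow (ladA ħ k μ ((m : ℝ) / n) Ω) ((ħ : ℂ) * (((m : ℝ) / n : ℝ) : ℂ)) (angL ħ γ Ω) n

/-- `(A_β†)^n (L_j^-)^m` with `β = m/n`. -/
def loweringIntegral (ħ k μ : ℝ) (γ : GammaMatrices N ι) (Ω : Region N) (m n : ℕ) (j : Fin N) :
    SpinOp Ω ι :=
  shiftPowRev (ladADag ħ k μ ((m : ℝ) / n) Ω) ((ħ : ℂ) * (((m : ℝ) / n : ℝ) : ℂ))
    (angL ħ γ Ω) n * ladMinus ħ γ Ω j ^ m

/-- `(L_j^+)^m (Â_β)^n` with `β = m/n`. -/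
def hatRaisingIntegral (ħ k μ' δ : ℝ) (γ : GammaMatrices N ι) (Ω : Region N)
    (hΩ : Admissible k δ Ω) (m n : ℕ) (j : Fin N) : SpinOp Ω ι :=
  ladPlus ħ γ Ω j ^ m *
    shiftPow (hatLadA ħ k μ' δ ((m : ℝ) / n) Ω hΩ) ((ħ : ℂ) * (((m : ℝ) / n : ℝ) : ℂ))
      (angL ħ γ Ω) n

/-- `(Â_β†)^n (L_j^-)^m` with `β = m/n`. -/
def hatLoweringIntegral (ħ k μ' δ : ℝ) (γ : GammaMatrices N ι) (Ω : Region N)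
    (hΩ : Admissible k δ Ω) (m n : ℕ) (j : Fin N) : SpinOp Ω ι :=
  shiftPowRev (hatLadADag ħ k μ' δ ((m : ℝ) / n) Ω hΩ) ((ħ : ℂ) * (((m : ℝ) / n : ℝ) : ℂ))
    (angL ħ γ Ω) n * ladMinus ħ γ Ω j ^ m

/-- `R_1 = (X + Y)/√2`. -/
def rungeOne {Ω : Region N} (X Y : SpinOp Ω ι) : SpinOp Ω ι := ((√2 : ℝ) : ℂ)⁻¹ • (X + Y)

/-- `R_2 = (X - Y)/(i√2)`. -/
def rungeTwo {Ω : Region N} (X Y : SpinOp Ω ι) : SpinOp Ω ι :=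
  (Complex.I * ((√2 : ℝ) : ℂ))⁻¹ • (X - Y)

/-- The `2N - 1` operators `C^{(2)}, …, C^{(N)}`, `C_{(2)}, …, C_{(N-1)}`, `X`, `Y`. -/
def integralFamily (ι : Type*) [Fintype ι] [DecidableEq ι] (ħ : ℝ) (Ω : Region N)
    (X Y : SpinOp Ω ι) : Fin (N - 1) ⊕ Fin (N - 2) ⊕ Fin 2 → SpinOp Ω ι
  | .inl a => scal ι (casimirFirst ħ Ω (a + 2))
  | .inr (.inl a) => scal ι (casimirLast ħ Ω (a + 2))
  | .inr (.inr e) => if e = 0 then X else Y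

/-- What is claimed of the operators `X = (L_j^+)^m (A_β)^n`, `Y = (A_β†)^n (L_j^-)^m`, and of
`R_1 = (X + Y)/√2`, `R_2 = (X - Y)/(i√2)`, with respect to the Hamiltonian `H`. -/
structure GenerateIntegrals (ħ : ℝ) (γ : GammaMatrices N ι) (Ω : Region N) (w : Space N → ℝ)
    (H : ScalarOp Ω) (X Y : SpinOp Ω ι) (d : ℕ) : Prop where
  /-- `Y` is the adjoint of `X`. -/
  adjoint : SpinIsFormalAdjoint w X Y
  /-- `R_1` and `R_2` are symmetric. -/
  symmetric_one : SpinIsFormalAdjoint w (rungeOne X Y) (rungeOne X Y)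
  symmetric_two : SpinIsFormalAdjoint w (rungeTwo X Y) (rungeTwo X Y)
  /-- `R_1` and `R_2` are integrals of motion. -/
  commute_one : Commute (rungeOne X Y) (scal ι H)
  commute_two : Commute (rungeTwo X Y) (scal ι H)
  /-- `R_1` and `R_2` are differential operators of order exactly `d`. -/
  order_one : SpinHasOrderLE d (rungeOne X Y) ∧ ¬ SpinHasOrderLE (d - 1) (rungeOne X Y)
  order_two : SpinHasOrderLE d (rungeTwo X Y) ∧ ¬ SpinHasOrderLE (d - 1) (rungeTwo X Y)
  /-- The Casimir operators are integrals of motion. -/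
  commute_first : ∀ a, 2 ≤ a → a ≤ N → Commute (casimirFirst ħ Ω a) H
  commute_last : ∀ a, 2 ≤ a → a ≤ N → Commute (casimirLast ħ Ω a) H
  /-- The Casimir operators, with any two of `H`, `R_1`, `R_2`, are `2N - 1` algebraically
  independent operators. -/
  indep_ham_one : AlgIndep (integralFamily ι ħ Ω (scal ι H) (rungeOne X Y))
  indep_ham_two : AlgIndep (integralFamily ι ħ Ω (scal ι H) (rungeTwo X Y))
  indep_one_two : AlgIndep (integralFamily ι ħ Ω (rungeOne X Y) (rungeTwo X Y))
  /-- Reduction to integrals of order exactly `d - 1` that do not involve the `γ_j`. -/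
  reduction : ∃ P Q : ScalarOp Ω, X = scal ι P + angL ħ γ Ω * scal ι Q ∧
    Commute P H ∧ Commute Q H ∧ HasOrderLE d P ∧ HasOrderLE (d - 1) Q ∧ ¬ HasOrderLE (d - 2) Q
  reduction_adjoint : ∃ P Q : ScalarOp Ω, Y = scal ι P + scal ι Q * angL ħ γ Ω ∧
    Commute P H ∧ Commute Q H ∧ HasOrderLE d P ∧ HasOrderLE (d - 1) Q ∧ ¬ HasOrderLE (d - 2) Q

end CurvedCoulomb

end

open scoped ContDiff

noncomputable section

set_option linter.unusedSectionVars false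

namespace CurvedCoulomb

variable {N : ℕ}

/-! ### The ring of operators -/

/-! Both Hamiltonians are radial problems h0 + h1 L² and are treated together as a `RadialModel`.
Put G = (1 + k²r²)/r, W = (1 - k²r²)/r and e = G (J_3 + iħ). Then e W = W e + iħ (W² + 4k²), and
this relation alone implies that e + iλW intertwines the kinetic energies at λ = L/β and at λ + ħ
(`radialKin_intertwine`), while λ + ħ/2 times its commutator with W is proportional to the
difference of these energies. The constant iμ therefore repairs the intertwining in the presence of
the Coulomb term: A_β(L) H(L) = H(L + ħβ) A_β(L) (`radialLow_intertwine`). The same computation with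
energy and coupling exchanged gives the case of Ĥ_β (`radialLow_intertwine_metamorphosis`).

On the angular side, Σ γ_a x_a and Σ γ_a p_a have the anticommutator 2 J_3. This yields L² = C + ħ²
and L L_j^+ = L_j^+ (L + ħ) (`angLO_sq`, `angLO_mul_ladPlusO`). As nβ = m, the n radial steps shift
L by mħ and the m angular steps undo the shift, so X commutes with H. Integration by parts makes Y
the adjoint of X; since H is symmetric and formal adjoints are unique, Y commutes with H as well.

Because L² is scalar, X has the form P + LQ. The Clifford relations make P and Q unique
(`eq_zero_of_split`), so each of them commutes with H.

Orders and algebraic independence are read off principal symbols. On an eigenvector of the symbol of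
L with eigenvalue l, where l² is the symbol of C, all operators concerned act by numbers, and the
leading symbol of a symmetrized polynomial is its top weighted component evaluated at these numbers
(`algIndep_of_sEig`). What remains is to find points of phase space at which a given nonzero
polynomial in these numbers does not vanish. The Casimir symbols are Gram determinants of initial
and final segments of the vectors x, ξ; generic values of them are realized by a walk through
symmetric 2×2 matrices with increments of rank one (`exists_gram`). At fixed Casimirs, a rotation in
the plane of x and ξ multiplies the symbol of X by a phase and divides that of Y by it, and the
radial momentum moves the energy h. The only relation left is XY = K F(h)^n with a nonconstant
polynomial F (`RadialModel.IsLadder.exists_point`).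

For maximal superintegrability, Q and its adjoint combine to one symmetric scalar integral R, which
joins H and the Casimir operators; H and C^{(2)}, …, C^{(N)} are the N commuting ones. The gamma
matrices are only auxiliary there, and the sign of β does not matter because H depends on β². -/

theorem smooth_ext {Ω : Region N} {f g : Smooth Ω} (h : ∀ x ∈ Ω.carrier, f.1 x = g.1 x) :
    f = g := by
  refine Subtype.ext (funext fun x => ?_)
  by_cases hx : x ∈ Ω.carrier
  · exact h x hx
  · rw [f.2.2 x hx, g.2.2 x hx]

/-- The operators `ScalarOp Ω` as a type with a single ring structure. -/
def Op (Ω : Region N) : Type := ScalarOp Ω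

instance (Ω : Region N) : Ring (Op Ω) := inferInstanceAs (Ring (ScalarOp Ω))
instance (Ω : Region N) : Algebra ℂ (Op Ω) := inferInstanceAs (Algebra ℂ (ScalarOp Ω))

/-- The action of an operator on a function. -/
def Op.app {Ω : Region N} (P : Op Ω) (f : Smooth Ω) : Smooth Ω := (show ScalarOp Ω from P) f

theorem op_ext {Ω : Region N} {P Q : Op Ω}
    (h : ∀ f, ∀ x ∈ Ω.carrier, (P.app f).1 x = (Q.app f).1 x) : P = Q :=
  LinearMap.ext fun f => smooth_ext (h f)

theorem of_apply {Ω : Region N} {a : Space N → ℂ} (ha : ContDiffOn ℝ ∞ a Ω.carrier)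
    {x : Space N} (hx : x ∈ Ω.carrier) : (Smooth.of Ω a ha).1 x = a x :=
  Set.indicator_of_mem hx a

section app
variable {Ω : Region N} (P Q : Op Ω) (f g : Smooth Ω) (x : Space N)

theorem app_mul : (P * Q).app f = P.app (Q.app f) := rfl
theorem app_one : (1 : Op Ω).app f = f := rfl
theorem app_add : ((P + Q).app f).1 x = (P.app f).1 x + (Q.app f).1 x := rfl
theorem app_sub : ((P - Q).app f).1 x = (P.app f).1 x - (Q.app f).1 x := rfl
theorem app_zero : ((0 : Op Ω).app f).1 x = 0 := rfl
theorem app_smul (c : ℂ) : ((c • P).app f).1 x = c * (P.app f).1 x := rfl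
theorem app_map_add : P.app (f + g) = P.app f + P.app g :=
  LinearMap.map_add (show ScalarOp Ω from P) f g
theorem app_map_smul (c : ℂ) : P.app (c • f) = c • P.app f :=
  LinearMap.map_smul (show ScalarOp Ω from P) c f

theorem app_sum {α : Type*} (s : Finset α) (P : α → Op Ω) :
    ((∑ i ∈ s, P i).app f).1 x = ∑ i ∈ s, ((P i).app f).1 x := by
  classical
  induction s using Finset.induction_on with
  | empty => rfl
  | insert i s hi ih => rw [Finset.sum_insert hi, Finset.sum_insert hi, app_add, ih]

end app

/-- `mulOp` as an element of the ring of operators. -/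
def mulO {Ω : Region N} (a : Smooth Ω) : Op Ω := mulOp a
/-- `x_j` as an element of the ring of operators. -/
def xO (Ω : Region N) (j : Fin N) : Op Ω := xOp Ω j
/-- `p_j` as an element of the ring of operators. -/
def pO (ħ : ℝ) (Ω : Region N) (j : Fin N) : Op Ω := pOp ħ Ω j
/-- `r` as an element of the ring of operators. -/
def rO (Ω : Region N) : Op Ω := rOp Ω
/-- `1 / r` as an element of the ring of operators. -/
def uO (Ω : Region N) : Op Ω := rInvOp Ω
/-- `√J_- / (1 - k² J_- - 4 δ √J_-)` as an element of the ring of operators. -/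
def vO {k δ : ℝ} {Ω : Region N} (hΩ : Admissible k δ Ω) : Op Ω := vInvOp k δ Ω hΩ

theorem mulO_app {Ω : Region N} (a f : Smooth Ω) (x : Space N) :
    ((mulO a).app f).1 x = a.1 x * f.1 x := rfl

theorem smooth_differentiableAt {Ω : Region N} (f : Smooth Ω) {x : Space N}
    (hx : x ∈ Ω.carrier) : DifferentiableAt ℝ f.1 x :=
  (f.2.1.contDiffAt (Ω.isOpen.mem_nhds hx)).differentiableAt (by simp)

theorem pO_app (ħ : ℝ) {Ω : Region N} (j : Fin N) (f : Smooth Ω) {x : Space N}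
    (hx : x ∈ Ω.carrier) : ((pO ħ Ω j).app f).1 x =
      -(Complex.I * (ħ : ℂ)) * fderiv ℝ f.1 x (EuclideanSpace.single j 1) :=
  congrArg (-(Complex.I * (ħ : ℂ)) * ·) (of_apply _ hx)

/-- The constant function `1`. -/
def oneFn (Ω : Region N) : Smooth Ω := Smooth.of Ω (fun _ => 1) contDiffOn_const

theorem oneFn_apply {Ω : Region N} {x : Space N} (hx : x ∈ Ω.carrier) :
    (oneFn Ω).1 x = 1 := of_apply _ hx

theorem mulO_oneFn (Ω : Region N) : mulO (oneFn Ω) = 1 :=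
  op_ext fun f x hx => by rw [mulO_app, oneFn_apply hx, one_mul, app_one]

theorem mulO_app_oneFn {Ω : Region N} (a : Smooth Ω) : (mulO a).app (oneFn Ω) = a :=
  smooth_ext fun x hx => by rw [mulO_app, oneFn_apply hx, mul_one]

theorem mulO_commute {Ω : Region N} (a b : Smooth Ω) : Commute (mulO a) (mulO b) :=
  op_ext fun _ _ _ => mul_left_comm _ _ _

theorem mulO_add {Ω : Region N} (a b : Smooth Ω) : mulO (a + b) = mulO a + mulO b :=
  op_ext fun _ _ _ => add_mul _ _ _

theorem mulO_smul {Ω : Region N} (c : ℂ) (a : Smooth Ω) : mulO (c • a) = c • mulO a :=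
  op_ext fun _ _ _ => mul_assoc _ _ _

theorem pO_mul_mulO (ħ : ℝ) {Ω : Region N} (j : Fin N) (a : Smooth Ω) :
    pO ħ Ω j * mulO a = mulO a * pO ħ Ω j + mulO ((pO ħ Ω j).app a) := by
  refine op_ext fun f x hx => ?_
  rw [app_mul, app_add, app_mul, mulO_app, mulO_app, pO_app ħ j _ hx, pO_app ħ j _ hx,
    pO_app ħ j _ hx]
  have : ((mulO a).app f).1 = fun x => a.1 x * f.1 x := rfl
  rw [this, fderiv_fun_mul (smooth_differentiableAt a hx) (smooth_differentiableAt f hx)]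
  simp only [add_apply, smul_apply, smul_eq_mul]
  ring

theorem pO_commute (ħ : ℝ) (Ω : Region N) (i j : Fin N) :
    Commute (pO ħ Ω i) (pO ħ Ω j) := by
  have key : ∀ (i j : Fin N) (f : Smooth Ω) (x : Space N), x ∈ Ω.carrier →
      ((pO ħ Ω i).app ((pO ħ Ω j).app f)).1 x =
        (-(Complex.I * (ħ : ℂ))) * ((-(Complex.I * (ħ : ℂ))) *
        fderiv ℝ (fderiv ℝ f.1) x (EuclideanSpace.single i 1) (EuclideanSpace.single j 1)) := by
    intro i j f x hx
    rw [pO_app ħ i _ hx]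
    have h1 : ((pO ħ Ω j).app f).1 =ᶠ[nhds x] fun y => -(Complex.I * (ħ : ℂ)) *
        fderiv ℝ f.1 y (EuclideanSpace.single j 1) := by
      filter_upwards [Ω.isOpen.mem_nhds hx] with y hy using pO_app ħ j f hy
    have h2 : DifferentiableAt ℝ (fderiv ℝ f.1) x :=
      ((f.2.1.fderiv_of_isOpen Ω.isOpen (m := ∞) (by simp)).contDiffAt
        (Ω.isOpen.mem_nhds hx)).differentiableAt (by simp)
    rw [h1.fderiv_eq, fderiv_const_mul (h2.clm_apply (differentiableAt_const _)),
      fderiv_clm_apply h2 (differentiableAt_const _)]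
    simp
  refine op_ext fun f x hx => ?_
  rw [app_mul, app_mul, key i j f x hx, key j i f x hx]
  have hs : IsSymmSndFDerivAt ℝ f.1 x :=
    (f.2.1.contDiffAt (Ω.isOpen.mem_nhds hx)).isSymmSndFDerivAt
      (by simpa using WithTop.coe_le_coe.mpr (le_top (a := (2 : ℕ∞))))
  rw [hs]

theorem fderiv_ofReal_coord (j : Fin N) (x v : Space N) :
    fderiv ℝ (fun x : Space N => ((x j : ℝ) : ℂ)) x v = ((v j : ℝ) : ℂ) := by
  have : (fun x : Space N => ((x j : ℝ) : ℂ)) =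
      (Complex.ofRealCLM.comp (EuclideanSpace.proj (𝕜 := ℝ) j)) := rfl
  rw [this, ContinuousLinearMap.fderiv]
  rfl

/-- The coordinate function `x_j`. -/
def coordFn (Ω : Region N) (j : Fin N) : Smooth Ω :=
  Smooth.of Ω (fun x => ((x j : ℝ) : ℂ)) (Complex.ofRealCLM.contDiff.comp_contDiffOn
      (EuclideanSpace.proj (𝕜 := ℝ) j).contDiff.contDiffOn)

theorem xO_eq (Ω : Region N) (j : Fin N) : xO Ω j = mulO (coordFn Ω j) := rfl

theorem coordFn_apply {Ω : Region N} (j : Fin N) {x : Space N} (hx : x ∈ Ω.carrier) :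
    (coordFn Ω j).1 x = ((x j : ℝ) : ℂ) := of_apply _ hx

theorem xO_commute (Ω : Region N) (i j : Fin N) : Commute (xO Ω i) (xO Ω j) :=
  mulO_commute _ _

theorem pO_mul_xO (ħ : ℝ) (Ω : Region N) (i j : Fin N) :
    pO ħ Ω i * xO Ω j =
      xO Ω j * pO ħ Ω i - (if i = j then Complex.I * (ħ : ℂ) else 0) • 1 := by
  rw [xO_eq, pO_mul_mulO, sub_eq_add_neg, ← neg_smul]
  congr 1
  refine op_ext fun f x hx => ?_
  rw [mulO_app, pO_app ħ i _ hx]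
  have h1 : (coordFn Ω j).1 =ᶠ[nhds x] fun x => ((x j : ℝ) : ℂ) := by
    filter_upwards [Ω.isOpen.mem_nhds hx] with y hy using coordFn_apply _ hy
  rw [h1.fderiv_eq, fderiv_ofReal_coord, app_smul, app_one]
  by_cases h : i = j
  · subst h; simp
  · simp [h, Ne.symm h]

theorem xO_app {Ω : Region N} (j : Fin N) (f : Smooth Ω) {x : Space N} (hx : x ∈ Ω.carrier) :
    ((xO Ω j).app f).1 x = ((x j : ℝ) : ℂ) * f.1 x := by
  rw [xO_eq, mulO_app, coordFn_apply _ hx]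

/-- `J_-` as an element of the ring of operators. -/
def JMinusO (Ω : Region N) (S : Finset (Fin N)) : Op Ω := ∑ i ∈ S, xO Ω i ^ 2
/-- `J_+` as an element of the ring of operators. -/
def JPlusO (ħ : ℝ) (Ω : Region N) (S : Finset (Fin N)) : Op Ω := ∑ i ∈ S, pO ħ Ω i ^ 2
/-- `J_3` as an element of the ring of operators. -/
def J3O (ħ : ℝ) (Ω : Region N) (S : Finset (Fin N)) : Op Ω :=
  ∑ i ∈ S, (xO Ω i * pO ħ Ω i - (Complex.I * ħ / 2) • 1)
/-- The Casimir operator as an element of the ring of operators. -/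
def casimirO (ħ : ℝ) (Ω : Region N) (S : Finset (Fin N)) : Op Ω :=
  (1 / 2 : ℂ) • (JPlusO ħ Ω S * JMinusO Ω S + JMinusO Ω S * JPlusO ħ Ω S) - J3O ħ Ω S ^ 2
/-- `L²` as an element of the ring of operators. -/
def LSqO (ħ : ℝ) (Ω : Region N) : Op Ω := casimirO ħ Ω Finset.univ + ((ħ : ℂ) ^ 2) • 1
/-- `J_3 + iħ` as an element of the ring of operators. -/
def dO (ħ : ℝ) (Ω : Region N) : Op Ω := J3O ħ Ω Finset.univ + (Complex.I * ħ) • 1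
/-- `L_{ij}` as an element of the ring of operators. -/
def rotO (ħ : ℝ) (Ω : Region N) (i j : Fin N) : Op Ω :=
  xO Ω i * pO ħ Ω j - xO Ω j * pO ħ Ω i
/-- `1 + k² J_-` as an element of the ring of operators. -/
def onePlusO (k : ℝ) (Ω : Region N) : Op Ω := 1 + ((k : ℂ) ^ 2) • JMinusO Ω Finset.univ
/-- `1 - k² J_-` as an element of the ring of operators. -/
def oneMinusO (k : ℝ) (Ω : Region N) : Op Ω := 1 - ((k : ℂ) ^ 2) • JMinusO Ω Finset.univ

theorem JMinusO_app {Ω : Region N} (S : Finset (Fin N)) (f : Smooth Ω) {x : Space N}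
    (hx : x ∈ Ω.carrier) :
    ((JMinusO Ω S).app f).1 x = (∑ i ∈ S, ((x i : ℝ) : ℂ) ^ 2) * f.1 x := by
  rw [JMinusO, app_sum, Finset.sum_mul]
  refine Finset.sum_congr rfl fun i _ => ?_
  rw [pow_two, app_mul, xO_app i _ hx, xO_app i _ hx]
  ring

theorem ofReal_norm_sq (x : Space N) : ((‖x‖ : ℝ) : ℂ) ^ 2 = ∑ i, ((x i : ℝ) : ℂ) ^ 2 := by
  have := EuclideanSpace.real_norm_sq_eq x
  exact_mod_cast congrArg (fun r : ℝ => (r : ℂ)) this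

theorem norm_ne_zero_of_mem {Ω : Region N} {x : Space N} (hx : x ∈ Ω.carrier) : ‖x‖ ≠ 0 :=
  fun h => Ω.zero_notMem (norm_eq_zero.mp h ▸ hx)

theorem norm_ne_zero_of_mem' {Ω : Region N} {x : Space N} (hx : x ∈ Ω.carrier) :
    ((‖x‖ : ℝ) : ℂ) ≠ 0 := by exact_mod_cast norm_ne_zero_of_mem hx

theorem rO_app {Ω : Region N} (f : Smooth Ω) {x : Space N} (hx : x ∈ Ω.carrier) :
    ((rO Ω).app f).1 x = ((‖x‖ : ℝ) : ℂ) * f.1 x :=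
  congrArg (· * f.1 x) (of_apply _ hx)

theorem uO_app {Ω : Region N} (f : Smooth Ω) {x : Space N} (hx : x ∈ Ω.carrier) :
    ((uO Ω).app f).1 x = ((‖x‖ : ℝ) : ℂ)⁻¹ * f.1 x := by
  rw [← Complex.ofReal_inv]
  exact congrArg (· * f.1 x) (of_apply _ hx)

theorem vO_app {k δ : ℝ} {Ω : Region N} (hΩ : Admissible k δ Ω) (f : Smooth Ω)
    {x : Space N} (hx : x ∈ Ω.carrier) : ((vO hΩ).app f).1 x =
      ((‖x‖ * (1 - k ^ 2 * ‖x‖ ^ 2 - 4 * δ * ‖x‖)⁻¹ : ℝ) : ℂ) * f.1 x :=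
  congrArg (· * f.1 x) (of_apply _ hx)

theorem JMinusO_univ_app {Ω : Region N} (f : Smooth Ω) {x : Space N}
    (hx : x ∈ Ω.carrier) :
    ((JMinusO Ω Finset.univ).app f).1 x = ((‖x‖ : ℝ) : ℂ) ^ 2 * f.1 x := by
  rw [JMinusO_app _ _ hx, ofReal_norm_sq]

theorem uO_sq_mul_JMinusO (Ω : Region N) : uO Ω ^ 2 * JMinusO Ω Finset.univ = 1 := by
  refine op_ext fun f x hx => ?_
  rw [pow_two, app_mul, app_mul, uO_app _ hx, uO_app _ hx, JMinusO_univ_app _ hx, app_one]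
  have := norm_ne_zero_of_mem' hx
  field_simp

theorem uO_mul_rO (Ω : Region N) : uO Ω * rO Ω = 1 := by
  refine op_ext fun f x hx => ?_
  rw [app_mul, uO_app _ hx, rO_app _ hx, app_one]
  have := norm_ne_zero_of_mem' hx
  field_simp

theorem vO_mul {k δ : ℝ} {Ω : Region N} (hΩ : Admissible k δ Ω) :
    vO hΩ * (uO Ω * oneMinusO k Ω - (4 * (δ : ℂ)) • 1) = 1 := by
  refine op_ext fun f x hx => ?_
  rw [app_mul, vO_app hΩ _ hx, app_sub, app_mul, uO_app _ hx, oneMinusO, app_sub, app_smul,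
    app_smul, JMinusO_univ_app _ hx, app_one]
  have h1 := norm_ne_zero_of_mem' hx
  have h2 : (1 : ℂ) - (k : ℂ) ^ 2 * (‖x‖ : ℂ) ^ 2 - 4 * δ * ‖x‖ ≠ 0 := by
    exact_mod_cast hΩ x hx
  push_cast
  have e : (‖x‖ : ℂ)⁻¹ * (f.1 x - (k : ℂ) ^ 2 * ((‖x‖ : ℂ) ^ 2 * f.1 x)) - 4 * (δ : ℂ) * f.1 x
    = (‖x‖ : ℂ)⁻¹ * (1 - (k : ℂ) ^ 2 * (‖x‖ : ℂ) ^ 2 - 4 * δ * ‖x‖) * f.1 x := by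
    field_simp
  rw [e]
  generalize (1 : ℂ) - (k : ℂ) ^ 2 * (‖x‖ : ℂ) ^ 2 - 4 * δ * ‖x‖ = w at h2
  field_simp

/-! ### Differential operators of finite order -/

/-- `HasOrderLE` for the ring of operators. -/
def OrdLE {Ω : Region N} : ℕ → Op Ω → Prop
  | 0, P => ∀ a : Smooth Ω, P * mulO a - mulO a * P = 0
  | d + 1, P => ∀ a : Smooth Ω, OrdLE d (P * mulO a - mulO a * P)

theorem hasOrderLE_iff {Ω : Region N} {d : ℕ} {P : Op Ω} : HasOrderLE d P ↔ OrdLE d P := by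
  induction d generalizing P with
  | zero => exact Iff.rfl
  | succ d ih => exact forall_congr' fun a => ih

/-- A linear map that commutes with all multiplications sends f = f·1 to f times its value on the
constant function 1. -/
theorem ordLE_zero_iff {Ω : Region N} {P : Op Ω} :
    OrdLE 0 P ↔ ∃ a : Smooth Ω, P = mulO a := by
  constructor
  · intro h
    refine ⟨P.app (oneFn Ω), op_ext fun f x _ => ?_⟩
    have h1 := congrArg (fun Q => Op.app Q (oneFn Ω)) (sub_eq_zero.mp (h f))
    simp only [app_mul, mulO_app_oneFn] at h1
    rw [h1, mulO_app, mulO_app, mul_comm]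
  · rintro ⟨a, rfl⟩ b
    exact sub_eq_zero.mpr (mulO_commute a b)

theorem ordLE_zero_op {Ω : Region N} (d : ℕ) : OrdLE d (0 : Op Ω) := by
  induction d with
  | zero => intro a; simp
  | succ d ih => intro a; simpa using ih

theorem OrdLE.succ {Ω : Region N} {d : ℕ} {P : Op Ω} (h : OrdLE d P) :
    OrdLE (d + 1) P := by
  induction d generalizing P with
  | zero => intro a; rw [h a]; exact ordLE_zero_op 0
  | succ d ih => exact fun a => ih (h a)

theorem OrdLE.mono {Ω : Region N} {d e : ℕ} {P : Op Ω} (h : OrdLE d P)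
    (hde : d ≤ e) : OrdLE e P := by
  induction e, hde using Nat.le_induction with
  | base => exact h
  | succ e _ ih => exact ih.succ

theorem OrdLE.add {Ω : Region N} {d : ℕ} {P Q : Op Ω} (hP : OrdLE d P)
    (hQ : OrdLE d Q) : OrdLE d (P + Q) := by
  induction d generalizing P Q with
  | zero => intro a; rw [add_mul, mul_add, add_sub_add_comm, hP a, hQ a, add_zero]
  | succ d ih => intro a; rw [add_mul, mul_add, add_sub_add_comm]; exact ih (hP a) (hQ a)

theorem OrdLE.smul {Ω : Region N} {d : ℕ} {P : Op Ω} (c : ℂ) (hP : OrdLE d P) :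
    OrdLE d (c • P) := by
  induction d generalizing P with
  | zero => intro a; rw [smul_mul_assoc, mul_smul_comm, ← smul_sub, hP a, smul_zero]
  | succ d ih => intro a; rw [smul_mul_assoc, mul_smul_comm, ← smul_sub]; exact ih (hP a)

theorem OrdLE.neg {Ω : Region N} {d : ℕ} {P : Op Ω} (hP : OrdLE d P) :
    OrdLE d (-P) := by
  simpa using hP.smul (-1)

theorem OrdLE.sub {Ω : Region N} {d : ℕ} {P Q : Op Ω} (hP : OrdLE d P)
    (hQ : OrdLE d Q) : OrdLE d (P - Q) := by
  rw [sub_eq_add_neg]; exact hP.add hQ.neg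

theorem OrdLE.sum {Ω : Region N} {d : ℕ} {α : Type*} (s : Finset α) {P : α → Op Ω}
    (hP : ∀ i ∈ s, OrdLE d (P i)) : OrdLE d (∑ i ∈ s, P i) := by
  classical
  induction s using Finset.induction_on with
  | empty => simpa using ordLE_zero_op d
  | insert i s hi ih =>
    rw [Finset.sum_insert hi]
    exact (hP i (Finset.mem_insert_self i s)).add
      (ih fun j hj => hP j (Finset.mem_insert_of_mem hj))

theorem ordLE_mulO {Ω : Region N} (a : Smooth Ω) : OrdLE 0 (mulO a) :=
  ordLE_zero_iff.mpr ⟨a, rfl⟩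

theorem ordLE_one {Ω : Region N} : OrdLE 0 (1 : Op Ω) :=
  mulO_oneFn Ω ▸ ordLE_mulO _

theorem OrdLE.mulO_mul {Ω : Region N} {d : ℕ} {P : Op Ω} (b : Smooth Ω)
    (hP : OrdLE d P) : OrdLE d (mulO b * P) := by
  induction d generalizing P with
  | zero =>
    intro a
    rw [mul_assoc, ← mul_assoc (mulO a), (mulO_commute a b).eq, mul_assoc, ← mul_sub, hP a,
      mul_zero]
  | succ d ih =>
    intro a
    rw [mul_assoc, ← mul_assoc (mulO a), (mulO_commute a b).eq, mul_assoc, ← mul_sub]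
    exact ih (hP a)

/-- Double induction on the orders through the Leibniz rule [PQ, a] = P [Q, a] + [P, a] Q, in which
each term has total order one less. -/
theorem OrdLE.mul {Ω : Region N} {d e : ℕ} {P Q : Op Ω} (hP : OrdLE d P)
    (hQ : OrdLE e Q) : OrdLE (d + e) (P * Q) := by
  have key : ∀ (P Q a : Op Ω), P * Q * a - a * (P * Q) =
      P * (Q * a - a * Q) + (P * a - a * P) * Q := fun P Q a => by noncomm_ring
  induction d generalizing P Q e with
  | zero =>
    obtain ⟨b, rfl⟩ := ordLE_zero_iff.mp hP
    rw [zero_add]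
    exact hQ.mulO_mul b
  | succ d ihd =>
    induction e generalizing Q with
    | zero =>
      rw [add_zero]
      intro a
      rw [key, hQ a, mul_zero, zero_add]
      exact ihd (hP a) hQ
    | succ e ihe =>
      intro a
      rw [key]
      refine OrdLE.add (ihe (hQ a)) ?_
      have := ihd (hP a) hQ
      rwa [show (d + 1).add e = d + (e + 1) from Nat.succ_add_eq_add_succ d e]

theorem OrdLE.mul_le {Ω : Region N} {d e c : ℕ} {P Q : Op Ω} (hP : OrdLE d P)
    (hQ : OrdLE e Q) (h : d + e ≤ c) : OrdLE c (P * Q) := (hP.mul hQ).mono h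

theorem OrdLE.pow {Ω : Region N} {d : ℕ} {P : Op Ω} (hP : OrdLE d P) (n : ℕ) :
    OrdLE (n * d) (P ^ n) := by
  induction n with
  | zero => simpa using ordLE_one
  | succ n ih => rw [pow_succ, Nat.succ_mul]; exact ih.mul hP

theorem ordLE_pO (ħ : ℝ) (Ω : Region N) (j : Fin N) : OrdLE 1 (pO ħ Ω j) := by
  intro a
  rw [pO_mul_mulO, add_sub_cancel_left]
  exact ordLE_mulO _

theorem ordLE_xO (Ω : Region N) (j : Fin N) : OrdLE 0 (xO Ω j) := ordLE_mulO _
theorem ordLE_rO (Ω : Region N) : OrdLE 0 (rO Ω) := ordLE_mulO _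
theorem ordLE_uO (Ω : Region N) : OrdLE 0 (uO Ω) := ordLE_mulO _

theorem OrdLE.commute {Ω : Region N} {P Q : Op Ω} (hP : OrdLE 0 P)
    (hQ : OrdLE 0 Q) : Commute P Q := by
  obtain ⟨a, rfl⟩ := ordLE_zero_iff.mp hP
  obtain ⟨b, rfl⟩ := ordLE_zero_iff.mp hQ
  exact mulO_commute a b

theorem ordLE_JMinus (Ω : Region N) (S : Finset (Fin N)) : OrdLE 0 (JMinusO Ω S) :=
  OrdLE.sum _ fun i _ => (ordLE_xO Ω i).pow 2

theorem ordLE_JPlus (ħ : ℝ) (Ω : Region N) (S : Finset (Fin N)) :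
    OrdLE 2 (JPlusO ħ Ω S) :=
  OrdLE.sum _ fun i _ => (ordLE_pO ħ Ω i).pow 2

theorem ordLE_J3 (ħ : ℝ) (Ω : Region N) (S : Finset (Fin N)) :
    OrdLE 1 (J3O ħ Ω S) :=
  OrdLE.sum _ fun i _ => ((ordLE_xO Ω i).mul_le (ordLE_pO ħ Ω i) (by simp)).sub
    ((ordLE_one.smul _).mono (by simp))

theorem ordLE_casimir (ħ : ℝ) (Ω : Region N) (S : Finset (Fin N)) :
    OrdLE 2 (casimirO ħ Ω S) :=
  (((ordLE_JPlus ħ Ω S).mul_le (ordLE_JMinus Ω S) (by simp)).add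
    ((ordLE_JMinus Ω S).mul_le (ordLE_JPlus ħ Ω S) (by simp))).smul _ |>.sub
    ((ordLE_J3 ħ Ω S).pow 2)

theorem ordLE_LSq (ħ : ℝ) (Ω : Region N) : OrdLE 2 (LSqO ħ Ω) :=
  (ordLE_casimir ħ Ω _).add ((ordLE_one.smul _).mono (by simp))

theorem ordLE_onePlus (k : ℝ) (Ω : Region N) : OrdLE 0 (onePlusO k Ω) :=
  ordLE_one.add ((ordLE_JMinus Ω _).smul _)

theorem ordLE_oneMinus (k : ℝ) (Ω : Region N) : OrdLE 0 (oneMinusO k Ω) :=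
  ordLE_one.sub ((ordLE_JMinus Ω _).smul _)

theorem ordLE_dO (ħ : ℝ) (Ω : Region N) : OrdLE 1 (dO ħ Ω) :=
  (ordLE_J3 ħ Ω _).add ((ordLE_one.smul _).mono (by simp))

theorem ordLE_rotO (ħ : ℝ) (Ω : Region N) (i j : Fin N) : OrdLE 1 (rotO ħ Ω i j) :=
  ((ordLE_xO Ω i).mul_le (ordLE_pO ħ Ω j) (by simp)).sub
    ((ordLE_xO Ω j).mul_le (ordLE_pO ħ Ω i) (by simp))

theorem ordLE_vO {k δ : ℝ} {Ω : Region N} (hΩ : Admissible k δ Ω) :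
    OrdLE 0 (vO hΩ) := ordLE_mulO _

/-! ### Commutators -/

section bracket
variable {B : Type*} [Ring B]

theorem mul_bracket (a b c : B) : ⁅a * b, c⁆ = a * ⁅b, c⁆ + ⁅a, c⁆ * b := by
  simp only [Ring.lie_def]; noncomm_ring

theorem bracket_mul (a b c : B) : ⁅a, b * c⁆ = b * ⁅a, c⁆ + ⁅a, b⁆ * c := by
  simp only [Ring.lie_def]; noncomm_ring

theorem bracket_eq_zero_iff {a b : B} : ⁅a, b⁆ = 0 ↔ Commute a b := by
  rw [Ring.lie_def, sub_eq_zero]; rfl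

theorem bracket_one (a : B) : ⁅a, (1 : B)⁆ = 0 := bracket_eq_zero_iff.mpr (Commute.one_right a)
theorem one_bracket (a : B) : ⁅(1 : B), a⁆ = 0 := bracket_eq_zero_iff.mpr (Commute.one_left a)

theorem mul_eq_of_bracket {a b c : B} (h : ⁅a, b⁆ = c) : a * b = b * a + c := by
  rw [← h, Ring.lie_def]; abel

theorem sub_bracket (a b c : B) : ⁅a - b, c⁆ = ⁅a, c⁆ - ⁅b, c⁆ := by
  simp only [Ring.lie_def]; noncomm_ring
theorem bracket_sub (a b c : B) : ⁅a, b - c⁆ = ⁅a, b⁆ - ⁅a, c⁆ := by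
  simp only [Ring.lie_def]; noncomm_ring
theorem add_bracket (a b c : B) : ⁅a + b, c⁆ = ⁅a, c⁆ + ⁅b, c⁆ := by
  simp only [Ring.lie_def]; noncomm_ring
theorem bracket_add (a b c : B) : ⁅a, b + c⁆ = ⁅a, b⁆ + ⁅a, c⁆ := by
  simp only [Ring.lie_def]; noncomm_ring
theorem smul_bracket [Algebra ℂ B] (c : ℂ) (a b : B) : ⁅c • a, b⁆ = c • ⁅a, b⁆ := by
  simp only [Ring.lie_def, smul_mul_assoc, mul_smul_comm, smul_sub]
theorem bracket_smul [Algebra ℂ B] (c : ℂ) (a b : B) : ⁅a, c • b⁆ = c • ⁅a, b⁆ := by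
  simp only [Ring.lie_def, smul_mul_assoc, mul_smul_comm, smul_sub]

/-- An inverse of `b` commutes with everything that commutes with `b`. -/
theorem commute_of_inverse {a b c : B} (h : Commute a b) (hbc : b * c = 1) (hcb : c * b = 1) :
    Commute a c := by
  have : a * c = c * b * (a * c) := by rw [hcb, one_mul]
  rw [Commute, SemiconjBy, this, mul_assoc, ← mul_assoc b, ← h.eq, mul_assoc a, hbc, mul_one]

end bracket

/-! ### Canonical commutation relations and angular momenta -/

section ccr
variable (ħ : ℝ) (Ω : Region N)

theorem bracket_pO_xO (i j : Fin N) :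
    ⁅pO ħ Ω i, xO Ω j⁆ = -((if i = j then Complex.I * (ħ : ℂ) else 0) • 1) := by
  rw [Ring.lie_def, pO_mul_xO]; abel

theorem bracket_xO_pO (i j : Fin N) :
    ⁅xO Ω i, pO ħ Ω j⁆ = (if j = i then Complex.I * (ħ : ℂ) else 0) • 1 := by
  rw [Ring.lie_def, pO_mul_xO]; abel

theorem bracket_xO_xO (i j : Fin N) : ⁅xO Ω i, xO Ω j⁆ = 0 :=
  bracket_eq_zero_iff.mpr (xO_commute Ω i j)

theorem bracket_pO_pO (i j : Fin N) : ⁅pO ħ Ω i, pO ħ Ω j⁆ = 0 :=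
  bracket_eq_zero_iff.mpr (pO_commute ħ Ω i j)

theorem bracket_rotO_xO (i j k : Fin N) : ⁅rotO ħ Ω i j, xO Ω k⁆ =
    (if i = k then Complex.I * (ħ : ℂ) else 0) • xO Ω j
      - (if j = k then Complex.I * (ħ : ℂ) else 0) • xO Ω i := by
  rw [rotO, sub_bracket, mul_bracket, mul_bracket, bracket_pO_xO, bracket_pO_xO, bracket_xO_xO,
    bracket_xO_xO]
  simp only [mul_neg, mul_smul_comm, mul_one, zero_mul, add_zero]
  abel

theorem bracket_rotO_pO (i j k : Fin N) : ⁅rotO ħ Ω i j, pO ħ Ω k⁆ =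
    (if i = k then Complex.I * (ħ : ℂ) else 0) • pO ħ Ω j
      - (if j = k then Complex.I * (ħ : ℂ) else 0) • pO ħ Ω i := by
  rw [rotO, sub_bracket, mul_bracket, mul_bracket, bracket_pO_pO, bracket_pO_pO, bracket_xO_pO,
    bracket_xO_pO]
  simp only [smul_mul_assoc, one_mul, mul_zero, zero_add, eq_comm]

theorem bracket_sum {B α : Type*} [Ring B] (a : B) (s : Finset α) (f : α → B) :
    ⁅a, ∑ i ∈ s, f i⁆ = ∑ i ∈ s, ⁅a, f i⁆ := by
  simp only [Ring.lie_def, Finset.mul_sum, Finset.sum_mul, Finset.sum_sub_distrib]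

theorem sum_bracket {B α : Type*} [Ring B] (a : B) (s : Finset α) (f : α → B) :
    ⁅∑ i ∈ s, f i, a⁆ = ∑ i ∈ s, ⁅f i, a⁆ := by
  simp only [Ring.lie_def, Finset.mul_sum, Finset.sum_mul, Finset.sum_sub_distrib]

variable {S : Finset (Fin N)} {i j : Fin N}

theorem sum_ite_smul {B : Type*} [AddCommGroup B] [Module ℂ B] (S : Finset (Fin N)) (i : Fin N)
    (c : ℂ) (f : Fin N → B) :
    ∑ k ∈ S, (if i = k then c else 0) • f k = if i ∈ S then c • f i else 0 := by
  simp [ite_smul]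

theorem rotO_commute_JMinusO (hi : i ∈ S) (hj : j ∈ S) :
    Commute (rotO ħ Ω i j) (JMinusO Ω S) := by
  rw [← bracket_eq_zero_iff, JMinusO, bracket_sum]
  simp only [pow_two, bracket_mul, bracket_rotO_xO, mul_sub, sub_mul, mul_smul_comm,
    smul_mul_assoc, Finset.sum_add_distrib, Finset.sum_sub_distrib, sum_ite_smul, hi, hj, if_true]
  rw [(xO_commute Ω i j).eq]
  abel

theorem rotO_commute_JPlusO (hi : i ∈ S) (hj : j ∈ S) :
    Commute (rotO ħ Ω i j) (JPlusO ħ Ω S) := by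
  rw [← bracket_eq_zero_iff, JPlusO, bracket_sum]
  simp only [pow_two, bracket_mul, bracket_rotO_pO, mul_sub, sub_mul, mul_smul_comm,
    smul_mul_assoc, Finset.sum_add_distrib, Finset.sum_sub_distrib, sum_ite_smul, hi, hj, if_true]
  rw [(pO_commute ħ Ω i j).eq]
  abel

theorem rotO_commute_J3O (hi : i ∈ S) (hj : j ∈ S) :
    Commute (rotO ħ Ω i j) (J3O ħ Ω S) := by
  rw [← bracket_eq_zero_iff, J3O, bracket_sum]
  simp only [bracket_mul, bracket_rotO_pO, bracket_rotO_xO, mul_sub, sub_mul, mul_smul_comm,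
    smul_mul_assoc, Finset.sum_add_distrib, Finset.sum_sub_distrib, sum_ite_smul, hi, hj, if_true,
    bracket_sub, bracket_smul, bracket_one, smul_zero, Finset.sum_const_zero]
  abel

theorem rotO_commute_casimirO (hi : i ∈ S) (hj : j ∈ S) :
    Commute (rotO ħ Ω i j) (casimirO ħ Ω S) := by
  have h1 := rotO_commute_JPlusO ħ Ω hi hj
  have h2 := rotO_commute_JMinusO ħ Ω hi hj
  have h3 := rotO_commute_J3O ħ Ω hi hj
  exact ((((h1.mul_right h2).add_right (h2.mul_right h1)).smul_right _).sub_right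
    (h3.pow_right 2))

/-- The contribution of one pair of indices to the Casimir operator. The parameter d is a when the
indices coincide and 0 when they differ, so the diagonal and off-diagonal terms of `casimirO_eq_sum`
are covered at once. -/
theorem two_particle_casimir {B : Type*} [Ring B] [Algebra ℂ B] {x y p q : B} (a d : ℂ)
    (hxy : x * y = y * x) (hpq : p * q = q * p) (hpx : p * x = x * p - a • 1)
    (hqy : q * y = y * q - a • 1) (hpy : p * y = y * p - d • 1) (hqx : q * x = x * q - d • 1) :
    (1 / 2 : ℂ) • ((p ^ 2 * y ^ 2 + y ^ 2 * p ^ 2) + (q ^ 2 * x ^ 2 + x ^ 2 * q ^ 2))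
      - ((x * p - (a / 2) • 1) * (y * q - (a / 2) • 1)
        + (y * q - (a / 2) • 1) * (x * p - (a / 2) • 1))
      = (x * q - y * p) ^ 2 + (2 * d ^ 2 - a ^ 2 / 2) • 1 := by
  have e : ∀ {s t : B} {c : ℂ}, t * s = s * t - c • 1 → ∀ z, t * (s * z) = s * (t * z) - c • z := by
    intro s t c h z
    rw [← mul_assoc, h, sub_mul, smul_mul_assoc, one_mul, mul_assoc]
  have hyx' : ∀ z, y * (x * z) = x * (y * z) := fun z => by
    rw [← mul_assoc, ← hxy, mul_assoc]
  simp only [pow_two, mul_assoc, mul_sub, sub_mul, e hpx, e hqy, e hpy, e hqx, hpy, hqx,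
    hyx', ← hpq, mul_smul_comm, smul_mul_assoc, mul_one, one_mul, smul_sub]
  module

/-- The Casimir operator is a quadratic expression in the angular momenta, up to a constant. -/
theorem casimirO_eq_sum (S : Finset (Fin N)) : ∃ c : ℂ, casimirO ħ Ω S =
    (1 / 2 : ℂ) • ∑ i ∈ S, ∑ j ∈ S, rotO ħ Ω i j ^ 2 + c • 1 := by
  have key : ∀ i j : Fin N, ∃ c : ℂ,
      (1 / 2 : ℂ) • ((pO ħ Ω i ^ 2 * xO Ω j ^ 2 + xO Ω j ^ 2 * pO ħ Ω i ^ 2)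
        + (pO ħ Ω j ^ 2 * xO Ω i ^ 2 + xO Ω i ^ 2 * pO ħ Ω j ^ 2))
      - ((xO Ω i * pO ħ Ω i - (Complex.I * ħ / 2) • 1) *
          (xO Ω j * pO ħ Ω j - (Complex.I * ħ / 2) • 1)
        + (xO Ω j * pO ħ Ω j - (Complex.I * ħ / 2) • 1) *
          (xO Ω i * pO ħ Ω i - (Complex.I * ħ / 2) • 1))
      = rotO ħ Ω i j ^ 2 + c • 1 := by
    intro i j
    have h1 := pO_mul_xO ħ Ω i j
    have h2 := pO_mul_xO ħ Ω j i
    have h3 := pO_mul_xO ħ Ω i i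
    have h4 := pO_mul_xO ħ Ω j j
    rw [if_pos rfl] at h3 h4
    simp only [@eq_comm _ j i] at h2
    exact ⟨_, two_particle_casimir _ _ (xO_commute Ω i j).eq (pO_commute ħ Ω i j).eq h3 h4 h1 h2⟩
  choose c hc using key
  refine ⟨(1 / 2 : ℂ) * ∑ i ∈ S, ∑ j ∈ S, c i j, ?_⟩
  -- Symmetrizing the double sum groups the terms (i, j) and (j, i); only their sum is a square of
  -- an angular momentum up to a constant.
  have h1 : ∀ F : Fin N → Fin N → Op Ω, (∑ i ∈ S, ∑ j ∈ S, F i j) =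
      (1 / 2 : ℂ) • ∑ i ∈ S, ∑ j ∈ S, (F i j + F j i) := by
    intro F
    simp only [Finset.sum_add_distrib]
    rw [Finset.sum_comm (f := fun i j => F j i)]
    module
  have h2 : casimirO ħ Ω S = ∑ i ∈ S, ∑ j ∈ S,
      ((1 / 2 : ℂ) • (pO ħ Ω i ^ 2 * xO Ω j ^ 2 + xO Ω j ^ 2 * pO ħ Ω i ^ 2) -
        (xO Ω i * pO ħ Ω i - (Complex.I * ħ / 2) • 1) *
          (xO Ω j * pO ħ Ω j - (Complex.I * ħ / 2) • 1)) := by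
    rw [casimirO, JPlusO, JMinusO, J3O, pow_two, Finset.sum_mul_sum, Finset.sum_mul_sum,
      Finset.sum_mul_sum, Finset.sum_comm (f := fun i j => xO Ω i ^ 2 * pO ħ Ω j ^ 2)]
    simp only [Finset.sum_sub_distrib, ← Finset.smul_sum, Finset.sum_add_distrib]
  rw [h2, h1]
  have h3 : ∀ i j, ((1 / 2 : ℂ) • (pO ħ Ω i ^ 2 * xO Ω j ^ 2 + xO Ω j ^ 2 * pO ħ Ω i ^ 2) -
        (xO Ω i * pO ħ Ω i - (Complex.I * ħ / 2) • 1) *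
          (xO Ω j * pO ħ Ω j - (Complex.I * ħ / 2) • 1)) +
      ((1 / 2 : ℂ) • (pO ħ Ω j ^ 2 * xO Ω i ^ 2 + xO Ω i ^ 2 * pO ħ Ω j ^ 2) -
        (xO Ω j * pO ħ Ω j - (Complex.I * ħ / 2) • 1) *
          (xO Ω i * pO ħ Ω i - (Complex.I * ħ / 2) • 1)) = rotO ħ Ω i j ^ 2 + c i j • 1 := by
    intro i j
    rw [← hc]
    module
  simp only [h3]
  simp only [Finset.sum_add_distrib, ← Finset.sum_smul, smul_add, smul_smul]

/-- What commutes with the angular momenta commutes with the Casimir operators. -/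
theorem casimirO_commute_of_rotO {P : Op Ω} (S : Finset (Fin N))
    (h : ∀ i ∈ S, ∀ j ∈ S, Commute (rotO ħ Ω i j) P) : Commute (casimirO ħ Ω S) P := by
  obtain ⟨c, hc⟩ := casimirO_eq_sum ħ Ω S
  rw [hc]
  refine Commute.add_left (Commute.smul_left (Commute.sum_left _ _ _ fun i hi =>
    Commute.sum_left _ _ _ fun j hj => (h i hi j hj).pow_left 2) _)
    ((Commute.one_left P).smul_left _)

theorem casimirO_commute_of_subset {S T : Finset (Fin N)} (h : S ⊆ T) :
    Commute (casimirO ħ Ω S) (casimirO ħ Ω T) :=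
  casimirO_commute_of_rotO ħ Ω S fun _ hi _ hj => rotO_commute_casimirO ħ Ω (h hi) (h hj)

theorem rotO_commute_LSqO (i j : Fin N) : Commute (rotO ħ Ω i j) (LSqO ħ Ω) :=
  (rotO_commute_casimirO ħ Ω (Finset.mem_univ i) (Finset.mem_univ j)).add_right
    ((Commute.one_right _).smul_right _)

/-! ### Radial operators -/

theorem uO_mul_uO_mul_JMinusO : uO Ω * (uO Ω * JMinusO Ω Finset.univ) = 1 := by
  rw [← mul_assoc, ← pow_two, uO_sq_mul_JMinusO]

theorem uO_commute {P : Op Ω} (hP : OrdLE 0 P) : Commute (uO Ω) P := (ordLE_uO Ω).commute hP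

theorem rO_eq : rO Ω = uO Ω * JMinusO Ω Finset.univ := by
  have h := (ordLE_rO Ω).commute (ordLE_uO Ω)
  rw [← mul_one (rO Ω), ← uO_mul_uO_mul_JMinusO, ← mul_assoc, h.eq, uO_mul_rO, one_mul]

/-- The commutator of an operator of order at most one with `1 / r` is determined by its
commutator with `r²`. -/
theorem bracket_uO {P a : Op Ω} (hP : OrdLE 1 P) (h : ⁅P, JMinusO Ω Finset.univ⁆ = a) :
    ⁅P, uO Ω⁆ = -((1 / 2 : ℂ) • (a * uO Ω ^ 3)) := by
  set u := uO Ω with hu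
  set r := rO Ω with hr
  set J := JMinusO Ω Finset.univ with hJ
  have ha : OrdLE 0 ⁅P, u⁆ := hP _
  have huJ : u ^ 2 * J = 1 := uO_sq_mul_JMinusO Ω
  have huc : Commute u ⁅P, u⁆ := uO_commute Ω ha
  have hJ0 : OrdLE 0 J := ordLE_JMinus Ω _
  have hJu : J * u ^ 2 = 1 := by rw [← huJ]; exact ((uO_commute Ω hJ0).pow_left 2).eq.symm
  have hru : r * u = 1 := by
    rw [← uO_mul_rO Ω]; exact ((ordLE_rO Ω).commute (ordLE_uO Ω)).eq
  -- The commutator with P acts on u²J = 1 as a derivation. The commutator of P with u has order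
  -- zero because P has order at most one, so it commutes with u.
  have h1 : (2 : ℂ) • (u * ⁅P, u⁆) * J + u ^ 2 * a = 0 := by
    have h0 : ⁅P, u ^ 2 * J⁆ = 0 := by rw [huJ, bracket_one]
    rw [bracket_mul, pow_two, bracket_mul, h, ← huc.eq] at h0
    rw [← h0, two_smul, pow_two]; abel
  have ha0 : OrdLE 0 a := by
    rw [← h, hJ, JMinusO, bracket_sum]
    refine OrdLE.sum _ fun i _ => ?_
    rw [pow_two, bracket_mul]
    exact ((ordLE_xO Ω i).mul (hP _)).add (OrdLE.mul (hP _) (ordLE_xO Ω i))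
  -- Solve for the commutator: r removes the factor u on the left and u² removes J on the right.
  have h2 : (2 : ℂ) • ⁅P, u⁆ = -(a * u ^ 3) := by
    calc (2 : ℂ) • ⁅P, u⁆ = r * ((2 : ℂ) • (u * ⁅P, u⁆) * J) * u ^ 2 := by
          rw [mul_assoc, mul_assoc _ J, hJu, mul_one, mul_smul_comm, ← mul_assoc, hru, one_mul]
      _ = r * (-(u ^ 2 * a)) * u ^ 2 := by rw [eq_neg_of_add_eq_zero_left h1]
      _ = -(r * u * (u * a) * u ^ 2) := by noncomm_ring
      _ = -(a * u ^ 3) := by rw [hru, one_mul, (uO_commute Ω ha0).eq]; noncomm_ring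
  rw [← smul_neg, ← h2, smul_smul]
  norm_num

theorem rotO_commute_uO (i j : Fin N) : Commute (rotO ħ Ω i j) (uO Ω) := by
  rw [← bracket_eq_zero_iff, bracket_uO Ω (ordLE_rotO ħ Ω i j) (bracket_eq_zero_iff.mpr
    (rotO_commute_JMinusO ħ Ω (Finset.mem_univ i) (Finset.mem_univ j)))]
  simp

theorem bracket_J3O_xO (k : Fin N) :
    ⁅J3O ħ Ω Finset.univ, xO Ω k⁆ = -((Complex.I * (ħ : ℂ)) • xO Ω k) := by
  rw [J3O, sum_bracket]
  simp [sub_bracket, mul_bracket, bracket_pO_xO, bracket_xO_xO, smul_bracket, one_bracket]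

theorem bracket_J3O_pO (k : Fin N) :
    ⁅J3O ħ Ω Finset.univ, pO ħ Ω k⁆ = (Complex.I * (ħ : ℂ)) • pO ħ Ω k := by
  rw [J3O, sum_bracket]
  simp [sub_bracket, mul_bracket, bracket_xO_pO, bracket_pO_pO, smul_bracket, one_bracket]

theorem bracket_J3O_JMinusO : ⁅J3O ħ Ω Finset.univ, JMinusO Ω Finset.univ⁆ =
    -((2 * (Complex.I * (ħ : ℂ))) • JMinusO Ω Finset.univ) := by
  rw [JMinusO, bracket_sum, Finset.smul_sum, ← Finset.sum_neg_distrib]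
  refine Finset.sum_congr rfl fun k _ => ?_
  rw [pow_two, bracket_mul, bracket_J3O_xO]
  simp only [mul_neg, neg_mul, mul_smul_comm, smul_mul_assoc]
  module

theorem dO_bracket (P : Op Ω) : ⁅dO ħ Ω, P⁆ = ⁅J3O ħ Ω Finset.univ, P⁆ := by
  rw [dO, add_bracket, smul_bracket, one_bracket, smul_zero, add_zero]

theorem rotO_commute_dO (i j : Fin N) : Commute (rotO ħ Ω i j) (dO ħ Ω) :=
  (rotO_commute_J3O ħ Ω (Finset.mem_univ i) (Finset.mem_univ j)).add_right
    ((Commute.one_right _).smul_right _)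

theorem bracket_dO_uO : ⁅dO ħ Ω, uO Ω⁆ = (Complex.I * (ħ : ℂ)) • uO Ω := by
  rw [bracket_uO Ω (ordLE_dO ħ Ω) ((dO_bracket ħ Ω _).trans (bracket_J3O_JMinusO ħ Ω))]
  have : JMinusO Ω Finset.univ * uO Ω ^ 3 = uO Ω := by
    have h := uO_commute Ω (ordLE_JMinus Ω Finset.univ)
    rw [← (h.pow_left 3).eq, pow_succ', mul_assoc, uO_sq_mul_JMinusO, mul_one]
  rw [neg_mul, smul_mul_assoc, this]
  module

end ccr

/-! ### The intertwining relation of the radial problem -/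

section radial
variable {B : Type*} [Ring B] [Algebra ℂ B]

/-- Twice the kinetic energy of the radial problem, in terms of `e = G D`, `W` and `ν = iλ`. -/
def radialKin (t κ : ℂ) (e W ν : B) : B := e * e - t • (W * e) - ν * ν * (W * W + κ • 1)

variable {t κ : ℂ} {e W ν : B}

/-- The factorization method: (e - (ν+t)W)(e + νW) is `radialKin` at ν plus κν(ν+t), and the product
in the opposite order is `radialKin` at ν + t plus the same term. The proof checks the consequence
by expanding both sides into words with ν first and W before e. -/
theorem radialKin_intertwine (heW : e * W = W * e + t • (W * W) + (t * κ) • 1)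
    (hνe : e * ν = ν * e) (hνW : W * ν = ν * W) :
    (e + ν * W) * radialKin t κ e W ν = radialKin t κ e W (ν + t • 1) * (e + ν * W) := by
  have h1 : ∀ z, e * (W * z) = W * (e * z) + t • (W * (W * z)) + (t * κ) • z := fun z => by
    rw [← mul_assoc, heW]; simp only [add_mul, smul_mul_assoc, one_mul, mul_assoc]
  have h2 : ∀ z, e * (ν * z) = ν * (e * z) := fun z => by rw [← mul_assoc, hνe, mul_assoc]
  have h3 : ∀ z, W * (ν * z) = ν * (W * z) := fun z => by rw [← mul_assoc, hνW, mul_assoc]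
  simp only [radialKin, mul_add, add_mul, mul_sub, sub_mul, mul_assoc, h1, h2, h3, heW, hνe, hνW,
    smul_mul_assoc, mul_smul_comm, smul_add, mul_one, one_mul]
  module

/-- The factor W² + κ is what the commutator of e + νW with W produces. This match makes the Coulomb
term compatible with the ladder, see `radialBase_bracket`. -/
theorem radialKin_sub : radialKin t κ e W ν - radialKin t κ e W (ν + t • 1) =
    (2 * t) • ((ν + (t / 2) • 1) * (W * W + κ • 1)) := by
  simp only [radialKin, mul_add, add_mul, mul_assoc,
    smul_mul_assoc, mul_smul_comm, smul_add, mul_one, one_mul]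
  module

/-- The lowering operator of the radial problem with coupling `M`. -/
def radialLow (ħ : ℂ) (e W lam M : B) : B :=
  ((√2 : ℝ) : ℂ)⁻¹ • (-((lam + (ħ / 2) • 1) * e)
      - Complex.I • (lam * (lam + (ħ / 2) • 1) * W) + Complex.I • M)

/-- The raising operator of the radial problem with coupling `M`. -/
def radialRaise (ħ : ℂ) (e W lam M : B) : B :=
  ((√2 : ℝ) : ℂ)⁻¹ • (-((lam + (ħ / 2) • 1) * e)
      + Complex.I • ((lam + ħ • 1) * (lam + (ħ / 2) • 1) * W) - Complex.I • M)

theorem radialLow_eq (ħ : ℂ) (e W lam M : B) : radialLow ħ e W lam M =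
    ((√2 : ℝ) : ℂ)⁻¹ • (-((lam + (ħ / 2) • 1) * (e + (Complex.I • lam) * W)) + Complex.I • M) := by
  rw [radialLow]
  congr 1
  have : lam * (lam + (ħ / 2) • 1) = (lam + (ħ / 2) • 1) * lam := by
    simp only [mul_add, add_mul, mul_smul_comm, smul_mul_assoc, one_mul, mul_one]
  rw [this]
  simp only [mul_add, smul_mul_assoc, mul_smul_comm, mul_assoc]
  abel

variable {ħ : ℂ} {lam : B}

/-- The Hamiltonian of the radial problem at angular momentum `lam`. -/
def radialHam (ħ κ : ℂ) (e W lam : B) : B :=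
  (1 / 2 : ℂ) • radialKin (Complex.I * ħ) κ e W (Complex.I • lam)

variable (heW : e * W = W * e + (Complex.I * ħ) • (W * W) + (Complex.I * ħ * κ) • 1)
    (hle : Commute e lam) (hlW : Commute W lam)

include heW hlW

/-- Adding a constant multiple of the coupling to the lowering operator works because of this
identity: the failure of the base operator to commute with W is the difference of the kinetic
energies on neighbouring levels. -/
theorem radialBase_bracket :
    Complex.I • ((lam + (ħ / 2) • 1) * (e + (Complex.I • lam) * W) * W
      - W * ((lam + (ħ / 2) • 1) * (e + (Complex.I • lam) * W))) =
      radialHam ħ κ e W lam - radialHam ħ κ e W (lam + ħ • 1)  := by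
  have h1 := radialKin_sub (e := e) (t := Complex.I * ħ) (κ := κ) (W := W) (ν := Complex.I • lam)
  have h2 : (Complex.I • lam + (Complex.I * ħ) • 1 : B) = Complex.I • (lam + ħ • 1) := by
    rw [smul_add, smul_smul]
  rw [h2] at h1
  rw [radialHam, radialHam, ← smul_sub, h1]
  have h3 : (Complex.I • lam + (Complex.I * ħ / 2) • 1 : B) = Complex.I • (lam + (ħ / 2) • 1) := by
    rw [smul_add, smul_smul, mul_div_assoc]
  have h4 : W * (lam + (ħ / 2) • 1) = (lam + (ħ / 2) • 1) * W := by
    simp only [mul_add, add_mul, mul_smul_comm, smul_mul_assoc, one_mul, mul_one, hlW.eq]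
  have h5 : (e + (Complex.I • lam) * W) * W - W * (e + (Complex.I • lam) * W)
      = (Complex.I * ħ) • (W * W + κ • 1) := by
    have : W * ((Complex.I • lam) * W) = (Complex.I • lam) * W * W := by
      rw [← mul_assoc, (hlW.smul_right _).eq]
    rw [mul_add, add_mul, heW, this]
    simp only [smul_add, smul_smul]
    abel
  rw [h3, mul_assoc, ← mul_assoc W, h4, mul_assoc, ← mul_sub, h5]
  simp only [mul_smul_comm, smul_mul_assoc, smul_smul]
  congr 1
  ring

include hle

theorem radialBase_intertwine :
    ((lam + (ħ / 2) • 1) * (e + (Complex.I • lam) * W)) * radialHam ħ κ e W lam =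
      radialHam ħ κ e W (lam + ħ • 1) * ((lam + (ħ / 2) • 1) * (e + (Complex.I • lam) * W)) := by
  have h1 := radialKin_intertwine (κ := κ) (ν := Complex.I • lam) heW
    (hle.smul_right _).eq (hlW.smul_right _).eq
  have hc : ∀ ν : B, Commute (lam + (ħ / 2) • 1) ν → Commute (lam + (ħ / 2) • 1)
      (radialKin (Complex.I * ħ) κ e W ν) := by
    intro ν hν
    have he : Commute (lam + (ħ / 2) • 1) e :=
      hle.symm.add_left ((Commute.one_left _).smul_left _)
    have hW : Commute (lam + (ħ / 2) • 1) W :=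
      hlW.symm.add_left ((Commute.one_left _).smul_left _)
    exact ((he.mul_right he).sub_right ((hW.mul_right he).smul_right _)).sub_right
      ((hν.mul_right hν).mul_right ((hW.mul_right hW).add_right
        ((Commute.one_right _).smul_right _)))
  have h2 : (Complex.I • lam + (Complex.I * ħ) • 1 : B) = Complex.I • (lam + ħ • 1) := by
    rw [smul_add, smul_smul]
  have hl : Commute (lam + (ħ / 2) • 1) lam :=
    (Commute.refl lam).add_left ((Commute.one_left _).smul_left _)
  rw [h2] at h1
  rw [radialHam, radialHam, mul_smul_comm, mul_assoc, h1, ← mul_assoc,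
    (hc _ ((hl.add_right ((Commute.one_right _).smul_right _)).smul_right _)).eq, mul_assoc]
  exact (smul_mul_assoc _ _ _).symm

/-- The intertwining relation of the Coulomb problem. -/
theorem radialLow_intertwine (μ : ℂ) :
    radialLow ħ e W lam (μ • 1) * (radialHam ħ κ e W lam - μ • W) =
      (radialHam ħ κ e W (lam + ħ • 1) - μ • W) * radialLow ħ e W lam (μ • 1) := by
  have h1 := radialBase_intertwine heW hle hlW
  have h2 := radialBase_bracket heW hlW
  rw [radialLow_eq, smul_mul_assoc, mul_smul_comm]
  congr 1
  set b := (lam + (ħ / 2) • 1) * (e + (Complex.I • lam) * W)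
  set T := radialHam ħ κ e W lam
  set T' := radialHam ħ κ e W (lam + ħ • 1)
  -- Once b T = T' b is used, the term μ[b, W] is left over, and it cancels against iμ(T - T').
  have h3 : b * W = W * b - Complex.I • (T - T') := by
    rw [← h2, smul_smul, Complex.I_mul_I]; module
  simp only [add_mul, mul_sub, sub_mul, mul_add, neg_mul, mul_neg, h1, mul_smul_comm,
    smul_mul_assoc, mul_one, one_mul, h3, smul_sub, smul_add, smul_neg]
  module

/-- The intertwining relation after coupling constant metamorphosis. -/
theorem radialLow_intertwine_metamorphosis {V : B} (μ' δ : ℂ) (hVW : V * (W - δ • 1) = 1)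
    (hWV : (W - δ • 1) * V = 1) :
    radialLow ħ e W lam (V * (radialHam ħ κ e W lam + μ' • 1)) *
        (V * (radialHam ħ κ e W lam + μ' • 1)) =
      (V * (radialHam ħ κ e W (lam + ħ • 1) + μ' • 1)) *
        radialLow ħ e W lam (V * (radialHam ħ κ e W lam + μ' • 1)) := by
  have h1 := radialBase_intertwine heW hle hlW
  have h2 := radialBase_bracket heW hlW
  rw [radialLow_eq, smul_mul_assoc, mul_smul_comm]
  congr 1
  set b := (lam + (ħ / 2) • 1) * (e + (Complex.I • lam) * W)
  set T := radialHam ħ κ e W lam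
  set T' := radialHam ħ κ e W (lam + ħ • 1)
  have h3 : b * W = W * b - Complex.I • (T - T') := by
    rw [← h2, smul_smul, Complex.I_mul_I]; module
  set H := V * (T + μ' • 1) with hH
  -- The eigenvalue equation of the Coulomb problem with coupling and energy exchanged: H stands to
  -- the left of T + μ' only through the factor W - δ, as the coupling does.
  have h4 : (W - δ • 1) * H = T + μ' • 1 := by rw [hH, ← mul_assoc, hWV, one_mul]
  clear_value H b T T'
  have h5 : (W - δ • 1) * b = b * (W - δ • 1) + Complex.I • (T - T') := by
    rw [sub_mul, mul_sub, h3]; simp only [smul_mul_assoc, mul_smul_comm, one_mul, mul_one]; abel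
  -- It suffices to prove the relation after multiplication by W - δ, which V inverts; there all
  -- occurrences of V disappear.
  have h6 : (W - δ • 1) * (-b * H + Complex.I • (H * H)) =
      (T' + μ' • 1) * (-b + Complex.I • H) := by
    rw [mul_add, neg_mul, mul_neg, ← mul_assoc, h5, add_mul, mul_assoc, h4, mul_smul_comm,
      ← mul_assoc, h4]
    simp only [add_mul, sub_mul, mul_add, mul_neg, h1, mul_smul_comm,
      smul_mul_assoc, mul_one, one_mul, smul_sub, smul_add]
    module
  calc (-b + Complex.I • H) * H = V * ((W - δ • 1) * (-b * H + Complex.I • (H * H))) := by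
        rw [← mul_assoc V, hVW, one_mul, add_mul, smul_mul_assoc]
    _ = V * (T' + μ' • 1) * (-b + Complex.I • H) := by rw [h6, mul_assoc]

end radial

/-! ### The radial operators -/

section ops
variable (ħ k : ℝ) (Ω : Region N)

/-- `G = (1 + k² r²) / r`. -/
def gO : Op Ω := onePlusO k Ω * uO Ω
/-- `W = (1 - k² r²) / r`. -/
def wO : Op Ω := uO Ω * oneMinusO k Ω
/-- `e = G D`. -/
def eO : Op Ω := gO k Ω * dO ħ Ω

theorem ordLE_gO : OrdLE 0 (gO k Ω) := (ordLE_onePlus k Ω).mul (ordLE_uO Ω)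
theorem ordLE_wO : OrdLE 0 (wO k Ω) := (ordLE_uO Ω).mul (ordLE_oneMinus k Ω)
theorem ordLE_eO : OrdLE 1 (eO ħ k Ω) := (ordLE_gO k Ω).mul (ordLE_dO ħ Ω)

theorem gO_eq : gO k Ω = uO Ω + ((k : ℂ) ^ 2) • rO Ω := by
  rw [gO, onePlusO, rO_eq, add_mul, one_mul, smul_mul_assoc,
    (uO_commute Ω (ordLE_JMinus Ω Finset.univ)).eq]

theorem wO_eq : wO k Ω = uO Ω - ((k : ℂ) ^ 2) • rO Ω := by
  rw [wO, oneMinusO, rO_eq, mul_sub, mul_one, mul_smul_comm]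

theorem bracket_dO_rO : ⁅dO ħ Ω, rO Ω⁆ = -((Complex.I * (ħ : ℂ)) • rO Ω) := by
  rw [rO_eq, bracket_mul, bracket_dO_uO, dO_bracket, bracket_J3O_JMinusO]
  simp only [mul_neg, mul_smul_comm, smul_mul_assoc]
  module

theorem bracket_dO_gO : ⁅dO ħ Ω, gO k Ω⁆ = (Complex.I * (ħ : ℂ)) • wO k Ω := by
  rw [gO_eq, wO_eq, bracket_add, bracket_smul, bracket_dO_uO, bracket_dO_rO]
  module

theorem bracket_dO_wO : ⁅dO ħ Ω, wO k Ω⁆ = (Complex.I * (ħ : ℂ)) • gO k Ω := by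
  rw [gO_eq, wO_eq, bracket_sub, bracket_smul, bracket_dO_uO, bracket_dO_rO]
  module

/-- The cross terms in the squares of 1/r ± k²r are ±2k², so the two squares differ by 4k². This is
the constant κ of the abstract radial problem. -/
theorem gO_mul_gO : gO k Ω * gO k Ω = wO k Ω * wO k Ω + (4 * (k : ℂ) ^ 2) • 1 := by
  have h1 := uO_mul_rO Ω
  have h2 : rO Ω * uO Ω = 1 := by rw [← (uO_commute Ω (ordLE_rO Ω)).eq, h1]
  rw [gO_eq, wO_eq]
  simp only [mul_add, add_mul, mul_sub, sub_mul, mul_smul_comm, smul_mul_assoc, h1, h2]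
  module

/-- The single relation on which the abstract radial problem rests, with t = iħ and κ = 4k². -/
theorem eO_mul_wO : eO ħ k Ω * wO k Ω = wO k Ω * eO ħ k Ω
    + (Complex.I * (ħ : ℂ)) • (wO k Ω * wO k Ω)
    + (Complex.I * (ħ : ℂ) * (4 * (k : ℂ) ^ 2)) • 1 := by
  rw [eO, mul_assoc, mul_eq_of_bracket (bracket_dO_wO ħ k Ω), mul_add, mul_smul_comm, gO_mul_gO,
    ← mul_assoc, ((ordLE_gO k Ω).commute (ordLE_wO k Ω)).eq, mul_assoc, smul_add, smul_smul,
    add_assoc]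

theorem gO_sq_mul_dO_sq : gO k Ω * gO k Ω * (dO ħ Ω * dO ħ Ω) =
    eO ħ k Ω * eO ħ k Ω - (Complex.I * (ħ : ℂ)) • (wO k Ω * eO ħ k Ω) := by
  have h : eO ħ k Ω * eO ħ k Ω = gO k Ω * (dO ħ Ω * gO k Ω) * dO ħ Ω := by
    rw [eO]; noncomm_ring
  rw [h, mul_eq_of_bracket (bracket_dO_gO ħ k Ω), mul_add, add_mul, mul_smul_comm, smul_mul_assoc,
    ((ordLE_gO k Ω).commute (ordLE_wO k Ω)).eq, eO]
  rw [mul_assoc (wO k Ω)]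
  noncomm_ring

theorem onePlusO_sq_mul (P : Op Ω) :
    onePlusO k Ω ^ 2 * (uO Ω ^ 2 * P) = gO k Ω * gO k Ω * P := by
  have h := (uO_commute Ω (ordLE_onePlus k Ω)).eq
  have : gO k Ω * gO k Ω = onePlusO k Ω ^ 2 * uO Ω ^ 2 := by
    rw [gO, mul_assoc, ← mul_assoc (uO Ω), h, pow_two, pow_two]; noncomm_ring
  rw [this, mul_assoc]

theorem rotO_commute_onePlusO (i j : Fin N) : Commute (rotO ħ Ω i j) (onePlusO k Ω) :=
  (Commute.one_right _).add_right ((rotO_commute_JMinusO ħ Ω (Finset.mem_univ i)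
    (Finset.mem_univ j)).smul_right _)

theorem rotO_commute_oneMinusO (i j : Fin N) : Commute (rotO ħ Ω i j) (oneMinusO k Ω) :=
  (Commute.one_right _).sub_right ((rotO_commute_JMinusO ħ Ω (Finset.mem_univ i)
    (Finset.mem_univ j)).smul_right _)

theorem rotO_commute_gO (i j : Fin N) : Commute (rotO ħ Ω i j) (gO k Ω) :=
  (rotO_commute_onePlusO ħ k Ω i j).mul_right (rotO_commute_uO ħ Ω i j)

theorem rotO_commute_wO (i j : Fin N) : Commute (rotO ħ Ω i j) (wO k Ω) :=
  (rotO_commute_uO ħ Ω i j).mul_right (rotO_commute_oneMinusO ħ k Ω i j)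

theorem rotO_commute_eO (i j : Fin N) : Commute (rotO ħ Ω i j) (eO ħ k Ω) :=
  (rotO_commute_gO ħ k Ω i j).mul_right (rotO_commute_dO ħ Ω i j)

variable {δ : ℝ} {Ω} {k} (hΩ : Admissible k δ Ω)

theorem vO_mul_wO : vO hΩ * (wO k Ω - (4 * (δ : ℂ)) • 1) = 1 := by
  rw [wO]; exact vO_mul hΩ

theorem ordLE_wO_sub : OrdLE 0 (wO k Ω - (4 * (δ : ℂ)) • 1) :=
  (ordLE_wO k Ω).sub (ordLE_one.smul _)

theorem wO_mul_vO : (wO k Ω - (4 * (δ : ℂ)) • 1) * vO hΩ = 1 := by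
  rw [(ordLE_wO_sub.commute (ordLE_vO hΩ)).eq]
  exact vO_mul_wO hΩ

theorem rotO_commute_vO (i j : Fin N) : Commute (rotO ħ Ω i j) (vO hΩ) :=
  commute_of_inverse ((rotO_commute_wO ħ k Ω i j).sub_right ((Commute.one_right _).smul_right _))
    (wO_mul_vO hΩ) (vO_mul_wO hΩ)

end ops

/-! ### Local operators and formal adjoints -/

section adj
variable {Ω : Region N}

/-- An operator that does not enlarge supports. -/
def IsLocal (P : Op Ω) : Prop := ∀ f : Smooth Ω, tsupport (P.app f).1 ⊆ tsupport f.1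

theorem isLocal_of_support {P : Op Ω}
    (h : ∀ f : Smooth Ω, ∀ x, x ∉ tsupport f.1 → (P.app f).1 x = 0) : IsLocal P := fun f =>
  closure_minimal (fun x hx => by by_contra hxf; exact hx (h f x hxf)) (isClosed_tsupport _)

theorem IsLocal.eq_zero {P : Op Ω} (h : IsLocal P) {f : Smooth Ω} {x : Space N}
    (hx : x ∉ tsupport f.1) : (P.app f).1 x = 0 := image_eq_zero_of_notMem_tsupport fun h' => hx (h f h')

theorem isLocal_mulO (a : Smooth Ω) : IsLocal (mulO a) := fun _ =>
  tsupport_mul_subset_right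

theorem isLocal_one : IsLocal (1 : Op Ω) := fun _ => subset_rfl

theorem IsLocal.add {P Q : Op Ω} (hP : IsLocal P) (hQ : IsLocal Q) : IsLocal (P + Q) :=
  isLocal_of_support fun f x hx => by rw [app_add, hP.eq_zero hx, hQ.eq_zero hx, add_zero]

theorem IsLocal.smul {P : Op Ω} (c : ℂ) (hP : IsLocal P) : IsLocal (c • P) :=
  isLocal_of_support fun f x hx => by rw [app_smul, hP.eq_zero hx, mul_zero]

theorem IsLocal.mul {P Q : Op Ω} (hP : IsLocal P) (hQ : IsLocal Q) : IsLocal (P * Q) :=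
  fun f => (hP _).trans (hQ f)

theorem isLocal_pO (ħ : ℝ) (j : Fin N) : IsLocal (pO ħ Ω j) := isLocal_of_support fun f x hx => by
  by_cases hΩ : x ∈ Ω.carrier
  · have h1 : fderiv ℝ f.1 x = 0 := by
      by_contra h
      exact hx (support_fderiv_subset ℝ h)
    rw [pO_app ħ j f hΩ, h1]
    simp
  · exact ((pO ħ Ω j).app f).2.2 x hΩ

/-- Test functions on `Ω`. -/
def IsTest (f : Smooth Ω) : Prop := HasCompactSupport f.1 ∧ tsupport f.1 ⊆ Ω.carrier

theorem IsLocal.isTest {P : Op Ω} (hP : IsLocal P) {f : Smooth Ω} (hf : IsTest f) :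
    IsTest (P.app f) :=
  ⟨hf.1.of_isClosed_subset (isClosed_tsupport _) (hP f), (hP f).trans hf.2⟩

theorem IsTest.contDiff {f : Smooth Ω} (hf : IsTest f) : ContDiff ℝ ∞ f.1 :=
  contDiff_iff_contDiffAt.mpr fun x => by
    by_cases hx : x ∈ tsupport f.1
    · exact f.2.1.contDiffAt (Ω.isOpen.mem_nhds (hf.2 hx))
    · exact contDiffAt_const.congr_of_eventuallyEq (notMem_tsupport_iff_eventuallyEq.mp hx)

theorem smooth_continuousAt (f : Smooth Ω) {x : Space N} (hx : x ∈ Ω.carrier) :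
    ContinuousAt f.1 x := (smooth_differentiableAt f hx).continuousAt

/-- Smooth real weights without zeros on `Ω`. -/
structure IsWeight (Ω : Region N) (w : Space N → ℝ) : Prop where
  contDiffOn : ContDiffOn ℝ ∞ w Ω.carrier
  ne_zero : ∀ x ∈ Ω.carrier, w x ≠ 0

theorem isWeight_one (Ω : Region N) : IsWeight Ω 1 := ⟨contDiffOn_const, fun _ _ => one_ne_zero⟩

/-- A real weight as a complex valued function. -/
def weightFn {w : Space N → ℝ} (hw : IsWeight Ω w) : Smooth Ω :=
  Smooth.of Ω (fun x => (w x : ℂ)) (Complex.ofRealCLM.contDiff.comp_contDiffOn hw.contDiffOn)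

theorem weightFn_apply {w : Space N → ℝ} (hw : IsWeight Ω w) {x : Space N}
    (hx : x ∈ Ω.carrier) : (weightFn hw).1 x = w x := of_apply _ hx

/-- The integrand of the pairing with the weight `w`. -/
def pair (w : Space N → ℝ) (f g : Smooth Ω) (x : Space N) : ℂ :=
  (starRingEnd ℂ) (f.1 x) * g.1 x * (w x : ℂ)

theorem pair_integrable {w : Space N → ℝ} (hw : IsWeight Ω w) {f g : Smooth Ω}
    (h : IsTest f ∨ IsTest g) : MeasureTheory.Integrable (pair w f g) := by
  have hf : tsupport (pair w f g) ⊆ tsupport f.1 := closure_mono fun x hx h0 => hx (by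
    simp only [pair, h0, map_zero, zero_mul])
  have hg : tsupport (pair w f g) ⊆ tsupport g.1 := closure_mono fun x hx h0 => hx (by
    simp only [pair, h0, mul_zero, zero_mul])
  have hΩ : tsupport (pair w f g) ⊆ Ω.carrier := by
    rcases h with h | h
    · exact hf.trans h.2
    · exact hg.trans h.2
  have hc : HasCompactSupport (pair w f g) := by
    rcases h with h | h
    · exact h.1.of_isClosed_subset (isClosed_tsupport _) hf
    · exact h.1.of_isClosed_subset (isClosed_tsupport _) hg
  refine Continuous.integrable_of_hasCompactSupport ?_ hc
  refine continuous_iff_continuousAt.mpr fun x => ?_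
  by_cases hx : x ∈ tsupport (pair w f g)
  · have hx' := hΩ hx
    refine ContinuousAt.mul (ContinuousAt.mul ?_ (smooth_continuousAt g hx')) ?_
    · exact Complex.continuous_conj.continuousAt.comp (smooth_continuousAt f hx')
    · exact Complex.continuous_ofReal.continuousAt.comp
        (hw.contDiffOn.continuousOn.continuousAt (Ω.isOpen.mem_nhds hx'))
  · exact continuousAt_const.congr (notMem_tsupport_iff_eventuallyEq.mp hx).symm

/-- `P` and `Q` are local operators and formal adjoints of each other. -/
structure Adj (w : Space N → ℝ) (P Q : Op Ω) : Prop where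
  left : IsLocal P
  right : IsLocal Q
  formal : ∀ f g : Smooth Ω, IsTest f → IsTest g →
    ∫ x, pair w f (P.app g) x = ∫ x, pair w (Q.app f) g x

theorem Adj.isFormalAdjoint {w : Space N → ℝ} {P Q : Op Ω} (h : Adj w P Q) :
    IsFormalAdjoint w P Q := fun f g hf hf' hg hg' => h.formal f g ⟨hf, hf'⟩ ⟨hg, hg'⟩

variable {w : Space N → ℝ}

theorem pair_conj (f g : Smooth Ω) (x : Space N) :
    (starRingEnd ℂ) (pair w f g x) = pair w g f x := by
  simp only [pair, map_mul, Complex.conj_conj, Complex.conj_ofReal]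
  ring

theorem Adj.symm {P Q : Op Ω} (h : Adj w P Q) : Adj w Q P := by
  refine ⟨h.right, h.left, fun f g hf hg => ?_⟩
  have h1 := congrArg (starRingEnd ℂ) (h.formal g f hg hf)
  rw [← integral_conj, ← integral_conj] at h1
  simp only [pair_conj] at h1
  exact h1.symm

theorem Adj.add (hw : IsWeight Ω w) {P P' Q Q' : Op Ω} (hP : Adj w P P') (hQ : Adj w Q Q') :
    Adj w (P + Q) (P' + Q') := by
  refine ⟨hP.left.add hQ.left, hP.right.add hQ.right, fun f g hf hg => ?_⟩
  have h1 : pair w f ((P + Q).app g) = fun x => pair w f (P.app g) x + pair w f (Q.app g) x := by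
    funext x; simp only [pair, app_add]; ring
  have h2 : pair w ((P' + Q').app f) g =
      fun x => pair w (P'.app f) g x + pair w (Q'.app f) g x := by
    funext x; simp only [pair, app_add, map_add]; ring
  rw [h1, h2, MeasureTheory.integral_add (pair_integrable hw (Or.inl hf))
    (pair_integrable hw (Or.inl hf)), MeasureTheory.integral_add (pair_integrable hw (Or.inr hg))
    (pair_integrable hw (Or.inr hg)), hP.formal f g hf hg, hQ.formal f g hf hg]

theorem Adj.smul (c : ℂ) {P P' : Op Ω} (hP : Adj w P P') :
    Adj w (c • P) ((starRingEnd ℂ) c • P') := by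
  refine ⟨hP.left.smul c, hP.right.smul _, fun f g hf hg => ?_⟩
  have h1 : pair w f ((c • P).app g) = fun x => c * pair w f (P.app g) x := by
    funext x; simp only [pair, app_smul]; ring
  have h2 : pair w (((starRingEnd ℂ) c • P').app f) g = fun x => c * pair w (P'.app f) g x := by
    funext x; simp only [pair, app_smul, map_mul, Complex.conj_conj]; ring
  rw [h1, h2, MeasureTheory.integral_const_mul, MeasureTheory.integral_const_mul,
    hP.formal f g hf hg]

theorem Adj.neg {P P' : Op Ω} (hP : Adj w P P') : Adj w (-P) (-P') := by
  simpa using hP.smul (-1)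

theorem Adj.sub (hw : IsWeight Ω w) {P P' Q Q' : Op Ω} (hP : Adj w P P') (hQ : Adj w Q Q') :
    Adj w (P - Q) (P' - Q') := by
  rw [sub_eq_add_neg, sub_eq_add_neg]; exact hP.add hw hQ.neg

theorem Adj.mul {P P' Q Q' : Op Ω} (hP : Adj w P P') (hQ : Adj w Q Q') :
    Adj w (P * Q) (Q' * P') := by
  refine ⟨hP.left.mul hQ.left, hQ.right.mul hP.right, fun f g hf hg => ?_⟩
  -- Locality guarantees that the intermediate functions are again test functions.
  rw [app_mul, app_mul, hP.formal f _ hf (hQ.left.isTest hg),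
    hQ.formal _ g (hP.right.isTest hf) hg]

theorem adj_one : Adj w (1 : Op Ω) 1 := ⟨isLocal_one, isLocal_one, fun _ _ _ _ => rfl⟩

theorem adj_zero : Adj w (0 : Op Ω) 0 := by simpa using (adj_one (Ω := Ω) (w := w)).smul 0

theorem Adj.pow {P P' : Op Ω} (hP : Adj w P P') (n : ℕ) : Adj w (P ^ n) (P' ^ n) := by
  induction n with
  | zero => simpa using adj_one
  | succ n ih => rw [pow_succ, pow_succ']; exact ih.mul hP

theorem Adj.sum (hw : IsWeight Ω w) {α : Type*} (s : Finset α) {P P' : α → Op Ω}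
    (h : ∀ i ∈ s, Adj w (P i) (P' i)) : Adj w (∑ i ∈ s, P i) (∑ i ∈ s, P' i) := by
  classical
  induction s using Finset.induction_on with
  | empty => simpa using adj_zero
  | insert i s hi ih =>
    rw [Finset.sum_insert hi, Finset.sum_insert hi]
    exact (h i (Finset.mem_insert_self i s)).add hw
      (ih fun j hj => h j (Finset.mem_insert_of_mem hj))

/-- The complex conjugate of a function. -/
def conjFn (a : Smooth Ω) : Smooth Ω :=
  ⟨fun x => (starRingEnd ℂ) (a.1 x), Complex.conjCLE.contDiff.comp_contDiffOn a.2.1,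
    fun x hx => by simp [a.2.2 x hx]⟩

theorem adj_mulO (a : Smooth Ω) : Adj w (mulO a) (mulO (conjFn a)) := by
  refine ⟨isLocal_mulO a, isLocal_mulO _, fun f g hf hg => ?_⟩
  congr 1
  funext x
  simp only [pair, mulO_app, conjFn, map_mul, Complex.conj_conj]
  ring

theorem adj_mulO_real (a : Smooth Ω) (h : ∀ x ∈ Ω.carrier, (starRingEnd ℂ) (a.1 x) = a.1 x) :
    Adj w (mulO a) (mulO a) := by
  have : conjFn a = a := smooth_ext h
  simpa only [this] using adj_mulO (w := w) a

theorem conj_of_apply {a : Space N → ℝ} (ha : ContDiffOn ℝ ∞ (fun x => (a x : ℂ)) Ω.carrier)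
    {x : Space N} (hx : x ∈ Ω.carrier) :
    (starRingEnd ℂ) ((Smooth.of Ω _ ha).1 x) = (Smooth.of Ω _ ha).1 x := by
  rw [of_apply _ hx, Complex.conj_ofReal]

theorem adj_xO (j : Fin N) : Adj w (xO Ω j) (xO Ω j) :=
  adj_mulO_real _ fun _ hx => conj_of_apply _ hx

theorem adj_uO : Adj w (uO Ω) (uO Ω) :=
  adj_mulO_real _ fun _ hx => conj_of_apply _ hx

theorem adj_vO {k δ : ℝ} (hΩ : Admissible k δ Ω) : Adj w (vO hΩ) (vO hΩ) :=
  adj_mulO_real _ fun _ hx => conj_of_apply _ hx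

theorem adj_pO (ħ : ℝ) (j : Fin N) : Adj 1 (pO ħ Ω j) (pO ħ Ω j) := by
  refine ⟨isLocal_pO ħ j, isLocal_pO ħ j, fun f g hf hg => ?_⟩
  set v : Space N := EuclideanSpace.single j 1
  -- For a test function the formula holds on the whole space, as both sides vanish off Ω; this
  -- permits integration by parts over all of space.
  have hpf : ∀ f : Smooth Ω, IsTest f → ∀ x, ((pO ħ Ω j).app f).1 x =
      -(Complex.I * (ħ : ℂ)) * fderiv ℝ f.1 x v := by
    intro f hf x
    by_cases hx : x ∈ Ω.carrier
    · exact pO_app ħ j f hx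
    · rw [((pO ħ Ω j).app f).2.2 x hx]
      have : fderiv ℝ f.1 x = 0 := by
        by_contra h
        exact hx (hf.2 (support_fderiv_subset ℝ h))
      rw [this]; simp
  have hF : ContDiff ℝ ∞ (conjFn f).1 := Complex.conjCLE.contDiff.comp hf.contDiff
  have hFd : ∀ x, fderiv ℝ (conjFn f).1 x v = (starRingEnd ℂ) (fderiv ℝ f.1 x v) := by
    intro x
    have h1 : (conjFn f).1 = Complex.conjCLE ∘ f.1 := rfl
    rw [h1, ContinuousLinearEquiv.comp_fderiv]
    rfl
  have hFc : HasCompactSupport (conjFn f).1 :=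
    hf.1.of_isClosed_subset (isClosed_tsupport _)
      (closure_mono fun x hx h0 => hx (by simp only [conjFn, h0, map_zero]))
  have hG := hg.contDiff
  have hFv : Continuous fun x => fderiv ℝ (conjFn f).1 x v :=
    (hF.continuous_fderiv (by simp)).clm_apply continuous_const
  have hGv : Continuous fun x => fderiv ℝ g.1 x v :=
    (hG.continuous_fderiv (by simp)).clm_apply continuous_const
  have key := integral_mul_fderiv_eq_neg_fderiv_mul_of_integrable (μ := MeasureTheory.volume)
    (f := (conjFn f).1) (g := g.1) (v := v)
    ((hFv.mul hG.continuous).integrable_of_hasCompactSupport hg.1.mul_left)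
    ((hF.continuous.mul hGv).integrable_of_hasCompactSupport hFc.mul_right)
    ((hF.continuous.mul hG.continuous).integrable_of_hasCompactSupport hg.1.mul_left)
    (fun x _ => (hF.differentiable (by simp)).differentiableAt)
    (fun x _ => (hG.differentiable (by simp)).differentiableAt)
  have h1 : pair 1 f ((pO ħ Ω j).app g) = fun x => -(Complex.I * (ħ : ℂ)) *
      ((conjFn f).1 x * fderiv ℝ g.1 x v) := by
    funext x
    simp only [pair, hpf g hg, conjFn, Pi.one_apply, Complex.ofReal_one]
    ring
  have h2 : pair 1 ((pO ħ Ω j).app f) g = fun x => (Complex.I * (ħ : ℂ)) *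
      (fderiv ℝ (conjFn f).1 x v * g.1 x) := by
    funext x
    simp only [pair, hpf f hf, hFd, Pi.one_apply, Complex.ofReal_one, map_mul, map_neg,
      Complex.conj_I, Complex.conj_ofReal]
    ring
  rw [h1, h2, MeasureTheory.integral_const_mul, MeasureTheory.integral_const_mul, key]
  ring

/-- Change of the weight. -/
theorem Adj.reweight {w' : Space N → ℝ} {U : Op Ω} (hU : IsLocal U)
    (hpair : ∀ f g : Smooth Ω, pair w' f g = pair w (U.app f) g) {P P' Q : Op Ω}
    (h : Adj w P P') (hQ : IsLocal Q) (hPQ : U * Q = P' * U) : Adj w' P Q := by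
  refine ⟨h.left, hQ, fun f g hf hg => ?_⟩
  rw [hpair, hpair, h.formal _ g (hU.isTest hf) hg, ← app_mul, ← app_mul, hPQ]

theorem pair_one_weightFn (hw : IsWeight Ω w) (f g : Smooth Ω) :
    pair w f g = pair 1 ((mulO (weightFn hw)).app f) g := by
  funext x
  by_cases hx : x ∈ Ω.carrier
  · simp only [pair, mulO_app, map_mul, weightFn_apply hw hx, Complex.conj_ofReal, Pi.one_apply,
      Complex.ofReal_one]
    ring
  · simp only [pair, g.2.2 x hx, mul_zero, zero_mul]

theorem Adj.weight_of_commute (hw : IsWeight Ω w) {P P' : Op Ω} (h : Adj 1 P P')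
    (hc : Commute P' (mulO (weightFn hw))) : Adj w P P' :=
  h.reweight (isLocal_mulO _) (pair_one_weightFn hw) h.right hc.eq.symm

/-- The formal adjoint of a local operator is unique. -/
theorem Adj.eq_zero (hw : IsWeight Ω w) {Q : Op Ω} (h : Adj w 0 Q) : Q = 0 := by
  refine op_ext fun f x hx => ?_
  obtain ⟨ε, hε, hball⟩ := Metric.isOpen_iff.mp Ω.isOpen x hx
  -- A cut-off that equals 1 near x and is supported in Ω. By locality, replacing f by its product
  -- with the cut-off does not change Qf at x, and the product is a test function.
  let χ : ContDiffBump x := ⟨ε / 4, ε / 2, by linarith, by linarith⟩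
  have hχΩ : tsupport (χ : Space N → ℝ) ⊆ Ω.carrier := by
    rw [χ.tsupport_eq]
    exact (Metric.closedBall_subset_ball (by change ε / 2 < ε; linarith)).trans hball
  let c : Smooth Ω := ⟨fun y => ((χ y : ℝ) : ℂ),
    (Complex.ofRealCLM.contDiff.comp χ.contDiff).contDiffOn, fun y hy => by
      beta_reduce
      rw [image_eq_zero_of_notMem_tsupport fun h' => hy (hχΩ h'), Complex.ofReal_zero]⟩
  have hcs : tsupport c.1 ⊆ tsupport (χ : Space N → ℝ) := closure_mono fun y hy h0 => hy (by
    change ((χ y : ℝ) : ℂ) = 0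
    rw [h0, Complex.ofReal_zero])
  have hct : IsTest c := ⟨χ.hasCompactSupport.of_isClosed_subset (isClosed_tsupport _) hcs,
    hcs.trans hχΩ⟩
  set f1 := (mulO c).app f with hf1
  have hf1t : IsTest f1 :=
    ⟨hct.1.of_isClosed_subset (isClosed_tsupport _) tsupport_mul_subset_left,
      tsupport_mul_subset_left.trans hct.2⟩
  have hQ1 : (Q.app f).1 x = (Q.app f1).1 x := by
    have hd : x ∉ tsupport (f + (-1 : ℂ) • f1).1 := by
      rw [notMem_tsupport_iff_eventuallyEq]
      filter_upwards [χ.eventuallyEq_one] with y hy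
      change f.1 y + (-1 : ℂ) * (((χ y : ℝ) : ℂ) * f.1 y) = 0
      rw [hy]; simp
    have h0 := h.right.eq_zero hd
    rw [app_map_add, app_map_smul] at h0
    change (Q.app f).1 x + (-1 : ℂ) * (Q.app f1).1 x = 0 at h0
    linear_combination h0
  rw [app_zero, hQ1]
  set q := Q.app f1
  have hqt : IsTest q := h.right.isTest hf1t
  -- Test against w·q instead of q: the integrand becomes |w q|², which is nonnegative even where
  -- the weight is negative.
  set g := (mulO (weightFn hw)).app q
  have hgt : IsTest g := (isLocal_mulO _).isTest hqt
  have h0 := h.formal f1 g hf1t hgt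
  have h1 : pair w f1 ((0 : Op Ω).app g) = fun _ => 0 := by
    funext y; simp only [pair, app_zero, mul_zero, zero_mul]
  have h2 : pair w q g = fun y => ((Complex.normSq (g.1 y) : ℝ) : ℂ) := by
    funext y
    by_cases hy : y ∈ Ω.carrier
    · simp only [pair, g, mulO_app, weightFn_apply hw hy, map_mul, Complex.normSq_ofReal,
        Complex.ofReal_mul, Complex.normSq_eq_conj_mul_self]
      ring
    · simp only [pair, g.2.2 y hy, mul_zero, zero_mul, map_zero, Complex.ofReal_zero]
  rw [h1, h2, MeasureTheory.integral_zero, integral_complex_ofReal] at h0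
  have h3 : ∫ y, Complex.normSq (g.1 y) = 0 := by exact_mod_cast h0.symm
  by_contra hne
  have hgx : Complex.normSq (g.1 x) ≠ 0 := by
    rw [ne_eq, Complex.normSq_eq_zero]
    simp only [g, mulO_app, weightFn_apply hw hx, mul_eq_zero, not_or]
    exact ⟨by exact_mod_cast hw.ne_zero x hx, hne⟩
  have hpos := Continuous.integral_pos_of_hasCompactSupport_nonneg_nonzero
    (μ := MeasureTheory.volume) (f := fun y => Complex.normSq (g.1 y))
    (Complex.continuous_normSq.comp hgt.contDiff.continuous)
    (hgt.1.comp_left (map_zero _)) (fun y => Complex.normSq_nonneg _) hgx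
  exact hpos.ne' h3

theorem Adj.unique (hw : IsWeight Ω w) {P Q Q' : Op Ω} (h : Adj w P Q) (h' : Adj w P Q') :
    Q = Q' := by
  have h0 := h.sub hw h'
  rw [sub_self] at h0
  exact sub_eq_zero.mp (h0.eq_zero hw)

/-- The adjoint of the commutator with a function is, up to sign, the commutator of the adjoint with
the conjugate function. Induction reduces to order zero, where uniqueness of the adjoint of 0
applies. -/
theorem Adj.ordLE (hw : IsWeight Ω w) {d : ℕ} {P Q : Op Ω} (h : Adj w P Q) (hP : OrdLE d P) :
    OrdLE d Q := by
  have key : ∀ {P Q : Op Ω} (a : Smooth Ω), Adj w P Q →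
      Adj w (-(P * mulO (conjFn a) - mulO (conjFn a) * P)) (Q * mulO a - mulO a * Q) := by
    intro P Q a h
    have ha : Adj w (mulO (conjFn a)) (mulO a) := (adj_mulO a).symm
    rw [neg_sub]
    exact (ha.mul h).sub hw (h.mul ha)
  induction d generalizing P Q with
  | zero =>
    intro a
    have h0 := key a h
    rw [hP, neg_zero] at h0
    exact h0.eq_zero hw
  | succ d ih => exact fun a => ih (key a h) (hP _).neg

end adj

/-! ### Adjoints of the basic operators -/

section adj
variable (ħ k : ℝ) {Ω : Region N} {w : Space N → ℝ}

theorem conj_I_mul : (starRingEnd ℂ) (Complex.I * (ħ : ℂ)) = -(Complex.I * (ħ : ℂ)) := by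
  rw [map_mul, Complex.conj_I, Complex.conj_ofReal, neg_mul]

/-- The adjoint of x_i p_i is p_i x_i = x_i p_i - iħ; the constant -iħ/2 for each coordinate is half
of the defect and hence symmetrizes. -/
theorem adj_J3O (S : Finset (Fin N)) : Adj 1 (J3O ħ Ω S) (J3O ħ Ω S) := by
  have hw := isWeight_one Ω
  have h : J3O ħ Ω S = ∑ i ∈ S, (pO ħ Ω i * xO Ω i -
      (starRingEnd ℂ) (Complex.I * ħ / 2) • 1) := by
    refine Finset.sum_congr rfl fun i _ => ?_
    rw [pO_mul_xO, if_pos rfl, map_div₀, conj_I_mul, map_ofNat]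
    module
  nth_rw 2 [h]
  exact Adj.sum hw _ fun i _ => ((adj_xO i).mul (adj_pO ħ i)).sub hw (adj_one.smul _)

theorem adj_rotO_one (i j : Fin N) : Adj 1 (rotO ħ Ω i j) (rotO ħ Ω i j) := by
  have h : rotO ħ Ω i j = pO ħ Ω j * xO Ω i - pO ħ Ω i * xO Ω j := by
    rw [rotO, pO_mul_xO, pO_mul_xO]
    simp only [eq_comm]
    abel
  nth_rw 2 [h]
  exact ((adj_xO i).mul (adj_pO ħ j)).sub (isWeight_one Ω) ((adj_xO j).mul (adj_pO ħ i))

theorem adj_dO_one : Adj 1 (dO ħ Ω) (dO ħ Ω - (2 * (Complex.I * ħ)) • 1) := by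
  have h : dO ħ Ω - (2 * (Complex.I * ħ)) • 1 =
      J3O ħ Ω Finset.univ + (starRingEnd ℂ) (Complex.I * ħ) • 1 := by
    rw [dO, conj_I_mul]; module
  rw [h]
  exact (adj_J3O ħ _).add (isWeight_one Ω) (adj_one.smul _)

theorem adj_JMinusO (hw : IsWeight Ω w) (S : Finset (Fin N)) :
    Adj w (JMinusO Ω S) (JMinusO Ω S) :=
  Adj.sum hw _ fun i _ => (adj_xO i).pow 2

theorem adj_JPlusO (S : Finset (Fin N)) : Adj 1 (JPlusO ħ Ω S) (JPlusO ħ Ω S) :=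
  Adj.sum (isWeight_one Ω) _ fun i _ => (adj_pO ħ i).pow 2

theorem adj_casimirO_one (S : Finset (Fin N)) : Adj 1 (casimirO ħ Ω S) (casimirO ħ Ω S) := by
  have hw := isWeight_one Ω
  have h1 := adj_JMinusO (Ω := Ω) hw S
  have h2 := adj_JPlusO ħ (Ω := Ω) S
  have h3 := (((h1.mul h2).add hw (h2.mul h1)).smul (1 / 2)).sub hw ((adj_J3O ħ S).pow 2)
  have e : (starRingEnd ℂ) (1 / 2 : ℂ) = 1 / 2 := by rw [map_div₀, map_one, map_ofNat]
  rw [e] at h3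
  have e2 : casimirO ħ Ω S = (1 / 2 : ℂ) • (JMinusO Ω S * JPlusO ħ Ω S +
      JPlusO ħ Ω S * JMinusO Ω S) - J3O ħ Ω S ^ 2 := by rw [add_comm]; rfl
  nth_rw 1 [e2]
  exact h3

theorem adj_onePlusO (hw : IsWeight Ω w) : Adj w (onePlusO k Ω) (onePlusO k Ω) := by
  have h := adj_one.add hw ((adj_JMinusO hw Finset.univ).smul ((k : ℂ) ^ 2))
  rwa [map_pow, Complex.conj_ofReal] at h

theorem adj_oneMinusO (hw : IsWeight Ω w) : Adj w (oneMinusO k Ω) (oneMinusO k Ω) := by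
  have h := adj_one.sub hw ((adj_JMinusO hw Finset.univ).smul ((k : ℂ) ^ 2))
  rwa [map_pow, Complex.conj_ofReal] at h

theorem adj_gO (hw : IsWeight Ω w) : Adj w (gO k Ω) (gO k Ω) := by
  have h := (adj_onePlusO k hw).mul adj_uO
  rwa [(uO_commute Ω (ordLE_onePlus k Ω)).eq] at h

theorem adj_wO (hw : IsWeight Ω w) : Adj w (wO k Ω) (wO k Ω) := by
  have h := adj_uO.mul (adj_oneMinusO k hw)
  rwa [← (uO_commute Ω (ordLE_oneMinus k Ω)).eq] at h

/-! ### The weights -/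

theorem isWeight_weight (Ω : Region N) : IsWeight Ω (weight k) := by
  have h : ∀ x : Space N, (1 + k ^ 2 * ‖x‖ ^ 2) ^ 2 ≠ 0 := fun x => by positivity
  refine ⟨?_, fun x _ => inv_ne_zero (h x)⟩
  exact ((contDiffOn_const.add (contDiffOn_const.mul ((contDiffOn_norm Ω).pow 2))).pow 2).inv
    fun x _ => h x

theorem mulO_weight_mul : mulO (weightFn (isWeight_weight k Ω)) * onePlusO k Ω ^ 2 = 1 := by
  refine op_ext fun f x hx => ?_
  have h : (1 + (k : ℂ) ^ 2 * (‖x‖ : ℂ) ^ 2) ≠ 0 := by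
    have : (1 + k ^ 2 * ‖x‖ ^ 2) ≠ 0 := by positivity
    exact_mod_cast this
  have h1 : ∀ g : Smooth Ω, ((onePlusO k Ω).app g).1 x =
      (1 + (k : ℂ) ^ 2 * (‖x‖ : ℂ) ^ 2) * g.1 x := fun g => by
    rw [onePlusO, app_add, app_smul, JMinusO_univ_app _ hx, app_one]; ring
  rw [app_mul, mulO_app, weightFn_apply _ hx, weight, pow_two (onePlusO k Ω), app_mul, h1, h1, app_one]
  push_cast
  generalize (1 + (k : ℂ) ^ 2 * (‖x‖ : ℂ) ^ 2) = z at h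
  field_simp

theorem mul_mulO_weight : onePlusO k Ω ^ 2 * mulO (weightFn (isWeight_weight k Ω)) = 1 := by
  rw [(((ordLE_onePlus k Ω).pow 2).commute (ordLE_mulO _)).eq, mulO_weight_mul]

theorem commute_mulO_weight {P : Op Ω} (h : Commute P (onePlusO k Ω)) :
    Commute P (mulO (weightFn (isWeight_weight k Ω))) :=
  commute_of_inverse (h.pow_right 2) (mul_mulO_weight k) (mulO_weight_mul k)

theorem adj_rotO_weight (i j : Fin N) : Adj (weight k) (rotO ħ Ω i j) (rotO ħ Ω i j) :=
  (adj_rotO_one ħ i j).weight_of_commute (isWeight_weight k Ω)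
    (commute_mulO_weight k (rotO_commute_onePlusO ħ k Ω i j))

theorem adj_casimirO_weight (S : Finset (Fin N)) :
    Adj (weight k) (casimirO ħ Ω S) (casimirO ħ Ω S) :=
  (adj_casimirO_one ħ S).weight_of_commute (isWeight_weight k Ω)
    (commute_mulO_weight k (casimirO_commute_of_rotO ħ Ω S fun i _ j _ =>
      rotO_commute_onePlusO ħ k Ω i j))

theorem bracket_dO_onePlusO : ⁅dO ħ Ω, onePlusO k Ω⁆ =
    -((2 * (Complex.I * (ħ : ℂ))) • (onePlusO k Ω - 1)) := by
  rw [onePlusO, bracket_add, bracket_one, bracket_smul, dO_bracket, bracket_J3O_JMinusO]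
  module

theorem isLocal_eO_sub : IsLocal (eO ħ k Ω - (Complex.I * (ħ : ℂ)) • wO k Ω) := by
  have hw := isWeight_one Ω
  exact (((adj_gO k hw).mul (adj_dO_one ħ)).sub hw ((adj_wO k hw).smul _)).left

/-- For Lebesgue measure the adjoint of G D is (D - 2iħ) G; conjugation by the density (1 + k²r²)⁻²
turns it into e - iħW. -/
theorem adj_eO_weight : Adj (weight k) (eO ħ k Ω) (eO ħ k Ω - (Complex.I * (ħ : ℂ)) • wO k Ω) := by
  have hw := isWeight_one Ω
  have h1 := (adj_gO k hw).mul (adj_dO_one ħ (Ω := Ω))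
  refine h1.reweight (isLocal_mulO _) (pair_one_weightFn (isWeight_weight k Ω))
    (isLocal_eO_sub ħ k) ?_
  set t := Complex.I * (ħ : ℂ)
  set m := mulO (weightFn (isWeight_weight k Ω))
  set P := onePlusO k Ω with hP
  have hmP : m * P ^ 2 = 1 := mulO_weight_mul k
  have hPm : P ^ 2 * m = 1 := mul_mulO_weight k
  have hDP : dO ħ Ω * P = P * dO ħ Ω + -((2 * t) • (P - 1)) :=
    mul_eq_of_bracket (bracket_dO_onePlusO ħ k)
  have hDu : dO ħ Ω * uO Ω = uO Ω * dO ħ Ω + t • uO Ω :=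
    mul_eq_of_bracket (bracket_dO_uO ħ Ω)
  have hPu : P * uO Ω = uO Ω * P := (uO_commute Ω (ordLE_onePlus k Ω)).eq.symm
  have hG : gO k Ω = uO Ω * P := hPu
  -- From 1 - k²r² = 2 - (1 + k²r²): every operator is now a word in 1/r, P and D, for which normal
  -- ordering decides equality.
  have hW : wO k Ω = (2 : ℂ) • uO Ω - uO Ω * P := by
    rw [wO, hP, oneMinusO, onePlusO, mul_sub, mul_add, mul_one]
    module
  have h2 : ∀ z, P * (uO Ω * z) = uO Ω * (P * z) := fun z => by
    rw [← mul_assoc, hPu, mul_assoc]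
  have h3 : ∀ z, dO ħ Ω * (uO Ω * z) = uO Ω * (dO ħ Ω * z) + t • (uO Ω * z) := fun z => by
    rw [← mul_assoc, hDu, add_mul, mul_assoc, smul_mul_assoc]
  have h4 : ∀ z, dO ħ Ω * (P * z) = P * (dO ħ Ω * z) + -((2 * t) • (P * z - z)) := fun z => by
    rw [← mul_assoc, hDP, add_mul, mul_assoc, neg_mul, smul_mul_assoc, sub_mul, one_mul]
  have key : P ^ 2 * ((dO ħ Ω - (2 * t) • 1) * gO k Ω) = (eO ħ k Ω - t • wO k Ω) * P ^ 2 := by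
    simp only [eO, hG, hW, pow_two, mul_add, mul_sub, sub_mul, mul_assoc, h2, h3, h4,
      hDP, hPu, smul_mul_assoc, mul_smul_comm, mul_neg, smul_sub, one_mul, mul_one]
    module
  calc m * (eO ħ k Ω - t • wO k Ω) = m * ((eO ħ k Ω - t • wO k Ω) * P ^ 2) * m := by
        rw [mul_assoc, mul_assoc _ _ m, hPm, mul_one]
    _ = _ := by rw [← key, ← mul_assoc, hmP, one_mul]

/-! #### The weight of the metamorphosed Hamiltonian -/

variable {k} {δ : ℝ}

theorem isWeight_hatWeight (hΩ : Admissible k δ Ω) : IsWeight Ω (hatWeight k δ) := by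
  have h0 : ∀ x ∈ Ω.carrier, ‖x‖ ≠ 0 := fun x hx => norm_ne_zero_of_mem hx
  refine ⟨?_, fun x hx => mul_ne_zero ?_ ((isWeight_weight k Ω).ne_zero x hx)⟩
  · exact ((((contDiffOn_norm Ω).inv h0).sub (contDiffOn_const.mul (contDiffOn_norm Ω))).sub
      contDiffOn_const).mul (isWeight_weight k Ω).contDiffOn
  · have h1 : ‖x‖⁻¹ - k ^ 2 * ‖x‖ - 4 * δ =
        ‖x‖⁻¹ * (1 - k ^ 2 * ‖x‖ ^ 2 - 4 * δ * ‖x‖) := by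
      have := h0 x hx
      field_simp
    rw [h1]
    exact mul_ne_zero (inv_ne_zero (h0 x hx)) (hΩ x hx)

theorem isLocal_wO_sub : IsLocal (wO k Ω - (4 * (δ : ℂ)) • 1) :=
  ((adj_wO k (isWeight_one Ω)).sub (isWeight_one Ω) (adj_one.smul _)).left

theorem pair_hatWeight (f g : Smooth Ω) :
    pair (hatWeight k δ) f g = pair (weight k) ((wO k Ω - (4 * (δ : ℂ)) • 1).app f) g := by
  funext x
  by_cases hx : x ∈ Ω.carrier
  · have h1 : ((wO k Ω - (4 * (δ : ℂ)) • 1).app f).1 x =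
        ((‖x‖⁻¹ - k ^ 2 * ‖x‖ - 4 * δ : ℝ) : ℂ) * f.1 x := by
      rw [wO_eq, app_sub, app_sub, app_smul, app_smul, uO_app _ hx, rO_app _ hx, app_one]
      push_cast
      ring
    simp only [pair, h1, hatWeight, map_mul, Complex.conj_ofReal, Complex.ofReal_mul]
    ring
  · simp only [pair, g.2.2 x hx, mul_zero, zero_mul]

/-- Adjoints for the weights of the two Hamiltonians. -/
theorem Adj.hat (hΩ : Admissible k δ Ω) {P P' : Op Ω} (h : Adj (CurvedCoulomb.weight k) P P') :
    Adj (hatWeight k δ) P (vO hΩ * P' * (wO k Ω - (4 * (δ : ℂ)) • 1)) := by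
  refine h.reweight isLocal_wO_sub pair_hatWeight
    (((isLocal_mulO _).mul h.right).mul isLocal_wO_sub) ?_
  rw [← mul_assoc, ← mul_assoc, wO_mul_vO, one_mul]

theorem Adj.hat_of_commute (hΩ : Admissible k δ Ω) {P : Op Ω} (h : Adj (CurvedCoulomb.weight k) P P)
    (hc : Commute P (wO k Ω)) : Adj (hatWeight k δ) P P := by
  have h1 := h.hat hΩ
  rwa [mul_assoc, (hc.sub_right ((Commute.one_right _).smul_right _)).eq, ← mul_assoc,
    vO_mul_wO, one_mul] at h1

/-- V is the inverse of W - 4δ, the ratio of the two weights, so it cancels the change of weight and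
V P is again symmetric. -/
theorem Adj.hat_vO_mul (hΩ : Admissible k δ Ω) {P : Op Ω} (h : Adj (CurvedCoulomb.weight k) P P) :
    Adj (hatWeight k δ) (vO hΩ * P) (vO hΩ * P) := by
  have h1 := ((adj_vO hΩ).mul h).hat hΩ
  rwa [mul_assoc, mul_assoc P, vO_mul_wO, mul_one] at h1

theorem adj_rotO_hatWeight (hΩ : Admissible k δ Ω) (i j : Fin N) :
    Adj (hatWeight k δ) (rotO ħ Ω i j) (rotO ħ Ω i j) :=
  (adj_rotO_weight ħ k i j).hat_of_commute hΩ (rotO_commute_wO ħ k Ω i j)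

theorem adj_casimirO_hatWeight (hΩ : Admissible k δ Ω) (S : Finset (Fin N)) :
    Adj (hatWeight k δ) (casimirO ħ Ω S) (casimirO ħ Ω S) :=
  (adj_casimirO_weight ħ k S).hat_of_commute hΩ (casimirO_commute_of_rotO ħ Ω S fun i _ j _ =>
      rotO_commute_wO ħ k Ω i j)

end adj

/-! ### Algebra of the angular momentum ladder -/

section ladder
variable {B : Type*} [Ring B] [Algebra ℂ B]

/-- The square of `-i x p + i J - ħ` in terms of the `sl(2)` generators `x²`, `p²`, `J`. -/
theorem sq_of_anticommutator {x p J : B} {ħ : ℂ} (hx : x * J = J * x + (Complex.I * ħ) • x)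
    (hp : p * J = J * p - (Complex.I * ħ) • p) (h : p * x = (2 : ℂ) • J - x * p) :
    (-(Complex.I • (x * p)) + Complex.I • J - ħ • 1) *
      (-(Complex.I • (x * p)) + Complex.I • J - ħ • 1) =
    (1 / 2 : ℂ) • (p ^ 2 * x ^ 2 + x ^ 2 * p ^ 2) - J ^ 2 + (ħ ^ 2) • 1 := by
  have hx' : ∀ z, x * (J * z) = J * (x * z) + (Complex.I * ħ) • (x * z) := fun z => by
    rw [← mul_assoc, hx, add_mul, mul_assoc, smul_mul_assoc]
  have hp' : ∀ z, p * (J * z) = J * (p * z) - (Complex.I * ħ) • (p * z) := fun z => by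
    rw [← mul_assoc, hp, sub_mul, mul_assoc, smul_mul_assoc]
  have h' : ∀ z, p * (x * z) = (2 : ℂ) • (J * z) - x * (p * z) := fun z => by
    rw [← mul_assoc, h, sub_mul, mul_assoc, smul_mul_assoc]
  have e1 : p * (p * (x * x)) = (2 : ℂ) • ((2 : ℂ) • (J * J) - J * (x * p))
      - (2 * (Complex.I * ħ)) • ((2 : ℂ) • J - x * p)
      - ((2 : ℂ) • ((2 : ℂ) • (J * J) - J * (x * p)) - (2 : ℂ) • (J * (x * p))
        + x * (p * (x * p))) := by
    simp only [h', h, hx, hx', hp', mul_sub, mul_add, mul_smul_comm, smul_add,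
      smul_sub]
    module
  have e2 : x * (x * (p * p)) = (2 : ℂ) • (J * (x * p)) + (2 * (Complex.I * ħ)) • (x * p)
      - x * (p * (x * p)) := by
    simp only [h', hx', mul_sub, mul_smul_comm, smul_add]
    module
  have hI : Complex.I * Complex.I = -1 := Complex.I_mul_I
  simp only [pow_two, mul_assoc, e1, e2]
  simp only [mul_add, add_mul, mul_sub, sub_mul, neg_mul, mul_neg, smul_mul_assoc, mul_smul_comm,
    mul_assoc, one_mul, mul_one, hp, hx', smul_add, smul_sub, smul_neg, smul_smul, hI]
  match_scalars <;> ring_nf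

/-- The shift property of the angular momentum ladder operator. -/
theorem ladder_shift {L E g n V : B} {ħ : ℂ} (hħ : ħ ≠ 0) (h1 : E * L = -((L + ħ • 1) * E))
    (h2 : L * n - n * L = ħ • (g * E - n)) (h3 : g * E + E * g = (2 : ℂ) • n)
    (h4 : L * L * g = g * (L * L))
    (h5 : L * L * n - n * (L * L) = (2 * (Complex.I * ħ)) • V - (ħ ^ 2) • n) :
    L * (L * n + Complex.I • V) = (L * n + Complex.I • V) * (L + ħ • 1) := by
  -- In the application g is γ_j. The anticommutator K of L and g commutes with L because L²
  -- commutes with g, and it commutes with E because of `h2`. With K in hand, words in L, E and g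
  -- have a normal form.
  obtain ⟨K, hK⟩ : ∃ K, K = L * g + g * L := ⟨_, rfl⟩
  have hn : n = (1 / 2 : ℂ) • (g * E + E * g) := by rw [h3]; module
  -- V is eliminated through the commutator of L² with n, so that the claim concerns L, E and g
  -- only.
  have hV : Complex.I • V =
      (1 / (2 * ħ)) • (L * L * n - n * (L * L) + (ħ ^ 2) • n) := by
    rw [h5, sub_add_cancel, smul_smul]
    congr 1
    field_simp
  have hEL : E * L = -(L * E) - ħ • E := by
    rw [h1, add_mul, smul_mul_assoc, one_mul]; abel
  have hgL : g * L = K - L * g := by rw [hK]; abel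
  have hEL' : ∀ z, E * (L * z) = -(L * (E * z)) - ħ • (E * z) := fun z => by
    rw [← mul_assoc, hEL, sub_mul, neg_mul, mul_assoc, smul_mul_assoc]
  have hgL' : ∀ z, g * (L * z) = K * z - L * (g * z) := fun z => by
    rw [← mul_assoc, hgL, sub_mul, mul_assoc]
  have hKL : L * K = K * L := by
    rw [hK, mul_add, add_mul, mul_assoc g, ← h4]; noncomm_ring
  have hKL' : ∀ z, L * (K * z) = K * (L * z) := fun z => by rw [← mul_assoc, hKL, mul_assoc]
  have hEK : E * K = K * E := by
    have : (1 / 2 : ℂ) • (K * E - E * K) = 0 := by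
      have h6 := h2
      rw [hn] at h6
      simp only [mul_smul_comm, smul_mul_assoc, mul_add, add_mul, mul_assoc, hEL, hgL, mul_sub,
        mul_neg, hgL', hEL'] at h6
      refine Eq.trans ?_ (sub_eq_zero.mpr h6)
      module
    rw [smul_eq_zero] at this
    rcases this with h | h
    · norm_num at h
    · exact (sub_eq_zero.mp h).symm
  have hEK' : ∀ z, E * (K * z) = K * (E * z) := fun z => by rw [← mul_assoc, hEK, mul_assoc]
  clear hK
  rw [hV, hn]
  simp only [mul_smul_comm, smul_mul_assoc, mul_add, add_mul, mul_assoc, hEL, hgL, mul_sub,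
        mul_neg, hgL', hEL', sub_mul, neg_mul, hKL, hKL', hEK, hEK', mul_one, smul_add,
        smul_sub, smul_neg, smul_smul]
  match_scalars <;> field_simp <;> ring

end ladder

/-! ### Matrices of operators -/

section spin
variable {ι : Type*} [Fintype ι] [DecidableEq ι]

/-- Matrices with entries in the ring of operators. -/
abbrev MOp (Ω : Region N) (ι : Type*) := Matrix ι ι (Op Ω)

/-- Scalar operators as matrices of operators. -/
def sc {Ω : Region N} (ι : Type*) [Fintype ι] [DecidableEq ι] : Op Ω →ₐ[ℂ] MOp Ω ι :=
  { Matrix.scalar ι with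
    commutes' := fun c => by
      ext a b
      change Matrix.scalar ι (algebraMap ℂ (Op Ω) c) a b = _
      rw [Matrix.scalar_apply, Matrix.algebraMap_eq_diagonal]
      rfl }

variable {Ω : Region N}

theorem sc_apply (P : Op Ω) : sc ι P = Matrix.diagonal fun _ => P := rfl

theorem sc_eq_scal (P : Op Ω) : sc ι P = scal ι P := rfl

theorem sc_mul_apply (P : Op Ω) (X : MOp Ω ι) (a b : ι) : (sc ι P * X) a b = P * X a b := by
  rw [sc_apply, Matrix.diagonal_mul]

theorem mul_sc_apply (P : Op Ω) (X : MOp Ω ι) (a b : ι) : (X * sc ι P) a b = X a b * P := by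
  rw [sc_apply, Matrix.mul_diagonal]

theorem commute_sc_iff {P : Op Ω} {X : MOp Ω ι} :
    Commute X (sc ι P) ↔ ∀ a b, Commute (X a b) P := by
  rw [Commute, SemiconjBy, ← Matrix.ext_iff]
  simp only [sc_mul_apply, mul_sc_apply]
  rfl

theorem commute_sc {P Q : Op Ω} (h : Commute P Q) : Commute (sc ι P) (sc ι Q) :=
  h.map (sc ι)

/-- The gamma matrices as matrices of operators. -/
def gam (γ : GammaMatrices N ι) (Ω : Region N) (j : Fin N) : MOp Ω ι :=
  (γ.mat j).map (algebraMap ℂ (Op Ω))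

variable (γ : GammaMatrices N ι)

theorem gam_commute_sc (j : Fin N) (P : Op Ω) : Commute (gam γ Ω j) (sc ι P) :=
  commute_sc_iff.mpr fun a b => Algebra.commutes (γ.mat j a b) P

theorem gam_mul_gam (i j : Fin N) :
    gam γ Ω i * gam γ Ω j = (γ.mat i * γ.mat j).map (algebraMap ℂ (Op Ω)) := by
  rw [Matrix.map_mul]; rfl

theorem gam_sq (j : Fin N) : gam γ Ω j * gam γ Ω j = 1 := by
  rw [gam_mul_gam, γ.sq, Matrix.map_one _ (map_zero _) (map_one _)]

theorem gam_anticomm (i j : Fin N) : gam γ Ω i * gam γ Ω j + gam γ Ω j * gam γ Ω i =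
    (if i = j then (2 : ℂ) else 0) • (1 : MOp Ω ι) := by
  split_ifs with h
  · rw [h, gam_sq, two_smul]
  · rw [gam_mul_gam, gam_mul_gam, ← Matrix.map_add _ (map_add _), γ.anticomm i j h, zero_smul]
    exact Matrix.map_zero _ (map_zero _)

/-- `L` as a matrix of operators. -/
def angLO (ħ : ℝ) (γ : GammaMatrices N ι) (Ω : Region N) : MOp Ω ι :=
  (-(Complex.I / 2)) •
    (∑ i, ∑ j, gam γ Ω i * gam γ Ω j * sc ι (rotO ħ Ω i j)
      + (Complex.I * ħ * ((N : ℂ) - 2)) • 1)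

theorem angL_eq (ħ : ℝ) : angL ħ γ Ω = angLO ħ γ Ω := rfl

/-- `n_j = x_j / r`. -/
def nO (Ω : Region N) (j : Fin N) : Op Ω := xO Ω j * uO Ω
/-- `V_j = (x_j J_3 - J_- p_j) / r`. -/
def vecO (ħ : ℝ) (Ω : Region N) (j : Fin N) : Op Ω :=
  uO Ω * (xO Ω j * J3O ħ Ω Finset.univ - JMinusO Ω Finset.univ * pO ħ Ω j)

/-- `L_j^+` as a matrix of operators. -/
def ladPlusO (ħ : ℝ) (γ : GammaMatrices N ι) (Ω : Region N) (j : Fin N) : MOp Ω ι :=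
  angLO ħ γ Ω * sc ι (nO Ω j) + Complex.I • sc ι (vecO ħ Ω j)

/-- `L_j^-` as a matrix of operators. -/
def ladMinusO (ħ : ℝ) (γ : GammaMatrices N ι) (Ω : Region N) (j : Fin N) : MOp Ω ι :=
  sc ι (nO Ω j) * angLO ħ γ Ω - Complex.I • sc ι (vecO ħ Ω j + (Complex.I * ħ) • nO Ω j)

theorem ladMinus_eq (ħ : ℝ) (j : Fin N) : ladMinus ħ γ Ω j = ladMinusO ħ γ Ω j := by
  have : uO Ω * (xO Ω j * J3O ħ Ω Finset.univ - JMinusO Ω Finset.univ * pO ħ Ω j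
      + (Complex.I * ħ) • xO Ω j) = vecO ħ Ω j + (Complex.I * ħ) • nO Ω j := by
    rw [mul_add, vecO, mul_smul_comm, nO, (uO_commute Ω (ordLE_xO Ω j)).eq]
  rw [ladMinusO, ← this]
  rfl

variable (ħ : ℝ)

/-- `∑ γ_a x_a`. -/
def xSlash : MOp Ω ι := ∑ a, gam γ Ω a * sc ι (xO Ω a)
/-- `∑ γ_a p_a`. -/
def pSlash : MOp Ω ι := ∑ a, gam γ Ω a * sc ι (pO ħ Ω a)

theorem slash_mul (P Q : Fin N → Op Ω) : (∑ a, gam γ Ω a * sc ι (P a)) *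
    (∑ a, gam γ Ω a * sc ι (Q a)) = ∑ a, ∑ b, gam γ Ω a * gam γ Ω b * sc ι (P a * Q b) := by
  rw [Finset.sum_mul_sum]
  refine Finset.sum_congr rfl fun a _ => Finset.sum_congr rfl fun b _ => ?_
  rw [mul_assoc, ← mul_assoc (sc ι (P a)), ← (gam_commute_sc γ b (P a)).eq, map_mul]
  simp only [mul_assoc]

theorem sum_ite_smul_sc (F : Fin N → Fin N → Op Ω) :
    ∑ a, ∑ b, ((if a = b then (2 : ℂ) else 0) • (1 : MOp Ω ι)) * sc ι (F a b) =
      (2 : ℂ) • sc ι (∑ a, F a a) := by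
  simp only [smul_mul_assoc, one_mul, sum_ite_smul, Finset.mem_univ, if_true, map_sum,
    Finset.smul_sum]

/-- After exchange of the summation indices the two sums differ only in the order of the gamma
matrices. The order of P and Q is kept, so no commutators of P with Q appear. -/
theorem slash_anticomm (P Q : Fin N → Op Ω) :
    (∑ a, ∑ b, gam γ Ω a * gam γ Ω b * sc ι (P a * Q b)) +
      (∑ a, ∑ b, gam γ Ω a * gam γ Ω b * sc ι (P b * Q a)) =
    (2 : ℂ) • sc ι (∑ a, P a * Q a) := by
  rw [Finset.sum_comm (f := fun a b => gam γ Ω a * gam γ Ω b * sc ι (P b * Q a)),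
    ← Finset.sum_add_distrib, ← sum_ite_smul_sc fun a b => P a * Q b]
  refine Finset.sum_congr rfl fun a _ => ?_
  rw [← Finset.sum_add_distrib]
  refine Finset.sum_congr rfl fun b _ => ?_
  rw [← gam_anticomm γ, add_mul]

theorem slash_sq {P : Fin N → Op Ω} (h : ∀ a b, Commute (P a) (P b)) :
    (∑ a, gam γ Ω a * sc ι (P a)) * (∑ a, gam γ Ω a * sc ι (P a)) =
      sc ι (∑ a, P a ^ 2) := by
  have h1 := slash_anticomm γ P P
  rw [slash_mul]
  simp only [fun a b => (h b a).eq, ← two_smul ℂ] at h1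
  simp only [pow_two]
  exact smul_right_injective _ (two_ne_zero' ℂ) h1

theorem xSlash_sq : xSlash γ * xSlash γ = sc ι (JMinusO Ω Finset.univ) :=
  slash_sq γ (xO_commute Ω)

theorem pSlash_sq : pSlash γ ħ * pSlash γ ħ = sc ι (JPlusO ħ Ω Finset.univ) :=
  slash_sq γ (pO_commute ħ Ω)

theorem sum_xO_mul_pO : ∑ a, xO Ω a * pO ħ Ω a =
    J3O ħ Ω Finset.univ + (N * (Complex.I * ħ / 2)) • 1 := by
  simp only [J3O, Finset.sum_sub_distrib, Finset.sum_const, Finset.card_univ, Fintype.card_fin]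
  module

theorem xSlash_mul_pSlash : xSlash γ * pSlash γ ħ =
    ∑ a, ∑ b, gam γ Ω a * gam γ Ω b * sc ι (xO Ω a * pO ħ Ω b) := slash_mul γ _ _

/-- By the Clifford relation the anticommutator is Σ (x_a p_a + p_a x_a), and the constants in J_3
are exactly those that make this equal to 2 J_3, independently of the dimension. -/
theorem pSlash_mul_xSlash : pSlash γ ħ * xSlash γ =
    (2 : ℂ) • sc ι (J3O ħ Ω Finset.univ) - xSlash γ * pSlash γ ħ := by
  have h1 := slash_anticomm (ι := ι) γ (xO Ω) (pO ħ Ω)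
  have h2 : pSlash γ ħ * xSlash γ = (∑ a, ∑ b, gam γ Ω a * gam γ Ω b * sc ι (xO Ω b * pO ħ Ω a))
      - (N * (Complex.I * ħ)) • 1 := by
    rw [pSlash, xSlash, slash_mul]
    have : ∀ a b, gam γ Ω a * gam γ Ω b * sc ι (pO ħ Ω a * xO Ω b) =
        gam γ Ω a * gam γ Ω b * sc ι (xO Ω b * pO ħ Ω a) -
          (if a = b then Complex.I * (ħ : ℂ) else 0) • (gam γ Ω a * gam γ Ω b) := by
      intro a b
      rw [pO_mul_xO, map_sub, map_smul, map_one, mul_sub, mul_smul_comm, mul_one]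
    simp only [this, Finset.sum_sub_distrib, sum_ite_smul, Finset.mem_univ, if_true, gam_sq,
      Finset.sum_const, Finset.card_univ, Fintype.card_fin]
    module
  rw [← xSlash_mul_pSlash, sum_xO_mul_pO] at h1
  rw [h2, eq_sub_of_add_eq' h1, map_add, map_smul, map_one]
  module

/-- The constant iħ(N - 2) in L is chosen to cancel the dimension dependent term in Σ x_a p_a = J_3
+ N iħ/2; only -ħ remains. -/
theorem angLO_eq : angLO ħ γ Ω = -(Complex.I • (xSlash γ * pSlash γ ħ))
    + Complex.I • sc ι (J3O ħ Ω Finset.univ) - (ħ : ℂ) • 1 := by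
  have h1 := slash_anticomm (ι := ι) γ (xO Ω) (pO ħ Ω)
  rw [← xSlash_mul_pSlash, sum_xO_mul_pO, map_add, map_smul, map_one] at h1
  have h2 : ∑ i, ∑ j, gam γ Ω i * gam γ Ω j * sc ι (rotO ħ Ω i j) = xSlash γ * pSlash γ ħ -
      ∑ a, ∑ b, gam γ Ω a * gam γ Ω b * sc ι (xO Ω b * pO ħ Ω a) := by
    rw [xSlash_mul_pSlash]
    simp only [rotO, map_sub, mul_sub, Finset.sum_sub_distrib]
  rw [angLO, h2, eq_sub_of_add_eq' h1]
  match_scalars <;> ring_nf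
  all_goals try (simp only [Complex.I_sq]; ring)

theorem xSlash_mul_J3 : xSlash γ * sc ι (J3O ħ Ω Finset.univ) =
    sc ι (J3O ħ Ω Finset.univ) * xSlash γ + (Complex.I * ħ) • xSlash γ := by
  rw [xSlash, Finset.sum_mul, Finset.mul_sum, Finset.smul_sum, ← Finset.sum_add_distrib]
  refine Finset.sum_congr rfl fun a _ => ?_
  have h := mul_eq_of_bracket (bracket_J3O_xO ħ Ω a)
  rw [mul_assoc, ← mul_assoc (sc ι _), ← (gam_commute_sc γ a _).eq, mul_assoc, ← map_mul,
    ← map_mul, h, map_add, mul_add, map_neg, map_smul, mul_neg, mul_smul_comm]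
  abel

theorem pSlash_mul_J3 : pSlash γ ħ * sc ι (J3O ħ Ω Finset.univ) =
    sc ι (J3O ħ Ω Finset.univ) * pSlash γ ħ - (Complex.I * ħ) • pSlash γ ħ := by
  rw [pSlash, Finset.sum_mul, Finset.mul_sum, Finset.smul_sum, ← Finset.sum_sub_distrib]
  refine Finset.sum_congr rfl fun a _ => ?_
  have h := mul_eq_of_bracket (bracket_J3O_pO ħ Ω a)
  rw [mul_assoc, ← mul_assoc (sc ι _), ← (gam_commute_sc γ a _).eq, mul_assoc, ← map_mul,
    ← map_mul, h, map_add, mul_add, map_smul, mul_smul_comm]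
  abel

/-- `L` is a square root of `C + ħ²`. -/
theorem angLO_sq : angLO ħ γ Ω * angLO ħ γ Ω = sc ι (LSqO ħ Ω) := by
  rw [angLO_eq, sq_of_anticommutator (xSlash_mul_J3 γ ħ) (pSlash_mul_J3 γ ħ)
    (pSlash_mul_xSlash γ ħ), pow_two, pow_two, xSlash_sq, pSlash_sq]
  simp only [LSqO, casimirO, map_add, map_sub, map_smul, map_mul, map_pow, map_one]

end spin

/-! ### The angular momentum ladder -/

section angular
variable {ι : Type*} [Fintype ι] [DecidableEq ι] (γ : GammaMatrices N ι) (ħ : ℝ) {Ω : Region N}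

theorem bracket_rotO_nO (i j k : Fin N) : ⁅rotO ħ Ω i j, nO Ω k⁆ =
    (if i = k then Complex.I * (ħ : ℂ) else 0) • nO Ω j
      - (if j = k then Complex.I * (ħ : ℂ) else 0) • nO Ω i := by
  rw [nO, bracket_mul, bracket_rotO_xO, bracket_eq_zero_iff.mpr (rotO_commute_uO ħ Ω i j)]
  simp only [nO, sub_mul, smul_mul_assoc, mul_zero, zero_add]

theorem ordLE_nO (j : Fin N) : OrdLE 0 (nO Ω j) := (ordLE_xO Ω j).mul (ordLE_uO Ω)

theorem rotO_swap (i j : Fin N) : rotO ħ Ω i j = -rotO ħ Ω j i := by rw [rotO, rotO]; abel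

/-- It writes V_k in terms of the unit vector and the angular momenta alone, which is not visible
from J_3 and p_k. Hence radial operators commute with V_k, and adjoints of V_k follow from those of
n_b and L_kb. -/
theorem sum_nO_mul_rotO (k : Fin N) : ∑ b, nO Ω b * rotO ħ Ω k b =
    vecO ħ Ω k + (N * (Complex.I * ħ / 2)) • nO Ω k := by
  have hu := fun b => uO_commute Ω (ordLE_xO Ω b)
  have h : ∀ b, nO Ω b * rotO ħ Ω k b = uO Ω * (xO Ω k * (xO Ω b * pO ħ Ω b)) -
      uO Ω * (xO Ω b ^ 2 * pO ħ Ω k) := by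
    intro b
    rw [nO, rotO, ← (hu b).eq, mul_assoc, mul_sub, mul_sub, ← mul_assoc (xO Ω b),
      (xO_commute Ω b k).eq, pow_two]
    simp only [mul_assoc]
  simp only [h, Finset.sum_sub_distrib]
  rw [← Finset.mul_sum, ← Finset.mul_sum, ← Finset.mul_sum, ← Finset.sum_mul, sum_xO_mul_pO,
    vecO, nO, ← (hu k).eq, JMinusO]
  simp only [mul_add, mul_sub, mul_smul_comm, mul_one]
  abel

theorem sum_rotO_mul_nO (k : Fin N) : ∑ b, rotO ħ Ω k b * nO Ω b =
    vecO ħ Ω k + (Complex.I * ħ - N * (Complex.I * ħ / 2)) • nO Ω k := by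
  have h : ∀ b, rotO ħ Ω k b * nO Ω b = nO Ω b * rotO ħ Ω k b +
      ((if k = b then Complex.I * (ħ : ℂ) else 0) • nO Ω b - (Complex.I * (ħ : ℂ)) • nO Ω k) := by
    intro b
    rw [mul_eq_of_bracket (bracket_rotO_nO ħ k b b), if_pos rfl]
  simp only [h, Finset.sum_add_distrib, Finset.sum_sub_distrib, sum_ite_smul, Finset.mem_univ,
    if_true, sum_nO_mul_rotO, Finset.sum_const, Finset.card_univ, Fintype.card_fin]
  module

/-- Up to a multiple of n_k, the vector V_k is the commutator of L² with n_k; `ladder_shift` uses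
this to eliminate V_k. -/
theorem bracket_LSqO_nO (k : Fin N) : LSqO ħ Ω * nO Ω k - nO Ω k * LSqO ħ Ω =
    (2 * (Complex.I * (ħ : ℂ))) • vecO ħ Ω k - ((ħ : ℂ) ^ 2) • nO Ω k := by
  obtain ⟨c, hc⟩ := casimirO_eq_sum ħ Ω Finset.univ
  rw [← Ring.lie_def, LSqO, hc, add_bracket, add_bracket, smul_bracket, smul_bracket, smul_bracket,
    one_bracket, smul_zero, smul_zero, add_zero, add_zero, sum_bracket]
  have h : ∀ i, ⁅∑ j, rotO ħ Ω i j ^ 2, nO Ω k⁆ = ∑ j,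
      ((if i = k then Complex.I * (ħ : ℂ) else 0) • (rotO ħ Ω i j * nO Ω j + nO Ω j * rotO ħ Ω i j)
      + (if j = k then Complex.I * (ħ : ℂ) else 0) •
        (rotO ħ Ω j i * nO Ω i + nO Ω i * rotO ħ Ω j i)) := by
    intro i
    rw [sum_bracket]
    refine Finset.sum_congr rfl fun j _ => ?_
    rw [pow_two, mul_bracket, bracket_rotO_nO, rotO_swap ħ j i]
    simp only [mul_sub, sub_mul, mul_smul_comm, smul_mul_assoc, mul_neg, neg_mul]
    module
  simp only [h, Finset.sum_add_distrib]
  rw [Finset.sum_comm (f := fun i j => (if j = k then Complex.I * (ħ : ℂ) else 0) •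
        (rotO ħ Ω j i * nO Ω i + nO Ω i * rotO ħ Ω j i))]
  simp only [← Finset.smul_sum, Finset.sum_add_distrib, sum_rotO_mul_nO, sum_nO_mul_rotO, eq_comm,
    sum_ite_smul, Finset.mem_univ, if_true]
  have hI : Complex.I * Complex.I = -1 := Complex.I_mul_I
  match_scalars
  · ring
  · linear_combination (ħ : ℂ) ^ 2 * hI

/-- Operators that commute with the angular momenta and with the unit vector `x / r`. -/
structure IsRadial (P : Op Ω) : Prop where
  rot : ∀ i j, Commute (rotO ħ Ω i j) P
  unit : ∀ j, Commute (nO Ω j) P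

variable {ħ}

theorem IsRadial.add {P Q : Op Ω} (hP : IsRadial ħ P) (hQ : IsRadial ħ Q) : IsRadial ħ (P + Q) :=
  ⟨fun i j => (hP.rot i j).add_right (hQ.rot i j), fun j => (hP.unit j).add_right (hQ.unit j)⟩
theorem IsRadial.sub {P Q : Op Ω} (hP : IsRadial ħ P) (hQ : IsRadial ħ Q) : IsRadial ħ (P - Q) :=
  ⟨fun i j => (hP.rot i j).sub_right (hQ.rot i j), fun j => (hP.unit j).sub_right (hQ.unit j)⟩
theorem IsRadial.mul {P Q : Op Ω} (hP : IsRadial ħ P) (hQ : IsRadial ħ Q) : IsRadial ħ (P * Q) :=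
  ⟨fun i j => (hP.rot i j).mul_right (hQ.rot i j), fun j => (hP.unit j).mul_right (hQ.unit j)⟩
theorem IsRadial.smul {P : Op Ω} (c : ℂ) (hP : IsRadial ħ P) : IsRadial ħ (c • P) :=
  ⟨fun i j => (hP.rot i j).smul_right c, fun j => (hP.unit j).smul_right c⟩
theorem isRadial_one : IsRadial ħ (1 : Op Ω) :=
  ⟨fun _ _ => Commute.one_right _, fun _ => Commute.one_right _⟩
theorem isRadial_zero : IsRadial ħ (0 : Op Ω) :=
  ⟨fun _ _ => Commute.zero_right _, fun _ => Commute.zero_right _⟩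

theorem IsRadial.vec {P : Op Ω} (hP : IsRadial ħ P) (j : Fin N) : Commute (vecO ħ Ω j) P := by
  rw [eq_sub_of_add_eq (sum_nO_mul_rotO ħ j).symm]
  exact (Commute.sum_left _ _ _ fun b _ => (hP.unit b).mul_left (hP.rot j b)).sub_left
    ((hP.unit j).smul_left _)

theorem isRadial_gO (k : ℝ) : IsRadial ħ (gO k Ω) :=
  ⟨rotO_commute_gO ħ k Ω, fun j => (ordLE_nO j).commute (ordLE_gO k Ω)⟩
theorem isRadial_wO (k : ℝ) : IsRadial ħ (wO k Ω) :=
  ⟨rotO_commute_wO ħ k Ω, fun j => (ordLE_nO j).commute (ordLE_wO k Ω)⟩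
theorem isRadial_vO {k δ : ℝ} (hΩ : Admissible k δ Ω) : IsRadial ħ (vO hΩ) :=
  ⟨rotO_commute_vO ħ hΩ, fun j => (ordLE_nO j).commute (ordLE_vO hΩ)⟩

/-- D generates dilations, and x_j/r is homogeneous of degree zero: the contributions of x_j and of
1/r cancel. -/
theorem isRadial_dO : IsRadial ħ (dO ħ Ω) := by
  refine ⟨rotO_commute_dO ħ Ω, fun j => Commute.symm (bracket_eq_zero_iff.mp ?_)⟩
  rw [nO, bracket_mul, bracket_dO_uO, dO_bracket, bracket_J3O_xO, mul_smul_comm, neg_mul,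
    smul_mul_assoc, add_neg_cancel]

theorem isRadial_eO (k : ℝ) : IsRadial ħ (eO ħ k Ω) := (isRadial_gO k).mul isRadial_dO

theorem angLO_commute_sc {P : Op Ω} (h : ∀ i j, Commute (rotO ħ Ω i j) P) :
    Commute (angLO ħ γ Ω) (sc ι P) :=
  ((Commute.sum_left _ _ _ fun i _ => Commute.sum_left _ _ _ fun j _ =>
    ((gam_commute_sc γ i P).mul_left (gam_commute_sc γ j P)).mul_left
      (commute_sc (h i j))).add_left ((Commute.one_left _).smul_left _)).smul_left _

theorem IsRadial.ladPlusO {P : Op Ω} (hP : IsRadial ħ P) (j : Fin N) :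
    Commute (ladPlusO ħ γ Ω j) (sc ι P) :=
  ((angLO_commute_sc γ hP.rot).mul_left (commute_sc (hP.unit j))).add_left
    ((commute_sc (hP.vec j)).smul_left _)

variable (ħ)

/-- `∑ γ_a x_a / r`. -/
def eSlash (γ : GammaMatrices N ι) (Ω : Region N) : MOp Ω ι := ∑ a, gam γ Ω a * sc ι (nO Ω a)

theorem eSlash_eq : eSlash γ Ω = xSlash γ * sc ι (uO Ω) := by
  rw [eSlash, xSlash, Finset.sum_mul]
  refine Finset.sum_congr rfl fun a _ => ?_
  rw [nO, map_mul, mul_assoc]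

/-- Equivalently, L + ħ/2 anticommutes with Σ γ_a x_a: it is the square root of the Casimir operator
of the superalgebra generated by Σ γ_a x_a and Σ γ_a p_a. -/
theorem xSlash_mul_angLO : xSlash γ * angLO ħ γ Ω =
    -((angLO ħ γ Ω + (ħ : ℂ) • 1) * xSlash γ) := by
  have h1 := xSlash_mul_J3 γ ħ (Ω := Ω)
  have h2 : xSlash γ * (xSlash γ * pSlash γ ħ) =
      xSlash γ * ((2 : ℂ) • sc ι (J3O ħ Ω Finset.univ) - pSlash γ ħ * xSlash γ) := by
    rw [pSlash_mul_xSlash]; abel_nf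
  rw [angLO_eq]
  simp only [mul_add, mul_sub, add_mul, sub_mul, mul_neg, neg_mul, mul_smul_comm, smul_mul_assoc,
    mul_one, one_mul, h2, h1, mul_assoc]
  match_scalars <;> ring_nf
  all_goals try (simp only [Complex.I_sq]; ring)

theorem eSlash_mul_angLO : eSlash γ Ω * angLO ħ γ Ω =
    -((angLO ħ γ Ω + (ħ : ℂ) • 1) * eSlash γ Ω) := by
  rw [eSlash_eq, mul_assoc, ← (angLO_commute_sc γ (rotO_commute_uO ħ Ω)).eq, ← mul_assoc,
    xSlash_mul_angLO, neg_mul, mul_assoc]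

theorem gam_mul_eSlash (j : Fin N) : gam γ Ω j * eSlash γ Ω + eSlash γ Ω * gam γ Ω j =
    (2 : ℂ) • sc ι (nO Ω j) := by
  have h : ∀ a, gam γ Ω j * (gam γ Ω a * sc ι (nO Ω a)) + gam γ Ω a * sc ι (nO Ω a) * gam γ Ω j =
      (if j = a then (2 : ℂ) else 0) • sc ι (nO Ω a) := by
    intro a
    rw [mul_assoc (gam γ Ω a), ← (gam_commute_sc γ j _).eq, ← mul_assoc, ← mul_assoc, ← add_mul,
      gam_anticomm, smul_mul_assoc, one_mul]
  rw [eSlash, Finset.mul_sum, Finset.sum_mul, ← Finset.sum_add_distrib]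
  simp only [h, sum_ite_smul, Finset.mem_univ, if_true]

theorem angLO_mul_nO (j : Fin N) : angLO ħ γ Ω * sc ι (nO Ω j) - sc ι (nO Ω j) * angLO ħ γ Ω =
    (ħ : ℂ) • (gam γ Ω j * eSlash γ Ω - sc ι (nO Ω j)) := by
  have h1 : ∀ a b, ⁅gam γ Ω a * gam γ Ω b * sc ι (rotO ħ Ω a b), sc ι (nO Ω j)⁆ =
      (if a = j then Complex.I * (ħ : ℂ) else 0) • (gam γ Ω a * (gam γ Ω b * sc ι (nO Ω b)))
      - (if b = j then Complex.I * (ħ : ℂ) else 0) • (gam γ Ω a * sc ι (nO Ω a) * gam γ Ω b) := by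
    intro a b
    rw [mul_bracket, bracket_eq_zero_iff.mpr ((gam_commute_sc γ a _).mul_left
      (gam_commute_sc γ b _)), zero_mul, add_zero, Ring.lie_def, ← map_mul, ← map_mul, ← map_sub,
      ← Ring.lie_def, bracket_rotO_nO, map_sub, map_smul, map_smul, mul_sub, mul_smul_comm,
      mul_smul_comm, mul_assoc, mul_assoc, mul_assoc, ← (gam_commute_sc γ b _).eq]
  rw [← Ring.lie_def, angLO, smul_bracket, add_bracket, smul_bracket, one_bracket, smul_zero,
    add_zero, sum_bracket]
  have h2 : ∀ a, ⁅∑ b, gam γ Ω a * gam γ Ω b * sc ι (rotO ħ Ω a b), sc ι (nO Ω j)⁆ =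
      (if a = j then Complex.I * (ħ : ℂ) else 0) • (gam γ Ω a * eSlash γ Ω) -
        (Complex.I * (ħ : ℂ)) • (gam γ Ω a * sc ι (nO Ω a) * gam γ Ω j) := by
    intro a
    rw [sum_bracket]
    simp only [h1, Finset.sum_sub_distrib, ← Finset.smul_sum, ← Finset.mul_sum, eq_comm,
      sum_ite_smul, Finset.mem_univ, if_true, eSlash]
  simp only [h2, Finset.sum_sub_distrib, ← Finset.smul_sum, ← Finset.sum_mul]
  simp only [eq_comm, sum_ite_smul, Finset.mem_univ, if_true]
  have h3 := eq_sub_of_add_eq' (gam_mul_eSlash γ (Ω := Ω) j)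
  rw [← eSlash, h3]
  match_scalars <;> ring_nf <;> simp only [Complex.I_sq] <;> ring

/-- The ladder operators shift the angular momentum. -/
theorem angLO_mul_ladPlusO (hħ : ħ ≠ 0) (j : Fin N) : angLO ħ γ Ω * ladPlusO ħ γ Ω j =
    ladPlusO ħ γ Ω j * (angLO ħ γ Ω + (ħ : ℂ) • 1) := by
  refine ladder_shift (by exact_mod_cast hħ) (eSlash_mul_angLO γ ħ) (angLO_mul_nO γ ħ j)
    (gam_mul_eSlash γ j) ?_ ?_
  · rw [angLO_sq, (gam_commute_sc γ j _).eq]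
  · rw [angLO_sq, ← map_mul, ← map_mul, ← map_sub, bracket_LSqO_nO, map_sub, map_smul, map_smul]

/-! ### Adjoints of matrices of operators -/

variable {w : Space N → ℝ}

/-- Formal adjoints for matrices of operators. -/
def SAdj (w : Space N → ℝ) (X Y : MOp Ω ι) : Prop := ∀ a b, Adj w (X a b) (Y b a)

theorem SAdj.isFormalAdjoint {X Y : MOp Ω ι} (h : SAdj w X Y) : SpinIsFormalAdjoint w X Y :=
  fun a b => (h a b).isFormalAdjoint

theorem SAdj.symm {X Y : MOp Ω ι} (h : SAdj w X Y) : SAdj w Y X := fun a b => (h b a).symm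

theorem SAdj.add (hw : IsWeight Ω w) {X X' Y Y' : MOp Ω ι} (hX : SAdj w X X')
    (hY : SAdj w Y Y') : SAdj w (X + Y) (X' + Y') := fun a b => (hX a b).add hw (hY a b)

theorem SAdj.sub (hw : IsWeight Ω w) {X X' Y Y' : MOp Ω ι} (hX : SAdj w X X')
    (hY : SAdj w Y Y') : SAdj w (X - Y) (X' - Y') := fun a b => (hX a b).sub hw (hY a b)

theorem SAdj.neg {X X' : MOp Ω ι} (hX : SAdj w X X') : SAdj w (-X) (-X') :=
  fun a b => (hX a b).neg

theorem SAdj.smul (c : ℂ) {X X' : MOp Ω ι} (hX : SAdj w X X') :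
    SAdj w (c • X) ((starRingEnd ℂ) c • X') := fun a b => (hX a b).smul c

theorem SAdj.mul (hw : IsWeight Ω w) {X X' Y Y' : MOp Ω ι} (hX : SAdj w X X')
    (hY : SAdj w Y Y') : SAdj w (X * Y) (Y' * X') := fun a b => by
  rw [Matrix.mul_apply, Matrix.mul_apply]
  exact Adj.sum hw _ fun c _ => (hX a c).mul (hY c b)

theorem SAdj.sum (hw : IsWeight Ω w) {α : Type*} (s : Finset α) {X Y : α → MOp Ω ι}
    (h : ∀ i ∈ s, SAdj w (X i) (Y i)) : SAdj w (∑ i ∈ s, X i) (∑ i ∈ s, Y i) := fun a b => by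
  rw [Matrix.sum_apply, Matrix.sum_apply]
  exact Adj.sum hw _ fun i hi => h i hi a b

theorem sAdj_sc {P Q : Op Ω} (h : Adj w P Q) : SAdj w (sc ι P) (sc ι Q) := fun a b => by
  rw [sc_apply, sc_apply, Matrix.diagonal_apply, Matrix.diagonal_apply]
  by_cases hab : a = b
  · rw [if_pos hab, if_pos hab.symm]; exact h
  · rw [if_neg hab, if_neg (Ne.symm hab)]; exact adj_zero

theorem sAdj_one : SAdj w (1 : MOp Ω ι) 1 := by
  rw [← map_one (sc (Ω := Ω) ι)]; exact sAdj_sc adj_one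

theorem SAdj.pow (hw : IsWeight Ω w) {X X' : MOp Ω ι} (hX : SAdj w X X') (n : ℕ) :
    SAdj w (X ^ n) (X' ^ n) := by
  induction n with
  | zero => simpa only [pow_zero] using sAdj_one
  | succ n ih => rw [pow_succ, pow_succ']; exact ih.mul hw hX

theorem SAdj.unique (hw : IsWeight Ω w) {X Y Y' : MOp Ω ι} (h : SAdj w X Y) (h' : SAdj w X Y') :
    Y = Y' := by
  ext a b
  exact (h b a).unique hw (h' b a)

theorem sAdj_gam (j : Fin N) : SAdj w (gam γ Ω j) (gam γ Ω j) := fun a b => by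
  have h1 : gam γ Ω j b a = (starRingEnd ℂ) (γ.mat j a b) • 1 := by
    rw [← Algebra.algebraMap_eq_smul_one]
    exact congrArg (algebraMap ℂ (Op Ω)) ((γ.isHermitian j).apply b a).symm
  have h2 : gam γ Ω j a b = γ.mat j a b • 1 := by
    rw [← Algebra.algebraMap_eq_smul_one]; rfl
  rw [h1, h2]
  exact adj_one.smul _

theorem conj_I_half_neg : (starRingEnd ℂ) (-(Complex.I / 2)) = Complex.I / 2 := by
  rw [map_neg, map_div₀, Complex.conj_I, map_ofNat]; ring

theorem sAdj_angLO (hw : IsWeight Ω w) (hrot : ∀ i j, Adj w (rotO ħ Ω i j) (rotO ħ Ω i j)) :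
    SAdj w (angLO ħ γ Ω) (angLO ħ γ Ω) := by
  have h1 : SAdj w (angLO ħ γ Ω) ((starRingEnd ℂ) (-(Complex.I / 2)) •
      (∑ i, ∑ j, sc ι (rotO ħ Ω i j) * (gam γ Ω j * gam γ Ω i)
      + (starRingEnd ℂ) (Complex.I * ħ * ((N : ℂ) - 2)) • 1)) :=
    SAdj.smul _ ((SAdj.sum hw _ fun i _ => SAdj.sum hw _ fun j _ =>
      ((sAdj_gam γ i).mul hw (sAdj_gam γ j)).mul hw (sAdj_sc (hrot i j))).add hw
        (sAdj_one.smul _))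
  -- Taking adjoints reverses γ_i γ_j. Renaming the indices restores the order at the cost of the
  -- sign of L_ij, and this sign is compensated by conjugating -i/2.
  have h2 : ∑ i, ∑ j, sc ι (rotO ħ Ω i j) * (gam γ Ω j * gam γ Ω i) =
      -∑ i, ∑ j, gam γ Ω i * gam γ Ω j * sc ι (rotO ħ Ω i j) := by
    rw [Finset.sum_comm, ← Finset.sum_neg_distrib]
    refine Finset.sum_congr rfl fun i _ => ?_
    rw [← Finset.sum_neg_distrib]
    refine Finset.sum_congr rfl fun j _ => ?_
    rw [← ((gam_commute_sc γ i _).mul_left (gam_commute_sc γ j _)).eq, rotO_swap ħ j i, map_neg,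
      mul_neg]
  have h3 : (starRingEnd ℂ) (Complex.I * ħ * ((N : ℂ) - 2)) = -(Complex.I * ħ * ((N : ℂ) - 2)) := by
    rw [map_mul, conj_I_mul, map_sub, map_natCast, map_ofNat, neg_mul]
  have h4 : (starRingEnd ℂ) (-(Complex.I / 2)) •
      (∑ i, ∑ j, sc ι (rotO ħ Ω i j) * (gam γ Ω j * gam γ Ω i)
      + (starRingEnd ℂ) (Complex.I * ħ * ((N : ℂ) - 2)) • 1) = angLO ħ γ Ω := by
    rw [h2, h3, conj_I_half_neg, angLO]
    module
  rwa [h4] at h1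

theorem adj_nO (j : Fin N) : Adj w (nO Ω j) (nO Ω j) := by
  have h := (adj_xO (w := w) j).mul (adj_uO (Ω := Ω))
  rwa [(uO_commute Ω (ordLE_xO Ω j)).eq] at h

/-- Taking adjoints turns Σ n_b L_kb into Σ L_kb n_b and conjugates the constant; comparing the two
expressions for V_k leaves iħ n_k. -/
theorem adj_vecO (hw : IsWeight Ω w) (hrot : ∀ i j, Adj w (rotO ħ Ω i j) (rotO ħ Ω i j))
    (j : Fin N) : Adj w (vecO ħ Ω j) (vecO ħ Ω j + (Complex.I * ħ) • nO Ω j) := by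
  have h1 := (Adj.sum hw Finset.univ fun b _ => (adj_nO (w := w) b).mul (hrot j b)).sub hw
    ((adj_nO (Ω := Ω) j).smul (N * (Complex.I * ħ / 2)))
  rw [sum_nO_mul_rotO, sum_rotO_mul_nO, add_sub_cancel_right, map_mul, map_div₀, conj_I_mul,
    map_natCast, map_ofNat] at h1
  convert h1 using 1
  module

theorem sAdj_ladPlusO (hw : IsWeight Ω w) (hrot : ∀ i j, Adj w (rotO ħ Ω i j) (rotO ħ Ω i j))
    (j : Fin N) : SAdj w (ladPlusO ħ γ Ω j) (ladMinusO ħ γ Ω j) := by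
  have h := ((sAdj_angLO γ ħ hw hrot).mul hw (sAdj_sc (adj_nO j))).add hw
    ((sAdj_sc (adj_vecO ħ hw hrot j)).smul Complex.I)
  rw [Complex.conj_I, neg_smul, ← sub_eq_add_neg] at h
  exact h

end angular

/-! ### Principal symbols -/

section iter
variable {B : Type*} [Ring B] [Algebra ℂ B]

/-- Iterated commutators with `a`. -/
def adIter (a : B) : ℕ → B → B
  | 0, P => P
  | d + 1, P => adIter a d (P * a - a * P)

variable (a : B)

theorem adIter_zero (d : ℕ) : adIter a d 0 = 0 := by
  induction d with
  | zero => rfl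
  | succ d ih => rw [adIter, zero_mul, mul_zero, sub_zero, ih]

theorem adIter_add (d : ℕ) (P Q : B) : adIter a d (P + Q) = adIter a d P + adIter a d Q := by
  induction d generalizing P Q with
  | zero => rfl
  | succ d ih => rw [adIter, adIter, adIter, ← ih]; congr 1; noncomm_ring

theorem adIter_smul (d : ℕ) (c : ℂ) (P : B) : adIter a d (c • P) = c • adIter a d P := by
  induction d generalizing P with
  | zero => rfl
  | succ d ih => rw [adIter, adIter, ← ih, smul_mul_assoc, mul_smul_comm, smul_sub]

theorem adIter_succ_add {d : ℕ} {P : B} (h : adIter a (d + 1) P = 0) (e : ℕ) :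
    adIter a (d + 1 + e) P = 0 := by
  induction d generalizing P with
  | zero =>
    rw [Nat.zero_add, Nat.add_comm, adIter]
    rw [adIter, adIter] at h
    rw [h, adIter_zero]
  | succ d ih => rw [Nat.add_right_comm, adIter]; exact ih h

/-- The leading term of the Leibniz rule. -/
theorem adIter_mul (d e : ℕ) {P Q : B} (hP : adIter a (d + 1) P = 0)
    (hQ : adIter a (e + 1) Q = 0) :
    adIter a (d + e) (P * Q) = ((d + e).choose d : ℂ) • (adIter a d P * adIter a e Q) := by
  obtain ⟨n, hn⟩ : ∃ n, n = d + e := ⟨_, rfl⟩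
  have leib : ∀ P Q : B, P * Q * a - a * (P * Q) = P * (Q * a - a * Q) + (P * a - a * P) * Q := by
    intro P Q; noncomm_ring
  induction n generalizing d e P Q with
  | zero =>
    obtain ⟨rfl, rfl⟩ : d = 0 ∧ e = 0 := by omega
    simp [adIter]
  | succ n ih =>
    rcases d with _ | d
    · obtain rfl : e = n + 1 := by omega
      have h0 : P * a - a * P = 0 := hP
      have h1 := ih 0 n hP (Q := Q * a - a * Q) hQ (by omega)
      simp only [Nat.zero_add, Nat.choose_zero_right, Nat.cast_one, one_smul] at h1 ⊢
      change adIter a n (P * Q * a - a * (P * Q)) = _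
      rw [leib, h0, zero_mul, add_zero, h1]
      rfl
    · rcases e with _ | e
      · have h0 : Q * a - a * Q = 0 := hQ
        have h1 := ih d 0 (P := P * a - a * P) hP hQ (by omega)
        simp only [Nat.add_zero, Nat.choose_self, Nat.cast_one, one_smul] at h1 ⊢
        change adIter a d (P * Q * a - a * (P * Q)) = _
        rw [leib, h0, mul_zero, zero_add, h1]
        rfl
      · have h1 := ih d (e + 1) (P := P * a - a * P) hP hQ (by omega)
        have h2 := ih (d + 1) e hP (Q := Q * a - a * Q) hQ (by omega)
        rw [show d + 1 + (e + 1) = d + 1 + e + 1 by omega, adIter, leib, adIter_add, h2,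
          show d + 1 + e = d + (e + 1) by omega, h1, Nat.choose_succ_succ']
        rw [show adIter a (d + 1) P = adIter a d (P * a - a * P) from rfl,
          show adIter a (e + 1) Q = adIter a e (Q * a - a * Q) from rfl, ← add_smul]
        push_cast
        ring_nf

end iter

section symbol
variable (ħ : ℝ) {Ω : Region N} (x : Space N) (ξ : Fin N → ℂ)

/-- The linear function `(i / ħ) ξ · x`. -/
def phase (ħ : ℝ) (Ω : Region N) (ξ : Fin N → ℂ) : Smooth Ω :=
  ∑ j, (Complex.I / ħ * ξ j) • coordFn Ω j

theorem mulO_phase : mulO (phase ħ Ω ξ) = ∑ j, (Complex.I / ħ * ξ j) • xO Ω j := by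
  rw [phase]
  generalize (Finset.univ : Finset (Fin N)) = S
  induction S using Finset.induction_on with
  | empty => exact op_ext fun f x _ => by rw [mulO_app]; exact zero_mul _
  | insert i s hi ih =>
    rw [Finset.sum_insert hi, Finset.sum_insert hi, mulO_add, mulO_smul, ih]; rfl

/-- `P` has order at most `d`, with principal symbol of value `s` at `(x, ξ)`. -/
structure HasSym (d : ℕ) (P : Op Ω) (s : ℂ) : Prop where
  ord : OrdLE d P
  eq : ∀ f : Smooth Ω, ((adIter (mulO (phase ħ Ω ξ)) d P).app f).1 x = d.factorial * s * f.1 x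

variable {ħ x ξ}

theorem OrdLE.adIter_eq_zero {d : ℕ} {P : Op Ω} (h : OrdLE d P) (a : Smooth Ω) :
    adIter (mulO a) (d + 1) P = 0 := by
  induction d generalizing P with
  | zero => exact h a
  | succ d ih => exact ih (h a)

theorem OrdLE.adIter_ordLE {d : ℕ} {P : Op Ω} (h : OrdLE d P) (a : Smooth Ω) :
    OrdLE 0 (adIter (mulO a) d P) := by
  induction d generalizing P with
  | zero => exact h
  | succ d ih => exact ih (h a)

theorem HasSym.add {d : ℕ} {P Q : Op Ω} {s t : ℂ} (hP : HasSym ħ x ξ d P s)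
    (hQ : HasSym ħ x ξ d Q t) : HasSym ħ x ξ d (P + Q) (s + t) :=
  ⟨hP.ord.add hQ.ord, fun f => by rw [adIter_add, app_add, hP.eq, hQ.eq]; ring⟩

theorem HasSym.smul {d : ℕ} {P : Op Ω} {s : ℂ} (c : ℂ) (hP : HasSym ħ x ξ d P s) :
    HasSym ħ x ξ d (c • P) (c * s) :=
  ⟨hP.ord.smul c, fun f => by rw [adIter_smul, app_smul, hP.eq]; ring⟩

theorem HasSym.neg {d : ℕ} {P : Op Ω} {s : ℂ} (hP : HasSym ħ x ξ d P s) :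
    HasSym ħ x ξ d (-P) (-s) := by simpa using hP.smul (-1)

theorem HasSym.sub {d : ℕ} {P Q : Op Ω} {s t : ℂ} (hP : HasSym ħ x ξ d P s)
    (hQ : HasSym ħ x ξ d Q t) : HasSym ħ x ξ d (P - Q) (s - t) := by
  rw [sub_eq_add_neg, sub_eq_add_neg]; exact hP.add hQ.neg

theorem HasSym.mul {d e : ℕ} {P Q : Op Ω} {s t : ℂ} (hP : HasSym ħ x ξ d P s)
    (hQ : HasSym ħ x ξ e Q t) : HasSym ħ x ξ (d + e) (P * Q) (s * t) := by
  refine ⟨hP.ord.mul hQ.ord, fun f => ?_⟩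
  rw [adIter_mul _ d e (hP.ord.adIter_eq_zero _) (hQ.ord.adIter_eq_zero _), app_smul, app_mul,
    hP.eq, hQ.eq]
  -- The binomial coefficient of the Leibniz rule is absorbed by the factorials in `HasSym`, so
  -- symbols are multiplicative.
  have h := congrArg (Nat.cast (R := ℂ)) (Nat.add_choose_mul_factorial_mul_factorial d e)
  push_cast at h
  rw [← h, Nat.choose_symm_add]
  ring

theorem OrdLE.hasSym_zero {d e : ℕ} {P : Op Ω} (h : OrdLE d P) (hde : d < e) :
    HasSym ħ x ξ e P 0 := by
  refine ⟨h.mono hde.le, fun f => ?_⟩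
  obtain ⟨c, rfl⟩ := Nat.exists_eq_add_of_le (Nat.succ_le_of_lt hde)
  rw [adIter_succ_add _ (h.adIter_eq_zero _), app_zero]
  ring

theorem hasSym_zero (d : ℕ) : HasSym ħ x ξ d (0 : Op Ω) 0 :=
  ⟨ordLE_zero_op d, fun f => by rw [adIter_zero, app_zero]; ring⟩

theorem hasSym_one : HasSym ħ x ξ 0 (1 : Op Ω) 1 :=
  ⟨ordLE_one, fun f => by rw [adIter, app_one]; simp⟩

theorem HasSym.pow {d : ℕ} {P : Op Ω} {s : ℂ} (hP : HasSym ħ x ξ d P s) (n : ℕ) :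
    HasSym ħ x ξ (d * n) (P ^ n) (s ^ n) := by
  induction n with
  | zero => simpa only [pow_zero, Nat.mul_zero] using hasSym_one
  | succ n ih => rw [pow_succ, pow_succ]; exact ih.mul hP

theorem HasSym.sum {α : Type*} (S : Finset α) {d : ℕ} {P : α → Op Ω} {s : α → ℂ}
    (h : ∀ i ∈ S, HasSym ħ x ξ d (P i) (s i)) : HasSym ħ x ξ d (∑ i ∈ S, P i) (∑ i ∈ S, s i) := by
  classical
  induction S using Finset.induction_on with
  | empty => simpa using hasSym_zero d
  | insert i S hi ih =>
    rw [Finset.sum_insert hi, Finset.sum_insert hi]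
    exact (h i (Finset.mem_insert_self i S)).add (ih fun j hj => h j (Finset.mem_insert_of_mem hj))

theorem OrdLE.exists_hasSym {d : ℕ} {P : Op Ω} (h : OrdLE d P) (ħ : ℝ) (x : Space N)
    (ξ : Fin N → ℂ) : ∃ s, HasSym ħ x ξ d P s := by
  obtain ⟨b, hb⟩ := ordLE_zero_iff.mp (h.adIter_ordLE (phase ħ Ω ξ))
  refine ⟨b.1 x / d.factorial, h, fun f => ?_⟩
  rw [hb, mulO_app]
  have : (d.factorial : ℂ) ≠ 0 := by exact_mod_cast d.factorial_ne_zero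
  field_simp

theorem HasSym.unique (hx : x ∈ Ω.carrier) {d : ℕ} {P : Op Ω} {s t : ℂ}
    (hP : HasSym ħ x ξ d P s) (hQ : HasSym ħ x ξ d P t) : s = t := by
  have h := (hP.eq (oneFn Ω)).symm.trans (hQ.eq (oneFn Ω))
  rw [oneFn_apply hx, mul_one, mul_one] at h
  exact mul_left_cancel₀ (by exact_mod_cast d.factorial_ne_zero) h

/-! #### Symbols of the basic operators -/

theorem hasSym_of_app {P : Op Ω} {s : ℂ} (h : OrdLE 0 P) (hs : ∀ f, (P.app f).1 x = s * f.1 x) :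
    HasSym ħ x ξ 0 P s := ⟨h, fun f => by rw [adIter, hs]; simp⟩

variable (hx : x ∈ Ω.carrier)

theorem hasSym_xO (hx : x ∈ Ω.carrier) (j : Fin N) : HasSym ħ x ξ 0 (xO Ω j) ((x j : ℝ) : ℂ) :=
  hasSym_of_app (ordLE_xO Ω j) fun f => xO_app j f hx

theorem hasSym_uO (hx : x ∈ Ω.carrier) : HasSym ħ x ξ 0 (uO Ω) ((‖x‖ : ℝ) : ℂ)⁻¹ :=
  hasSym_of_app (ordLE_uO Ω) fun f => uO_app f hx

theorem hasSym_rO (hx : x ∈ Ω.carrier) : HasSym ħ x ξ 0 (rO Ω) ((‖x‖ : ℝ) : ℂ) :=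
  hasSym_of_app (ordLE_rO Ω) fun f => rO_app f hx

theorem hasSym_vO {k δ : ℝ} (hΩ : Admissible k δ Ω) (hx : x ∈ Ω.carrier) :
    HasSym ħ x ξ 0 (vO hΩ) ((‖x‖ * (1 - k ^ 2 * ‖x‖ ^ 2 - 4 * δ * ‖x‖)⁻¹ : ℝ) : ℂ) :=
  hasSym_of_app (ordLE_vO hΩ) fun f => vO_app hΩ f hx

theorem hasSym_pO (hħ : ħ ≠ 0) (j : Fin N) : HasSym ħ x ξ 1 (pO ħ Ω j) (ξ j) := by
  refine ⟨ordLE_pO ħ Ω j, fun f => ?_⟩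
  -- The factor i/ħ in the phase cancels the -iħ in p_j and leaves exactly ξ_j.
  have h : adIter (mulO (phase ħ Ω ξ)) 1 (pO ħ Ω j) = ξ j • 1 := by
    rw [adIter, adIter, mulO_phase, ← Ring.lie_def, bracket_sum]
    simp only [bracket_smul, bracket_pO_xO, smul_neg, smul_smul, mul_ite, mul_zero]
    rw [Finset.sum_neg_distrib, ← Finset.sum_smul, Finset.sum_ite_eq, if_pos (Finset.mem_univ j),
      ← neg_smul]
    congr 1
    have : (ħ : ℂ) ≠ 0 := by exact_mod_cast hħ
    field_simp
    rw [Complex.I_sq]; ring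
  rw [h, app_smul, app_one]
  simp

theorem hasSym_rotO (hħ : ħ ≠ 0) (hx : x ∈ Ω.carrier) (i j : Fin N) :
    HasSym ħ x ξ 1 (rotO ħ Ω i j) ((x i : ℝ) * ξ j - (x j : ℝ) * ξ i) := by
  have h1 := (hasSym_xO (ħ := ħ) (ξ := ξ) hx i).mul (hasSym_pO (Ω := Ω) (x := x) (ξ := ξ) hħ j)
  have h2 := (hasSym_xO (ħ := ħ) (ξ := ξ) hx j).mul (hasSym_pO (Ω := Ω) (x := x) (ξ := ξ) hħ i)
  exact h1.sub h2

theorem hasSym_JMinusO (hx : x ∈ Ω.carrier) (S : Finset (Fin N)) :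
    HasSym ħ x ξ 0 (JMinusO Ω S) (∑ i ∈ S, ((x i : ℝ) : ℂ) ^ 2) :=
  HasSym.sum S fun i _ => (hasSym_xO hx i).pow 2

theorem hasSym_JPlusO (hħ : ħ ≠ 0) (S : Finset (Fin N)) :
    HasSym ħ x ξ 2 (JPlusO ħ Ω S) (∑ i ∈ S, ξ i ^ 2) :=
  HasSym.sum S fun i _ => (hasSym_pO hħ i).pow 2

theorem hasSym_J3O (hħ : ħ ≠ 0) (hx : x ∈ Ω.carrier) (S : Finset (Fin N)) :
    HasSym ħ x ξ 1 (J3O ħ Ω S) (∑ i ∈ S, (x i : ℝ) * ξ i) := by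
  refine HasSym.sum S fun i _ => ?_
  have h := ((hasSym_xO (ħ := ħ) (ξ := ξ) hx i).mul (hasSym_pO (Ω := Ω) (x := x) hħ i)).sub
    ((ordLE_one.smul (Complex.I * ħ / 2)).hasSym_zero (Nat.lt_succ_self 0))
  rw [sub_zero] at h
  exact h

/-- The symbol of the Casimir operator. -/
def casimirSym (S : Finset (Fin N)) (y ξ : Fin N → ℂ) : ℂ :=
  (∑ i ∈ S, y i ^ 2) * (∑ i ∈ S, ξ i ^ 2) - (∑ i ∈ S, y i * ξ i) ^ 2

theorem hasSym_casimirO (hħ : ħ ≠ 0) (hx : x ∈ Ω.carrier) (S : Finset (Fin N)) :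
    HasSym ħ x ξ 2 (casimirO ħ Ω S) (casimirSym S (fun i => ((x i : ℝ) : ℂ)) ξ) := by
  have h1 := hasSym_JMinusO (ħ := ħ) (ξ := ξ) hx S
  have h2 := hasSym_JPlusO (Ω := Ω) (x := x) (ξ := ξ) hħ S
  have h3 := ((((h2.mul h1).add (h1.mul h2)).smul (1 / 2)).sub ((hasSym_J3O hħ hx S).pow 2))
  have e : casimirSym S (fun i => ((x i : ℝ) : ℂ)) ξ =
      1 / 2 * ((∑ i ∈ S, ξ i ^ 2) * (∑ i ∈ S, ((x i : ℝ) : ℂ) ^ 2) +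
        (∑ i ∈ S, ((x i : ℝ) : ℂ) ^ 2) * (∑ i ∈ S, ξ i ^ 2)) -
        (∑ i ∈ S, ((x i : ℝ) : ℂ) * ξ i) ^ 2 := by
    rw [casimirSym]; ring
  rw [e]
  exact h3

theorem hasSym_gO (hx : x ∈ Ω.carrier) (k : ℝ) :
    HasSym ħ x ξ 0 (gO k Ω) ((‖x‖ : ℂ)⁻¹ + (k : ℂ) ^ 2 * ‖x‖) := by
  rw [gO_eq]; exact (hasSym_uO hx).add ((hasSym_rO hx).smul _)

theorem hasSym_wO (hx : x ∈ Ω.carrier) (k : ℝ) :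
    HasSym ħ x ξ 0 (wO k Ω) ((‖x‖ : ℂ)⁻¹ - (k : ℂ) ^ 2 * ‖x‖) := by
  rw [wO_eq]; exact (hasSym_uO hx).sub ((hasSym_rO hx).smul _)

theorem hasSym_eO (hħ : ħ ≠ 0) (hx : x ∈ Ω.carrier) (k : ℝ) : HasSym ħ x ξ 1 (eO ħ k Ω)
    (((‖x‖ : ℂ)⁻¹ + (k : ℂ) ^ 2 * ‖x‖) * ∑ i, (x i : ℝ) * ξ i) := by
  have h := (hasSym_J3O (ξ := ξ) hħ hx Finset.univ).add
    ((ordLE_one.smul (Complex.I * ħ)).hasSym_zero (Nat.lt_succ_self 0))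
  rw [add_zero] at h
  have h1 := (hasSym_gO (ħ := ħ) (ξ := ξ) hx k).mul h
  exact h1

/-! #### Symbols of matrices of operators -/

variable {ι : Type*} [Fintype ι] [DecidableEq ι]

/-- The principal symbol of a matrix of operators. -/
def SSym (ħ : ℝ) (x : Space N) (ξ : Fin N → ℂ) (d : ℕ) (X : MOp Ω ι) (S : Matrix ι ι ℂ) : Prop :=
  ∀ a b, HasSym ħ x ξ d (X a b) (S a b)

theorem SSym.add {d : ℕ} {X Y : MOp Ω ι} {S T : Matrix ι ι ℂ} (hX : SSym ħ x ξ d X S)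
    (hY : SSym ħ x ξ d Y T) : SSym ħ x ξ d (X + Y) (S + T) := fun a b => (hX a b).add (hY a b)

theorem SSym.neg {d : ℕ} {X : MOp Ω ι} {S : Matrix ι ι ℂ} (hX : SSym ħ x ξ d X S) :
    SSym ħ x ξ d (-X) (-S) := fun a b => (hX a b).neg

theorem SSym.smul {d : ℕ} {X : MOp Ω ι} {S : Matrix ι ι ℂ} (c : ℂ) (hX : SSym ħ x ξ d X S) :
    SSym ħ x ξ d (c • X) (c • S) := fun a b => (hX a b).smul c

theorem SSym.mul {d e : ℕ} {X Y : MOp Ω ι} {S T : Matrix ι ι ℂ} (hX : SSym ħ x ξ d X S)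
    (hY : SSym ħ x ξ e Y T) : SSym ħ x ξ (d + e) (X * Y) (S * T) := fun a b => by
  rw [Matrix.mul_apply, Matrix.mul_apply]
  exact HasSym.sum _ fun c _ => (hX a c).mul (hY c b)

theorem sSym_zero (d : ℕ) : SSym ħ x ξ d (0 : MOp Ω ι) 0 := fun _ _ => hasSym_zero d

theorem SSym.sum {α : Type*} (U : Finset α) {d : ℕ} {X : α → MOp Ω ι} {S : α → Matrix ι ι ℂ}
    (h : ∀ i ∈ U, SSym ħ x ξ d (X i) (S i)) : SSym ħ x ξ d (∑ i ∈ U, X i) (∑ i ∈ U, S i) :=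
  fun a b => by
    rw [Matrix.sum_apply, Matrix.sum_apply]
    exact HasSym.sum _ fun i hi => h i hi a b

theorem HasSym.sc {d : ℕ} {P : Op Ω} {s : ℂ} (h : HasSym ħ x ξ d P s) :
    SSym ħ x ξ d (sc ι P) (s • 1) := fun a b => by
  rw [sc_apply, Matrix.diagonal_apply, Matrix.smul_apply, Matrix.one_apply]
  split_ifs
  · rw [smul_eq_mul, mul_one]; exact h
  · rw [smul_zero]; exact hasSym_zero d

theorem sSym_one : SSym ħ x ξ 0 (1 : MOp Ω ι) 1 := by
  have h := (hasSym_one (ħ := ħ) (x := x) (ξ := ξ) (Ω := Ω)).sc (ι := ι)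
  rwa [map_one, one_smul] at h

/-- Matrices of operators of lower order have vanishing principal symbol. -/
theorem sSym_zero_of_ordLE {d e : ℕ} {X : MOp Ω ι} (h : ∀ a b, OrdLE d (X a b)) (hde : d < e) :
    SSym ħ x ξ e X 0 := fun a b => (h a b).hasSym_zero hde

theorem SSym.unique (hx : x ∈ Ω.carrier) {d : ℕ} {X : MOp Ω ι} {S T : Matrix ι ι ℂ}
    (hS : SSym ħ x ξ d X S) (hT : SSym ħ x ξ d X T) : S = T := by
  ext a b
  exact (hS a b).unique hx (hT a b)

theorem sSym_gam (γ : GammaMatrices N ι) (j : Fin N) :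
    SSym ħ x ξ 0 (gam γ Ω j) (γ.mat j) := fun a b => by
  have h2 : gam γ Ω j a b = γ.mat j a b • 1 := by rw [← Algebra.algebraMap_eq_smul_one]; rfl
  rw [h2]
  simpa only [mul_one] using (hasSym_one (ħ := ħ) (x := x) (ξ := ξ)).smul (γ.mat j a b)

/-- The symbol of `L`. -/
def angSym (γ : GammaMatrices N ι) (y ξ : Fin N → ℂ) : Matrix ι ι ℂ :=
  (-(Complex.I / 2)) • ∑ i, ∑ j, (y i * ξ j - y j * ξ i) • (γ.mat i * γ.mat j)

theorem sSym_angLO (γ : GammaMatrices N ι) (hħ : ħ ≠ 0) (hx : x ∈ Ω.carrier) :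
    SSym ħ x ξ 1 (angLO ħ γ Ω) (angSym γ (fun i => ((x i : ℝ) : ℂ)) ξ) := by
  have h1 : SSym ħ x ξ 1 (∑ i, ∑ j, gam γ Ω i * gam γ Ω j * sc ι (rotO ħ Ω i j)) _ :=
    SSym.sum _ fun i _ => SSym.sum _ fun j _ => ((sSym_gam γ i).mul (sSym_gam γ j)).mul
      (hasSym_rotO (ξ := ξ) hħ hx i j).sc
  have h2 : SSym ħ x ξ 1 ((Complex.I * ħ * ((N : ℂ) - 2)) • (1 : MOp Ω ι)) 0 :=
    sSym_zero_of_ordLE (d := 0) (fun a b => by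
      rw [Matrix.smul_apply, Matrix.one_apply]
      refine OrdLE.smul _ ?_
      split_ifs
      · exact ordLE_one
      · exact ordLE_zero_op 0) Nat.one_pos
  have h3 := (h1.add h2).smul (-(Complex.I / 2))
  rw [add_zero] at h3
  simp only [mul_smul_comm, mul_one] at h3
  exact h3

end symbol

/-! ### Separation of the scalar part and the part proportional to `L` -/

section reduce
variable {Ω : Region N} {w : Space N → ℝ}

/-- Operators with a formal adjoint. -/
def HasAdj (w : Space N → ℝ) (P : Op Ω) : Prop := ∃ P', Adj w P P'

theorem Adj.hasAdj {P Q : Op Ω} (h : Adj w P Q) : HasAdj w P := ⟨Q, h⟩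
theorem HasAdj.add (hw : IsWeight Ω w) {P Q : Op Ω} :
    HasAdj w P → HasAdj w Q → HasAdj w (P + Q) := fun ⟨_, h⟩ ⟨_, h'⟩ => ⟨_, h.add hw h'⟩
theorem HasAdj.sub (hw : IsWeight Ω w) {P Q : Op Ω} :
    HasAdj w P → HasAdj w Q → HasAdj w (P - Q) := fun ⟨_, h⟩ ⟨_, h'⟩ => ⟨_, h.sub hw h'⟩
theorem HasAdj.mul {P Q : Op Ω} :
    HasAdj w P → HasAdj w Q → HasAdj w (P * Q) := fun ⟨_, h⟩ ⟨_, h'⟩ => ⟨_, h.mul h'⟩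
theorem HasAdj.smul {P : Op Ω} (c : ℂ) : HasAdj w P → HasAdj w (c • P) :=
  fun ⟨_, h⟩ => ⟨_, h.smul c⟩
theorem HasAdj.neg {P : Op Ω} : HasAdj w P → HasAdj w (-P) := fun ⟨_, h⟩ => ⟨_, h.neg⟩

/-- Differential operators of order less than `d`. -/
def OrdLT : ℕ → Op Ω → Prop
  | 0, P => P = 0
  | d + 1, P => OrdLE d P

theorem OrdLT.ordLE {d : ℕ} {P : Op Ω} (h : OrdLT (d + 1) P) : OrdLE d P := h

theorem OrdLT.add {d : ℕ} {P Q : Op Ω} (hP : OrdLT d P) (hQ : OrdLT d Q) : OrdLT d (P + Q) := by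
  cases d with
  | zero => rw [OrdLT] at *; rw [hP, hQ, add_zero]
  | succ d => exact OrdLE.add hP hQ

theorem OrdLT.smul {d : ℕ} {P : Op Ω} (c : ℂ) (hP : OrdLT d P) : OrdLT d (c • P) := by
  cases d with
  | zero => rw [OrdLT] at *; rw [hP, smul_zero]
  | succ d => exact OrdLE.smul c hP

theorem OrdLT.mul {d e : ℕ} {P Q : Op Ω} (hP : OrdLT d P) (hQ : OrdLE e Q) :
    OrdLT (d + e) (P * Q) := by
  cases d with
  | zero =>
    rw [OrdLT] at hP
    rw [hP, zero_mul]
    cases e with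
    | zero => rfl
    | succ e => exact ordLE_zero_op _
  | succ d => rw [Nat.add_right_comm]; exact OrdLE.mul (P := P) hP hQ

theorem OrdLE.mul_ordLT {d e : ℕ} {P Q : Op Ω} (hP : OrdLE d P) (hQ : OrdLT e Q) :
    OrdLT (d + e) (P * Q) := by
  cases e with
  | zero =>
    rw [OrdLT] at hQ
    rw [hQ, mul_zero]
    cases d with
    | zero => rfl
    | succ e => exact ordLE_zero_op _
  | succ e => exact hP.mul (Q := Q) hQ

theorem OrdLT.weaken {d : ℕ} {P : Op Ω} (hP : OrdLT d P) : OrdLE d P := by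
  cases d with
  | zero => rw [OrdLT] at hP; rw [hP]; exact ordLE_zero_op 0
  | succ d => exact OrdLE.succ hP

/-- The factor C has order two, and each of P and Q has one order to spare. When d or e is 0 the
corresponding factor is zero by the convention in `OrdLT`. -/
theorem OrdLT.two_mul {d e : ℕ} {C P Q : Op Ω} (hC : OrdLE 2 C) (hP : OrdLT d P)
    (hQ : OrdLT e Q) : OrdLE (d + e) (C * (P * Q)) := by
  have h0 : C * (P * Q) = 0 → OrdLE (d + e) (C * (P * Q)) := fun h => by
    rw [h]; exact ordLE_zero_op _
  rcases d with _ | d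
  · rw [OrdLT] at hP
    exact h0 (by rw [hP, zero_mul, mul_zero])
  rcases e with _ | e
  · rw [OrdLT] at hQ
    exact h0 (by rw [hQ, mul_zero, mul_zero])
  exact (hC.mul (hP.ordLE.mul hQ.ordLE)).mono (by omega)

variable {ι : Type*} [Fintype ι] [DecidableEq ι] {γ : GammaMatrices N ι} {ħ : ℝ}

/-- `X = P + L Q` with scalar operators `P` of order at most `d` and `Q` of order less than `d`. -/
structure Splits (w : Space N → ℝ) (ħ : ℝ) (γ : GammaMatrices N ι) (d : ℕ) (X : MOp Ω ι)
    (P Q : Op Ω) : Prop where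
  eq : X = sc ι P + angLO ħ γ Ω * sc ι Q
  ord : OrdLE d P
  ord_lt : OrdLT d Q
  adj : HasAdj w P
  adj' : HasAdj w Q

theorem splits_one : Splits w ħ γ 0 (1 : MOp Ω ι) 1 0 :=
  ⟨by rw [map_one, map_zero, mul_zero, add_zero], ordLE_one, rfl, adj_one.hasAdj, adj_zero.hasAdj⟩

/-- Multiplication of split operators, the first of which shifts `L`. -/
theorem Splits.mul_of_shift (hw : IsWeight Ω w) (hC : HasAdj w (LSqO ħ Ω)) {d e : ℕ} {X Y : MOp Ω ι}
    {P Q a b : Op Ω} (hX : Splits w ħ γ d X P Q) (hY : Splits w ħ γ e Y a b) {c : ℂ}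
    (hc : X * angLO ħ γ Ω = (angLO ħ γ Ω - c • 1) * X) :
    Splits w ħ γ (d + e) (X * Y) (P * a + (LSqO ħ Ω * (Q * b) - c • (P * b)))
      (Q * a + P * b + (-c) • (Q * b)) := by
  have hPb : OrdLT (d + e) (P * b) := hX.ord.mul_ordLT hY.ord_lt
  have hQa : OrdLT (d + e) (Q * a) := hX.ord_lt.mul hY.ord
  have hQb : OrdLT (d + e) (Q * b) := by
    rcases d with _ | d
    · rw [hX.ord_lt, zero_mul]
      exact (show OrdLT (e) (0 : Op Ω) by
        cases e with
        | zero => rfl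
        | succ e => exact ordLE_zero_op _) |> fun h => by rwa [Nat.zero_add]
    · have h := (hX.ord_lt.ordLE).mul_ordLT hY.ord_lt
      have h2 := h.weaken
      rw [Nat.add_right_comm]
      exact h2
  refine ⟨?_, (hX.ord.mul hY.ord).add ((OrdLT.two_mul (ordLE_LSq ħ Ω) hX.ord_lt hY.ord_lt).sub
    (hPb.weaken.smul c)), (hQa.add hPb).add (hQb.smul _),
    (hX.adj.mul hY.adj).add hw ((hC.mul (hX.adj'.mul hY.adj')).sub hw ((hX.adj.mul hY.adj').smul c)),
    ((hX.adj'.mul hY.adj).add hw (hX.adj.mul hY.adj')).add hw ((hX.adj'.mul hY.adj').smul _)⟩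
  -- The L of the second factor is carried to the left of X by the shift relation. Together with the
  -- L inside X it forms L², which is scalar.
  have h1 : X * Y = X * sc ι a + (angLO ħ γ Ω - c • 1) * X * sc ι b := by
    rw [hY.eq, mul_add, ← mul_assoc, hc]
  have h2 : ∀ z, angLO ħ γ Ω * (angLO ħ γ Ω * z) = sc ι (LSqO ħ Ω) * z := fun z => by
    rw [← mul_assoc, angLO_sq]
  rw [h1, hX.eq]
  simp only [map_add, map_sub, map_smul, map_mul, mul_add, add_mul, sub_mul, mul_assoc, h2,
    smul_mul_assoc, one_mul, mul_smul_comm]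
  module

/-- Multiplication of split operators with rotation invariant parts. -/
theorem Splits.mul_of_commute (hw : IsWeight Ω w) (hC : HasAdj w (LSqO ħ Ω)) {d e : ℕ}
    {X Y : MOp Ω ι} {P Q a b : Op Ω} (hX : Splits w ħ γ d X P Q) (hY : Splits w ħ γ e Y a b)
    (hP : ∀ i j, Commute (rotO ħ Ω i j) P) (hQ : ∀ i j, Commute (rotO ħ Ω i j) Q) :
    Splits w ħ γ (d + e) (X * Y) (P * a + LSqO ħ Ω * (Q * b)) (Q * a + P * b) := by
  have h := hX.mul_of_shift hw hC hY (c := 0) (by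
    rw [zero_smul, sub_zero, hX.eq, mul_add, add_mul, (angLO_commute_sc γ hP).eq, mul_assoc,
      (angLO_commute_sc γ hQ).eq])
  simpa only [zero_smul, neg_zero, sub_zero, add_zero] using h

/-- The complement of a coordinate hyperplane is dense: move off it along the j-th axis and pass to
the limit. -/
theorem smooth_eq_zero_of_coord {f : Smooth Ω} (j : Fin N)
    (h : ∀ x ∈ Ω.carrier, x j ≠ 0 → f.1 x = 0) {x : Space N} (hx : x ∈ Ω.carrier) : f.1 x = 0 := by
  by_cases hj : x j = 0
  · have hc : Filter.Tendsto (fun t : ℝ => x + t • EuclideanSpace.single j (1 : ℝ))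
        (nhdsWithin 0 {0}ᶜ) (nhds x) := by
      have : Continuous fun t : ℝ => x + t • EuclideanSpace.single j (1 : ℝ) := by fun_prop
      have h2 := this.tendsto 0
      simp only [zero_smul, add_zero] at h2
      exact h2.mono_left nhdsWithin_le_nhds
    have h1 := (smooth_continuousAt f hx).tendsto.comp hc
    refine tendsto_nhds_unique h1 (tendsto_const_nhds.congr' ?_)
    filter_upwards [hc.eventually (Ω.isOpen.mem_nhds hx), self_mem_nhdsWithin] with t ht ht0
    exact (h _ ht (by simpa [hj] using ht0)).symm
  · exact h x hx hj

theorem eq_zero_of_xO_mul (j : Fin N) {P : Op Ω} (h : xO Ω j * P = 0) : P = 0 := by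
  refine op_ext fun f x hx => ?_
  rw [app_zero]
  refine smooth_eq_zero_of_coord j (fun x hx hj => ?_) hx
  have h1 := congrArg (fun Q => (Op.app Q f).1 x) h
  simp only [app_mul, xO_app j _ hx, app_zero, mul_eq_zero] at h1
  exact h1.resolve_left (Complex.ofReal_ne_zero.mpr hj)

/-- Angular momenta are not left zero divisors among the differential operators. -/
theorem eq_zero_of_rotO_mul (hħ : ħ ≠ 0) {i j : Fin N} (hij : i ≠ j) {d : ℕ} {P : Op Ω}
    (hP : OrdLE d P) (h : rotO ħ Ω i j * P = 0) : P = 0 := by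
  have hI : Complex.I * (ħ : ℂ) ≠ 0 := mul_ne_zero Complex.I_ne_zero (by exact_mod_cast hħ)
  -- The leading iterated commutator of L_ij P with x_i is a nonzero multiple of x_j times that of
  -- P, and x_j is not a zero divisor. So the order of P with respect to x_i can be lowered until P
  -- itself vanishes.
  have step : ∀ e, adIter (mulO (coordFn Ω i)) (e + 1) P = 0 →
      adIter (mulO (coordFn Ω i)) e P = 0 := by
    intro e he
    have h1 := adIter_mul _ 1 e ((ordLE_rotO ħ Ω i j).adIter_eq_zero (coordFn Ω i)) he
    have h2 : adIter (mulO (coordFn Ω i)) 1 (rotO ħ Ω i j) = (Complex.I * (ħ : ℂ)) • xO Ω j := by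
      have h3 := bracket_rotO_xO ħ Ω i j i
      rw [if_pos rfl, if_neg hij.symm, zero_smul, sub_zero] at h3
      exact h3
    rw [h, adIter_zero, h2, smul_mul_assoc, smul_smul, eq_comm, smul_eq_zero] at h1
    refine eq_zero_of_xO_mul j (h1.resolve_left (mul_ne_zero ?_ hI))
    exact_mod_cast (Nat.choose_pos (by omega)).ne'
  have all : ∀ e, adIter (mulO (coordFn Ω i)) e P = 0 → P = 0 := by
    intro e
    induction e with
    | zero => exact fun h => h
    | succ e ih => exact fun h => ih (step e h)
  exact all _ (hP.adIter_eq_zero _)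

/-- The scalar parts `P`, `Q` of `P + L Q` are unique. -/
theorem eq_zero_of_split [Nonempty ι] (hN : 2 ≤ N) (hħ : ħ ≠ 0) {d : ℕ} {P Q : Op Ω}
    (hQ : OrdLE d Q) (h : sc ι P + angLO ħ γ Ω * sc ι Q = 0) : P = 0 ∧ Q = 0 := by
  have hinj : ∀ {R : Op Ω}, sc ι R = 0 → R = 0 := fun {R} hR => by
    obtain ⟨a⟩ := ‹Nonempty ι›
    have := congrFun (congrFun hR a) a
    rwa [sc_apply, Matrix.diagonal_apply_eq] at this
  suffices hQ0 : Q = 0 by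
    rw [hQ0, map_zero, mul_zero, add_zero] at h
    exact ⟨hinj h, hQ0⟩
  set S : MOp Ω ι := ∑ i, ∑ j, gam γ Ω i * gam γ Ω j * sc ι (rotO ħ Ω i j) with hS
  -- By the hypothesis S·Q is a combination of the scalar matrices P and Q, hence commutes with
  -- every gamma matrix.
  have hcomm : ∀ j, Commute (gam γ Ω j) (S * sc ι Q) := by
    intro j
    have h1 : S * sc ι Q = (2 * Complex.I) • (-sc ι P) -
        (Complex.I * ħ * ((N : ℂ) - 2)) • sc ι Q := by
      rw [← eq_neg_of_add_eq_zero_right h, angLO, ← hS]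
      simp only [add_mul, smul_mul_assoc, one_mul, smul_add, smul_smul]
      match_scalars <;> ring_nf
      all_goals try (simp only [show Complex.I ^ 3 = -Complex.I by rw [pow_succ, Complex.I_sq]; ring,
        Complex.I_sq]; ring)
    rw [h1]
    exact ((gam_commute_sc γ j P).neg_right.smul_right _).sub_right
      ((gam_commute_sc γ j Q).smul_right _)
  let i : Fin N := ⟨0, by omega⟩
  let j : Fin N := ⟨1, by omega⟩
  have hij : i ≠ j := by simp [i, j, Fin.ext_iff]
  -- The commutator with γ_i keeps only the terms of S that contain the index i.
  have e1 : ⁅gam γ Ω i, S⁆ = (4 : ℂ) • ∑ b, gam γ Ω b * sc ι (rotO ħ Ω i b) := by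
    have h1 : ∀ a b, ⁅gam γ Ω i, gam γ Ω a * gam γ Ω b * sc ι (rotO ħ Ω a b)⁆ =
        (if i = a then (2 : ℂ) else 0) • (gam γ Ω b * sc ι (rotO ħ Ω a b)) -
        (if i = b then (2 : ℂ) else 0) • (gam γ Ω a * sc ι (rotO ħ Ω a b)) := by
      intro a b
      rw [bracket_mul, bracket_eq_zero_iff.mpr (gam_commute_sc γ i _), mul_zero, zero_add]
      have h2 : ⁅gam γ Ω i, gam γ Ω a * gam γ Ω b⁆ = (if i = a then (2 : ℂ) else 0) • gam γ Ω b -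
          (if i = b then (2 : ℂ) else 0) • gam γ Ω a := by
        have ha := gam_anticomm γ (Ω := Ω) i a
        have hb := gam_anticomm γ (Ω := Ω) i b
        rw [Ring.lie_def, ← mul_assoc, eq_sub_of_add_eq ha, mul_assoc (gam γ Ω a), sub_mul,
          smul_mul_assoc, one_mul, mul_assoc, eq_sub_of_add_eq hb, mul_sub, mul_smul_comm, mul_one]
        abel
      rw [h2, sub_mul, smul_mul_assoc, smul_mul_assoc]
    rw [hS, bracket_sum]
    simp only [bracket_sum, h1, Finset.sum_sub_distrib, ← Finset.smul_sum, sum_ite_smul,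
      Finset.mem_univ, if_true]
    simp only [rotO_swap ħ _ i, map_neg, mul_neg, Finset.sum_neg_distrib]
    module
  have e2 : ∑ b, gam γ Ω b * sc ι (rotO ħ Ω i b * Q) = 0 := by
    have h1 : ⁅gam γ Ω i, S⁆ * sc ι Q = 0 := by
      have h2 := bracket_eq_zero_iff.mpr (hcomm i)
      rwa [bracket_mul, bracket_eq_zero_iff.mpr (gam_commute_sc γ i Q), mul_zero, zero_add] at h2
    rw [e1, smul_mul_assoc, smul_eq_zero, Finset.sum_mul] at h1
    have h3 := h1.resolve_left (by norm_num)
    simpa only [mul_assoc, ← map_mul] using h3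
  -- The anticommutator with γ_j then singles out the term b = j, which leaves L_ij Q = 0 for two
  -- distinct indices.
  have e3 : (2 : ℂ) • sc ι (rotO ħ Ω i j * Q) = 0 := by
    have h1 : gam γ Ω j * (∑ b, gam γ Ω b * sc ι (rotO ħ Ω i b * Q)) +
        (∑ b, gam γ Ω b * sc ι (rotO ħ Ω i b * Q)) * gam γ Ω j = 0 := by
      rw [e2, mul_zero, zero_mul, add_zero]
    rw [Finset.mul_sum, Finset.sum_mul, ← Finset.sum_add_distrib] at h1
    have h2 : ∀ b, gam γ Ω j * (gam γ Ω b * sc ι (rotO ħ Ω i b * Q)) +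
        gam γ Ω b * sc ι (rotO ħ Ω i b * Q) * gam γ Ω j =
        (if j = b then (2 : ℂ) else 0) • sc ι (rotO ħ Ω i b * Q) := by
      intro b
      rw [mul_assoc (gam γ Ω b), ← (gam_commute_sc γ j _).eq, ← mul_assoc, ← mul_assoc, ← add_mul,
        gam_anticomm, smul_mul_assoc, one_mul]
    simpa only [h2, sum_ite_smul, Finset.mem_univ, if_true] using h1
  exact eq_zero_of_rotO_mul hħ hij hQ (hinj ((smul_eq_zero.mp e3).resolve_left (by norm_num)))

theorem ladPlusO_pow_mul_angLO (hħ : ħ ≠ 0) (j : Fin N) (m : ℕ) :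
    ladPlusO ħ γ Ω j ^ m * angLO ħ γ Ω =
      (angLO ħ γ Ω - ((m : ℂ) * ħ) • 1) * ladPlusO ħ γ Ω j ^ m := by
  induction m with
  | zero => simp
  | succ m ih =>
    have h := angLO_mul_ladPlusO γ ħ (Ω := Ω) hħ j
    rw [mul_add, mul_smul_comm, mul_one] at h
    rw [pow_succ, mul_assoc, eq_sub_of_add_eq h.symm, mul_sub, ← mul_assoc, ih, mul_assoc,
      ← pow_succ, mul_smul_comm, ← pow_succ]
    simp only [sub_mul, smul_mul_assoc, one_mul]
    push_cast
    module

theorem ordLE_vecO (j : Fin N) : OrdLE 1 (vecO ħ Ω j) :=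
  (ordLE_uO Ω).mul (e := 1) (OrdLE.sub ((ordLE_xO Ω j).mul (e := 1) (ordLE_J3 ħ Ω _))
    ((ordLE_JMinus Ω _).mul (e := 1) (ordLE_pO ħ Ω j)))

/-- The powers of the angular momentum ladder operators split. -/
theorem exists_splits_ladPlusO_pow (hw : IsWeight Ω w)
    (hrot : ∀ i j, Adj w (rotO ħ Ω i j) (rotO ħ Ω i j)) (hC : HasAdj w (LSqO ħ Ω)) (hħ : ħ ≠ 0)
    (j : Fin N) (m : ℕ) : ∃ P Q, Splits w ħ γ m (ladPlusO ħ γ Ω j ^ m) P Q := by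
  induction m with
  | zero => exact ⟨1, 0, by rw [pow_zero]; exact splits_one⟩
  | succ m ih =>
    obtain ⟨P, Q, h⟩ := ih
    have h1 : Splits w ħ γ 1 (ladPlusO ħ γ Ω j) (Complex.I • vecO ħ Ω j) (nO Ω j) :=
      ⟨by rw [map_smul, ladPlusO, add_comm], (ordLE_vecO j).smul _, ordLE_nO j,
        (adj_vecO ħ hw hrot j).hasAdj.smul _, (adj_nO j).hasAdj⟩
    rw [pow_succ]
    exact ⟨_, _, h.mul_of_shift hw hC h1 (ladPlusO_pow_mul_angLO hħ j m)⟩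

end reduce

/-! ### Families of radial problems with a ladder -/

/-- The data of a radial problem: the Hamiltonian `h0 + h1 Λ²`, the coupling `M0 + M1 Λ²` in the
ladder operators, and the factor of the kinetic energy. -/
structure RadialModel (Ω : Region N) where
  h0 : Op Ω
  h1 : Op Ω
  M0 : Op Ω
  M1 : Op Ω
  v : Space N → ℂ
  ν : ℂ

section model
variable {Ω : Region N} {ι : Type*} [Fintype ι] [DecidableEq ι]

/-- The scalar Hamiltonian. -/
def RadialModel.ham (D : RadialModel Ω) (ħ : ℝ) : Op Ω := D.h0 + D.h1 * LSqO ħ Ω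

/-- The Hamiltonian at angular momentum `Λ`. -/
def RadialModel.hamAt (D : RadialModel Ω) (Λ : MOp Ω ι) : MOp Ω ι :=
  sc ι D.h0 + sc ι D.h1 * (Λ * Λ)

/-- The coupling in the ladder operators. -/
def RadialModel.coup (D : RadialModel Ω) (Λ : MOp Ω ι) : MOp Ω ι :=
  sc ι D.M0 + sc ι D.M1 * (Λ * Λ)

/-- The lowering operator of the radial problem. -/
def RadialModel.low (D : RadialModel Ω) (ħ k β : ℝ) (Λ : MOp Ω ι) : MOp Ω ι :=
  radialLow (ħ : ℂ) (sc ι (eO ħ k Ω)) (sc ι (wO k Ω)) ((β : ℂ)⁻¹ • Λ) (D.coup Λ)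

/-- The raising operator of the radial problem. -/
def RadialModel.raise (D : RadialModel Ω) (ħ k β : ℝ) (Λ : MOp Ω ι) : MOp Ω ι :=
  radialRaise (ħ : ℂ) (sc ι (eO ħ k Ω)) (sc ι (wO k Ω)) ((β : ℂ)⁻¹ • Λ)
    (D.coup (Λ + ((ħ : ℂ) * β) • 1))

/-- Values of the symbols of the radial operators at distance `r` from the origin. -/
def gVal (k : ℝ) (x : Space N) : ℂ := (‖x‖ : ℂ)⁻¹ + (k : ℂ) ^ 2 * ‖x‖
/-- Values of the symbols of the radial operators at distance `r` from the origin. -/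
def wVal (k : ℝ) (x : Space N) : ℂ := (‖x‖ : ℂ)⁻¹ - (k : ℂ) ^ 2 * ‖x‖

/-- The properties of the Hamiltonians that are used. -/
structure RadialModel.IsLadder (D : RadialModel Ω) (ħ k β : ℝ) (w : Space N → ℝ)
    (ι : Type*) [Fintype ι] [DecidableEq ι] : Prop where
  weight : IsWeight Ω w
  rot_adj : ∀ i j, Adj w (rotO ħ Ω i j) (rotO ħ Ω i j)
  e_adj : HasAdj w (eO ħ k Ω)
  h0_adj : Adj w D.h0 D.h0
  h1_adj : Adj w D.h1 D.h1
  M0_adj : Adj w D.M0 D.M0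
  M1_adj : Adj w D.M1 D.M1
  h0_rad : IsRadial ħ D.h0
  h1_rad : IsRadial ħ D.h1
  M0_rad : IsRadial ħ D.M0
  M1_rad : IsRadial ħ D.M1
  -- General Λ are needed because the shifted powers use the ladder at all the arguments L + iħβ
  -- with i < n (here i counts steps).
  intertwine : ∀ Λ : MOp Ω ι, (∀ P, IsRadial ħ P → Commute (sc ι P) Λ) →
    D.low ħ k β Λ * D.hamAt Λ = D.hamAt (Λ + ((ħ : ℂ) * β) • 1) * D.low ħ k β Λ
  low_adj : ∀ Λ : MOp Ω ι, (∀ P, IsRadial ħ P → Commute (sc ι P) Λ) → SAdj w Λ Λ →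
    SAdj w (D.low ħ k β Λ) (D.raise ħ k β Λ)
  h0_sym : ∀ x ∈ Ω.carrier, ∀ ξ, HasSym ħ x ξ 2 D.h0
    (1 / 2 * D.v x * (gVal k x * ∑ i, (x i : ℝ) * ξ i) ^ 2)
  h1_sym : ∀ x ∈ Ω.carrier, ∀ ξ, HasSym ħ x ξ 0 D.h1 (1 / 2 * D.v x * gVal k x ^ 2 / (β : ℂ) ^ 2)
  M0_sym : ∀ x ∈ Ω.carrier, ∀ ξ, HasSym ħ x ξ 2 D.M0
    (D.ν * (1 / 2 * D.v x * (gVal k x * ∑ i, (x i : ℝ) * ξ i) ^ 2))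
  M1_eq : D.M1 = D.ν • D.h1
  v_ne : ∀ x ∈ Ω.carrier, D.v x ≠ 0
  v_congr : ∀ x y, ‖x‖ = ‖y‖ → D.v x = D.v y
  -- With l in the role of L/β, the right side is the product of the symbols of the lowering and
  -- raising operators. It depends on the radial momentum ε only through the energy, as the
  -- classical counterpart of A†A being a polynomial in H.
  low_raise : ∀ x ∈ Ω.carrier, ∀ l : ℂ, l ≠ 0 → ∃ F : Polynomial ℂ, F.natDegree ≠ 0 ∧
    ∀ ε : ℂ, F.eval (1 / 2 * D.v x * (ε ^ 2 + l ^ 2 * gVal k x ^ 2)) =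
      1 / 2 * (l ^ 2 * ε ^ 2 +
        (l ^ 2 * wVal k x - D.ν * (1 / 2 * D.v x * (ε ^ 2 + l ^ 2 * gVal k x ^ 2))) ^ 2)

variable {D : RadialModel Ω} {ħ k β : ℝ} {w : Space N → ℝ} (γ : GammaMatrices N ι)

theorem sc_commute_shift {P : Op Ω} (hP : IsRadial ħ P) (z : ℂ) :
    Commute (sc ι P) (angLO ħ γ Ω + z • 1) :=
  (angLO_commute_sc γ hP.rot).symm.add_right ((Commute.one_right _).smul_right _)

theorem hamAt_angLO : D.hamAt (angLO ħ γ Ω) = sc ι (D.ham ħ) := by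
  rw [RadialModel.hamAt, angLO_sq, RadialModel.ham, map_add, map_mul]

namespace RadialModel.IsLadder
variable (hD : D.IsLadder ħ k β w ι)
include hD

theorem ang_adj (z : ℝ) : SAdj w (angLO ħ γ Ω + (z : ℂ) • 1) (angLO ħ γ Ω + (z : ℂ) • 1) := by
  have h := (sAdj_one (ι := ι) (Ω := Ω) (w := w)).smul (z : ℂ)
  rw [Complex.conj_ofReal] at h
  exact (sAdj_angLO γ ħ hD.weight hD.rot_adj).add hD.weight h

theorem ham_adj (hC : Adj w (LSqO ħ Ω) (LSqO ħ Ω)) : Adj w (D.ham ħ) (D.ham ħ) := by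
  have h := hD.h0_adj.add hD.weight (hD.h1_adj.mul hC)
  have hc : Commute (LSqO ħ Ω) D.h1 :=
    (casimirO_commute_of_rotO ħ Ω _ fun i _ j _ => hD.h1_rad.rot i j).add_left
      ((Commute.one_left _).smul_left _)
  rwa [hc.eq] at h

theorem LSq_adj [Nonempty ι] (γ : GammaMatrices N ι) : Adj w (LSqO ħ Ω) (LSqO ħ Ω) := by
  have h := hD.ang_adj γ 0
  rw [Complex.ofReal_zero, zero_smul, add_zero] at h
  have h2 := h.mul hD.weight h
  rw [angLO_sq] at h2
  obtain ⟨a⟩ := ‹Nonempty ι›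
  have h3 := h2 a a
  rwa [sc_apply, Matrix.diagonal_apply_eq] at h3

theorem shiftPow_adj (n : ℕ) : SAdj w
    (shiftPow (D.low ħ k β) ((ħ : ℂ) * β) (angLO ħ γ Ω) n)
    (shiftPowRev (D.raise ħ k β) ((ħ : ℂ) * β) (angLO ħ γ Ω) n) := by
  induction n with
  | zero => exact sAdj_one
  | succ n ih =>
    refine SAdj.mul hD.weight (hD.low_adj _ (fun P hP => sc_commute_shift γ hP _) ?_) ih
    have h := hD.ang_adj γ (n * (ħ * β))
    push_cast at h
    exact h

theorem adjoint (m n : ℕ) (j : Fin N) : SAdj w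
    (ladPlusO ħ γ Ω j ^ m * shiftPow (D.low ħ k β) ((ħ : ℂ) * β) (angLO ħ γ Ω) n)
    (shiftPowRev (D.raise ħ k β) ((ħ : ℂ) * β) (angLO ħ γ Ω) n * ladMinusO ħ γ Ω j ^ m) :=
  ((sAdj_ladPlusO γ ħ hD.weight hD.rot_adj j).pow hD.weight m).mul hD.weight (hD.shiftPow_adj γ n)

theorem shiftPow_hamAt (n : ℕ) :
    shiftPow (D.low ħ k β) ((ħ : ℂ) * β) (angLO ħ γ Ω) n * D.hamAt (angLO ħ γ Ω) =
      D.hamAt (angLO ħ γ Ω + ((n : ℂ) * ((ħ : ℂ) * β)) • 1) *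
        shiftPow (D.low ħ k β) ((ħ : ℂ) * β) (angLO ħ γ Ω) n := by
  induction n with
  | zero => simp [shiftPow]
  | succ n ih =>
    rw [shiftPow, mul_assoc, ih, ← mul_assoc, hD.intertwine _ fun P hP => sc_commute_shift γ hP _,
      mul_assoc, add_assoc, ← add_smul]
    congr 4
    push_cast
    ring

theorem ladPlusO_hamAt (hħ : ħ ≠ 0) (z : ℂ) (j : Fin N) :
    ladPlusO ħ γ Ω j * D.hamAt (angLO ħ γ Ω + (z + ħ) • 1) =
      D.hamAt (angLO ħ γ Ω + z • 1) * ladPlusO ħ γ Ω j := by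
  have h0 := (hD.h0_rad.ladPlusO γ j).eq
  have h1 := (hD.h1_rad.ladPlusO γ j).eq
  have h2 : ladPlusO ħ γ Ω j * (angLO ħ γ Ω + (z + ħ) • 1) =
      (angLO ħ γ Ω + z • 1) * ladPlusO ħ γ Ω j := by
    rw [add_mul, angLO_mul_ladPlusO γ ħ hħ, smul_mul_assoc, one_mul]
    simp only [mul_add, mul_smul_comm, mul_one, add_smul]
    abel
  rw [RadialModel.hamAt, RadialModel.hamAt, mul_add, h0, ← mul_assoc, h1, mul_assoc, ← mul_assoc
    (ladPlusO ħ γ Ω j), h2, mul_assoc, h2,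
    add_mul (sc ι D.h0)]
  simp only [mul_assoc]

theorem ladPlusO_pow_hamAt (hħ : ħ ≠ 0) (m : ℕ) (j : Fin N) :
    ladPlusO ħ γ Ω j ^ m * D.hamAt (angLO ħ γ Ω + ((m : ℂ) * ħ) • 1) =
      D.hamAt (angLO ħ γ Ω) * ladPlusO ħ γ Ω j ^ m := by
  induction m with
  | zero => simp
  | succ m ih =>
    have h := hD.ladPlusO_hamAt γ hħ ((m : ℂ) * ħ) j
    rw [pow_succ, mul_assoc, Nat.cast_add, Nat.cast_one, add_mul, one_mul, h, ← mul_assoc, ih,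
      mul_assoc]

/-- The n radial steps raise the argument L of the Hamiltonian by nħβ = mħ, and the m angular steps
take it back to L. This is where rationality of β enters. -/
theorem commute_ham (hħ : ħ ≠ 0) {m n : ℕ} (hmn : (n : ℂ) * β = m) (j : Fin N) : Commute
    (ladPlusO ħ γ Ω j ^ m * shiftPow (D.low ħ k β) ((ħ : ℂ) * β) (angLO ħ γ Ω) n)
    (sc ι (D.ham ħ)) := by
  have h : (n : ℂ) * ((ħ : ℂ) * β) = m * ħ := by rw [← hmn]; ring
  rw [Commute, SemiconjBy, ← hamAt_angLO (D := D) γ, mul_assoc, hD.shiftPow_hamAt, h, ← mul_assoc,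
    hD.ladPlusO_pow_hamAt γ hħ, mul_assoc]

theorem ham_ord : OrdLE 2 (D.ham ħ) := by
  obtain ⟨x, hx⟩ := Ω.nonempty
  exact (hD.h0_sym x hx 0).ord.add ((hD.h1_sym x hx 0).ord.mul_le (e := 2) (ordLE_LSq ħ Ω) le_rfl)

/-- The radial ladder operators split. -/
theorem splits_low (hC : HasAdj w (LSqO ħ Ω)) (z : ℂ) : ∃ P Q : Op Ω,
    Splits w ħ γ 2 (D.low ħ k β (angLO ħ γ Ω + z • 1)) P Q ∧
      (∀ i j, Commute (rotO ħ Ω i j) P) ∧ ∀ i j, Commute (rotO ħ Ω i j) Q := by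
  obtain ⟨x, hx⟩ := Ω.nonempty
  have hw := hD.weight
  have oM0 := (hD.M0_sym x hx 0).ord
  have oM1 : OrdLE 0 D.M1 := by rw [hD.M1_eq]; exact (hD.h1_sym x hx 0).ord.smul _
  have oe := ordLE_eO ħ k Ω
  have ow := ordLE_wO k Ω
  have oC := ordLE_LSq ħ Ω
  have re := rotO_commute_eO ħ k Ω
  have rw' := rotO_commute_wO ħ k Ω
  have rC := rotO_commute_LSqO ħ Ω
  have aw : HasAdj w (wO k Ω) := (adj_wO k hw).hasAdj
  have aM0 := hD.M0_adj.hasAdj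
  have aM1 := hD.M1_adj.hasAdj
  set b := (β : ℂ)⁻¹
  -- With λ = bL + bz one has λ + ħ/2 = bL + c. Expanding and replacing L² by the scalar operator
  -- separates the part free of L from the coefficient of L.
  set c := b * z + ħ / 2 with hc
  refine ⟨((√2 : ℝ) : ℂ)⁻¹ • (-(c • eO ħ k Ω) + (-(Complex.I * b ^ 2)) • (LSqO ħ Ω * wO k Ω)
      + (-(Complex.I * (b * z * c))) • wO k Ω
      + Complex.I • (D.M0 + (D.M1 * LSqO ħ Ω + (z ^ 2) • D.M1))),
    ((√2 : ℝ) : ℂ)⁻¹ • ((-b) • eO ħ k Ω + (-(Complex.I * (b * (b * z + c)))) • wO k Ω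
      + (2 * z * Complex.I) • D.M1), ⟨?_, ?_, ?_, ?_, ?_⟩, ?_, ?_⟩
  · have h1 := (angLO_commute_sc γ re).eq
    have h2 := (angLO_commute_sc γ rw').eq
    have h3 := (angLO_commute_sc γ hD.M1_rad.rot).eq
    have h4 : sc ι (LSqO ħ Ω) * sc ι (wO k Ω) = angLO ħ γ Ω * (angLO ħ γ Ω * sc ι (wO k Ω)) := by
      rw [← angLO_sq γ, mul_assoc]
    have h5 : sc ι D.M1 * sc ι (LSqO ħ Ω) = angLO ħ γ Ω * (angLO ħ γ Ω * sc ι D.M1) := by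
      rw [← angLO_sq γ, ← mul_assoc, ← mul_assoc, ← h3, mul_assoc, mul_assoc, ← h3]
    have h6 : sc ι D.M1 * (angLO ħ γ Ω * angLO ħ γ Ω) = angLO ħ γ Ω * (angLO ħ γ Ω * sc ι D.M1) := by
      rw [angLO_sq, h5]
    rw [RadialModel.low, radialLow, RadialModel.coup]
    simp only [map_add, map_smul, map_mul, map_neg, h4, h5]
    simp only [mul_add, add_mul, smul_mul_assoc, mul_smul_comm, one_mul, mul_one, smul_add,
      h6, ← h3, mul_assoc]
    rw [hc]
    module
  · exact OrdLE.smul _ ((((oe.smul _).neg.mono (by norm_num)).add ((oC.mul (e := 0) ow).smul _) |>.add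
      ((ow.smul _).mono (by norm_num))).add ((oM0.add ((oM1.mul_le oC le_rfl).add
        ((oM1.smul _).mono (by norm_num)))).smul _))
  · exact OrdLE.smul _ (((oe.smul _).add ((ow.smul _).mono (by norm_num))).add
      ((oM1.smul _).mono (by norm_num)))
  · exact HasAdj.smul _ ((((hD.e_adj.smul _).neg.add hw ((hC.mul aw).smul _)).add hw
      (aw.smul _)).add hw ((aM0.add hw ((aM1.mul hC).add hw (aM1.smul _))).smul _))
  · exact HasAdj.smul _ (((hD.e_adj.smul _).add hw (aw.smul _)).add hw (aM1.smul _))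
  · intro i j
    have rM0 := hD.M0_rad.rot i j
    have rM1 := hD.M1_rad.rot i j
    exact Commute.smul_right (((((re i j).smul_right _).neg_right.add_right
      (((rC i j).mul_right (rw' i j)).smul_right _)).add_right ((rw' i j).smul_right _)).add_right
      ((rM0.add_right ((rM1.mul_right (rC i j)).add_right (rM1.smul_right _))).smul_right _)) _
  · intro i j
    have rM1 := hD.M1_rad.rot i j
    exact Commute.smul_right ((((re i j).smul_right _).add_right ((rw' i j).smul_right _)).add_right
      (rM1.smul_right _)) _

theorem splits_shiftPow (hC : HasAdj w (LSqO ħ Ω)) (n : ℕ) : ∃ P Q : Op Ω,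
    Splits w ħ γ (2 * n) (shiftPow (D.low ħ k β) ((ħ : ℂ) * β) (angLO ħ γ Ω) n) P Q ∧
      (∀ i j, Commute (rotO ħ Ω i j) P) ∧ ∀ i j, Commute (rotO ħ Ω i j) Q := by
  induction n with
  | zero => exact ⟨1, 0, splits_one, fun _ _ => Commute.one_right _, fun _ _ => Commute.zero_right _⟩
  | succ n ih =>
    obtain ⟨P, Q, h, hP, hQ⟩ := ih
    obtain ⟨a, b, h', ha, hb⟩ := hD.splits_low γ hC ((n : ℂ) * ((ħ : ℂ) * β))
    have h2 := h'.mul_of_commute hD.weight hC h ha hb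
    rw [show 2 * (n + 1) = 2 + 2 * n by ring]
    exact ⟨_, _, h2, fun i j => ((ha i j).mul_right (hP i j)).add_right
      ((rotO_commute_LSqO ħ Ω i j).mul_right ((hb i j).mul_right (hQ i j))), fun i j =>
        ((hb i j).mul_right (hP i j)).add_right ((ha i j).mul_right (hQ i j))⟩

/-- The scalar integrals of motion obtained from the ladder operators. -/
theorem exists_splits [Nonempty ι] (hN : 2 ≤ N) (hħ : ħ ≠ 0) {m n : ℕ} (hn : 0 < n)
    (hmn : (n : ℂ) * β = m) (j : Fin N) : ∃ P Q : Op Ω, Splits w ħ γ (m + 2 * n)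
      (ladPlusO ħ γ Ω j ^ m * shiftPow (D.low ħ k β) ((ħ : ℂ) * β) (angLO ħ γ Ω) n) P Q ∧
      Commute P (D.ham ħ) ∧ Commute Q (D.ham ħ) := by
  have hC := (hD.LSq_adj γ).hasAdj
  obtain ⟨P, Q, h⟩ := exists_splits_ladPlusO_pow (γ := γ) hD.weight hD.rot_adj hC hħ j m
  obtain ⟨a, b, h', ha, hb⟩ := hD.splits_shiftPow γ hC n
  have h2 := h.mul_of_shift hD.weight hC h' (ladPlusO_pow_mul_angLO hħ j m)
  refine ⟨_, _, h2, ?_⟩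
  have h3 := hD.commute_ham γ hħ hmn j
  obtain ⟨d, hd⟩ : ∃ d, m + 2 * n = d + 1 := ⟨m + 2 * n - 1, by omega⟩
  generalize P * a + (LSqO ħ Ω * (Q * b) - ((m : ℂ) * ħ) • (P * b)) = P' at *
  generalize Q * a + P * b + (-((m : ℂ) * ħ)) • (Q * b) = Q' at *
  rw [h2.eq, ← bracket_eq_zero_iff] at h3
  -- H commutes with L, so the commutator of P + LQ with H splits again, with parts the commutators
  -- of P and Q. Uniqueness of the splitting makes both vanish.
  have hLH : Commute (angLO ħ γ Ω) (sc ι (D.ham ħ)) := angLO_commute_sc γ fun i j =>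
    (hD.h0_rad.rot i j).add_right ((hD.h1_rad.rot i j).mul_right (rotO_commute_LSqO ħ Ω i j))
  rw [add_bracket, mul_bracket, bracket_eq_zero_iff.mpr hLH, zero_mul, add_zero, Ring.lie_def,
    Ring.lie_def, ← map_mul, ← map_mul, ← map_mul, ← map_mul, ← map_sub, ← map_sub] at h3
  have hQ : OrdLE d Q' := by have := h2.ord_lt; rw [hd] at this; exact this
  obtain ⟨h4, h5⟩ := eq_zero_of_split hN hħ ((hQ.mul hD.ham_ord).sub
    ((hD.ham_ord.mul hQ).mono (by omega))) h3
  exact ⟨sub_eq_zero.mp h4, sub_eq_zero.mp h5⟩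

end RadialModel.IsLadder

end model

/-! ### The two Hamiltonians -/

section instances
variable (ħ k : ℝ) (Ω : Region N)

/-- The radial part of the kinetic energy. -/
def kinO : Op Ω :=
  (1 / 2 : ℂ) • (eO ħ k Ω * eO ħ k Ω - (Complex.I * (ħ : ℂ)) • (wO k Ω * eO ħ k Ω))

/-- The angular part of the kinetic energy. -/
def centO (β : ℝ) : Op Ω :=
  (1 / 2 * ((β : ℂ) ^ 2)⁻¹) • (wO k Ω * wO k Ω + (4 * (k : ℂ) ^ 2) • 1)

/-- The radial problem of `H_β`. -/
def coulombModel (μ β : ℝ) : RadialModel Ω where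
  h0 := kinO ħ k Ω - (μ : ℂ) • wO k Ω
  h1 := centO k Ω β
  M0 := (μ : ℂ) • 1
  M1 := 0
  v := fun _ => 1
  ν := 0

/-- The radial problem of `Ĥ_β`. -/
def hatModel {Ω : Region N} (μ' δ β : ℝ) (hΩ : Admissible k δ Ω) : RadialModel Ω where
  h0 := vO hΩ * (kinO ħ k Ω + ((μ' : ℂ) / 2) • 1)
  h1 := vO hΩ * centO k Ω β
  M0 := vO hΩ * (kinO ħ k Ω + ((μ' : ℂ) / 2) • 1)
  M1 := vO hΩ * centO k Ω β
  v := fun x => (wVal k x - 4 * δ)⁻¹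
  ν := 1

variable {ħ k Ω}

theorem adj_kinO : Adj (weight k) (kinO ħ k Ω) (kinO ħ k Ω) := by
  have h := adj_eO_weight ħ k (Ω := Ω)
  have h1 := (h.symm.mul h).smul (1 / 2)
  have e : (starRingEnd ℂ) (1 / 2 : ℂ) = 1 / 2 := by rw [map_div₀, map_one, map_ofNat]
  rw [e] at h1
  have h2 : kinO ħ k Ω =
      (1 / 2 : ℂ) • ((eO ħ k Ω - (Complex.I * (ħ : ℂ)) • wO k Ω) * eO ħ k Ω) := by
    rw [kinO, sub_mul, smul_mul_assoc]
  rwa [h2]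

theorem adj_centO {w : Space N → ℝ} (hw : IsWeight Ω w) (β : ℝ) :
    Adj w (centO k Ω β) (centO k Ω β) := by
  have h := ((adj_wO k hw).mul (adj_wO k hw)).add hw
    ((adj_one (w := w) (Ω := Ω)).smul ((4 * k ^ 2 : ℝ) : ℂ)) |>.smul ((1 / 2 * (β ^ 2)⁻¹ : ℝ) : ℂ)
  rw [Complex.conj_ofReal, Complex.conj_ofReal] at h
  push_cast at h
  exact h

theorem isRadial_kinO : IsRadial ħ (kinO ħ k Ω) :=
  IsRadial.smul _ (((isRadial_eO k).mul (isRadial_eO k)).sub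
    (((isRadial_wO k).mul (isRadial_eO k)).smul _))

theorem isRadial_centO (β : ℝ) : IsRadial ħ (centO k Ω β) :=
  IsRadial.smul _ (((isRadial_wO k).mul (isRadial_wO k)).add (isRadial_one.smul _))

theorem gVal_sq {x : Space N} (hx : x ∈ Ω.carrier) :
    gVal k x ^ 2 = wVal k x ^ 2 + 4 * (k : ℂ) ^ 2 := by
  have := norm_ne_zero_of_mem' hx
  rw [gVal, wVal]
  field_simp
  ring

variable {x : Space N} {ξ : Fin N → ℂ}

theorem hasSym_kinO (hħ : ħ ≠ 0) (hx : x ∈ Ω.carrier) : HasSym ħ x ξ 2 (kinO ħ k Ω)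
    (1 / 2 * (gVal k x * ∑ i, (x i : ℝ) * ξ i) ^ 2) := by
  have he := hasSym_eO (ξ := ξ) hħ hx k
  have hwe := (ordLE_wO k Ω).mul (ordLE_eO ħ k Ω)
  have h := ((he.mul he).sub ((hwe.smul (Complex.I * ħ)).hasSym_zero (e := 1 + 1)
    (by norm_num))).smul (1 / 2)
  rw [sub_zero] at h
  rw [pow_two (gVal k x * _)]
  exact h

theorem hasSym_centO (hx : x ∈ Ω.carrier) (β : ℝ) : HasSym ħ x ξ 0 (centO k Ω β)
    (1 / 2 * gVal k x ^ 2 / (β : ℂ) ^ 2) := by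
  have hw := hasSym_wO (ħ := ħ) (ξ := ξ) hx k
  have h := ((hw.mul hw).add (hasSym_one.smul (4 * (k : ℂ) ^ 2))).smul (1 / 2 * ((β : ℂ) ^ 2)⁻¹)
  have e : 1 / 2 * gVal k x ^ 2 / (β : ℂ) ^ 2 = 1 / 2 * ((β : ℂ) ^ 2)⁻¹ *
      (wVal k x * wVal k x + 4 * (k : ℂ) ^ 2 * 1) := by
    rw [gVal_sq hx]; ring
  rw [e]
  exact h

theorem wVal_sub_ne_zero {δ : ℝ} (hΩ : Admissible k δ Ω) (hx : x ∈ Ω.carrier) :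
    wVal k x - 4 * δ ≠ 0 := by
  have h1 := norm_ne_zero_of_mem' hx
  have h2 : ((1 - k ^ 2 * ‖x‖ ^ 2 - 4 * δ * ‖x‖ : ℝ) : ℂ) ≠ 0 :=
    Complex.ofReal_ne_zero.mpr (hΩ x hx)
  push_cast at h2
  intro h
  apply h2
  rw [wVal] at h
  have h3 := congrArg (fun z => (‖x‖ : ℂ) * z) h
  simp only [mul_sub, mul_zero, mul_inv_cancel₀ h1] at h3
  linear_combination h3

theorem hasSym_vO' {δ : ℝ} (hΩ : Admissible k δ Ω) (hx : x ∈ Ω.carrier) :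
    HasSym ħ x ξ 0 (vO hΩ) (wVal k x - 4 * δ)⁻¹ := by
  have h := hasSym_vO (ħ := ħ) (ξ := ξ) hΩ hx
  have h1 := norm_ne_zero_of_mem' hx
  have e : ((‖x‖ * (1 - k ^ 2 * ‖x‖ ^ 2 - 4 * δ * ‖x‖)⁻¹ : ℝ) : ℂ) = (wVal k x - 4 * δ)⁻¹ := by
    have h2 : wVal k x - 4 * δ = (‖x‖ : ℂ)⁻¹ *
        ((1 - k ^ 2 * ‖x‖ ^ 2 - 4 * δ * ‖x‖ : ℝ) : ℂ) := by
      rw [wVal]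
      push_cast
      field_simp
    rw [h2, mul_inv, inv_inv]
    push_cast
    ring
  rwa [e] at h

variable {ι : Type*} [Fintype ι] [DecidableEq ι]

theorem radialHam_eq {β : ℝ} {Λ : MOp Ω ι}
    (hΛ : ∀ P, IsRadial ħ P → Commute (sc ι P) Λ) :
    radialHam (ħ : ℂ) (4 * (k : ℂ) ^ 2) (sc ι (eO ħ k Ω)) (sc ι (wO k Ω)) ((β : ℂ)⁻¹ • Λ) =
      sc ι (kinO ħ k Ω) + sc ι (centO k Ω β) * (Λ * Λ) := by
  have h1 := hΛ _ (((isRadial_wO (ħ := ħ) k).mul (isRadial_wO k)).add (isRadial_one.smul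
    (4 * (k : ℂ) ^ 2)))
  have h2 := (h1.mul_right h1).eq
  rw [map_add, map_mul, map_smul, map_one] at h2
  rw [radialHam, radialKin, kinO, centO]
  simp only [map_smul, map_sub, map_add, map_mul, map_one]
  simp only [smul_mul_assoc, mul_smul_comm, smul_smul]
  rw [h2]
  have hI : Complex.I * Complex.I = -1 := Complex.I_mul_I
  have e : Complex.I * (β : ℂ)⁻¹ * (Complex.I * (β : ℂ)⁻¹) = -((β : ℂ) ^ 2)⁻¹ := by
    rw [← inv_pow]; linear_combination ((β : ℂ)⁻¹ ^ 2) * hI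
  rw [e]
  module

theorem sc_eO_mul_wO : sc ι (eO ħ k Ω) * sc ι (wO k Ω) = sc ι (wO k Ω) * sc ι (eO ħ k Ω) +
    (Complex.I * (ħ : ℂ)) • (sc ι (wO k Ω) * sc ι (wO k Ω))
      + (Complex.I * (ħ : ℂ) * (4 * (k : ℂ) ^ 2)) • 1 := by
  have h := congrArg (sc ι) (eO_mul_wO ħ k Ω)
  simpa only [map_mul, map_add, map_smul, map_one] using h

/-- The adjoint of the lowering operator of the radial problem. -/
theorem sAdj_radialLow {w : Space N → ℝ} (hw : IsWeight Ω w) {e' : Op Ω} {Λ M : MOp Ω ι} {β : ℝ}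
    (he : Adj w (eO ħ k Ω) e') (he' : Commute (sc ι e') Λ) (hM : SAdj w M M)
    (hΛ : ∀ P, IsRadial ħ P → Commute (sc ι P) Λ) (hΛ' : SAdj w Λ Λ) :
    SAdj w (radialLow (ħ : ℂ) (sc ι (eO ħ k Ω)) (sc ι (wO k Ω)) ((β : ℂ)⁻¹ • Λ) M)
      (((√2 : ℝ) : ℂ)⁻¹ • (-(((β : ℂ)⁻¹ • Λ + ((ħ : ℂ) / 2) • 1) * sc ι e')
        + Complex.I • (((β : ℂ)⁻¹ • Λ) * ((β : ℂ)⁻¹ • Λ + ((ħ : ℂ) / 2) • 1) * sc ι (wO k Ω))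
        - Complex.I • M)) := by
  have c1 : (starRingEnd ℂ) (β : ℂ)⁻¹ = (β : ℂ)⁻¹ := by rw [map_inv₀, Complex.conj_ofReal]
  have c2 : (starRingEnd ℂ) ((ħ : ℂ) / 2) = (ħ : ℂ) / 2 := by
    rw [map_div₀, Complex.conj_ofReal, map_ofNat]
  have c3 : (starRingEnd ℂ) ((√2 : ℝ) : ℂ)⁻¹ = ((√2 : ℝ) : ℂ)⁻¹ := by
    rw [map_inv₀, Complex.conj_ofReal]
  have h1 : SAdj w ((β : ℂ)⁻¹ • Λ) ((β : ℂ)⁻¹ • Λ) := by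
    have h := hΛ'.smul (β : ℂ)⁻¹
    rwa [c1] at h
  have h2 := h1.add hw ((sAdj_one (ι := ι) (Ω := Ω)).smul ((ħ : ℂ) / 2))
  rw [c2] at h2
  have h3 := ((((h2.mul hw (sAdj_sc he)).neg.sub hw (((h1.mul hw h2).mul hw
    (sAdj_sc (adj_wO k hw))).smul Complex.I)).add hw (hM.smul Complex.I))).smul ((√2 : ℝ) : ℂ)⁻¹
  rw [c3, Complex.conj_I] at h3
  have k1 : Commute (sc ι e') ((β : ℂ)⁻¹ • Λ + ((ħ : ℂ) / 2) • 1) :=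
    (he'.smul_right _).add_right ((Commute.one_right _).smul_right _)
  have k2 : Commute (sc ι (wO k Ω)) ((β : ℂ)⁻¹ • Λ) := (hΛ _ (isRadial_wO k)).smul_right _
  have k3 : Commute (sc ι (wO k Ω)) ((β : ℂ)⁻¹ • Λ + ((ħ : ℂ) / 2) • 1) :=
    k2.add_right ((Commute.one_right _).smul_right _)
  have k4 : Commute ((β : ℂ)⁻¹ • Λ) ((β : ℂ)⁻¹ • Λ + ((ħ : ℂ) / 2) • 1) :=
    (Commute.refl _).add_right ((Commute.one_right _).smul_right _)
  rw [k1.eq, (k3.mul_right k2).eq, ← k4.eq, neg_smul, neg_smul, sub_neg_eq_add,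
    ← sub_eq_add_neg] at h3
  exact h3

/-- For the weight of Ĥ_β the adjoint of e has an extra term iħQ, with Q = V(W² + 4k²). It changes
the coupling Ĥ(Λ) into Ĥ(Λ + ħβ), because the two differ by ħ Q (Λ/β + ħ/2); the term -iħW changes λ
in front of W into λ + ħ. -/
theorem raise_adjoint_identity {B : Type*} [Ring B] [Algebra ℂ B] {b β ħ : ℂ} (hb : b * β = 1)
    (e W K : B) {Q Λ : B} (h : Q * Λ = Λ * Q) :
    (((√2 : ℝ) : ℂ)⁻¹ • (-((b • Λ + (ħ / 2) • 1) * (e - (Complex.I * ħ) • W + (Complex.I * ħ) • Q))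
        + Complex.I • ((b • Λ) * (b • Λ + (ħ / 2) • 1) * W)
        - Complex.I • (K + (1 / 2 * b ^ 2) • (Q * (Λ * Λ))))) =
      ((√2 : ℝ) : ℂ)⁻¹ • (-((b • Λ + (ħ / 2) • 1) * e)
        + Complex.I • ((b • Λ + ħ • 1) * (b • Λ + (ħ / 2) • 1) * W)
        - Complex.I • (K + (1 / 2 * b ^ 2) •
          (Q * ((Λ + (ħ * β) • 1) * (Λ + (ħ * β) • 1))))) := by
  congr 1
  simp only [mul_add, add_mul, mul_sub, smul_mul_assoc, mul_smul_comm, mul_one, one_mul, smul_add,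
    smul_smul, h]
  have h1 : Complex.I * (1 / 2 * b ^ 2) * (ħ * β) = Complex.I * ħ * b / 2 := by
    linear_combination (Complex.I * ħ * b / 2) * hb
  simp only [← mul_assoc] at h1 ⊢
  simp only [h1]
  match_scalars <;> first | ring1 | linear_combination (Complex.I * ħ ^ 2 / 2) * hb

theorem coulombModel_isLadder (hħ : ħ ≠ 0) (μ : ℝ) {β : ℝ} (hβ : β ≠ 0) :
    (coulombModel ħ k Ω μ β).IsLadder ħ k β (weight k) ι := by
  have hw := isWeight_weight k Ω
  have hβ' : (β : ℂ) ≠ 0 := Complex.ofReal_ne_zero.mpr hβ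
  have aμ : Adj (weight k) ((μ : ℂ) • (1 : Op Ω)) ((μ : ℂ) • 1) := by
    have h := (adj_one (w := weight k) (Ω := Ω)).smul (μ : ℂ)
    rwa [Complex.conj_ofReal] at h
  have ham : ∀ Λ : MOp Ω ι, (∀ P, IsRadial ħ P → Commute (sc ι P) Λ) →
      (coulombModel ħ k Ω μ β).hamAt Λ = radialHam (ħ : ℂ) (4 * (k : ℂ) ^ 2) (sc ι (eO ħ k Ω))
        (sc ι (wO k Ω)) ((β : ℂ)⁻¹ • Λ) - (μ : ℂ) • sc ι (wO k Ω) := by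
    intro Λ hΛ
    rw [radialHam_eq hΛ, RadialModel.hamAt, coulombModel, map_sub, map_smul]
    abel
  have coup : ∀ Λ : MOp Ω ι, (coulombModel ħ k Ω μ β).coup Λ = (μ : ℂ) • 1 := by
    intro Λ
    rw [RadialModel.coup, coulombModel, map_zero, zero_mul, add_zero, map_smul, map_one]
  exact
  { weight := hw
    rot_adj := adj_rotO_weight ħ k
    e_adj := (adj_eO_weight ħ k).hasAdj
    h0_adj := by
      have h := (adj_wO k hw).smul (μ : ℂ)
      rw [Complex.conj_ofReal] at h
      exact adj_kinO.sub hw h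
    h1_adj := adj_centO hw β
    M0_adj := aμ
    M1_adj := adj_zero
    h0_rad := isRadial_kinO.sub ((isRadial_wO k).smul _)
    h1_rad := isRadial_centO β
    M0_rad := isRadial_one.smul _
    M1_rad := isRadial_zero
    intertwine := by
      intro Λ hΛ
      have hΛ2 : ∀ P, IsRadial ħ P → Commute (sc ι P) (Λ + ((ħ : ℂ) * β) • 1) := fun P hP =>
        (hΛ P hP).add_right ((Commute.one_right _).smul_right _)
      have e : (β : ℂ)⁻¹ • (Λ + ((ħ : ℂ) * β) • 1) = (β : ℂ)⁻¹ • Λ + (ħ : ℂ) • 1 := by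
        rw [smul_add, smul_smul]; congr 2; field_simp
      rw [ham _ hΛ, ham _ hΛ2, RadialModel.low, coup, e]
      exact radialLow_intertwine sc_eO_mul_wO ((hΛ _ (isRadial_eO k)).smul_right _)
        ((hΛ _ (isRadial_wO k)).smul_right _) _
    low_adj := by
      intro Λ hΛ hΛ'
      have h := sAdj_radialLow (β := β) hw (adj_eO_weight ħ k)
        (hΛ _ ((isRadial_eO k).sub ((isRadial_wO k).smul _))) (M := (μ : ℂ) • (1 : MOp Ω ι))
        (by have := sAdj_sc (ι := ι) aμ; rwa [map_smul, map_one] at this) hΛ hΛ'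
      rw [RadialModel.low, RadialModel.raise, coup, coup]
      convert h using 1
      -- The term -iħW in the adjoint of e turns the factor λ in front of W into λ + ħ.
      rw [radialRaise]
      simp only [map_sub, map_smul, mul_add, add_mul, mul_sub, smul_mul_assoc, mul_smul_comm,
        one_mul, mul_one]
      module
    h0_sym := by
      intro x hx ξ
      have h := (hasSym_kinO (k := k) (ξ := ξ) hħ hx).sub
        (((ordLE_wO k Ω).smul (μ : ℂ)).hasSym_zero (Nat.two_pos))
      rw [sub_zero] at h
      simp only [coulombModel, mul_one]
      exact h
    h1_sym := by
      intro x hx ξ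
      simp only [coulombModel, mul_one]
      exact hasSym_centO hx β
    M0_sym := by
      intro x hx ξ
      simp only [coulombModel, zero_mul]
      exact (ordLE_one.smul (μ : ℂ)).hasSym_zero Nat.two_pos
    M1_eq := (zero_smul _ _).symm
    v_ne := fun _ _ => one_ne_zero
    v_congr := fun _ _ _ => rfl
    low_raise := by
      intro x hx l hl
      -- As g² = w² + 4k², the product of the symbols is l²h - 2k²l⁴.
      refine ⟨Polynomial.C (l ^ 2) * Polynomial.X + Polynomial.C (-(2 * (k : ℂ) ^ 2 * l ^ 4)), ?_,
        fun ε => ?_⟩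
      · rw [Polynomial.natDegree_linear (pow_ne_zero 2 hl)]; exact one_ne_zero
      · simp only [Polynomial.eval_add, Polynomial.eval_mul, Polynomial.eval_C, Polynomial.eval_X,
          coulombModel]
        linear_combination (1 / 2 * l ^ 4) * gVal_sq (k := k) hx }

theorem hatModel_isLadder (hħ : ħ ≠ 0) (μ' : ℝ) {δ β : ℝ} (hβ : β ≠ 0) (hΩ : Admissible k δ Ω) :
    (hatModel ħ k μ' δ β hΩ).IsLadder ħ k β (hatWeight k δ) ι := by
  have hw := isWeight_hatWeight hΩ
  have hβ' : (β : ℂ) ≠ 0 := Complex.ofReal_ne_zero.mpr hβ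
  have e2 : ∀ Λ : MOp Ω ι, (β : ℂ)⁻¹ • (Λ + ((ħ : ℂ) * β) • 1) = (β : ℂ)⁻¹ • Λ + (ħ : ℂ) • 1 := by
    intro Λ
    rw [smul_add, smul_smul]; congr 2; field_simp
  have ham : ∀ Λ : MOp Ω ι, (∀ P, IsRadial ħ P → Commute (sc ι P) Λ) →
      (hatModel ħ k μ' δ β hΩ).hamAt Λ = sc ι (vO hΩ) *
        (radialHam (ħ : ℂ) (4 * (k : ℂ) ^ 2) (sc ι (eO ħ k Ω))
        (sc ι (wO k Ω)) ((β : ℂ)⁻¹ • Λ) + ((μ' : ℂ) / 2) • 1) := by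
    intro Λ hΛ
    rw [radialHam_eq hΛ, RadialModel.hamAt, hatModel, map_mul, map_mul, map_add, map_smul, map_one]
    simp only [mul_add, mul_assoc]
    abel
  have radV := isRadial_vO (ħ := ħ) hΩ
  have a0 : Adj (hatWeight k δ) (hatModel ħ k μ' δ β hΩ).h0 (hatModel ħ k μ' δ β hΩ).h0 := by
    refine Adj.hat_vO_mul hΩ (adj_kinO.add (isWeight_weight k Ω) ?_)
    have h := (adj_one (w := weight k) (Ω := Ω)).smul ((μ' / 2 : ℝ) : ℂ)
    rw [Complex.conj_ofReal] at h
    push_cast at h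
    exact h
  have a1 : Adj (hatWeight k δ) (hatModel ħ k μ' δ β hΩ).h1 (hatModel ħ k μ' δ β hΩ).h1 :=
    Adj.hat_vO_mul hΩ (adj_centO (isWeight_weight k Ω) β)
  have r0 : IsRadial ħ (hatModel ħ k μ' δ β hΩ).h0 :=
    radV.mul (isRadial_kinO.add (isRadial_one.smul _))
  have r1 : IsRadial ħ (hatModel ħ k μ' δ β hΩ).h1 := radV.mul (isRadial_centO β)
  have s0 : ∀ x ∈ Ω.carrier, ∀ ξ, HasSym ħ x ξ 2 (hatModel ħ k μ' δ β hΩ).h0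
      (1 / 2 * (wVal k x - 4 * δ)⁻¹ * (gVal k x * ∑ i, (x i : ℝ) * ξ i) ^ 2) := by
    intro x hx ξ
    have h := (hasSym_vO' (ħ := ħ) hΩ hx).mul ((hasSym_kinO (k := k) (ξ := ξ) hħ hx).add
        ((ordLE_one.smul ((μ' : ℂ) / 2)).hasSym_zero (Nat.two_pos)))
    rw [add_zero, ← mul_assoc, mul_comm _ (1 / 2 : ℂ)] at h
    exact h
  exact
  { weight := hw
    rot_adj := adj_rotO_hatWeight ħ hΩ
    e_adj := (Adj.hat hΩ (adj_eO_weight ħ k)).hasAdj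
    h0_adj := a0
    h1_adj := a1
    M0_adj := a0
    M1_adj := a1
    h0_rad := r0
    h1_rad := r1
    M0_rad := r0
    M1_rad := r1
    intertwine := by
      intro Λ hΛ
      have hΛ2 : ∀ P, IsRadial ħ P → Commute (sc ι P) (Λ + ((ħ : ℂ) * β) • 1) := fun P hP =>
        (hΛ P hP).add_right ((Commute.one_right _).smul_right _)
      have h1 := congrArg (sc ι) (vO_mul_wO hΩ)
      have h2 := congrArg (sc ι) (wO_mul_vO hΩ)
      rw [map_mul, map_sub, map_smul, map_one] at h1 h2
      rw [show (hatModel ħ k μ' δ β hΩ).low ħ k β Λ = radialLow (ħ : ℂ) (sc ι (eO ħ k Ω))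
        (sc ι (wO k Ω)) ((β : ℂ)⁻¹ • Λ) ((hatModel ħ k μ' δ β hΩ).hamAt Λ) from rfl,
        ham _ hΛ, ham _ hΛ2, e2]
      exact radialLow_intertwine_metamorphosis sc_eO_mul_wO ((hΛ _ (isRadial_eO k)).smul_right _)
        ((hΛ _ (isRadial_wO k)).smul_right _) _ _ h1 h2
    low_adj := by
      intro Λ hΛ hΛ'
      set t := Complex.I * (ħ : ℂ) with ht
      -- The adjoint of e for the new weight: conjugating by W - 4δ adds V times the commutator of e
      -- with W.
      have e' : vO hΩ * (eO ħ k Ω - t • wO k Ω) * (wO k Ω - (4 * (δ : ℂ)) • 1) =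
          eO ħ k Ω - t • wO k Ω + t • (vO hΩ * (wO k Ω * wO k Ω + (4 * (k : ℂ) ^ 2) • 1)) := by
        have h1 : (eO ħ k Ω - t • wO k Ω) * (wO k Ω - (4 * (δ : ℂ)) • 1) =
            (wO k Ω - (4 * (δ : ℂ)) • 1) * (eO ħ k Ω - t • wO k Ω)
              + t • (wO k Ω * wO k Ω + (4 * (k : ℂ) ^ 2) • 1) := by
          have h := eO_mul_wO ħ k Ω
          rw [← ht] at h
          simp only [mul_sub, sub_mul, h, smul_mul_assoc, mul_smul_comm, mul_one, one_mul]
          module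
        rw [mul_assoc, h1, mul_add, ← mul_assoc, vO_mul_wO, one_mul, mul_smul_comm]
      have re' : IsRadial ħ (vO hΩ * (eO ħ k Ω - t • wO k Ω) * (wO k Ω - (4 * (δ : ℂ)) • 1)) :=
        (radV.mul ((isRadial_eO k).sub ((isRadial_wO k).smul _))).mul
          ((isRadial_wO k).sub (isRadial_one.smul _))
      have hM : SAdj (hatWeight k δ) ((hatModel ħ k μ' δ β hΩ).coup Λ)
          ((hatModel ħ k μ' δ β hΩ).coup Λ) := by
        have h := ((sAdj_sc (ι := ι) a1).mul hw (hΛ'.mul hw hΛ'))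
        have hc := ((hΛ _ r1).mul_right (hΛ _ r1)).eq
        rw [← hc] at h
        exact (sAdj_sc a0).add hw h
      have h := sAdj_radialLow (β := β) hw (Adj.hat hΩ (adj_eO_weight ħ k)) (hΛ _ re') hM hΛ hΛ'
      have key := raise_adjoint_identity (b := (β : ℂ)⁻¹) (β := β) (ħ := ħ) (inv_mul_cancel₀ hβ')
        (sc ι (eO ħ k Ω)) (sc ι (wO k Ω))
        (sc ι (vO hΩ * (kinO ħ k Ω + ((μ' : ℂ) / 2) • 1)))
        (hΛ _ (radV.mul (((isRadial_wO k).mul (isRadial_wO k)).add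
          (isRadial_one.smul (4 * (k : ℂ) ^ 2))))).eq
      have hM' : ∀ Λ : MOp Ω ι, (hatModel ħ k μ' δ β hΩ).coup Λ =
          sc ι (vO hΩ * (kinO ħ k Ω + ((μ' : ℂ) / 2) • 1)) + (1 / 2 * (β : ℂ)⁻¹ ^ 2) •
            (sc ι (vO hΩ * (wO k Ω * wO k Ω + (4 * (k : ℂ) ^ 2) • 1)) * (Λ * Λ)) := by
        intro Λ
        rw [RadialModel.coup, hatModel, centO, mul_smul_comm, map_smul, smul_mul_assoc, inv_pow]
      rw [e', map_add, map_sub, map_smul, map_smul, ht, hM', key, ← hM' Λ, ← hM'] at h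
      exact h
    h0_sym := s0
    h1_sym := by
      intro x hx ξ
      have h := (hasSym_vO' (ħ := ħ) (ξ := ξ) hΩ hx).mul (hasSym_centO (k := k) (ξ := ξ) hx β)
      have e : (wVal k x - 4 * δ)⁻¹ * (1 / 2 * gVal k x ^ 2 / (β : ℂ) ^ 2) =
        1 / 2 * (wVal k x - 4 * δ)⁻¹ * gVal k x ^ 2 / (β : ℂ) ^ 2 := by ring
      rw [e] at h
      exact h
    M0_sym := by
      intro x hx ξ
      have h := s0 x hx ξ
      rw [← one_mul (1 / 2 * (wVal k x - 4 * δ)⁻¹ * (gVal k x * ∑ i, (x i : ℝ) * ξ i) ^ 2)] at h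
      exact h
    M1_eq := (one_smul _ _).symm
    v_ne := fun _ hx => inv_ne_zero (wVal_sub_ne_zero hΩ hx)
    v_congr := fun x y h => by simp only [hatModel, wVal, h]
    low_raise := by
      intro x hx l hl
      -- Eliminating ε² through h = (ε² + l²g²)/(2(w - 4δ)) cancels all occurrences of w and leaves
      -- h²/2 - 4δl²h - 2k²l⁴.
      refine ⟨Polynomial.C (1 / 2) * Polynomial.X ^ 2 + Polynomial.C (-(4 * (δ : ℂ) * l ^ 2)) *
        Polynomial.X + Polynomial.C (-(2 * (k : ℂ) ^ 2 * l ^ 4)), ?_, fun ε => ?_⟩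
      · rw [Polynomial.natDegree_quadratic (by norm_num)]; exact two_ne_zero
      · simp only [Polynomial.eval_add, Polynomial.eval_mul, Polynomial.eval_C, Polynomial.eval_X,
          Polynomial.eval_pow, hatModel]
        have h0 := wVal_sub_ne_zero hΩ hx
        obtain ⟨h, hh⟩ : ∃ h, h = 1 / 2 * (wVal k x - 4 * δ)⁻¹ * (ε ^ 2 + l ^ 2 * gVal k x ^ 2) :=
          ⟨_, rfl⟩
        rw [← hh]
        have h1 : ε ^ 2 = 2 * h * (wVal k x - 4 * δ) - l ^ 2 * gVal k x ^ 2 := by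
          rw [hh]; field_simp; ring
        rw [h1]
        linear_combination (1 / 2 * l ^ 4) * gVal_sq (k := k) hx }

/-! #### The operators of the statement -/

theorem kinO_eq : kinO ħ k Ω = (1 / 2 : ℂ) • (onePlusO k Ω ^ 2 * (uO Ω ^ 2 * dO ħ Ω ^ 2)) := by
  rw [onePlusO_sq_mul, pow_two (dO ħ Ω), gO_sq_mul_dO_sq, kinO]

theorem centO_mul (β : ℝ) (P : Op Ω) : centO k Ω β * P =
    (1 / 2 * ((β : ℂ) ^ 2)⁻¹) • (onePlusO k Ω ^ 2 * (uO Ω ^ 2 * P)) := by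
  rw [onePlusO_sq_mul, gO_mul_gO, centO, smul_mul_assoc]

/-- An operator, as an element of the ring of operators. -/
def opOf (P : ScalarOp Ω) : Op Ω := P

theorem opOf_mul (P Q : ScalarOp Ω) : opOf (P * Q) = opOf P * opOf Q := rfl
theorem opOf_add (P Q : ScalarOp Ω) : opOf (P + Q) = opOf P + opOf Q := rfl
theorem opOf_sub (P Q : ScalarOp Ω) : opOf (P - Q) = opOf P - opOf Q := rfl
theorem opOf_smul (c : ℂ) (P : ScalarOp Ω) : opOf (c • P) = c • opOf P := rfl
theorem opOf_pow_two (P : ScalarOp Ω) : opOf (P ^ 2) = opOf P ^ 2 := by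
  rw [pow_two P, pow_two, opOf_mul]
theorem opOf_onePlus : opOf (onePlus k Ω) = onePlusO k Ω := rfl
theorem opOf_oneMinus : opOf (oneMinus k Ω) = oneMinusO k Ω := rfl
theorem opOf_rInv : opOf (rInvOp Ω) = uO Ω := rfl
theorem opOf_J3Shift : opOf (J3Shift ħ Ω) = dO ħ Ω := rfl
theorem opOf_LSq : opOf (LSq ħ Ω) = LSqO ħ Ω := rfl
theorem opOf_vInv {δ : ℝ} (hΩ : Admissible k δ Ω) : opOf (vInvOp k δ Ω hΩ) = vO hΩ := rfl

theorem hamiltonian_eq (ħ k μ β : ℝ) (Ω : Region N) :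
    opOf (hamiltonian ħ k μ β Ω) = (coulombModel ħ k Ω μ β).ham ħ := by
  simp only [hamiltonian, opOf_mul, opOf_add, opOf_sub, opOf_smul, opOf_pow_two, opOf_onePlus,
    opOf_oneMinus, opOf_rInv, opOf_J3Shift, opOf_LSq]
  rw [RadialModel.ham, coulombModel, centO_mul, kinO_eq, mul_add, mul_smul_comm, wO]
  module

theorem hatHamiltonian_eq (ħ k μ' δ β : ℝ) (hΩ : Admissible k δ Ω) :
    opOf (hatHamiltonian ħ k μ' δ β Ω hΩ) = (hatModel ħ k μ' δ β hΩ).ham ħ := by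
  simp only [hatHamiltonian, opOf_mul, opOf_add, opOf_smul, opOf_pow_two, opOf_onePlus,
    opOf_vInv, opOf_rInv, opOf_J3Shift, opOf_LSq]
  rw [RadialModel.ham, hatModel, mul_assoc, mul_assoc, centO_mul, kinO_eq]
  simp only [mul_add, mul_smul_comm, mul_one]
  module

theorem hatHamiltonianAt_eq (ħ k μ' δ β : ℝ) (hΩ : Admissible k δ Ω) (Λ : MOp Ω ι) :
    hatHamiltonianAt ħ k μ' δ β Ω hΩ Λ = (hatModel ħ k μ' δ β hΩ).coup Λ := by
  have h' : (1 / 2 : ℂ) • (sc ι (vO hΩ * onePlusO k Ω ^ 2) * (sc ι (uO Ω ^ 2 * dO ħ Ω ^ 2) +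
      ((β : ℂ) ^ 2)⁻¹ • (sc ι (uO Ω ^ 2) * Λ ^ 2))) + ((μ' : ℂ) / 2) • sc ι (vO hΩ) =
      (hatModel ħ k μ' δ β hΩ).coup Λ := by
    have h := centO_mul (k := k) (Ω := Ω) β 1
    rw [mul_one, mul_one] at h
    rw [RadialModel.coup, hatModel, h, kinO_eq, pow_two Λ]
    simp only [map_mul, map_add, map_smul, mul_add, mul_smul_comm, smul_mul_assoc, mul_one,
      mul_assoc]
    module
  exact h'

theorem coulombModel_coup (μ β : ℝ) (Λ : MOp Ω ι) :
    (coulombModel ħ k Ω μ β).coup Λ = (μ : ℂ) • 1 := by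
  rw [RadialModel.coup, coulombModel, map_zero, zero_mul, add_zero, map_smul, map_one]

theorem ladA_eq (ħ k μ β : ℝ) :
    ladA (ι := ι) ħ k μ β Ω = (coulombModel ħ k Ω μ β).low ħ k β := by
  funext Λ
  exact congrArg (lowerForm ħ k β Ω Λ) (coulombModel_coup (ħ := ħ) (k := k) μ β Λ).symm

theorem ladADag_eq (ħ k μ β : ℝ) :
    ladADag (ι := ι) ħ k μ β Ω = (coulombModel ħ k Ω μ β).raise ħ k β := by
  funext Λ
  exact congrArg (raiseForm ħ k β Ω Λ) (coulombModel_coup (ħ := ħ) (k := k) μ β _).symm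

theorem hatLadA_eq (ħ k μ' δ β : ℝ) (hΩ : Admissible k δ Ω) :
    hatLadA (ι := ι) ħ k μ' δ β Ω hΩ = (hatModel ħ k μ' δ β hΩ).low ħ k β := by
  funext Λ
  exact congrArg (lowerForm ħ k β Ω Λ) (hatHamiltonianAt_eq ħ k μ' δ β hΩ Λ)

theorem hatLadADag_eq (ħ k μ' δ β : ℝ) (hΩ : Admissible k δ Ω) :
    hatLadADag (ι := ι) ħ k μ' δ β Ω hΩ = (hatModel ħ k μ' δ β hΩ).raise ħ k β := by
  funext Λ
  exact congrArg (raiseForm ħ k β Ω Λ) (hatHamiltonianAt_eq ħ k μ' δ β hΩ _)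

/-- The operator `(L_j^+)^m (A_β)^n` of a radial problem. -/
def RadialModel.raising (D : RadialModel Ω) (ħ k : ℝ) (γ : GammaMatrices N ι) (m n : ℕ)
    (j : Fin N) : MOp Ω ι :=
  ladPlusO ħ γ Ω j ^ m * shiftPow (D.low ħ k ((m : ℝ) / n))
    ((ħ : ℂ) * (((m : ℝ) / n : ℝ) : ℂ)) (angLO ħ γ Ω) n

/-- The operator `(A_β†)^n (L_j^-)^m` of a radial problem. -/
def RadialModel.lowering (D : RadialModel Ω) (ħ k : ℝ) (γ : GammaMatrices N ι) (m n : ℕ)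
    (j : Fin N) : MOp Ω ι :=
  shiftPowRev (D.raise ħ k ((m : ℝ) / n))
    ((ħ : ℂ) * (((m : ℝ) / n : ℝ) : ℂ)) (angLO ħ γ Ω) n * ladMinusO ħ γ Ω j ^ m

theorem raisingIntegral_eq (ħ k μ : ℝ) (γ : GammaMatrices N ι) (m n : ℕ) (j : Fin N) :
    raisingIntegral ħ k μ γ Ω m n j =
      (coulombModel ħ k Ω μ ((m : ℝ) / n)).raising ħ k γ m n j := by
  rw [raisingIntegral, ladA_eq, angL_eq]; rfl

theorem loweringIntegral_eq (ħ k μ : ℝ) (γ : GammaMatrices N ι) (m n : ℕ) (j : Fin N) :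
    loweringIntegral ħ k μ γ Ω m n j =
      (coulombModel ħ k Ω μ ((m : ℝ) / n)).lowering ħ k γ m n j := by
  rw [loweringIntegral, ladADag_eq, angL_eq, ladMinus_eq]; rfl

theorem hatRaisingIntegral_eq (ħ k μ' δ : ℝ) (γ : GammaMatrices N ι) (hΩ : Admissible k δ Ω)
    (m n : ℕ) (j : Fin N) : hatRaisingIntegral ħ k μ' δ γ Ω hΩ m n j =
      (hatModel ħ k μ' δ ((m : ℝ) / n) hΩ).raising ħ k γ m n j := by
  rw [hatRaisingIntegral, hatLadA_eq, angL_eq]; rfl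

theorem hatLoweringIntegral_eq (ħ k μ' δ : ℝ) (γ : GammaMatrices N ι) (hΩ : Admissible k δ Ω)
    (m n : ℕ) (j : Fin N) : hatLoweringIntegral ħ k μ' δ γ Ω hΩ m n j =
      (hatModel ħ k μ' δ ((m : ℝ) / n) hΩ).lowering ħ k γ m n j := by
  rw [hatLoweringIntegral, hatLadADag_eq, angL_eq, ladMinus_eq]; rfl

end instances

/-! ### A criterion for algebraic independence -/

section criterion
variable {Ω : Region N} {ι : Type*} [Fintype ι] [DecidableEq ι]

/-- `X` has order at most `d`, and `w` is an eigenvector of its principal symbol at `(x, ξ)` with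
eigenvalue `c`. -/
def SEig (ħ : ℝ) (x : Space N) (ξ : Fin N → ℂ) (w : ι → ℂ) (d : ℕ) (X : MOp Ω ι) (c : ℂ) : Prop :=
  ∃ S, SSym ħ x ξ d X S ∧ S.mulVec w = c • w

variable {ħ : ℝ} {x : Space N} {ξ : Fin N → ℂ} {w : ι → ℂ}

theorem SEig.mul {d e : ℕ} {X Y : MOp Ω ι} {a b : ℂ} (hX : SEig ħ x ξ w d X a)
    (hY : SEig ħ x ξ w e Y b) : SEig ħ x ξ w (d + e) (X * Y) (a * b) := by
  obtain ⟨S, hS, hSw⟩ := hX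
  obtain ⟨T, hT, hTw⟩ := hY
  refine ⟨S * T, hS.mul hT, ?_⟩
  rw [← Matrix.mulVec_mulVec, hTw, Matrix.mulVec_smul, hSw, smul_smul, mul_comm]

theorem SEig.add {d : ℕ} {X Y : MOp Ω ι} {a b : ℂ} (hX : SEig ħ x ξ w d X a)
    (hY : SEig ħ x ξ w d Y b) : SEig ħ x ξ w d (X + Y) (a + b) := by
  obtain ⟨S, hS, hSw⟩ := hX
  obtain ⟨T, hT, hTw⟩ := hY
  exact ⟨S + T, hS.add hT, by rw [Matrix.add_mulVec, hTw, hSw, add_smul]⟩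

theorem SEig.smul {d : ℕ} {X : MOp Ω ι} {a : ℂ} (c : ℂ) (hX : SEig ħ x ξ w d X a) :
    SEig ħ x ξ w d (c • X) (c * a) := by
  obtain ⟨S, hS, hSw⟩ := hX
  exact ⟨c • S, hS.smul c, by rw [Matrix.smul_mulVec, hSw, smul_smul]⟩

theorem SEig.neg {d : ℕ} {X : MOp Ω ι} {a : ℂ} (hX : SEig ħ x ξ w d X a) :
    SEig ħ x ξ w d (-X) (-a) := by simpa using hX.smul (-1)

theorem SEig.sub {d : ℕ} {X Y : MOp Ω ι} {a b : ℂ} (hX : SEig ħ x ξ w d X a)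
    (hY : SEig ħ x ξ w d Y b) : SEig ħ x ξ w d (X - Y) (a - b) := by
  rw [sub_eq_add_neg, sub_eq_add_neg]; exact hX.add hY.neg

theorem sEig_zero (d : ℕ) : SEig ħ x ξ w d (0 : MOp Ω ι) 0 :=
  ⟨0, sSym_zero d, by rw [Matrix.zero_mulVec, zero_smul]⟩

theorem sEig_one : SEig ħ x ξ w 0 (1 : MOp Ω ι) 1 :=
  ⟨1, sSym_one, by rw [Matrix.one_mulVec, one_smul]⟩

theorem sEig_sc {d : ℕ} {P : Op Ω} {s : ℂ} (h : HasSym ħ x ξ d P s)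
    (w : ι → ℂ) :
    SEig ħ x ξ w d (sc ι P) s :=
  ⟨_, h.sc, by rw [Matrix.smul_mulVec, Matrix.one_mulVec]⟩

theorem SEig.pow {d : ℕ} {X : MOp Ω ι} {a : ℂ} (hX : SEig ħ x ξ w d X a) (n : ℕ) :
    SEig ħ x ξ w (d * n) (X ^ n) (a ^ n) := by
  induction n with
  | zero => simpa only [pow_zero, Nat.mul_zero] using sEig_one
  | succ n ih => rw [pow_succ, pow_succ]; exact ih.mul hX

theorem SEig.sum {α : Type*} (U : Finset α) {d : ℕ} {X : α → MOp Ω ι} {a : α → ℂ}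
    (h : ∀ i ∈ U, SEig ħ x ξ w d (X i) (a i)) :
    SEig ħ x ξ w d (∑ i ∈ U, X i) (∑ i ∈ U, a i) := by
  classical
  induction U using Finset.induction_on with
  | empty => simpa using sEig_zero d
  | insert i U hi ih =>
    rw [Finset.sum_insert hi, Finset.sum_insert hi]
    exact (h i (Finset.mem_insert_self i U)).add (ih fun j hj => h j (Finset.mem_insert_of_mem hj))

theorem SEig.of_lt {d e : ℕ} {X : MOp Ω ι} {a : ℂ} (hX : SEig ħ x ξ w d X a) (hde : d < e) :
    SEig ħ x ξ w e X 0 := by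
  obtain ⟨S, hS, -⟩ := hX
  exact ⟨0, sSym_zero_of_ordLE (fun a b => (hS a b).ord) hde, by
    rw [Matrix.zero_mulVec, zero_smul]⟩

theorem SEig.unique (hx : x ∈ Ω.carrier) (hw : w ≠ 0) {d : ℕ} {X : MOp Ω ι} {a b : ℂ}
    (ha : SEig ħ x ξ w d X a) (hb : SEig ħ x ξ w d X b) : a = b := by
  obtain ⟨S, hS, hSw⟩ := ha
  obtain ⟨T, hT, hTw⟩ := hb
  rw [hS.unique hx hT, hTw] at hSw
  exact (smul_left_injective ℂ hw hSw).symm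

variable {σ : Type*} {F : σ → MOp Ω ι} {d : σ → ℕ} {c : σ → ℂ}

theorem sEig_list_prod (h : ∀ i, SEig ħ x ξ w (d i) (F i) (c i)) (l : List σ) :
    SEig ħ x ξ w (l.map d).sum (l.map F).prod (l.map c).prod := by
  induction l with
  | nil => exact sEig_one
  | cons i l ih =>
    simp only [List.map_cons, List.prod_cons, List.sum_cons]
    exact (h i).mul ih

theorem sEig_list_sum {n : ℕ} {a : ℂ} (l : List (MOp Ω ι)) (h : ∀ X ∈ l, SEig ħ x ξ w n X a) :
    SEig ħ x ξ w n l.sum (l.length * a) := by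
  induction l with
  | nil => simpa using sEig_zero n
  | cons X l ih =>
    rw [List.sum_cons, List.length_cons, Nat.cast_add, Nat.cast_one, add_mul, one_mul, add_comm _ a]
    exact (h X List.mem_cons_self).add (ih fun Y hY => h Y (List.mem_cons_of_mem _ hY))

/-- On a common eigenvector of the symbols every ordering of the factors has the same eigenvalue, so
the mean over orderings has it too. -/
theorem sEig_symProd (h : ∀ i, SEig ħ x ξ w (d i) (F i) (c i)) (l : List σ) :
    SEig ħ x ξ w (l.map d).sum (symProd (l.map F)) (l.map c).prod := by
  have h1 : SEig ħ x ξ w (l.map d).sum (((l.map F).permutations.map List.prod).sum)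
      (((l.map F).permutations.map List.prod).length * (l.map c).prod) := by
    refine sEig_list_sum _ fun X hX => ?_
    rw [List.mem_map] at hX
    obtain ⟨l', hl', rfl⟩ := hX
    rw [← List.map_permutations, List.mem_map] at hl'
    obtain ⟨l'', hl'', rfl⟩ := hl'
    have hp := List.mem_permutations.mp hl''
    rw [← (hp.map d).sum_eq, ← (hp.map c).prod_eq]
    exact sEig_list_prod h l''
  have h2 := h1.smul (((l.map F).length.factorial : ℂ)⁻¹)
  have h3 : ((l.map F).length.factorial : ℂ) ≠ 0 := by exact_mod_cast Nat.factorial_ne_zero _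
  rw [List.length_map (f := List.prod), List.length_permutations, ← mul_assoc,
    inv_mul_cancel₀ h3, one_mul] at h2
  exact h2

theorem multiset_sum_toMultiset (d : σ → ℕ) (s : σ →₀ ℕ) :
    ((Finsupp.toMultiset s).map d).sum = Finsupp.weight d s := by
  induction s using Finsupp.induction_linear with
  | zero => simp
  | add f g hf hg => rw [map_add, Multiset.map_add, Multiset.sum_add, hf, hg, map_add]
  | single a n => simp [Finsupp.weight_apply, Multiset.map_nsmul, Multiset.sum_nsmul]

theorem multiset_prod_toMultiset (c : σ → ℂ) (s : σ →₀ ℕ) :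
    ((Finsupp.toMultiset s).map c).prod = s.prod fun i k => c i ^ k := by
  induction s using Finsupp.induction_linear with
  | zero => simp
  | add f g hf hg =>
    classical
    rw [map_add, Multiset.map_add, Multiset.prod_add, hf, hg,
      Finsupp.prod_add_index' (fun _ => pow_zero _) fun _ _ _ => pow_add _ _ _]
  | single a n => simp [Multiset.map_nsmul, Multiset.prod_nsmul]

theorem sEig_symMonomial (h : ∀ i, SEig ħ x ξ w (d i) (F i) (c i)) (s : σ →₀ ℕ) :
    SEig ħ x ξ w (Finsupp.weight d s) (symMonomial F s) (s.prod fun i k => c i ^ k) := by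
  have h1 := sEig_symProd h (Finsupp.toMultiset s).toList
  have e1 : ((Finsupp.toMultiset s).toList.map d).sum = Finsupp.weight d s := by
    rw [← multiset_sum_toMultiset, ← Multiset.sum_coe, ← Multiset.map_coe, Multiset.coe_toList]
  have e2 : ((Finsupp.toMultiset s).toList.map c).prod = s.prod fun i k => c i ^ k := by
    rw [← multiset_prod_toMultiset, ← Multiset.prod_coe, ← Multiset.map_coe, Multiset.coe_toList]
  rw [e1, e2] at h1
  exact h1

/-- Let q be the component of p of highest weight, each variable being weighted by the order of its
operator. The monomials outside q have lower order and vanishing symbol at the top order, so the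
vanishing of the symmetrized polynomial forces q = 0 at the eigenvalues. The hypothesis is therefore
applied to q rather than to p. -/
theorem algIndep_of_sEig (d : σ → ℕ) (h : ∀ p : MvPolynomial σ ℂ, p ≠ 0 →
    ∃ x ∈ Ω.carrier, ∃ ξ, ∃ w : ι → ℂ, w ≠ 0 ∧ ∃ c : σ → ℂ,
      (∀ i, SEig ħ x ξ w (d i) (F i) (c i)) ∧ MvPolynomial.eval c p ≠ 0) : AlgIndep F := by
  intro p hp
  by_contra hne
  obtain ⟨s, hs, hmax⟩ := Finset.exists_max_image p.support (Finsupp.weight d)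
    (MvPolynomial.support_nonempty.mpr hne)
  set D := Finsupp.weight d s
  have hq : MvPolynomial.weightedHomogeneousComponent d D p ≠ 0 := by
    intro h0
    have h1 := MvPolynomial.coeff_weightedHomogeneousComponent (w := d) (n := D) (φ := p) s
    rw [h0, MvPolynomial.coeff_zero, if_pos rfl] at h1
    exact MvPolynomial.mem_support_iff.mp hs h1.symm
  obtain ⟨x, hx, ξ, w, hw, c, hc, hev⟩ := h _ hq
  apply hev
  rw [MvPolynomial.weightedHomogeneousComponent_apply, map_sum, Finset.sum_filter]
  refine SEig.unique (ħ := ħ) (ξ := ξ) (X := ∑ s ∈ p.support, p.coeff s • symMonomial F s) hx hw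
    (d := D) ?_ (by rw [hp]; exact sEig_zero D)
  refine SEig.sum _ fun t ht => ?_
  have h1 := (sEig_symMonomial hc t).smul (p.coeff t)
  split_ifs with h2
  · rw [MvPolynomial.eval_monomial, ← h2]
    exact h1
  · exact h1.of_lt (lt_of_le_of_ne (hmax t ht) h2)

theorem symMonomial_map {A B : Type*} [Ring A] [Algebra ℂ A] [Ring B] [Algebra ℂ B] (φ : A →ₐ[ℂ] B)
    (F : σ → A) (s : σ →₀ ℕ) : φ (symMonomial F s) = symMonomial (fun i => φ (F i)) s := by
  have h : ((Finsupp.toMultiset s).toList.map fun i => φ (F i)) =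
      ((Finsupp.toMultiset s).toList.map F).map φ := by rw [List.map_map]; rfl
  rw [symMonomial, symMonomial, h, symProd, symProd, map_smul, map_list_sum, List.map_map,
    List.length_map, ← List.map_permutations, List.map_map]
  congr 2
  · rw [List.length_map, List.length_map]
  · rw [List.map_map, ← List.map_permutations, List.map_map]
    congr 1
    funext l
    simp only [Function.comp_apply, map_list_prod, List.map_map]

theorem AlgIndep.of_map {A B : Type*} [Ring A] [Algebra ℂ A] [Ring B] [Algebra ℂ B] (φ : A →ₐ[ℂ] B)
    {F : σ → A} (h : AlgIndep fun i => φ (F i)) : AlgIndep F := by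
  intro p hp
  refine h p ?_
  have := congrArg φ hp
  rw [map_sum, map_zero] at this
  simpa only [map_smul, symMonomial_map] using this

theorem algIndep_comp_of_sEig {τ : Type*} (e : τ ≃ σ) (d : σ → ℕ)
    (h : ∀ p : MvPolynomial σ ℂ, p ≠ 0 →
      ∃ x ∈ Ω.carrier, ∃ ξ, ∃ w : ι → ℂ, w ≠ 0 ∧ ∃ c : σ → ℂ,
        (∀ i, SEig ħ x ξ w (d i) (F i) (c i)) ∧ MvPolynomial.eval c p ≠ 0) :
    AlgIndep fun i => F (e i) := by
  refine algIndep_of_sEig (ħ := ħ) (fun i => d (e i)) fun p hp => ?_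
  obtain ⟨x, hx, ξ, w, hw, c, hc, hev⟩ := h (MvPolynomial.rename e p) fun h0 =>
    hp (MvPolynomial.rename_injective e e.injective (by rw [h0, map_zero]))
  refine ⟨x, hx, ξ, w, hw, fun i => c (e i), fun i => hc _, ?_⟩
  rwa [MvPolynomial.eval_rename] at hev

end criterion

/-! ### Symbols of the ladder operators -/

section ladderSymbols
variable {Ω : Region N} {ι : Type*} [Fintype ι] [DecidableEq ι]
variable {ħ k β : ℝ} {x : Space N} {ξ : Fin N → ℂ} {w : ι → ℂ}

/-- The value of `x · ξ`. -/
def dotVal (x : Space N) (ξ : Fin N → ℂ) : ℂ := ∑ i, ((x i : ℝ) : ℂ) * ξ i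

/-- The value of the symbol of the components of the ladder operators of `L`. -/
def vecVal (x : Space N) (ξ : Fin N → ℂ) (j : Fin N) : ℂ :=
  (‖x‖ : ℂ)⁻¹ * (((x j : ℝ) : ℂ) * dotVal x ξ - (∑ i, ((x i : ℝ) : ℂ) ^ 2) * ξ j)

/-- The value of the symbol of `x_j / r`. -/
def nVal (x : Space N) (j : Fin N) : ℂ := ((x j : ℝ) : ℂ) * (‖x‖ : ℂ)⁻¹

theorem hasSym_nO (hx : x ∈ Ω.carrier) (j : Fin N) : HasSym ħ x ξ 0 (nO Ω j) (nVal x j) :=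
  (hasSym_xO hx j).mul (hasSym_uO hx)

theorem hasSym_vecO (hħ : ħ ≠ 0) (hx : x ∈ Ω.carrier) (j : Fin N) :
    HasSym ħ x ξ 1 (vecO ħ Ω j) (vecVal x ξ j) := by
  have h1 := (hasSym_xO (ħ := ħ) (ξ := ξ) hx j).mul (hasSym_J3O hħ hx Finset.univ)
  have h2 := (hasSym_JMinusO (ħ := ħ) (ξ := ξ) hx Finset.univ).mul (hasSym_pO (Ω := Ω) hħ j)
  exact (hasSym_uO (ħ := ħ) (ξ := ξ) hx).mul (h1.sub h2)

theorem hasSym_LSqO (hħ : ħ ≠ 0) (hx : x ∈ Ω.carrier) : HasSym ħ x ξ 2 (LSqO ħ Ω)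
    (casimirSym Finset.univ (fun i => ((x i : ℝ) : ℂ)) ξ) := by
  have h := (hasSym_casimirO (ξ := ξ) hħ hx Finset.univ).add
    ((ordLE_one.smul ((ħ : ℂ) ^ 2)).hasSym_zero Nat.two_pos)
  rwa [add_zero] at h

/-- Follows from L² = C + ħ² by multiplicativity and uniqueness of symbols, without any computation
with gamma matrices. -/
theorem angSym_sq (γ : GammaMatrices N ι) (hħ : ħ ≠ 0) (hx : x ∈ Ω.carrier) :
    angSym γ (fun i => ((x i : ℝ) : ℂ)) ξ * angSym γ (fun i => ((x i : ℝ) : ℂ)) ξ =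
      casimirSym Finset.univ (fun i => ((x i : ℝ) : ℂ)) ξ • 1 := by
  have h1 := (sSym_angLO (ξ := ξ) γ hħ hx).mul (sSym_angLO (ξ := ξ) γ hħ hx)
  rw [angLO_sq] at h1
  exact h1.unique hx (hasSym_LSqO hħ hx).sc

/-- Every square root of the symbol of `L²` is an eigenvalue of the symbol of `L`. -/
theorem exists_angSym_eigenvector [Nonempty ι] (γ : GammaMatrices N ι) (hħ : ħ ≠ 0)
    (hx : x ∈ Ω.carrier) {l : ℂ} (hl : l ≠ 0)
    (hc : l ^ 2 = casimirSym Finset.univ (fun i => ((x i : ℝ) : ℂ)) ξ) :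
    ∃ w : ι → ℂ, w ≠ 0 ∧ (angSym γ (fun i => ((x i : ℝ) : ℂ)) ξ).mulVec w = l • w := by
  set A := angSym γ (fun i => ((x i : ℝ) : ℂ)) ξ with hA
  have hA2 : A * A = (l ^ 2) • 1 := by rw [hc]; exact angSym_sq γ hħ hx
  -- As A² = l², every nonzero vector in the range of A + l is an eigenvector with eigenvalue l. The
  -- case A = -l is excluded by the symbol E of Σ γ_a x_a: it anticommutes with A, hence would
  -- vanish, while E² = r² ≠ 0.
  by_cases h0 : A + l • 1 = 0
  · exfalso
    set E : Matrix ι ι ℂ := ∑ a, γ.mat a * ((x a : ℝ) : ℂ) • (1 : Matrix ι ι ℂ) with hE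
    have sE : SSym ħ x ξ 0 (xSlash γ (Ω := Ω)) E :=
      SSym.sum _ fun a _ => (sSym_gam γ a).mul (hasSym_xO (ħ := ħ) (ξ := ξ) hx a).sc
    have h1 := sE.mul (sSym_angLO (ξ := ξ) γ hħ hx)
    rw [xSlash_mul_angLO, Nat.zero_add] at h1
    have h2 : SSym ħ x ξ 1 ((ħ : ℂ) • (1 : MOp Ω ι)) 0 := by
      have := (sSym_one (ħ := ħ) (x := x) (ξ := ξ) (Ω := Ω) (ι := ι)).smul (ħ : ℂ)
      exact sSym_zero_of_ordLE (fun a b => (this a b).ord) Nat.one_pos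
    have h3 := (((sSym_angLO (ξ := ξ) γ hħ hx).add h2).mul sE).neg
    rw [add_zero, add_zero] at h3
    have h4 : E * A = -(A * E) := h1.unique hx h3
    have h5 : E * E = (∑ i, ((x i : ℝ) : ℂ) ^ 2) • 1 := by
      have := sE.mul sE
      rw [xSlash_sq] at this
      exact this.unique hx (hasSym_JMinusO hx Finset.univ).sc
    have h6 : A = -(l • 1) := eq_neg_of_add_eq_zero_left h0
    rw [h6, mul_neg, neg_mul, neg_neg, mul_smul_comm, smul_mul_assoc, mul_one, one_mul,
      neg_eq_iff_add_eq_zero, ← two_smul ℂ, smul_smul] at h4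
    have h7 : E = 0 := (smul_eq_zero.mp h4).resolve_left (mul_ne_zero two_ne_zero hl)
    rw [h7, mul_zero] at h5
    have h8 := (smul_eq_zero.mp h5.symm).resolve_right one_ne_zero
    have h9 : (‖x‖ : ℂ) ^ 2 = 0 := by
      rw [← h8, ← Complex.ofReal_pow, EuclideanSpace.norm_sq_eq]
      push_cast
      refine Finset.sum_congr rfl fun i _ => ?_
      rw [← Complex.ofReal_pow, ← Complex.ofReal_pow, Real.norm_eq_abs, sq_abs]
    exact norm_ne_zero_of_mem' hx (pow_eq_zero_iff two_ne_zero |>.mp h9)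
  · obtain ⟨v, hv⟩ : ∃ v, (A + l • 1).mulVec v ≠ 0 := by
      by_contra! h
      exact h0 (Matrix.ext_of_mulVec_single fun i => by rw [h, Matrix.zero_mulVec])
    refine ⟨_, hv, ?_⟩
    have : A * (A + l • 1) = l • (A + l • 1) := by
      rw [mul_add, hA2, mul_smul_comm, mul_one, smul_add, smul_smul, pow_two, add_comm]
    rw [Matrix.mulVec_mulVec, this, Matrix.smul_mulVec]

/-- `w` is an eigenvector of the symbol of `L`. -/
theorem sEig_angLO (γ : GammaMatrices N ι) (hħ : ħ ≠ 0) (hx : x ∈ Ω.carrier) {l : ℂ}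
    (hw : (angSym γ (fun i => ((x i : ℝ) : ℂ)) ξ).mulVec w = l • w) (z : ℂ) :
    SEig ħ x ξ w 1 (angLO ħ γ Ω + z • 1) l := by
  have h1 : SEig ħ x ξ w 1 (angLO ħ γ Ω) l := ⟨_, sSym_angLO γ hħ hx, hw⟩
  have h2 := h1.add (((sEig_one (ι := ι) (Ω := Ω)).smul z).of_lt Nat.one_pos)
  rwa [add_zero] at h2

theorem sEig_ladPlusO (γ : GammaMatrices N ι) (hħ : ħ ≠ 0) (hx : x ∈ Ω.carrier) {l : ℂ}
    (hw : (angSym γ (fun i => ((x i : ℝ) : ℂ)) ξ).mulVec w = l • w) (j : Fin N) :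
    SEig ħ x ξ w 1 (ladPlusO ħ γ Ω j) (l * nVal x j + Complex.I * vecVal x ξ j) := by
  have h1 : SEig ħ x ξ w 1 (angLO ħ γ Ω) l := ⟨_, sSym_angLO γ hħ hx, hw⟩
  exact (h1.mul (sEig_sc (hasSym_nO hx j) w)).add
    ((sEig_sc (hasSym_vecO hħ hx j) w).smul Complex.I)

theorem sEig_ladMinusO (γ : GammaMatrices N ι) (hħ : ħ ≠ 0) (hx : x ∈ Ω.carrier) {l : ℂ}
    (hw : (angSym γ (fun i => ((x i : ℝ) : ℂ)) ξ).mulVec w = l • w) (j : Fin N) :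
    SEig ħ x ξ w 1 (ladMinusO ħ γ Ω j) (l * nVal x j - Complex.I * vecVal x ξ j) := by
  have h1 : SEig ħ x ξ w 1 (angLO ħ γ Ω) l := ⟨_, sSym_angLO γ hħ hx, hw⟩
  have h2 := (hasSym_vecO (ξ := ξ) hħ hx j).add
    (((ordLE_nO j).smul (Complex.I * ħ)).hasSym_zero Nat.one_pos)
  rw [add_zero] at h2
  have h3 := ((sEig_sc (hasSym_nO hx j) w).mul h1).sub ((sEig_sc h2 w).smul Complex.I)
  rw [mul_comm (nVal x j)] at h3
  exact h3

variable {D : RadialModel Ω}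

/-- The value of the symbol of the Hamiltonian, in terms of the symbols `ε` of `e` and `lam` of
`L / β`. -/
def RadialModel.hVal (D : RadialModel Ω) (k : ℝ) (x : Space N) (ε lam : ℂ) : ℂ :=
  1 / 2 * D.v x * (ε ^ 2 + lam ^ 2 * gVal k x ^ 2)

/-- The value of the symbol of the lowering operator. -/
def RadialModel.lowVal (D : RadialModel Ω) (k : ℝ) (x : Space N) (ε lam : ℂ) : ℂ :=
  ((√2 : ℝ) : ℂ)⁻¹ * (-(lam * ε) - Complex.I * (lam * lam * wVal k x)
    + Complex.I * (D.ν * D.hVal k x ε lam))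

/-- The value of the symbol of the raising operator. -/
def RadialModel.raiseVal (D : RadialModel Ω) (k : ℝ) (x : Space N) (ε lam : ℂ) : ℂ :=
  ((√2 : ℝ) : ℂ)⁻¹ * (-(lam * ε) + Complex.I * (lam * lam * wVal k x)
    - Complex.I * (D.ν * D.hVal k x ε lam))

theorem RadialModel.lowVal_neg (ε lam : ℂ) : D.lowVal k x ε (-lam) = -D.raiseVal k x ε lam := by
  rw [lowVal, raiseVal, hVal, hVal]; ring

/-- The terms linear in ε cancel, so for given λ the product is a function of the energy alone;
`low_raise` says which. -/
theorem RadialModel.lowVal_mul_raiseVal (ε lam : ℂ) :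
    D.lowVal k x ε lam * D.raiseVal k x ε lam = 1 / 2 * (lam ^ 2 * ε ^ 2 +
      (lam ^ 2 * wVal k x - D.ν * D.hVal k x ε lam) ^ 2) := by
  have h : ((√2 : ℝ) : ℂ)⁻¹ ^ 2 = 1 / 2 := by
    rw [← Complex.ofReal_inv, ← Complex.ofReal_pow, inv_pow, Real.sq_sqrt (by norm_num)]
    norm_num
  rw [lowVal, raiseVal]
  linear_combination ((lam ^ 2 * ε ^ 2 - Complex.I ^ 2 *
    (lam ^ 2 * wVal k x - D.ν * D.hVal k x ε lam) ^ 2)) * h -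
    1 / 2 * (lam ^ 2 * wVal k x - D.ν * D.hVal k x ε lam) ^ 2 * Complex.I_sq

namespace RadialModel.IsLadder
variable {wt : Space N → ℝ} (hD : D.IsLadder ħ k β wt ι)
include hD

theorem hasSym_ham (hħ : ħ ≠ 0) (hx : x ∈ Ω.carrier) {l : ℂ}
    (hc : l ^ 2 = casimirSym Finset.univ (fun i => ((x i : ℝ) : ℂ)) ξ) :
    HasSym ħ x ξ 2 (D.ham ħ) (D.hVal k x (gVal k x * dotVal x ξ) (l / β)) := by
  have h := (hD.h0_sym x hx ξ).add (((hD.h1_sym x hx ξ).mul (hasSym_LSqO hħ hx)))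
  rw [← hc] at h
  have e : D.hVal k x (gVal k x * dotVal x ξ) (l / β) =
      1 / 2 * D.v x * (gVal k x * ∑ i, (x i : ℝ) * ξ i) ^ 2 +
        1 / 2 * D.v x * gVal k x ^ 2 / (β : ℂ) ^ 2 * l ^ 2 := by
    rw [hVal, dotVal]; ring
  rw [e]
  exact h

theorem sEig_coup (hx : x ∈ Ω.carrier) {l : ℂ} {Λ : MOp Ω ι} (hΛ : SEig ħ x ξ w 1 Λ l) :
    SEig ħ x ξ w 2 (D.coup Λ) (D.ν * D.hVal k x (gVal k x * dotVal x ξ) (l / β)) := by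
  have h1 := (hD.h1_sym x hx ξ).smul D.ν
  rw [← hD.M1_eq] at h1
  have h := (sEig_sc (hD.M0_sym x hx ξ) w).add ((sEig_sc h1 w).mul (hΛ.mul hΛ))
  have e : D.ν * D.hVal k x (gVal k x * dotVal x ξ) (l / β) =
      D.ν * (1 / 2 * D.v x * (gVal k x * ∑ i, (x i : ℝ) * ξ i) ^ 2) +
        D.ν * (1 / 2 * D.v x * gVal k x ^ 2 / (β : ℂ) ^ 2) * (l * l) := by
    rw [hVal, dotVal]; ring
  rw [e]
  exact h

theorem sEig_low (hħ : ħ ≠ 0) (hx : x ∈ Ω.carrier) {l : ℂ} {Λ : MOp Ω ι}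
    (hΛ : SEig ħ x ξ w 1 Λ l) :
    SEig ħ x ξ w 2 (D.low ħ k β Λ) (D.lowVal k x (gVal k x * dotVal x ξ) (l / β)) := by
  have h1 := hΛ.smul (β : ℂ)⁻¹
  have h2 := h1.add (((sEig_one (ι := ι) (Ω := Ω)).smul ((ħ : ℂ) / 2)).of_lt Nat.one_pos)
  rw [add_zero] at h2
  have he := sEig_sc (hasSym_eO (ξ := ξ) hħ hx k) w
  have hW := sEig_sc (hasSym_wO (ħ := ħ) (ξ := ξ) hx k) w
  have h := (((h2.mul he).neg.sub (((h1.mul h2).mul hW).smul Complex.I)).add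
    ((hD.sEig_coup hx hΛ).smul Complex.I)).smul ((√2 : ℝ) : ℂ)⁻¹
  rw [show (β : ℂ)⁻¹ * l = l / β by rw [div_eq_mul_inv, mul_comm]] at h
  exact h

theorem sEig_raise (hħ : ħ ≠ 0) (hx : x ∈ Ω.carrier) {l : ℂ} {Λ : MOp Ω ι}
    (hΛ : SEig ħ x ξ w 1 Λ l) :
    SEig ħ x ξ w 2 (D.raise ħ k β Λ) (D.raiseVal k x (gVal k x * dotVal x ξ) (l / β)) := by
  have h1 := hΛ.smul (β : ℂ)⁻¹
  have h0 : ∀ c : ℂ, ∀ {X : MOp Ω ι} {a : ℂ}, SEig ħ x ξ w 1 X a →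
      SEig ħ x ξ w 1 (X + c • 1) a := fun c X a hX => by
    have h2 := hX.add (((sEig_one (ι := ι) (Ω := Ω)).smul c).of_lt Nat.one_pos)
    rwa [add_zero] at h2
  have he := sEig_sc (hasSym_eO (ξ := ξ) hħ hx k) w
  have hW := sEig_sc (hasSym_wO (ħ := ħ) (ξ := ξ) hx k) w
  have h := ((((h0 (ħ / 2) h1).mul he).neg.add ((((h0 ħ h1).mul (h0 (ħ / 2) h1)).mul hW).smul
    Complex.I)).sub ((hD.sEig_coup hx (h0 (ħ * β) hΛ)).smul Complex.I)).smul ((√2 : ℝ) : ℂ)⁻¹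
  rw [show (β : ℂ)⁻¹ * l = l / β by rw [div_eq_mul_inv, mul_comm]] at h
  exact h

variable (γ : GammaMatrices N ι) {l : ℂ}

theorem sEig_shiftPow (hħ : ħ ≠ 0) (hx : x ∈ Ω.carrier)
    (hw : (angSym γ (fun i => ((x i : ℝ) : ℂ)) ξ).mulVec w = l • w) (n : ℕ) :
    SEig ħ x ξ w (2 * n) (shiftPow (D.low ħ k β) ((ħ : ℂ) * β) (angLO ħ γ Ω) n)
      (D.lowVal k x (gVal k x * dotVal x ξ) (l / β) ^ n) := by
  induction n with
  | zero => exact sEig_one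
  | succ n ih =>
    rw [shiftPow, pow_succ', Nat.mul_succ, Nat.add_comm]
    exact (hD.sEig_low hħ hx (sEig_angLO γ hħ hx hw _)).mul ih

theorem sEig_shiftPowRev (hħ : ħ ≠ 0) (hx : x ∈ Ω.carrier)
    (hw : (angSym γ (fun i => ((x i : ℝ) : ℂ)) ξ).mulVec w = l • w) (n : ℕ) :
    SEig ħ x ξ w (2 * n) (shiftPowRev (D.raise ħ k β) ((ħ : ℂ) * β) (angLO ħ γ Ω) n)
      (D.raiseVal k x (gVal k x * dotVal x ξ) (l / β) ^ n) := by
  induction n with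
  | zero => exact sEig_one
  | succ n ih =>
    rw [shiftPowRev, pow_succ, Nat.mul_succ]
    exact ih.mul (hD.sEig_raise hħ hx (sEig_angLO γ hħ hx hw _))

end RadialModel.IsLadder

/-- The value of the symbol of the raising integral. -/
def RadialModel.xVal (D : RadialModel Ω) (k β : ℝ) (m n : ℕ) (j : Fin N) (x : Space N)
    (ξ : Fin N → ℂ) (l : ℂ) : ℂ :=
  (l * nVal x j + Complex.I * vecVal x ξ j) ^ m *
    D.lowVal k x (gVal k x * dotVal x ξ) (l / β) ^ n

/-- The value of the symbol of the lowering integral. -/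
def RadialModel.yVal (D : RadialModel Ω) (k β : ℝ) (m n : ℕ) (j : Fin N) (x : Space N)
    (ξ : Fin N → ℂ) (l : ℂ) : ℂ :=
  (l * nVal x j - Complex.I * vecVal x ξ j) ^ m *
    D.raiseVal k x (gVal k x * dotVal x ξ) (l / β) ^ n

/-- Changing the sign of l exchanges the two ladders. Thus the symbol of Q, the odd part of that of
X in l divided by l, is a combination of the symbols of X and Y. -/
theorem RadialModel.xVal_neg (m n : ℕ) (j : Fin N) (l : ℂ) :
    D.xVal k β m n j x ξ (-l) = (-1) ^ (m + n) * D.yVal k β m n j x ξ l := by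
  rw [xVal, yVal, neg_div, lowVal_neg, neg_pow (raiseVal _ _ _ _ _),
    show -l * nVal x j + Complex.I * vecVal x ξ j =
      -(l * nVal x j - Complex.I * vecVal x ξ j) by ring, neg_pow (l * nVal x j - _), pow_add]
  ring

namespace RadialModel.IsLadder
variable {wt : Space N → ℝ} {m n : ℕ} (hD : D.IsLadder ħ k ((m : ℝ) / n) wt ι)
variable (γ : GammaMatrices N ι) {l : ℂ}
include hD

theorem sEig_raising (hħ : ħ ≠ 0) (hx : x ∈ Ω.carrier)
    (hw : (angSym γ (fun i => ((x i : ℝ) : ℂ)) ξ).mulVec w = l • w) (j : Fin N) :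
    SEig ħ x ξ w (m + 2 * n) (D.raising ħ k γ m n j) (D.xVal k ((m : ℝ) / n) m n j x ξ l) := by
  have h := (sEig_ladPlusO γ hħ hx hw j).pow m
  rw [one_mul] at h
  exact h.mul (hD.sEig_shiftPow γ hħ hx hw n)

theorem sEig_lowering (hħ : ħ ≠ 0) (hx : x ∈ Ω.carrier)
    (hw : (angSym γ (fun i => ((x i : ℝ) : ℂ)) ξ).mulVec w = l • w) (j : Fin N) :
    SEig ħ x ξ w (m + 2 * n) (D.lowering ħ k γ m n j) (D.yVal k ((m : ℝ) / n) m n j x ξ l) := by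
  have h := (sEig_ladMinusO γ hħ hx hw j).pow m
  rw [one_mul] at h
  have h2 := (hD.sEig_shiftPowRev γ hħ hx hw n).mul h
  rw [mul_comm (_ ^ n) (_ ^ m), add_comm (2 * n)] at h2
  exact h2

end RadialModel.IsLadder

end ladderSymbols

/-! ### Independence of the symbols of the Casimir operators -/

section walk

/-- Symmetric matrices of rank one. -/
theorem exists_rank_one {A B C : ℂ} (h : A * C = B ^ 2) :
    ∃ x ξ : ℂ, x ^ 2 = A ∧ x * ξ = B ∧ ξ ^ 2 = C := by
  by_cases hA : A = 0
  · obtain ⟨ξ, hξ⟩ := IsAlgClosed.exists_pow_nat_eq C Nat.two_pos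
    rw [hA, zero_mul] at h
    exact ⟨0, ξ, by rw [hA]; ring, by rw [pow_eq_zero_iff two_ne_zero |>.mp h.symm, zero_mul], hξ⟩
  · obtain ⟨x, hx⟩ := IsAlgClosed.exists_pow_nat_eq A Nat.two_pos
    have hx0 : x ≠ 0 := fun h0 => hA (by rw [← hx, h0]; ring)
    refine ⟨x, B / x, hx, by field_simp, ?_⟩
    rw [div_pow, hx, ← h]
    field_simp

/-- One step of a null walk. -/
theorem exists_null_step (π : ℂ) (hπ : π ≠ 0) {s s' : ℂ} (hs : s ≠ 0) (hs' : s' ≠ 0) (d : ℂ) :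
    ∃ π' : ℂ, π' ≠ 0 ∧ (π' - π) * (s' / π' - s / π) = d ^ 2 := by
  -- With π' = ρπ the equation becomes sρ² - (s + s' - d²)ρ + s' = 0, whose roots are nonzero
  -- because s' ≠ 0.
  obtain ⟨D, hD⟩ := IsAlgClosed.exists_eq_mul_self (discrim s (-(s + s' - d ^ 2)) s')
  obtain ⟨ρ, hρ⟩ := exists_quadratic_eq_zero hs ⟨D, hD⟩
  have hρ0 : ρ ≠ 0 := fun h => hs' (by rw [h] at hρ; linear_combination hρ)
  refine ⟨ρ * π, mul_ne_zero hρ0 hπ, ?_⟩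
  field_simp
  linear_combination -hρ

/-- The triples (π, q, s/π) are the entries of partial Gram matrices of two vectors, with the
product of the diagonal entries prescribed. Each increment has determinant zero, hence rank one, and
so comes from adding one coordinate to each vector. -/
theorem exists_null_walk (s q : ℕ → ℂ) (hs : ∀ a, s a ≠ 0) : ∃ π : ℕ → ℂ, (∀ a, π a ≠ 0) ∧
    ∀ a, (π (a + 1) - π a) * (s (a + 1) / π (a + 1) - s a / π a) = (q (a + 1) - q a) ^ 2 := by
  choose! f hf1 hf2 using fun (a : ℕ) (π : ℂ) (hπ : π ≠ 0) =>
    exists_null_step π hπ (hs a) (hs (a + 1)) (q (a + 1) - q a)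
  let π : ℕ → ℂ := fun a => Nat.rec 1 (fun a p => f a p) a
  have h0 : ∀ a, π a ≠ 0 := fun a => by
    induction a with
    | zero => exact one_ne_zero
    | succ a ih => exact hf1 a _ ih
  exact ⟨π, h0, fun a => hf2 a _ (h0 a)⟩

/-- Pairs of vectors with prescribed partial Gram determinants. -/
theorem exists_gram {M : ℕ} (hM : 1 ≤ M) {g : ℂ} (hg : g ≠ 0) (t t' : ℕ → ℂ) (h1 : t 1 = 0)
    (h2 : t' M = 0)
    (hs : ∀ a, 1 ≤ a → a ≤ M → (t' a + g ^ 2 - t a) ^ 2 + 4 * g ^ 2 * t a ≠ 0) :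
    ∃ (x ξ A B C : ℕ → ℂ), (∀ a ≤ M + 1, ∑ i ∈ Finset.range a, x i ^ 2 = A a ∧
        ∑ i ∈ Finset.range a, x i * ξ i = B a ∧ ∑ i ∈ Finset.range a, ξ i ^ 2 = C a) ∧
      A (M + 1) = 0 ∧ B (M + 1) = g ∧ C (M + 1) = 0 ∧
      ∀ a, 1 ≤ a → a ≤ M → A a * C a - B a ^ 2 = t a ∧ A a * C a - B a ^ 2 - g ^ 2 + 2 * g * B a
        = t' a := by
  -- The two prescribed determinants fix the off-diagonal entry B = q and the product AC = s = t +
  -- q². The hypothesis `hs` says s ≠ 0, up to the factor 4g².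
  set q : ℕ → ℂ := fun a => (t' a + g ^ 2 - t a) / (2 * g) with hq
  set s : ℕ → ℂ := fun a => if 1 ≤ a ∧ a ≤ M then t a + q a ^ 2 else 1 with hsdef
  have s_eq : ∀ a, 1 ≤ a → a ≤ M → s a = t a + q a ^ 2 := fun a h h' => if_pos ⟨h, h'⟩
  have s_ne : ∀ a, s a ≠ 0 := by
    intro a
    simp only [hsdef]
    split_ifs with h
    · intro h0
      apply hs a h.1 h.2
      have : (2 * g) * q a = t' a + g ^ 2 - t a := by rw [hq]; field_simp
      linear_combination 4 * g ^ 2 * h0 - (t' a + g ^ 2 - t a + 2 * g * q a) * this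
    · exact one_ne_zero
  obtain ⟨π, hπ, hstep⟩ := exists_null_walk s q s_ne
  set A : ℕ → ℂ := fun a => if 1 ≤ a ∧ a ≤ M then π a else 0 with hA
  set B : ℕ → ℂ := fun a => if 1 ≤ a ∧ a ≤ M then q a else if a = 0 then 0 else g with hB
  set C : ℕ → ℂ := fun a => if 1 ≤ a ∧ a ≤ M then s a / π a else 0 with hC
  have inA : ∀ a, 1 ≤ a → a ≤ M → A a = π a ∧ B a = q a ∧ C a = s a / π a :=
    fun a h h' => ⟨if_pos ⟨h, h'⟩, if_pos ⟨h, h'⟩, if_pos ⟨h, h'⟩⟩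
  have z0 : A 0 = 0 ∧ B 0 = 0 ∧ C 0 = 0 := by simp [hA, hB, hC]
  have zM : A (M + 1) = 0 ∧ B (M + 1) = g ∧ C (M + 1) = 0 := by simp [hA, hB, hC]
  -- The path is completed by the zero matrix at a = 0 and by the matrix with diagonal 0 and
  -- off-diagonal entry g at a = M + 1. The first and last increments are of rank one because of
  -- `h1` and `h2`.
  have step : ∀ a < M + 1, (A (a + 1) - A a) * (C (a + 1) - C a) = (B (a + 1) - B a) ^ 2 := by
    intro a ha
    rcases Nat.eq_zero_or_pos a with rfl | h0
    · obtain ⟨e1, e2, e3⟩ := inA 1 le_rfl hM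
      rw [zero_add, z0.1, z0.2.1, z0.2.2, e1, e2, e3, sub_zero, sub_zero, sub_zero,
        mul_div_cancel₀ _ (hπ 1), s_eq 1 le_rfl hM, h1, zero_add]
    obtain ⟨e1, e2, e3⟩ := inA a h0 (by omega)
    rcases Nat.lt_or_ge a M with h | h
    · obtain ⟨f1, f2, f3⟩ := inA (a + 1) (by omega) (by omega)
      rw [e1, e2, e3, f1, f2, f3, hstep]
    · obtain rfl : a = M := by omega
      rw [e1, e2, e3, zM.1, zM.2.1, zM.2.2, zero_sub, zero_sub, neg_mul_neg,
        mul_div_cancel₀ _ (hπ a), s_eq a h0 le_rfl]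
      have : (2 * g) * q a = t' a + g ^ 2 - t a := by rw [hq]; field_simp
      rw [h2] at this
      linear_combination this
  choose! x ξ hx using fun a ha => exists_rank_one (step a ha)
  refine ⟨x, ξ, A, B, C, ?_, zM.1, zM.2.1, zM.2.2, ?_⟩
  · intro a ha
    induction a with
    | zero => simp [z0]
    | succ a ih =>
      obtain ⟨i1, i2, i3⟩ := ih (by omega)
      obtain ⟨j1, j2, j3⟩ := hx a (by omega)
      simp only [Finset.sum_range_succ, i1, i2, i3, j1, j2, j3]
      exact ⟨by ring, by ring, by ring⟩
  · intro a ha ha'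
    obtain ⟨e1, e2, e3⟩ := inA a ha ha'
    have : (2 * g) * q a = t' a + g ^ 2 - t a := by rw [hq]; field_simp
    rw [e1, e2, e3, mul_div_cancel₀ _ (hπ a), s_eq a ha ha']
    exact ⟨by ring, by linear_combination this⟩

end walk

/-! ### Generic values of the Casimir symbols -/

section density

/-- The values of the symbols of the Casimir operators, with two further values. -/
def famVal (y ξ : Fin N → ℂ) (u v : ℂ) : Fin (N - 1) ⊕ Fin (N - 2) ⊕ Fin 2 → ℂ
  | .inl a => casimirSym {i | (i : ℕ) < a + 2} y ξ
  | .inr (.inl a) => casimirSym {i | N ≤ (i : ℕ) + (a + 2)} y ξ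
  | .inr (.inr e) => if e = 0 then u else v

theorem sum_first (f : ℕ → ℂ) {a : ℕ} (ha : a ≤ N) :
    ∑ i ∈ ({i | (i : ℕ) < a} : Finset (Fin N)), f i = ∑ i ∈ Finset.range a, f i := by
  rw [Finset.sum_filter, Fin.sum_univ_eq_sum_range (fun i => if i < a then f i else 0),
    ← Finset.sum_filter]
  congr 1
  ext i
  simp only [Finset.mem_filter, Finset.mem_range]
  omega

theorem sum_last (f : ℕ → ℂ) {a b : ℕ} (hab : a + b = N) :
    ∑ i ∈ ({i | N ≤ (i : ℕ) + b} : Finset (Fin N)), f i =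
      ∑ i ∈ Finset.range N, f i - ∑ i ∈ Finset.range a, f i := by
  rw [← sum_first f (show a ≤ N by omega), ← Fin.sum_univ_eq_sum_range f N, eq_sub_iff_add_eq,
    add_comm, ← Finset.sum_filter_add_sum_filter_not Finset.univ (fun i : Fin N => (i : ℕ) < a)]
  congr 1
  refine Finset.sum_congr ?_ fun _ _ => rfl
  ext i
  simp only [Finset.mem_filter, Finset.mem_univ, true_and]
  omega

/-- The total Gram matrix is taken with zero diagonal and off-diagonal entry g, g² = -t N, which
gives the total Casimir the value t N. The last coordinates form the complement of an initial
segment, so their Gram matrix is the total one minus a partial one. -/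
theorem exists_casimirSym_eq (hN : 2 ≤ N) (c : Fin (N - 1) ⊕ Fin (N - 2) ⊕ Fin 2 → ℂ)
    (t t' : ℕ → ℂ) (ht : ∀ a : Fin (N - 1), c (.inl a) = t (a + 2))
    (ht' : ∀ a : Fin (N - 2), c (.inr (.inl a)) = t' (N - (a + 2))) (h1 : t 1 = 0)
    (h2 : t' (N - 1) = 0) (hN0 : t N ≠ 0)
    (hs : ∀ a, 1 ≤ a → a ≤ N - 1 → (t' a - t N - t a) ^ 2 - 4 * t N * t a ≠ 0) :
    ∃ y ξ u v, c = famVal y ξ u v := by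
  obtain ⟨g, hg⟩ := IsAlgClosed.exists_pow_nat_eq (-t N) Nat.two_pos
  have hg0 : g ≠ 0 := fun h => hN0 (by rw [h] at hg; linear_combination hg)
  obtain ⟨x, ξ, A, B, C, hS, zA, zB, zC, hd⟩ := exists_gram (M := N - 1) (by omega) hg0 t t' h1 h2
    (fun a h h' => by
      rw [hg]
      have := hs a h h'
      intro h0
      exact this (by linear_combination h0))
  rw [show N - 1 + 1 = N by omega] at hS zA zB zC
  refine ⟨fun i => x i, fun i => ξ i, c (.inr (.inr 0)), c (.inr (.inr 1)), ?_⟩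
  funext s
  rcases s with a | a | e
  · have ha : (a : ℕ) + 2 ≤ N := by omega
    rw [ht, famVal, casimirSym, sum_first (fun i => x i ^ 2) ha, sum_first (fun i => ξ i ^ 2) ha,
      sum_first (fun i => x i * ξ i) ha, (hS _ ha).1, (hS _ ha).2.1, (hS _ ha).2.2]
    rcases Nat.lt_or_ge (a + 2) N with h | h
    · exact (hd _ (by omega) (by omega)).1.symm
    · rw [show (a : ℕ) + 2 = N by omega, zA, zB, zC]
      linear_combination hg
  · obtain ⟨b, hb⟩ : ∃ b, b + ((a : ℕ) + 2) = N := ⟨N - (a + 2), by omega⟩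
    have hb' : b ≤ N := by omega
    rw [ht', famVal, casimirSym, sum_last (fun i => x i ^ 2) hb, sum_last (fun i => ξ i ^ 2) hb,
      sum_last (fun i => x i * ξ i) hb, (hS _ le_rfl).1, (hS _ le_rfl).2.1, (hS _ le_rfl).2.2,
      (hS _ hb').1, (hS _ hb').2.1, (hS _ hb').2.2, zA, zB, zC, show N - (a + 2) = b by omega,
      ← (hd b (by omega) (by omega)).2]
    ring
  · fin_cases e <;> rfl

open MvPolynomial in
/-- No polynomial vanishes on all values of the symbols of the Casimir operators. -/
theorem exists_famVal_ne_zero (hN : 2 ≤ N)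
    {p : MvPolynomial (Fin (N - 1) ⊕ Fin (N - 2) ⊕ Fin 2) ℂ} (hp : p ≠ 0) :
    ∃ y ξ u v, eval (famVal y ξ u v) p ≠ 0 ∧ casimirSym Finset.univ y ξ ≠ 0 := by
  -- `T a` stands for the Casimir of the first a coordinates and `T' a` for that of the coordinates
  -- after them. The default value 0 is the true one at a = 1 and a = N - 1 respectively, since a
  -- single coordinate has vanishing Casimir.
  let T : ℕ → MvPolynomial (Fin (N - 1) ⊕ Fin (N - 2) ⊕ Fin 2) ℂ := fun a =>
    if h : 2 ≤ a ∧ a ≤ N then X (.inl ⟨a - 2, by omega⟩) else 0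
  let T' : ℕ → MvPolynomial (Fin (N - 1) ⊕ Fin (N - 2) ⊕ Fin 2) ℂ := fun a =>
    if h : 1 ≤ a ∧ a + 2 ≤ N then X (.inr (.inl ⟨N - a - 2, by omega⟩)) else 0
  let Λ : ℕ → MvPolynomial (Fin (N - 1) ⊕ Fin (N - 2) ⊕ Fin 2) ℂ := fun a =>
    (T' a - T N - T a) ^ 2 - 4 * T N * T a
  have hΛ : ∏ a ∈ Finset.Icc 1 (N - 1), Λ a ≠ 0 := by
    rw [Finset.prod_ne_zero_iff]
    intro a ha h0
    rw [Finset.mem_Icc] at ha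
    -- At the point where the total Casimir is 1 and all other variables are 0, the discriminant
    -- equals 1.
    have h1 := congrArg (eval fun s : Fin (N - 1) ⊕ Fin (N - 2) ⊕ Fin 2 =>
      if s = .inl ⟨N - 2, by omega⟩ then (1 : ℂ) else 0) h0
    have e1 : T N = X (.inl ⟨N - 2, by omega⟩) := dif_pos ⟨hN, le_rfl⟩
    have e2 : eval (fun s : Fin (N - 1) ⊕ Fin (N - 2) ⊕ Fin 2 =>
        if s = .inl ⟨N - 2, by omega⟩ then (1 : ℂ) else 0) (T a) = 0 := by
      simp only [T]
      split_ifs with h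
      · rw [eval_X, if_neg]
        intro h'
        have := Fin.mk.inj_iff.mp (Sum.inl.inj h')
        omega
      · exact map_zero _
    have e3 : eval (fun s : Fin (N - 1) ⊕ Fin (N - 2) ⊕ Fin 2 =>
        if s = .inl ⟨N - 2, by omega⟩ then (1 : ℂ) else 0) (T' a) = 0 := by
      simp only [T']
      split_ifs with h
      · rw [eval_X, if_neg (by simp)]
      · exact map_zero _
    simp only [Λ, map_sub, map_mul, map_pow, e1, e2, e3, eval_X, if_pos] at h1
    norm_num at h1
  have hTN : T N ≠ 0 := by
    simp only [T]
    rw [dif_pos ⟨hN, le_rfl⟩]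
    exact X_ne_zero _
  obtain ⟨c, hc⟩ : ∃ c, eval c (p * T N * ∏ a ∈ Finset.Icc 1 (N - 1), Λ a) ≠ 0 := by
    by_contra! h
    exact mul_ne_zero (mul_ne_zero hp hTN) hΛ (MvPolynomial.funext fun c => by rw [h, map_zero])
  rw [map_mul, map_mul, map_prod] at hc
  have hc1 := left_ne_zero_of_mul (left_ne_zero_of_mul hc)
  have hc2 := right_ne_zero_of_mul (left_ne_zero_of_mul hc)
  have hc3 := Finset.prod_ne_zero_iff.mp (right_ne_zero_of_mul hc)
  obtain ⟨y, ξ, u, v, rfl⟩ := exists_casimirSym_eq hN c (fun a => eval c (T a))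
    (fun a => eval c (T' a)) (fun a => by
      simp only [T]
      rw [dif_pos (by omega), eval_X]; rfl) (fun a => by
      simp only [T']
      rw [dif_pos (by omega), eval_X]
      congr 3
      ext
      change (a : ℕ) = N - (N - (a + 2)) - 2
      omega) (by simp only [T]; rw [dif_neg (by omega), map_zero])
    (by simp only [T']; rw [dif_neg (by omega), map_zero]) hc2 (fun a h h' => by
      have := hc3 a (Finset.mem_Icc.mpr ⟨h, h'⟩)
      simpa only [Λ, map_sub, map_mul, map_pow, map_ofNat] using this)
  refine ⟨y, ξ, u, v, hc1, ?_⟩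
  simp only [T] at hc2
  rw [dif_pos ⟨hN, le_rfl⟩, eval_X, famVal] at hc2
  convert hc2 using 2
  ext i
  simp only [Finset.mem_univ, Finset.mem_filter, true_and, true_iff]
  omega

open MvPolynomial in
/-- The previous statement at real points of an open set. -/
theorem exists_real_famVal_ne_zero (hN : 2 ≤ N) (Ω : Region N) (j : Fin N)
    {p : MvPolynomial (Fin (N - 1) ⊕ Fin (N - 2) ⊕ Fin 2) ℂ} (hp : p ≠ 0) :
    ∃ x ∈ Ω.carrier, ∃ y : Space N, x j ≠ 0 ∧
      casimirSym Finset.univ (fun i => ((x i : ℝ) : ℂ)) (fun i => ((y i : ℝ) : ℂ)) ≠ 0 ∧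
      ∃ u v, eval (famVal (fun i => ((x i : ℝ) : ℂ)) (fun i => ((y i : ℝ) : ℂ)) u v) p ≠ 0 := by
  obtain ⟨y, ξ, u, v, h1, h2⟩ := exists_famVal_ne_zero hN hp
  let cas : Finset (Fin N) → MvPolynomial (Fin N ⊕ Fin N) ℂ := fun S =>
    (∑ i ∈ S, X (.inl i) ^ 2) * (∑ i ∈ S, X (.inr i) ^ 2) - (∑ i ∈ S, X (.inl i) * X (.inr i)) ^ 2
  have ecas : ∀ S (e : Fin N ⊕ Fin N → ℂ), eval e (cas S) =
      casimirSym S (fun i => e (.inl i)) (fun i => e (.inr i)) := by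
    intro S e
    simp only [cas, casimirSym, map_sub, map_mul, map_pow, map_sum, eval_X]
  let fam : Fin (N - 1) ⊕ Fin (N - 2) ⊕ Fin 2 → MvPolynomial (Fin N ⊕ Fin N) ℂ
    | .inl a => cas {i | (i : ℕ) < a + 2}
    | .inr (.inl a) => cas {i | N ≤ (i : ℕ) + (a + 2)}
    | .inr (.inr e) => C (if e = 0 then u else v)
  have efam : ∀ e : Fin N ⊕ Fin N → ℂ, eval e (aeval fam p) =
      eval (famVal (fun i => e (.inl i)) (fun i => e (.inr i)) u v) p := by
    intro e
    have h : (eval e).comp (aeval (R := ℂ) fam).toRingHom =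
        eval (famVal (fun i => e (.inl i)) (fun i => e (.inr i)) u v) := by
      refine ringHom_ext (fun a => by simp) fun s => ?_
      rw [RingHom.comp_apply, eval_X]
      change eval e (aeval fam (X s)) = _
      rw [aeval_X]
      rcases s with a | a | a
      · exact ecas _ e
      · exact ecas _ e
      · exact eval_C _
    exact RingHom.congr_fun h p
  have hq : aeval fam p * (X (.inl j) * cas Finset.univ) ≠ 0 := by
    refine mul_ne_zero (fun h => h1 ?_) (mul_ne_zero (X_ne_zero _) fun h => h2 ?_)
    · have := efam (Sum.elim y ξ)
      rw [h, map_zero] at this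
      exact this.symm
    · have := ecas Finset.univ (Sum.elim y ξ)
      rw [h, map_zero] at this
      exact this.symm
  obtain ⟨x₀, hx₀⟩ := Ω.nonempty
  -- An open set contains a box with infinite sides, and a polynomial that vanishes on a product of
  -- infinite sets is zero. So complex points may be replaced by real ones with x in Ω.
  obtain ⟨U, hU, hUΩ⟩ := isOpen_pi_iff'.mp
    (Ω.isOpen.preimage (PiLp.continuous_toLp 2 (fun _ : Fin N => ℝ))) x₀.ofLp hx₀
  have hinf : ∀ i, (Set.image Complex.ofReal (U i)).Infinite := fun i =>
    (infinite_of_mem_nhds (x₀.ofLp i) ((hU i).1.mem_nhds (hU i).2)).image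
      Complex.ofReal_injective.injOn
  have hinf' : (Set.range Complex.ofReal).Infinite :=
    Set.infinite_range_of_injective Complex.ofReal_injective
  obtain ⟨e, he, hne⟩ : ∃ e ∈ Set.pi Set.univ
      (Sum.elim (fun i => Set.image Complex.ofReal (U i)) fun _ => Set.range Complex.ofReal),
      eval e (aeval fam p * (X (.inl j) * cas Finset.univ)) ≠ 0 := by
    by_contra! h
    refine hq (MvPolynomial.funext_set _ ?_ fun e he => by rw [h e he, map_zero])
    rintro (i | i)
    · exact hinf i
    · exact hinf'
  have hx : ∀ i, ∃ a ∈ U i, (a : ℂ) = e (.inl i) := fun i => he (.inl i) (Set.mem_univ _)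
  have hy : ∀ i, ∃ a : ℝ, (a : ℂ) = e (.inr i) := fun i => he (.inr i) (Set.mem_univ _)
  choose x hxU hxe using hx
  choose y hye using hy
  refine ⟨WithLp.toLp 2 x, hUΩ fun i _ => hxU i, WithLp.toLp 2 y, ?_, ?_, u, v, ?_⟩
  · rw [map_mul, map_mul, eval_X, ← hxe] at hne
    exact fun h0 => right_ne_zero_of_mul hne (by
      change x j = 0 at h0
      rw [h0, Complex.ofReal_zero, zero_mul])
  · rw [map_mul, map_mul, ecas] at hne
    have := right_ne_zero_of_mul (right_ne_zero_of_mul hne)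
    simpa only [← hxe, ← hye] using this
  · rw [map_mul, efam] at hne
    have := left_ne_zero_of_mul hne
    simpa only [← hxe, ← hye] using this

end density

/-! ### Rotations in the plane of motion -/

section rotation

/-- A Gram determinant is multiplied by the square of the determinant of a substitution.
Substitutions of determinant one in the plane of x and ξ therefore preserve the Casimir symbols of
all sets of coordinates at once. -/
theorem casimirSym_linear (S : Finset (Fin N)) (y ξ : Fin N → ℂ) (a b c d : ℂ) :
    casimirSym S (fun i => a * y i + b * ξ i) (fun i => c * y i + d * ξ i) =
      (a * d - b * c) ^ 2 * casimirSym S y ξ := by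
  have h : ∀ a b c d : ℂ, ∑ i ∈ S, (a * y i + b * ξ i) * (c * y i + d * ξ i) =
      a * c * ∑ i ∈ S, y i ^ 2 + (a * d + b * c) * ∑ i ∈ S, y i * ξ i +
        b * d * ∑ i ∈ S, ξ i ^ 2 := by
    intro a b c d
    rw [Finset.mul_sum, Finset.mul_sum, Finset.mul_sum, ← Finset.sum_add_distrib,
      ← Finset.sum_add_distrib]
    exact Finset.sum_congr rfl fun i _ => by ring
  simp only [casimirSym, pow_two (_ + _), h]
  ring

theorem sum_sq_eq_norm (x : Space N) : ∑ i, ((x i : ℝ) : ℂ) ^ 2 = (‖x‖ : ℂ) ^ 2 := by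
  rw [← Complex.ofReal_pow, EuclideanSpace.norm_sq_eq]
  push_cast
  refine Finset.sum_congr rfl fun i _ => ?_
  rw [← Complex.ofReal_pow, ← Complex.ofReal_pow, Real.norm_eq_abs, sq_abs]

/-- Rotating a point of phase space in the plane of motion. -/
theorem exists_rotation {x y : Space N} (hx : x ≠ 0) {j : Fin N} (hj : x j ≠ 0)
    (hc : casimirSym Finset.univ (fun i => ((x i : ℝ) : ℂ)) (fun i => ((y i : ℝ) : ℂ)) ≠ 0) :
    ∃ l : ℂ, l ≠ 0 ∧
      l ^ 2 = casimirSym Finset.univ (fun i => ((x i : ℝ) : ℂ)) (fun i => ((y i : ℝ) : ℂ)) ∧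
      ∃ (z : Space N) (κ κ' : ℂ), κ * κ' ≠ 0 ∧ ∀ (θ : ℝ) (σ : ℂ), ∃ ξ : Fin N → ℂ,
        ‖Real.cos θ • x + Real.sin θ • z‖ = ‖x‖ ∧
        (∀ S, casimirSym S (fun i => (((Real.cos θ • x + Real.sin θ • z) i : ℝ) : ℂ)) ξ =
          casimirSym S (fun i => ((x i : ℝ) : ℂ)) (fun i => ((y i : ℝ) : ℂ))) ∧
        dotVal (Real.cos θ • x + Real.sin θ • z) ξ = σ * (‖x‖ : ℂ) ^ 2 ∧
        l * nVal (Real.cos θ • x + Real.sin θ • z) j +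
          Complex.I * vecVal (Real.cos θ • x + Real.sin θ • z) ξ j =
            Complex.exp (θ * Complex.I) * κ ∧
        l * nVal (Real.cos θ • x + Real.sin θ • z) j -
          Complex.I * vecVal (Real.cos θ • x + Real.sin θ • z) ξ j =
            Complex.exp (-(θ * Complex.I)) * κ' := by
  have hr : ‖x‖ ≠ 0 := norm_ne_zero_iff.mpr hx
  have hr' : (‖x‖ : ℂ) ≠ 0 := Complex.ofReal_ne_zero.mpr hr
  obtain ⟨p, hp⟩ : ∃ p : ℝ, p = ∑ i, x i * y i := ⟨_, rfl⟩
  set c : ℝ := ‖x‖ ^ 2 * ‖y‖ ^ 2 - p ^ 2 with hcdef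
  have hcc : casimirSym Finset.univ (fun i => ((x i : ℝ) : ℂ)) (fun i => ((y i : ℝ) : ℂ)) =
      (c : ℂ) := by
    rw [casimirSym, sum_sq_eq_norm, sum_sq_eq_norm, hcdef, hp]
    push_cast
    rfl
  have hc0 : 0 < c := by
    have h1 : c ≠ 0 := fun h => hc (by rw [hcc, h, Complex.ofReal_zero])
    have h2 : p ^ 2 ≤ ‖x‖ ^ 2 * ‖y‖ ^ 2 := by
      rw [EuclideanSpace.real_norm_sq_eq, EuclideanSpace.real_norm_sq_eq, hp]
      exact Finset.sum_mul_sq_le_sq_mul_sq Finset.univ (fun i => x i) (fun i => y i)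
    exact lt_of_le_of_ne (sub_nonneg.mpr h2) h1.symm
  set l : ℝ := √c with hl
  have hl0 : l ≠ 0 := (Real.sqrt_pos.mpr hc0).ne'
  have hl2 : l ^ 2 = c := Real.sq_sqrt hc0.le
  have hl' : (l : ℂ) ≠ 0 := Complex.ofReal_ne_zero.mpr hl0
  -- The vector of the plane of x and y that is orthogonal to x and has the same length.
  set z : Space N := (-(l⁻¹ * p)) • x + (l⁻¹ * ‖x‖ ^ 2) • y with hz
  have zi : ∀ i, z i = -(l⁻¹ * p) * x i + l⁻¹ * ‖x‖ ^ 2 * y i := fun i => rfl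
  have sxx : ∑ i, x i ^ 2 = ‖x‖ ^ 2 := (EuclideanSpace.real_norm_sq_eq x).symm
  have syy : ∑ i, y i ^ 2 = ‖y‖ ^ 2 := (EuclideanSpace.real_norm_sq_eq y).symm
  have sxz : ∑ i, x i * z i = 0 := by
    have : ∑ i, x i * z i = -(l⁻¹ * p) * ∑ i, x i ^ 2 + l⁻¹ * ‖x‖ ^ 2 * ∑ i, x i * y i := by
      rw [Finset.mul_sum, Finset.mul_sum, ← Finset.sum_add_distrib]
      exact Finset.sum_congr rfl fun i _ => by rw [zi]; ring
    rw [this, sxx, ← hp]; ring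
  have szz : ∑ i, z i ^ 2 = ‖x‖ ^ 2 := by
    have : ∑ i, z i ^ 2 = (l⁻¹ * p) ^ 2 * ∑ i, x i ^ 2
        + 2 * (-(l⁻¹ * p) * (l⁻¹ * ‖x‖ ^ 2)) * ∑ i, x i * y i
        + (l⁻¹ * ‖x‖ ^ 2) ^ 2 * ∑ i, y i ^ 2 := by
      rw [Finset.mul_sum, Finset.mul_sum, Finset.mul_sum, ← Finset.sum_add_distrib,
        ← Finset.sum_add_distrib]
      exact Finset.sum_congr rfl fun i _ => by rw [zi]; ring
    rw [this, sxx, syy, ← hp]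
    field_simp
    rw [hl2, hcdef]
    ring
  have txx : ∑ i, ((x i : ℝ) : ℂ) ^ 2 = (‖x‖ : ℂ) ^ 2 := sum_sq_eq_norm x
  have txz : ∑ i, ((x i : ℝ) : ℂ) * ((z i : ℝ) : ℂ) = 0 := by
    exact_mod_cast congrArg Complex.ofReal sxz
  have tzz : ∑ i, ((z i : ℝ) : ℂ) ^ 2 = (‖x‖ : ℂ) ^ 2 := by
    exact_mod_cast congrArg Complex.ofReal szz
  have hbil : ∀ a b a' b' : ℂ, ∑ i, (a * ((x i : ℝ) : ℂ) + b * ((z i : ℝ) : ℂ)) *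
      (a' * ((x i : ℝ) : ℂ) + b' * ((z i : ℝ) : ℂ)) = (a * a' + b * b') * (‖x‖ : ℂ) ^ 2 := by
    intro a b a' b'
    have : ∑ i, (a * ((x i : ℝ) : ℂ) + b * ((z i : ℝ) : ℂ)) *
      (a' * ((x i : ℝ) : ℂ) + b' * ((z i : ℝ) : ℂ)) = a * a' * ∑ i, ((x i : ℝ) : ℂ) ^ 2 +
      (a * b' + b * a') * ∑ i, ((x i : ℝ) : ℂ) * ((z i : ℝ) : ℂ) +
      b * b' * ∑ i, ((z i : ℝ) : ℂ) ^ 2 := by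
      rw [Finset.mul_sum, Finset.mul_sum, Finset.mul_sum, ← Finset.sum_add_distrib,
        ← Finset.sum_add_distrib]
      exact Finset.sum_congr rfl fun i _ => by ring
    rw [this, txx, txz, tzz]
    ring
  refine ⟨l, hl', by rw [hcc, ← hl2, Complex.ofReal_pow], z,
    l * (‖x‖ : ℂ)⁻¹ * (x j - Complex.I * z j), l * (‖x‖ : ℂ)⁻¹ * (x j + Complex.I * z j), ?_, ?_⟩
  · have h1 : (((x j : ℝ) : ℂ) - Complex.I * z j) * (((x j : ℝ) : ℂ) + Complex.I * z j) =
        ((x j ^ 2 + z j ^ 2 : ℝ) : ℂ) := by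
      push_cast
      linear_combination -((z j : ℝ) : ℂ) ^ 2 * Complex.I_sq
    have h2 : x j ^ 2 + z j ^ 2 ≠ 0 := by positivity
    have h3 : (l : ℂ) * (‖x‖ : ℂ)⁻¹ * (x j - Complex.I * z j) *
        (l * (‖x‖ : ℂ)⁻¹ * (x j + Complex.I * z j)) =
        (l * (‖x‖ : ℂ)⁻¹) ^ 2 * ((x j ^ 2 + z j ^ 2 : ℝ) : ℂ) := by
      rw [← h1]; ring
    rw [h3]
    exact mul_ne_zero (pow_ne_zero 2 (mul_ne_zero hl' (inv_ne_zero hr')))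
      (Complex.ofReal_ne_zero.mpr h2)
  intro θ σ
  set C : ℂ := (Real.cos θ : ℂ) with hC
  set S : ℂ := (Real.sin θ : ℂ) with hS
  have hCS : C ^ 2 + S ^ 2 = 1 := by
    rw [hC, hS]; exact_mod_cast Real.cos_sq_add_sin_sq θ
  set xθ : Space N := Real.cos θ • x + Real.sin θ • z with hxθ
  have xi : ∀ i, ((xθ i : ℝ) : ℂ) = C * ((x i : ℝ) : ℂ) + S * ((z i : ℝ) : ℂ) := fun i => by
    rw [hC, hS, ← Complex.ofReal_mul, ← Complex.ofReal_mul, ← Complex.ofReal_add]; rfl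
  have hnorm : ‖xθ‖ = ‖x‖ := by
    have h1 := hbil C S C S
    simp only [← xi, ← pow_two] at h1
    rw [sum_sq_eq_norm, hCS, one_mul] at h1
    have h2 : ‖xθ‖ ^ 2 = ‖x‖ ^ 2 := by exact_mod_cast h1
    exact (pow_left_inj₀ (norm_nonneg _) (norm_nonneg _) two_ne_zero).mp h2
  -- The coefficients of ξ = σ x_θ + (l/r²)(-sin θ x + cos θ z): radial momentum σ at the rotated
  -- point x_θ, with the angular momentum unchanged.
  set a : ℂ := σ * C - l / (‖x‖ : ℂ) ^ 2 * S with ha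
  set b : ℂ := σ * S + l / (‖x‖ : ℂ) ^ 2 * C with hb
  have hdot : dotVal xθ (fun i => a * ((x i : ℝ) : ℂ) + b * ((z i : ℝ) : ℂ)) =
      σ * (‖x‖ : ℂ) ^ 2 := by
    rw [dotVal]
    simp only [xi]
    rw [hbil, ha, hb]
    linear_combination (σ * (‖x‖ : ℂ) ^ 2) * hCS
  have hvec : vecVal xθ (fun i => a * ((x i : ℝ) : ℂ) + b * ((z i : ℝ) : ℂ)) j =
      -((‖x‖ : ℂ)⁻¹ * l * (C * z j - S * x j)) := by
    rw [vecVal, hdot, sum_sq_eq_norm, hnorm, xi, ha, hb]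
    field_simp
    ring
  have hn : nVal xθ j = (C * x j + S * z j) * (‖x‖ : ℂ)⁻¹ := by rw [nVal, hnorm, xi]
  have hexp : Complex.exp (θ * Complex.I) = C + S * Complex.I := by
    rw [Complex.exp_mul_I, hC, hS, Complex.ofReal_cos, Complex.ofReal_sin]
  have hexp' : Complex.exp (-(θ * Complex.I)) = C - S * Complex.I := by
    rw [← neg_mul, Complex.exp_mul_I, Complex.cos_neg, Complex.sin_neg, hC, hS, Complex.ofReal_cos,
      Complex.ofReal_sin]
    ring
  refine ⟨fun i => a * ((x i : ℝ) : ℂ) + b * ((z i : ℝ) : ℂ), hnorm, fun U => ?_, hdot, ?_, ?_⟩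
  · simp only [xi]
    have e : (fun i => ((z i : ℝ) : ℂ)) = fun i => ((-(l⁻¹ * p) : ℝ) : ℂ) * ((x i : ℝ) : ℂ) +
        ((l⁻¹ * ‖x‖ ^ 2 : ℝ) : ℂ) * ((y i : ℝ) : ℂ) := by
      funext i
      rw [zi]; push_cast; rfl
    have h1 := casimirSym_linear U (fun i => ((x i : ℝ) : ℂ)) (fun i => ((z i : ℝ) : ℂ)) C S a b
    have h2 := casimirSym_linear U (fun i => ((x i : ℝ) : ℂ)) (fun i => ((y i : ℝ) : ℂ)) 1 0
      ((-(l⁻¹ * p) : ℝ) : ℂ) ((l⁻¹ * ‖x‖ ^ 2 : ℝ) : ℂ)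
    simp only [one_mul, zero_mul, add_zero, sub_zero] at h2
    rw [h1, e, h2, ← mul_assoc]
    have h3 : (C * b - S * a) * ((l⁻¹ * ‖x‖ ^ 2 : ℝ) : ℂ) = 1 := by
      rw [ha, hb]
      push_cast
      field_simp
      linear_combination (l : ℂ) * hCS
    rw [← mul_pow, h3, one_pow, one_mul]
  · rw [hvec, hn, hexp]
    linear_combination ((‖x‖ : ℂ)⁻¹ * l * S * z j) * Complex.I_sq
  · rw [hvec, hn, hexp']
    linear_combination ((‖x‖ : ℂ)⁻¹ * l * S * z j) * Complex.I_sq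

/-- Entire functions that do not vanish identically do not vanish on any real interval. -/
theorem exists_real_ne_zero {f : ℂ → ℂ} (hf : Differentiable ℂ f) {z : ℂ} (hz : f z ≠ 0) {U : Set ℝ}
    (hU : U ∈ nhds (0 : ℝ)) : ∃ θ ∈ U, f (θ : ℂ) ≠ 0 := by
  by_contra! h
  have h1 : AnalyticOnNhd ℂ f Set.univ := fun w _ => hf.analyticAt w
  have h2 : ∃ᶠ w in nhdsWithin (0 : ℂ) {0}ᶜ, f w = 0 := by
    have ht : Filter.Tendsto (fun t : ℝ => (t : ℂ)) (nhdsWithin 0 {0}ᶜ) (nhdsWithin 0 {0}ᶜ) := by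
      refine tendsto_nhdsWithin_of_tendsto_nhds_of_eventually_within _ ?_ ?_
      · exact (Complex.continuous_ofReal.tendsto' 0 0 Complex.ofReal_zero).mono_left nhdsWithin_le_nhds
      · filter_upwards [self_mem_nhdsWithin] with t ht
        exact fun h0 => ht (Complex.ofReal_eq_zero.mp h0)
    refine ht.frequently (Filter.Eventually.frequently ?_)
    filter_upwards [nhdsWithin_le_nhds hU] with t ht
    exact h t ht
  have h3 := h1.eq_of_frequently_eq (g := 0) (fun w _ => analyticAt_const) h2
  exact hz (congrFun h3 z)

end rotation

/-! ### Joint values of the symbols of the Casimirs, the Hamiltonian and the ladder integrals -/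

section density
variable {Ω : Region N} {ι : Type*} [Fintype ι] [DecidableEq ι]
variable {ħ k : ℝ} {D : RadialModel Ω} {wt : Space N → ℝ} {m n : ℕ}

theorem gVal_ne_zero (k : ℝ) {x : Space N} (hx : x ≠ 0) : gVal k x ≠ 0 := by
  have h : 0 < ‖x‖ := norm_pos_iff.mpr hx
  have h1 : 0 < ‖x‖⁻¹ + k ^ 2 * ‖x‖ := by positivity
  rw [gVal]
  exact_mod_cast h1.ne'

theorem gVal_congr (k : ℝ) {x y : Space N} (h : ‖x‖ = ‖y‖) : gVal k x = gVal k y := by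
  rw [gVal, gVal, h]

theorem wVal_congr (k : ℝ) {x y : Space N} (h : ‖x‖ = ‖y‖) : wVal k x = wVal k y := by
  rw [wVal, wVal, h]

/-- At given values of the symbols of the Casimir operators, the symbols of the Hamiltonian and of
the ladder integrals satisfy no relation but the one for the product of the ladder integrals. -/
theorem RadialModel.IsLadder.exists_point (hD : D.IsLadder ħ k ((m : ℝ) / n) wt ι) (hm : 0 < m)
    (hn : 0 < n) {x y : Space N} (hx : x ∈ Ω.carrier) {j : Fin N} (hj : x j ≠ 0)
    (hc : casimirSym Finset.univ (fun i => ((x i : ℝ) : ℂ)) (fun i => ((y i : ℝ) : ℂ)) ≠ 0) :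
    ∃ l : ℂ, l ≠ 0 ∧
      l ^ 2 = casimirSym Finset.univ (fun i => ((x i : ℝ) : ℂ)) (fun i => ((y i : ℝ) : ℂ)) ∧
      ∃ (F : Polynomial ℂ) (K : ℂ), F.natDegree ≠ 0 ∧ K ≠ 0 ∧
        ∀ f : ℂ → ℂ → ℂ, Differentiable ℂ (fun q : ℂ × ℂ => f q.1 q.2) → ∀ h₀ X₀ : ℂ,
          F.eval h₀ ≠ 0 → X₀ ≠ 0 → f X₀ (K * F.eval h₀ ^ n / X₀) ≠ 0 →
          ∃ x' ∈ Ω.carrier, ∃ ξ : Fin N → ℂ,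
            (∀ S, casimirSym S (fun i => ((x' i : ℝ) : ℂ)) ξ =
              casimirSym S (fun i => ((x i : ℝ) : ℂ)) (fun i => ((y i : ℝ) : ℂ))) ∧
            D.hVal k x' (gVal k x' * dotVal x' ξ) (l / ((m : ℝ) / n : ℝ)) = h₀ ∧
            f (D.xVal k ((m : ℝ) / n) m n j x' ξ l) (D.yVal k ((m : ℝ) / n) m n j x' ξ l) ≠ 0 := by
  have hx0 : x ≠ 0 := fun h => Ω.zero_notMem (h ▸ hx)
  have hr : (‖x‖ : ℂ) ≠ 0 := norm_ne_zero_of_mem' hx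
  obtain ⟨l, hl, hl2, z, κ, κ', hκ, hrot⟩ := exists_rotation hx0 hj hc
  have hβ : (((m : ℝ) / n : ℝ) : ℂ) ≠ 0 := by
    have h1 : (m : ℝ) ≠ 0 := by exact_mod_cast hm.ne'
    have h2 : (n : ℝ) ≠ 0 := by exact_mod_cast hn.ne'
    exact_mod_cast div_ne_zero h1 h2
  obtain ⟨lam, hlam⟩ : ∃ lam, lam = l / (((m : ℝ) / n : ℝ) : ℂ) := ⟨_, rfl⟩
  have hlam0 : lam ≠ 0 := hlam ▸ div_ne_zero hl hβ
  obtain ⟨F, hF, hFe⟩ := hD.low_raise x hx lam hlam0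
  refine ⟨l, hl, hl2, F, (κ * κ') ^ m, hF, pow_ne_zero m hκ, fun f hf h₀ X₀ hF0 hX0 hf0 => ?_⟩
  have hv := hD.v_ne x hx
  have hg := gVal_ne_zero k hx0
  -- The radial momentum that gives the energy h₀. It may be complex, which is harmless as only x
  -- has to be real.
  obtain ⟨ε, hε⟩ := IsAlgClosed.exists_pow_nat_eq (2 * h₀ / D.v x - lam ^ 2 * gVal k x ^ 2)
    Nat.two_pos
  have hh : D.hVal k x ε lam = h₀ := by
    rw [RadialModel.hVal, hε]; field_simp; ring
  have hprod : D.lowVal k x ε lam * D.raiseVal k x ε lam = F.eval h₀ := by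
    rw [RadialModel.lowVal_mul_raiseVal, ← hh, RadialModel.hVal, hFe]
  have hα : D.lowVal k x ε lam ≠ 0 := fun h => hF0 (by rw [← hprod, h, zero_mul])
  have hα' : D.raiseVal k x ε lam ≠ 0 := fun h => hF0 (by rw [← hprod, h, mul_zero])
  obtain ⟨a, ha⟩ : ∃ a, a = κ ^ m * D.lowVal k x ε lam ^ n := ⟨_, rfl⟩
  obtain ⟨b, hb⟩ : ∃ b, b = κ' ^ m * D.raiseVal k x ε lam ^ n := ⟨_, rfl⟩
  have ha0 : a ≠ 0 := ha ▸ mul_ne_zero (pow_ne_zero _ (left_ne_zero_of_mul hκ)) (pow_ne_zero _ hα)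
  have hab : a * b = (κ * κ') ^ m * F.eval h₀ ^ n := by
    rw [ha, hb, ← hprod, mul_pow, mul_pow]; ring
  -- The values of f along the rotation by θ, extended to complex θ.
  let φ : ℂ → ℂ := fun θ => f (Complex.exp (m * (θ * Complex.I)) * a)
    (Complex.exp (-(m * (θ * Complex.I))) * b)
  have hφ : Differentiable ℂ φ := by
    have : Differentiable ℂ fun θ : ℂ => (Complex.exp (m * (θ * Complex.I)) * a,
        Complex.exp (-(m * (θ * Complex.I))) * b) := by fun_prop
    exact hf.comp this
  have hmC : (m : ℂ) ≠ 0 := by exact_mod_cast hm.ne'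
  -- At this complex angle the two arguments of f are X₀ and ab/X₀. As φ is entire, it is also
  -- nonzero at real angles so small that the rotated point stays in Ω.
  have hz : φ (Complex.log (X₀ / a) / (m * Complex.I)) ≠ 0 := by
    have e : (m : ℂ) * (Complex.log (X₀ / a) / (m * Complex.I) * Complex.I) =
        Complex.log (X₀ / a) := by
      have := Complex.I_ne_zero
      field_simp
    have e1 : X₀ / a * a = X₀ := div_mul_cancel₀ _ ha0
    have e2 : (X₀ / a)⁻¹ * b = (κ * κ') ^ m * F.eval h₀ ^ n / X₀ := by
      rw [← hab]; field_simp
    simp only [φ, e, Complex.exp_neg, Complex.exp_log (div_ne_zero hX0 ha0), e1, e2]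
    exact hf0
  have hU : {θ : ℝ | Real.cos θ • x + Real.sin θ • z ∈ Ω.carrier} ∈ nhds (0 : ℝ) := by
    have hcont : Continuous fun θ : ℝ => Real.cos θ • x + Real.sin θ • z := by fun_prop
    refine hcont.continuousAt.preimage_mem_nhds (Ω.isOpen.mem_nhds ?_)
    simpa using hx
  obtain ⟨θ, hθ, hne⟩ := exists_real_ne_zero hφ hz hU
  obtain ⟨ξ, hnorm, hcas, hdot, hplus, hminus⟩ := hrot θ (ε / (gVal k x * (‖x‖ : ℂ) ^ 2))
  have hg' := gVal_congr k hnorm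
  have hε' : gVal k (Real.cos θ • x + Real.sin θ • z) *
      dotVal (Real.cos θ • x + Real.sin θ • z) ξ = ε := by
    rw [hdot, hg']; field_simp
  have hv' := hD.v_congr _ _ hnorm
  have hw' := wVal_congr k hnorm
  refine ⟨_, hθ, ξ, hcas, ?_, ?_⟩
  · rw [hε', ← hlam, ← hh, RadialModel.hVal, RadialModel.hVal, hv', hg']
  · have eh : D.hVal k (Real.cos θ • x + Real.sin θ • z) ε lam = D.hVal k x ε lam := by
      rw [RadialModel.hVal, RadialModel.hVal, hv', hg']
    have e1 : D.xVal k ((m : ℝ) / n) m n j (Real.cos θ • x + Real.sin θ • z) ξ l =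
        Complex.exp (m * (θ * Complex.I)) * a := by
      rw [RadialModel.xVal, hplus, hε', ← hlam, RadialModel.lowVal, eh, hw', ha,
        RadialModel.lowVal, mul_pow, ← Complex.exp_nat_mul, mul_assoc]
    have e2 : D.yVal k ((m : ℝ) / n) m n j (Real.cos θ • x + Real.sin θ • z) ξ l =
        Complex.exp (-(m * (θ * Complex.I))) * b := by
      rw [RadialModel.yVal, hminus, hε', ← hlam, RadialModel.raiseVal, eh, hw', hb,
        RadialModel.raiseVal, mul_pow, ← Complex.exp_nat_mul, mul_assoc, mul_neg]
    rw [e1, e2]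
    exact hne

theorem differentiable_eval {σ E : Type*} [NormedAddCommGroup E] [NormedSpace ℂ E]
    (p : MvPolynomial σ ℂ) {c : E → σ → ℂ} (hc : ∀ i, Differentiable ℂ fun q => c q i) :
    Differentiable ℂ fun q => MvPolynomial.eval (c q) p := by
  induction p using MvPolynomial.induction_on with
  | C a => simp
  | add p q hp hq => simp only [map_add]; exact hp.fun_add hq
  | mul_X p i hp => simp only [map_mul, MvPolynomial.eval_X]; exact hp.fun_mul (hc i)

theorem casimirFam_congr {y ξ y' ξ' : Fin N → ℂ} (h : ∀ S, casimirSym S y ξ = casimirSym S y' ξ')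
    (u v : ℂ) : famVal y ξ u v = famVal y' ξ' u v := by
  funext s
  rcases s with a | a | e
  · exact h _
  · exact h _
  · rfl

/-- Density for the Hamiltonian and a combination of the ladder integrals. -/
theorem RadialModel.IsLadder.exists_ham (hD : D.IsLadder ħ k ((m : ℝ) / n) wt ι) (hN : 2 ≤ N)
    (hm : 0 < m) (hn : 0 < n) (j : Fin N) (A B : ℂ → ℂ) (hA : ∀ l ≠ 0, A l ≠ 0)
    (hB : ∀ l ≠ 0, B l ≠ 0) {p : MvPolynomial (Fin (N - 1) ⊕ Fin (N - 2) ⊕ Fin 2) ℂ} (hp : p ≠ 0) :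
    ∃ x ∈ Ω.carrier, ∃ ξ : Fin N → ℂ, ∃ l : ℂ, l ≠ 0 ∧
      l ^ 2 = casimirSym Finset.univ (fun i => ((x i : ℝ) : ℂ)) ξ ∧
      MvPolynomial.eval (famVal (fun i => ((x i : ℝ) : ℂ)) ξ
        (D.hVal k x (gVal k x * dotVal x ξ) (l / ((m : ℝ) / n : ℝ)))
        (A l * D.xVal k ((m : ℝ) / n) m n j x ξ l + B l * D.yVal k ((m : ℝ) / n) m n j x ξ l)) p
        ≠ 0 := by
  obtain ⟨x, hx, y, hj, hc, u, v, huv⟩ := exists_real_famVal_ne_zero hN Ω j hp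
  obtain ⟨l, hl, hl2, F, K, hF, hK, h⟩ := hD.exists_point hm hn hx hj hc
  -- Nonvanishing persists near u, and F has only finitely many zeros, so u can be moved off them.
  obtain ⟨h₀, h1, h2⟩ : ∃ h₀, MvPolynomial.eval (famVal (fun i => ((x i : ℝ) : ℂ))
      (fun i => ((y i : ℝ) : ℂ)) h₀ v) p ≠ 0 ∧ F.eval h₀ ≠ 0 := by
    have hd : Differentiable ℂ fun h₀ : ℂ => MvPolynomial.eval (famVal (fun i => ((x i : ℝ) : ℂ))
        (fun i => ((y i : ℝ) : ℂ)) h₀ v) p := by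
      refine differentiable_eval p fun s => ?_
      rcases s with a | a | e
      · exact differentiable_const _
      · exact differentiable_const _
      · by_cases he : e = 0
        · simp only [famVal, if_pos he]; exact differentiable_id
        · simp only [famVal, if_neg he]; exact differentiable_const _
    have h1 : ∀ᶠ h₀ in nhds u, MvPolynomial.eval (famVal (fun i => ((x i : ℝ) : ℂ))
        (fun i => ((y i : ℝ) : ℂ)) h₀ v) p ≠ 0 := hd.continuous.continuousAt.eventually_ne huv
    have hF0 : F ≠ 0 := fun h => hF (by rw [h, Polynomial.natDegree_zero])
    have hinf := infinite_of_mem_nhds u h1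
    obtain ⟨h₀, hh, hh'⟩ := hinf.exists_notMem_finite
      (Polynomial.finite_setOfPred_isRoot hF0)
    exact ⟨h₀, hh, hh'⟩
  have hAl := hA l hl
  have hBl := hB l hl
  have hKF : K * F.eval h₀ ^ n ≠ 0 := mul_ne_zero hK (pow_ne_zero _ h2)
  -- The pair X₀, Y₀ has the prescribed product K F(h₀)^n, so A X₀ + B Y₀ = v is a quadratic
  -- equation for X₀.
  obtain ⟨s, hs⟩ := IsAlgClosed.exists_eq_mul_self
    (discrim (A l) (-v) (B l * (K * F.eval h₀ ^ n)))
  obtain ⟨X₀, hX⟩ := exists_quadratic_eq_zero hAl ⟨s, hs⟩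
  have hX0 : X₀ ≠ 0 := fun h0 => mul_ne_zero hBl hKF (by rw [h0] at hX; linear_combination hX)
  obtain ⟨x', hx', ξ, hcas, hh, hf⟩ := h (fun X Y => MvPolynomial.eval
    (famVal (fun i => ((x i : ℝ) : ℂ)) (fun i => ((y i : ℝ) : ℂ)) h₀ (A l * X + B l * Y)) p) (by
      refine differentiable_eval p fun s => ?_
      rcases s with a | a | e
      · exact differentiable_const _
      · exact differentiable_const _
      · by_cases he : e = 0
        · simp only [famVal, if_pos he]; exact differentiable_const _
        · simp only [famVal, if_neg he]; fun_prop) h₀ X₀ h2 hX0 (by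
      have e : A l * X₀ + B l * (K * F.eval h₀ ^ n / X₀) = v := by
        field_simp
        linear_combination hX
      rw [e]; exact h1)
  refine ⟨x', hx', ξ, l, hl, by rw [hl2, hcas], ?_⟩
  rw [hh, casimirFam_congr hcas]
  exact hf

/-- Density for the ladder integrals. -/
theorem RadialModel.IsLadder.exists_runge (hD : D.IsLadder ħ k ((m : ℝ) / n) wt ι) (hN : 2 ≤ N)
    (hm : 0 < m) (hn : 0 < n) (j : Fin N)
    {p : MvPolynomial (Fin (N - 1) ⊕ Fin (N - 2) ⊕ Fin 2) ℂ} (hp : p ≠ 0) :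
    ∃ x ∈ Ω.carrier, ∃ ξ : Fin N → ℂ, ∃ l : ℂ, l ≠ 0 ∧
      l ^ 2 = casimirSym Finset.univ (fun i => ((x i : ℝ) : ℂ)) ξ ∧
      MvPolynomial.eval (famVal (fun i => ((x i : ℝ) : ℂ)) ξ
        (((√2 : ℝ) : ℂ)⁻¹ * (D.xVal k ((m : ℝ) / n) m n j x ξ l
          + D.yVal k ((m : ℝ) / n) m n j x ξ l))
        ((Complex.I * ((√2 : ℝ) : ℂ))⁻¹ * (D.xVal k ((m : ℝ) / n) m n j x ξ l
          - D.yVal k ((m : ℝ) / n) m n j x ξ l))) p ≠ 0 := by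
  -- The factor u² + v² = 2 X₀ Y₀ is included in order that neither X₀ nor Y₀ vanishes.
  have hu : (MvPolynomial.X (.inr (.inr 0)) ^ 2 + MvPolynomial.X (.inr (.inr 1)) ^ 2 :
      MvPolynomial (Fin (N - 1) ⊕ Fin (N - 2) ⊕ Fin 2) ℂ) ≠ 0 := by
    intro h
    have := congrArg (MvPolynomial.eval fun s => if s = .inr (.inr 0) then (1 : ℂ) else 0) h
    simp at this
  obtain ⟨x, hx, y, hj, hc, u, v, huv⟩ := exists_real_famVal_ne_zero hN Ω j (mul_ne_zero hp hu)
  rw [map_mul] at huv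
  have h1 := left_ne_zero_of_mul huv
  have h2 := right_ne_zero_of_mul huv
  simp only [map_add, map_pow, MvPolynomial.eval_X, famVal, if_pos, if_neg one_ne_zero] at h2
  obtain ⟨l, hl, hl2, F, K, hF, hK, h⟩ := hD.exists_point hm hn hx hj hc
  have hs2 : ((√2 : ℝ) : ℂ) ^ 2 = 2 := by
    rw [← Complex.ofReal_pow, Real.sq_sqrt (by norm_num)]; norm_num
  have hs0 : ((√2 : ℝ) : ℂ) ≠ 0 := fun h => by rw [h] at hs2; norm_num at hs2
  obtain ⟨X₀, hX₀⟩ : ∃ X, X = ((√2 : ℝ) : ℂ)⁻¹ * (u + Complex.I * v) := ⟨_, rfl⟩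
  obtain ⟨Y₀, hY₀⟩ : ∃ X, X = ((√2 : ℝ) : ℂ)⁻¹ * (u - Complex.I * v) := ⟨_, rfl⟩
  have hXY : X₀ * Y₀ = ((√2 : ℝ) : ℂ)⁻¹ ^ 2 * (u ^ 2 + v ^ 2) := by
    rw [hX₀, hY₀]; linear_combination (-((√2 : ℝ) : ℂ)⁻¹ ^ 2 * v ^ 2) * Complex.I_sq
  have hXY0 : X₀ * Y₀ ≠ 0 := by
    rw [hXY]; exact mul_ne_zero (pow_ne_zero _ (inv_ne_zero hs0)) h2
  have eu : ((√2 : ℝ) : ℂ)⁻¹ * (X₀ + Y₀) = u := by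
    rw [hX₀, hY₀]; field_simp; rw [hs2]; ring
  have ev : (Complex.I * ((√2 : ℝ) : ℂ))⁻¹ * (X₀ - Y₀) = v := by
    have := Complex.I_ne_zero
    rw [hX₀, hY₀]; field_simp; rw [hs2]; ring
  -- Here X₀ and Y₀ are prescribed and the energy is adjusted: h₀ is chosen with K F(h₀)^n = X₀ Y₀,
  -- which is possible as F is not constant.
  obtain ⟨q, hq⟩ := IsAlgClosed.exists_pow_nat_eq (X₀ * Y₀ / K) hn
  obtain ⟨h₀, hh₀⟩ := IsAlgClosed.exists_root (F - Polynomial.C q) (by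
    rw [Polynomial.degree_sub_C (Polynomial.natDegree_pos_iff_degree_pos.mp
      (Nat.pos_of_ne_zero hF))]
    exact (Polynomial.natDegree_pos_iff_degree_pos.mp (Nat.pos_of_ne_zero hF)).ne')
  have hFq : F.eval h₀ = q := by
    rw [Polynomial.IsRoot, Polynomial.eval_sub, Polynomial.eval_C] at hh₀
    exact sub_eq_zero.mp hh₀
  have hq0 : q ≠ 0 := fun h0 => div_ne_zero hXY0 hK (by rw [← hq, h0, zero_pow hn.ne'])
  obtain ⟨x', hx', ξ, hcas, -, hf⟩ := h (fun X Y => MvPolynomial.eval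
    (famVal (fun i => ((x i : ℝ) : ℂ)) (fun i => ((y i : ℝ) : ℂ))
      (((√2 : ℝ) : ℂ)⁻¹ * (X + Y)) ((Complex.I * ((√2 : ℝ) : ℂ))⁻¹ * (X - Y))) p) (by
      refine differentiable_eval p fun s => ?_
      rcases s with a | a | e
      · exact differentiable_const _
      · exact differentiable_const _
      · by_cases he : e = 0
        · simp only [famVal, if_pos he]; fun_prop
        · simp only [famVal, if_neg he]; fun_prop) h₀ X₀ (hFq ▸ hq0) (left_ne_zero_of_mul hXY0) (by
      have e : K * F.eval h₀ ^ n / X₀ = Y₀ := by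
        have := left_ne_zero_of_mul hXY0
        rw [hFq, hq]; field_simp
      rw [e, eu, ev]; exact h1)
  refine ⟨x', hx', ξ, l, hl, by rw [hl2, hcas], ?_⟩
  rw [casimirFam_congr hcas]
  exact hf

end density

/-! ### The integrals of motion generated by the ladder operators -/

section generate
variable {Ω : Region N} {ι : Type*} [Fintype ι] [DecidableEq ι]
variable {ħ k : ℝ} {D : RadialModel Ω} {wt : Space N → ℝ} {m n : ℕ}
variable {x : Space N} {ξ : Fin N → ℂ}

/-- Take adjoints in P H = H P and use that formal adjoints are unique. -/
theorem Adj.commute (hw : IsWeight Ω wt) {P P' H : Op Ω} (hP : Adj wt P P') (hH : Adj wt H H)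
    (h : Commute P H) : Commute P' H := by
  have h1 := hP.mul hH
  rw [h.eq] at h1
  exact (hH.mul hP).unique hw h1

theorem SAdj.commute (hw : IsWeight Ω wt) {X Y H : MOp Ω ι} (hX : SAdj wt X Y) (hH : SAdj wt H H)
    (h : Commute X H) : Commute Y H := by
  have h1 := hX.mul hw hH
  rw [h.eq] at h1
  exact (hH.mul hw hX).unique hw h1

/-- The symbol of the part proportional to `L`, from the eigenvalues at both square roots of the
symbol of `L²`. -/
theorem hasSym_of_eigenvalues [Nonempty ι] (γ : GammaMatrices N ι) (hħ : ħ ≠ 0)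
    (hx : x ∈ Ω.carrier) {d : ℕ} {P Q : Op Ω} {X : MOp Ω ι} (hP : OrdLE (d + 1) P)
    (hQ : OrdLE d Q) {f : ℂ → ℂ}
    (he : ∀ (v : ι → ℂ) (l : ℂ), (angSym γ (fun i => ((x i : ℝ) : ℂ)) ξ).mulVec v = l • v →
      SEig ħ x ξ v (d + 1) X (f l))
    (hX : ∀ (v : ι → ℂ) (l s t : ℂ), (angSym γ (fun i => ((x i : ℝ) : ℂ)) ξ).mulVec v = l • v →
      HasSym ħ x ξ (d + 1) P s → HasSym ħ x ξ d Q t → SEig ħ x ξ v (d + 1) X (s + l * t))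
    {l : ℂ} (hl : l ≠ 0)
    (hc : l ^ 2 = casimirSym Finset.univ (fun i => ((x i : ℝ) : ℂ)) ξ) :
    HasSym ħ x ξ d Q ((2 * l)⁻¹ * (f l - f (-l))) := by
  obtain ⟨s, hs⟩ := hP.exists_hasSym ħ x ξ
  obtain ⟨t, ht⟩ := hQ.exists_hasSym ħ x ξ
  -- The eigenvectors for l and -l give the equations f(l) = s + lt and f(-l) = s - lt for the same
  -- s and t.
  obtain ⟨v, hv0, hv⟩ := exists_angSym_eigenvector γ hħ hx hl hc
  obtain ⟨u, hu0, hu⟩ := exists_angSym_eigenvector γ hħ hx (neg_ne_zero.mpr hl)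
    (by rw [neg_sq]; exact hc)
  have h1 := (he v l hv).unique hx hv0 (hX v l s t hv hs ht)
  have h2 := (he u (-l) hu).unique hx hu0 (hX u (-l) s t hu hs ht)
  have e : (2 * l)⁻¹ * (f l - f (-l)) = t := by
    rw [h1, h2]; field_simp; ring
  rw [e]
  exact ht

theorem sEig_split (γ : GammaMatrices N ι) (hħ : ħ ≠ 0) (hx : x ∈ Ω.carrier) {d : ℕ} {P Q : Op Ω}
    {v : ι → ℂ} {l s t : ℂ} (hv : (angSym γ (fun i => ((x i : ℝ) : ℂ)) ξ).mulVec v = l • v)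
    (hs : HasSym ħ x ξ (d + 1) P s) (ht : HasSym ħ x ξ d Q t) :
    SEig ħ x ξ v (d + 1) (sc ι P + angLO ħ γ Ω * sc ι Q) (s + l * t) := by
  have h : SEig ħ x ξ v 1 (angLO ħ γ Ω) l := ⟨_, sSym_angLO γ hħ hx, hv⟩
  have h1 := h.mul (sEig_sc ht v)
  rw [Nat.add_comm] at h1
  exact (sEig_sc hs v).add h1

theorem sEig_split' (γ : GammaMatrices N ι) (hħ : ħ ≠ 0) (hx : x ∈ Ω.carrier) {d : ℕ} {P Q : Op Ω}
    {v : ι → ℂ} {l s t : ℂ} (hv : (angSym γ (fun i => ((x i : ℝ) : ℂ)) ξ).mulVec v = l • v)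
    (hs : HasSym ħ x ξ (d + 1) P s) (ht : HasSym ħ x ξ d Q t) :
    SEig ħ x ξ v (d + 1) (sc ι P + sc ι Q * angLO ħ γ Ω) (s + l * t) := by
  have h : SEig ħ x ξ v 1 (angLO ħ γ Ω) l := ⟨_, sSym_angLO γ hħ hx, hv⟩
  have h1 := (sEig_sc ht v).mul h
  rw [mul_comm t l] at h1
  exact (sEig_sc hs v).add h1

theorem RadialModel.yVal_neg {β : ℝ} (m n : ℕ) (j : Fin N) (l : ℂ) :
    D.yVal k β m n j x ξ (-l) = (-1) ^ (m + n) * D.xVal k β m n j x ξ l := by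
  have h := D.xVal_neg (k := k) (β := β) (x := x) (ξ := ξ) m n j (-l)
  rw [neg_neg] at h
  rw [h, ← mul_assoc, ← mul_pow]
  norm_num

/-- The Casimir operators together with two further operators. -/
def famO (ι : Type*) [Fintype ι] [DecidableEq ι] (ħ : ℝ) (F G : MOp Ω ι) :
    Fin (N - 1) ⊕ Fin (N - 2) ⊕ Fin 2 → MOp Ω ι
  | .inl a => sc ι (casimirO ħ Ω {i | (i : ℕ) < a + 2})
  | .inr (.inl a) => sc ι (casimirO ħ Ω {i | N ≤ (i : ℕ) + (a + 2)})
  | .inr (.inr e) => if e = 0 then F else G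

theorem famO_eq (ħ : ℝ) (F G : MOp Ω ι) (s : Fin (N - 1) ⊕ Fin (N - 2) ⊕ Fin 2) :
    integralFamily ι ħ Ω F G s = famO ι ħ F G s := by
  rcases s with c | c | e <;> rfl

theorem AlgIndep.integralFamily {F G : MOp Ω ι} (h : AlgIndep (famO ι ħ F G)) :
    AlgIndep (CurvedCoulomb.integralFamily ι ħ Ω F G) := by
  have e : CurvedCoulomb.integralFamily ι ħ Ω F G = famO ι ħ F G := funext (famO_eq ħ F G)
  rw [e]
  exact h

/-- The orders of the members of the family. -/
def famDeg (dF dG : ℕ) : Fin (N - 1) ⊕ Fin (N - 2) ⊕ Fin 2 → ℕ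
  | .inl _ => 2
  | .inr (.inl _) => 2
  | .inr (.inr e) => if e = 0 then dF else dG

theorem sEig_famO (hħ : ħ ≠ 0) (hx : x ∈ Ω.carrier) {v : ι → ℂ} {F G : MOp Ω ι} {dF dG : ℕ}
    {a b : ℂ} (hF : SEig ħ x ξ v dF F a) (hG : SEig ħ x ξ v dG G b)
    (s : Fin (N - 1) ⊕ Fin (N - 2) ⊕ Fin 2) :
    SEig ħ x ξ v (famDeg dF dG s) (famO ι ħ F G s)
      (famVal (fun i => ((x i : ℝ) : ℂ)) ξ a b s) := by
  rcases s with c | c | e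
  · exact sEig_sc (hasSym_casimirO hħ hx _) v
  · exact sEig_sc (hasSym_casimirO hħ hx _) v
  · by_cases he : e = 0
    · simp only [famDeg, famO, famVal, if_pos he]; exact hF
    · simp only [famDeg, famO, famVal, if_neg he]; exact hG

namespace RadialModel.IsLadder
variable (hD : D.IsLadder ħ k ((m : ℝ) / n) wt ι) (γ : GammaMatrices N ι)
include hD

theorem sAdj_raising (j : Fin N) :
    SAdj wt (D.raising ħ k γ m n j) (D.lowering ħ k γ m n j) :=
  hD.adjoint γ m n j

theorem raising_commute (hħ : ħ ≠ 0) (hn : 0 < n) (j : Fin N) :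
    Commute (D.raising ħ k γ m n j) (sc ι (D.ham ħ)) :=
  hD.commute_ham γ hħ (by
    have : (n : ℂ) ≠ 0 := by exact_mod_cast hn.ne'
    push_cast
    field_simp) j

theorem lowering_commute [Nonempty ι] (hħ : ħ ≠ 0) (hn : 0 < n) (j : Fin N) :
    Commute (D.lowering ħ k γ m n j) (sc ι (D.ham ħ)) :=
  (hD.sAdj_raising γ j).commute hD.weight (sAdj_sc (hD.ham_adj (hD.LSq_adj γ)))
    (hD.raising_commute γ hħ hn j)

theorem sEig_comb (hħ : ħ ≠ 0) (hx : x ∈ Ω.carrier) {v : ι → ℂ} {l : ℂ}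
    (hv : (angSym γ (fun i => ((x i : ℝ) : ℂ)) ξ).mulVec v = l • v) (j : Fin N) (a b : ℂ) :
    SEig ħ x ξ v (m + 2 * n) (a • D.raising ħ k γ m n j + b • D.lowering ħ k γ m n j)
      (a * D.xVal k ((m : ℝ) / n) m n j x ξ l + b * D.yVal k ((m : ℝ) / n) m n j x ξ l) :=
  ((hD.sEig_raising γ hħ hx hv j).smul a).add ((hD.sEig_lowering γ hħ hx hv j).smul b)

/-- The orders of the combinations of the ladder integrals. -/
theorem ord_comb [Nonempty ι] (hN : 2 ≤ N) (hħ : ħ ≠ 0) (hm : 0 < m) (hn : 0 < n) (j : Fin N)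
    {a b : ℂ} (ha : a ≠ 0) (hb : b ≠ 0) :
    (∀ s t, OrdLE (m + 2 * n) ((a • D.raising ħ k γ m n j + b • D.lowering ħ k γ m n j) s t)) ∧
    ¬ ∀ s t, OrdLE (m + 2 * n - 1)
      ((a • D.raising ħ k γ m n j + b • D.lowering ħ k γ m n j) s t) := by
  -- Density for the polynomial that is just the last variable: the symbol of the combination is
  -- nonzero at some point.
  obtain ⟨x, hx, ξ, l, hl, hc, hne⟩ := hD.exists_ham hN hm hn j (fun _ => a) (fun _ => b)
    (fun _ _ => ha) (fun _ _ => hb) (p := MvPolynomial.X (.inr (.inr 1))) (MvPolynomial.X_ne_zero _)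
  rw [MvPolynomial.eval_X] at hne
  obtain ⟨v, hv0, hv⟩ := exists_angSym_eigenvector γ hħ hx hl hc
  have h := hD.sEig_comb γ hħ hx hv j a b
  refine ⟨fun s t => ?_, fun h0 => hne ?_⟩
  · obtain ⟨S, hS, -⟩ := h
    exact (hS s t).ord
  · refine h.unique hx hv0 ⟨0, sSym_zero_of_ordLE h0 (by omega), ?_⟩
    rw [Matrix.zero_mulVec, zero_smul]

theorem algIndep_ham_comb [Nonempty ι] (hN : 2 ≤ N) (hħ : ħ ≠ 0) (hm : 0 < m) (hn : 0 < n)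
    (j : Fin N) {a b : ℂ} (ha : a ≠ 0) (hb : b ≠ 0) : AlgIndep (famO ι ħ (sc ι (D.ham ħ))
      (a • D.raising ħ k γ m n j + b • D.lowering ħ k γ m n j)) := by
  refine algIndep_of_sEig (ħ := ħ) (famDeg 2 (m + 2 * n)) fun p hp => ?_
  obtain ⟨x, hx, ξ, l, hl, hc, hne⟩ := hD.exists_ham hN hm hn j (fun _ => a) (fun _ => b)
    (fun _ _ => ha) (fun _ _ => hb) hp
  obtain ⟨v, hv0, hv⟩ := exists_angSym_eigenvector γ hħ hx hl hc
  exact ⟨x, hx, ξ, v, hv0, _, sEig_famO hħ hx (sEig_sc (hD.hasSym_ham hħ hx hc) v)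
    (hD.sEig_comb γ hħ hx hv j a b), hne⟩

theorem algIndep_runge [Nonempty ι] (hN : 2 ≤ N) (hħ : ħ ≠ 0) (hm : 0 < m) (hn : 0 < n)
    (j : Fin N) : AlgIndep (famO ι ħ
      (((√2 : ℝ) : ℂ)⁻¹ • (D.raising ħ k γ m n j + D.lowering ħ k γ m n j))
      ((Complex.I * ((√2 : ℝ) : ℂ))⁻¹ • (D.raising ħ k γ m n j - D.lowering ħ k γ m n j))) := by
  refine algIndep_of_sEig (ħ := ħ) (famDeg (m + 2 * n) (m + 2 * n)) fun p hp => ?_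
  obtain ⟨x, hx, ξ, l, hl, hc, hne⟩ := hD.exists_runge hN hm hn j hp
  obtain ⟨v, hv0, hv⟩ := exists_angSym_eigenvector γ hħ hx hl hc
  have h1 := hD.sEig_raising γ hħ hx hv j
  have h2 := hD.sEig_lowering γ hħ hx hv j
  exact ⟨x, hx, ξ, v, hv0, _, sEig_famO hħ hx ((h1.add h2).smul _) ((h1.sub h2).smul _), hne⟩

/-- The scalar integrals of motion. -/
theorem exists_reduction [Nonempty ι] (hN : 2 ≤ N) (hħ : ħ ≠ 0) (hn : 0 < n)
    (j : Fin N) {d : ℕ} (hd : m + 2 * n = d + 1) : ∃ P Q P' Q' : Op Ω,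
      D.raising ħ k γ m n j = sc ι P + angLO ħ γ Ω * sc ι Q ∧
      D.lowering ħ k γ m n j = sc ι P' + sc ι Q' * angLO ħ γ Ω ∧
      Commute P (D.ham ħ) ∧ Commute Q (D.ham ħ) ∧ Commute P' (D.ham ħ) ∧ Commute Q' (D.ham ħ) ∧
      OrdLE (d + 1) P ∧ OrdLE d Q ∧ OrdLE (d + 1) P' ∧ OrdLE d Q' ∧ Adj wt Q Q' ∧
      ∀ x ∈ Ω.carrier, ∀ ξ : Fin N → ℂ, ∀ l : ℂ, l ≠ 0 →
        l ^ 2 = casimirSym Finset.univ (fun i => ((x i : ℝ) : ℂ)) ξ →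
        HasSym ħ x ξ d Q ((2 * l)⁻¹ * (D.xVal k ((m : ℝ) / n) m n j x ξ l -
          (-1) ^ (m + n) * D.yVal k ((m : ℝ) / n) m n j x ξ l)) ∧
        HasSym ħ x ξ d Q' ((2 * l)⁻¹ * (D.yVal k ((m : ℝ) / n) m n j x ξ l -
          (-1) ^ (m + n) * D.xVal k ((m : ℝ) / n) m n j x ξ l)) := by
  have hn0 : (n : ℂ) ≠ 0 := by exact_mod_cast hn.ne'
  obtain ⟨P, Q, hS, hP, hQ⟩ := hD.exists_splits γ hN hħ hn
    (show (n : ℂ) * (((m : ℝ) / n : ℝ) : ℂ) = m by push_cast; field_simp) j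
  obtain ⟨P', hP'⟩ := hS.adj
  obtain ⟨Q', hQ'⟩ := hS.adj'
  have hw := hD.weight
  have hH := hD.ham_adj (hD.LSq_adj γ)
  have oP : OrdLE (d + 1) P := hd ▸ hS.ord
  have oQ : OrdLE d Q := by have := hS.ord_lt; rw [hd] at this; exact this
  have oP' := hP'.ordLE hw oP
  have oQ' := hQ'.ordLE hw oQ
  have hL := sAdj_angLO γ ħ hw hD.rot_adj
  have eX : D.raising ħ k γ m n j = sc ι P + angLO ħ γ Ω * sc ι Q := hS.eq
  -- The adjoint of P + LQ is P' + Q'L, and adjoints of matrices of operators are unique.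
  have eY : D.lowering ħ k γ m n j = sc ι P' + sc ι Q' * angLO ħ γ Ω := by
    have h := hD.sAdj_raising γ j
    rw [eX] at h
    exact h.unique hw ((sAdj_sc hP').add hw (hL.mul hw (sAdj_sc hQ')))
  refine ⟨P, Q, P', Q', eX, eY, hP, hQ, hP'.commute hw hH hP, hQ'.commute hw hH hQ, oP, oQ, oP',
    oQ', hQ', fun x hx ξ l hl hc => ⟨?_, ?_⟩⟩
  · rw [← D.xVal_neg]
    refine hasSym_of_eigenvalues γ hħ hx (X := D.raising ħ k γ m n j) oP oQ
      (f := fun l => D.xVal k ((m : ℝ) / n) m n j x ξ l) (fun v l hv => ?_)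
      (fun v l s t hv hs ht => ?_) hl hc
    · rw [← hd]; exact hD.sEig_raising γ hħ hx hv j
    · rw [eX]; exact sEig_split γ hħ hx hv hs ht
  · rw [← D.yVal_neg]
    refine hasSym_of_eigenvalues γ hħ hx (X := D.lowering ħ k γ m n j) oP' oQ'
      (f := fun l => D.yVal k ((m : ℝ) / n) m n j x ξ l) (fun v l hv => ?_)
      (fun v l s t hv hs ht => ?_) hl hc
    · rw [← hd]; exact hD.sEig_lowering γ hħ hx hv j
    · rw [eY]; exact sEig_split' γ hħ hx hv hs ht

/-- An operator the symbol of which is a combination of the symbols of the ladder integrals is not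
of lower order. -/
theorem not_ordLE_of_hasSym (hN : 2 ≤ N) (hm : 0 < m) (hn : 0 < n) (j : Fin N) {d : ℕ}
    {Q : Op Ω} {A B : ℂ → ℂ} (hA : ∀ l ≠ 0, A l ≠ 0) (hB : ∀ l ≠ 0, B l ≠ 0)
    (h : ∀ x ∈ Ω.carrier, ∀ ξ : Fin N → ℂ, ∀ l : ℂ, l ≠ 0 →
      l ^ 2 = casimirSym Finset.univ (fun i => ((x i : ℝ) : ℂ)) ξ →
      HasSym ħ x ξ d Q (A l * D.xVal k ((m : ℝ) / n) m n j x ξ l +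
        B l * D.yVal k ((m : ℝ) / n) m n j x ξ l)) {e : ℕ} (he : e < d) : ¬ OrdLE e Q := by
  intro h0
  obtain ⟨x, hx, ξ, l, hl, hc, hne⟩ := hD.exists_ham hN hm hn j A B hA hB
    (p := MvPolynomial.X (.inr (.inr 1))) (MvPolynomial.X_ne_zero _)
  rw [MvPolynomial.eval_X] at hne
  exact hne ((h x hx ξ l hl hc).unique hx (h0.hasSym_zero he))

theorem ham_rot (i j : Fin N) : Commute (rotO ħ Ω i j) (D.ham ħ) :=
  (hD.h0_rad.rot i j).add_right ((hD.h1_rad.rot i j).mul_right (rotO_commute_LSqO ħ Ω i j))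

theorem casimirO_commute_ham (S : Finset (Fin N)) : Commute (casimirO ħ Ω S) (D.ham ħ) :=
  casimirO_commute_of_rotO ħ Ω S fun i _ j _ => hD.ham_rot i j

end RadialModel.IsLadder

theorem conj_inv_sqrt_two : (starRingEnd ℂ) ((√2 : ℝ) : ℂ)⁻¹ = ((√2 : ℝ) : ℂ)⁻¹ := by
  rw [map_inv₀, Complex.conj_ofReal]

theorem conj_inv_I_mul_sqrt_two : (starRingEnd ℂ) (Complex.I * ((√2 : ℝ) : ℂ))⁻¹ =
    -(Complex.I * ((√2 : ℝ) : ℂ))⁻¹ := by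
  rw [map_inv₀, map_mul, Complex.conj_I, Complex.conj_ofReal, neg_mul, inv_neg]

theorem RadialModel.IsLadder.generateIntegrals [Nonempty ι]
    (hD : D.IsLadder ħ k ((m : ℝ) / n) wt ι) (γ : GammaMatrices N ι) (hN : 2 ≤ N) (hħ : ħ ≠ 0)
    (hm : 0 < m) (hn : 0 < n) (j : Fin N) {H : ScalarOp Ω} (hH : opOf H = D.ham ħ)
    {X Y : SpinOp Ω ι} (hX : X = D.raising ħ k γ m n j) (hY : Y = D.lowering ħ k γ m n j) :
    GenerateIntegrals ħ γ Ω wt H X Y (m + 2 * n) := by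
  have hw := hD.weight
  have hs : ((√2 : ℝ) : ℂ)⁻¹ ≠ 0 := inv_ne_zero (by
    exact_mod_cast (Real.sqrt_pos.mpr (by norm_num : (0 : ℝ) < 2)).ne')
  have ht : (Complex.I * ((√2 : ℝ) : ℂ))⁻¹ ≠ 0 := by
    rw [mul_inv]; exact mul_ne_zero (inv_ne_zero Complex.I_ne_zero) hs
  have hA := hD.sAdj_raising γ j
  have a1 := ((hA.add hw hA.symm).smul ((√2 : ℝ) : ℂ)⁻¹)
  rw [conj_inv_sqrt_two, add_comm (D.lowering ħ k γ m n j)] at a1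
  have a2 := ((hA.sub hw hA.symm).smul (Complex.I * ((√2 : ℝ) : ℂ))⁻¹)
  rw [conj_inv_I_mul_sqrt_two, neg_smul, ← smul_neg, neg_sub] at a2
  have cX := hD.raising_commute γ hħ hn j
  have cY := hD.lowering_commute γ hħ hn j
  have c1 := (cX.add_left cY).smul_left ((√2 : ℝ) : ℂ)⁻¹
  have c2 := (cX.sub_left cY).smul_left (Complex.I * ((√2 : ℝ) : ℂ))⁻¹
  have e1 : ((√2 : ℝ) : ℂ)⁻¹ • D.raising ħ k γ m n j + ((√2 : ℝ) : ℂ)⁻¹ • D.lowering ħ k γ m n j =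
      ((√2 : ℝ) : ℂ)⁻¹ • (D.raising ħ k γ m n j + D.lowering ħ k γ m n j) := (smul_add _ _ _).symm
  have e2 : (Complex.I * ((√2 : ℝ) : ℂ))⁻¹ • D.raising ħ k γ m n j +
      (-(Complex.I * ((√2 : ℝ) : ℂ))⁻¹) • D.lowering ħ k γ m n j =
      (Complex.I * ((√2 : ℝ) : ℂ))⁻¹ • (D.raising ħ k γ m n j - D.lowering ħ k γ m n j) := by
    rw [smul_sub, neg_smul, sub_eq_add_neg]
  have o1 := hD.ord_comb γ hN hħ hm hn j hs hs
  have o2 := hD.ord_comb γ hN hħ hm hn j ht (neg_ne_zero.mpr ht)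
  have i1 := hD.algIndep_ham_comb γ hN hħ hm hn j hs hs
  have i2 := hD.algIndep_ham_comb γ hN hħ hm hn j ht (neg_ne_zero.mpr ht)
  have i3 := hD.algIndep_runge γ hN hħ hm hn j
  rw [e1] at o1 i1
  rw [e2] at o2 i2
  have cC := fun S => hD.casimirO_commute_ham S
  obtain ⟨d, hd⟩ : ∃ d, m + 2 * n = d + 1 := ⟨m + 2 * n - 1, by omega⟩
  obtain ⟨P, Q, P', Q', eX, eY, hP, hQ, hP', hQ', oP, oQ, oP', oQ', -, hsym⟩ :=
    hD.exists_reduction γ hN hħ hn j hd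
  have h2 : ∀ l : ℂ, l ≠ 0 → (2 * l)⁻¹ ≠ 0 := fun l hl => inv_ne_zero (mul_ne_zero two_ne_zero hl)
  have h3 : ∀ l : ℂ, l ≠ 0 → -((2 * l)⁻¹ * (-1) ^ (m + n)) ≠ 0 := fun l hl =>
    neg_ne_zero.mpr (mul_ne_zero (h2 l hl) (pow_ne_zero _ (neg_ne_zero.mpr one_ne_zero)))
  have nQ : ¬ OrdLE (m + 2 * n - 2) Q := hD.not_ordLE_of_hasSym hN hm hn j (d := d) h2 h3
    (fun x hx ξ l hl hc => by
      have h := (hsym x hx ξ l hl hc).1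
      rw [mul_sub, ← mul_assoc, sub_eq_add_neg, ← neg_mul] at h
      exact h) (by omega)
  have nQ' : ¬ OrdLE (m + 2 * n - 2) Q' := hD.not_ordLE_of_hasSym hN hm hn j (d := d) h3 h2
    (fun x hx ξ l hl hc => by
      have h := (hsym x hx ξ l hl hc).2
      rw [mul_sub, ← mul_assoc, sub_eq_add_neg, ← neg_mul, add_comm] at h
      exact h) (by omega)
  obtain rfl : H = D.ham ħ := hH
  subst hX hY
  rw [← hd] at oP oP'
  obtain rfl : d = m + 2 * n - 1 := by omega
  exact
    { adjoint := hA.isFormalAdjoint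
      symmetric_one := a1.isFormalAdjoint
      symmetric_two := a2.isFormalAdjoint
      commute_one := c1
      commute_two := c2
      order_one := ⟨fun s t => hasOrderLE_iff.mpr (o1.1 s t),
        fun h => o1.2 fun s t => hasOrderLE_iff.mp (h s t)⟩
      order_two := ⟨fun s t => hasOrderLE_iff.mpr (o2.1 s t),
        fun h => o2.2 fun s t => hasOrderLE_iff.mp (h s t)⟩
      commute_first := fun a _ _ => cC _
      commute_last := fun a _ _ => cC _
      indep_ham_one := AlgIndep.integralFamily i1
      indep_ham_two := AlgIndep.integralFamily i2
      indep_one_two := AlgIndep.integralFamily i3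
      reduction := ⟨P, Q, eX, hP, hQ, hasOrderLE_iff.mpr oP, hasOrderLE_iff.mpr oQ,
        fun h => nQ (hasOrderLE_iff.mp h)⟩
      reduction_adjoint := ⟨P', Q', eY, hP', hQ', hasOrderLE_iff.mpr oP', hasOrderLE_iff.mpr oQ',
        fun h => nQ' (hasOrderLE_iff.mp h)⟩ }

end generate

/-! ### Maximal superintegrability -/

section maximal
variable {Ω : Region N}

/-- The scalar Casimir operators together with two further scalar operators. -/
def scalarFam (ħ : ℝ) (F G : Op Ω) : Fin (N - 1) ⊕ Fin (N - 2) ⊕ Fin 2 → Op Ω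
  | .inl a => casimirO ħ Ω {i | (i : ℕ) < a + 2}
  | .inr (.inl a) => casimirO ħ Ω {i | N ≤ (i : ℕ) + (a + 2)}
  | .inr (.inr e) => if e = 0 then F else G

theorem sc_scalarFam (ι : Type*) [Fintype ι] [DecidableEq ι] (ħ : ℝ) (F G : Op Ω)
    (s : Fin (N - 1) ⊕ Fin (N - 2) ⊕ Fin 2) :
    sc ι (scalarFam ħ F G s) = famO ι ħ (sc ι F) (sc ι G) s := by
  rcases s with c | c | e
  · rfl
  · rfl
  · by_cases he : e = 0
    · simp only [scalarFam, famO, if_pos he]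
    · simp only [scalarFam, famO, if_neg he]

/-- A property of the Casimir operators and of two further operators holds for the family. -/
theorem scalarFam_induction {ħ : ℝ} {F G : Op Ω} {p : Op Ω → Prop}
    (hC : ∀ S, p (casimirO ħ Ω S)) (hF : p F) (hG : p G)
    (s : Fin (N - 1) ⊕ Fin (N - 2) ⊕ Fin 2) : p (scalarFam ħ F G s) := by
  rcases s with c | c | e
  · exact hC _
  · exact hC _
  · by_cases he : e = 0
    · simp only [scalarFam, if_pos he]; exact hF
    · simp only [scalarFam, if_neg he]; exact hG

theorem casimirO_first_commute (ħ : ℝ) (a b : ℕ) :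
    Commute (casimirO ħ Ω {i : Fin N | (i : ℕ) < a}) (casimirO ħ Ω {i : Fin N | (i : ℕ) < b}) := by
  rcases le_total a b with h | h
  · exact casimirO_commute_of_subset ħ Ω fun i hi => by
      simp only [Finset.mem_filter, Finset.mem_univ, true_and] at hi ⊢; omega
  · exact (casimirO_commute_of_subset ħ Ω fun i hi => by
      simp only [Finset.mem_filter, Finset.mem_univ, true_and] at hi ⊢; omega).symm

/-- The indices of the mutually commuting operators. -/
def commutingIndices (N : ℕ) : Finset (Fin (N - 1) ⊕ Fin (N - 2) ⊕ Fin 2) :=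
  insert (.inr (.inr 0)) (Finset.univ.map Function.Embedding.inl)

theorem card_commutingIndices (hN : 2 ≤ N) : (commutingIndices N).card = N := by
  rw [commutingIndices, Finset.card_insert_of_notMem (by simp), Finset.card_map, Finset.card_univ,
    Fintype.card_fin]
  omega

theorem scalarFam_commute {ħ : ℝ} {F G : Op Ω} (hF : ∀ S, Commute (casimirO ħ Ω S) F)
    {s t : Fin (N - 1) ⊕ Fin (N - 2) ⊕ Fin 2} (hs : s ∈ commutingIndices N)
    (ht : t ∈ commutingIndices N) : Commute (scalarFam ħ F G s) (scalarFam ħ F G t) := by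
  simp only [commutingIndices, Finset.mem_insert, Finset.mem_map, Finset.mem_univ, true_and,
    Function.Embedding.inl_apply] at hs ht
  rcases hs with rfl | ⟨a, rfl⟩ <;> rcases ht with rfl | ⟨b, rfl⟩
  · exact Commute.refl _
  · exact (hF _).symm
  · exact hF _
  · exact casimirO_first_commute ħ _ _

theorem RadialModel.IsLadder.isMaximallySuperintegrable {ι : Type*} [Fintype ι] [DecidableEq ι]
    [Nonempty ι] {ħ k : ℝ} {D : RadialModel Ω} {wt : Space N → ℝ} {m n : ℕ}
    (hD : D.IsLadder ħ k ((m : ℝ) / n) wt ι) (γ : GammaMatrices N ι) (hN : 2 ≤ N) (hħ : ħ ≠ 0)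
    (hm : 0 < m) (hn : 0 < n) (hcas : ∀ S, Adj wt (casimirO ħ Ω S) (casimirO ħ Ω S))
    {H : ScalarOp Ω} (hH : opOf H = D.ham ħ) : IsMaximallySuperintegrable wt H := by
  have hw := hD.weight
  let j : Fin N := ⟨0, by omega⟩
  obtain ⟨d, hd⟩ : ∃ d, m + 2 * n = d + 1 := ⟨m + 2 * n - 1, by omega⟩
  obtain ⟨P, Q, P', Q', -, -, -, hQ, -, hQ', -, oQ, -, oQ', hadj, hsym⟩ :=
    hD.exists_reduction γ hN hħ hn j hd
  obtain ⟨σ, hσ⟩ : ∃ σ : ℂ, σ = (-1) ^ (m + n) := ⟨_, rfl⟩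
  -- R = cQ - σcQ' is symmetric exactly if the conjugate of c is -σc for the sign σ = (-1)^(m+n):
  -- take c = i for σ = 1 and c = 1 for σ = -1.
  obtain ⟨c, hc0, hcσ, hσ2⟩ : ∃ c : ℂ, c ≠ 0 ∧ (starRingEnd ℂ) c = -(σ * c) ∧ σ * σ = 1 := by
    rcases Nat.even_or_odd (m + n) with h | h
    · exact ⟨Complex.I, Complex.I_ne_zero, by rw [hσ, h.neg_one_pow, Complex.conj_I, one_mul],
        by rw [hσ, h.neg_one_pow, one_mul]⟩
    · exact ⟨1, one_ne_zero, by rw [hσ, h.neg_one_pow, map_one]; norm_num,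
        by rw [hσ, h.neg_one_pow]; norm_num⟩
  have hσ0 : σ ≠ 0 := fun h => by rw [h, zero_mul] at hσ2; exact zero_ne_one hσ2
  obtain ⟨R, hR⟩ : ∃ R : Op Ω, R = c • Q + (-(σ * c)) • Q' := ⟨_, rfl⟩
  have aR : Adj wt R R := by
    have h := (hadj.smul c).add hw (hadj.symm.smul (-(σ * c)))
    rwa [hcσ, ← hcσ, Complex.conj_conj, hcσ, add_comm (_ • Q'), ← hR] at h
  have oR : OrdLE d R := hR ▸ (oQ.smul _).add (oQ'.smul _)
  have cR : Commute R (D.ham ħ) := hR ▸ (hQ.smul_left _).add_left (hQ'.smul_left _)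
  -- The symbols of Q and -σQ' coincide, so with this choice of signs they add up; the combination
  -- cQ + σcQ' would lose its leading symbol.
  have sR : ∀ x ∈ Ω.carrier, ∀ ξ : Fin N → ℂ, ∀ l : ℂ, l ≠ 0 →
      l ^ 2 = casimirSym Finset.univ (fun i => ((x i : ℝ) : ℂ)) ξ →
      HasSym ħ x ξ d R (c / l * D.xVal k ((m : ℝ) / n) m n j x ξ l +
        -(σ * c / l) * D.yVal k ((m : ℝ) / n) m n j x ξ l) := by
    intro x hx ξ l hl hc
    obtain ⟨h1, h2⟩ := hsym x hx ξ l hl hc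
    have h := (h1.smul c).add (h2.smul (-(σ * c)))
    rw [← hR, ← hσ] at h
    convert h using 1
    field_simp
    linear_combination (-(D.xVal k ((m : ℝ) / n) m n j x ξ l)) * hσ2
  obtain rfl : H = D.ham ħ := hH
  let e : Fin (2 * N - 1) ≃ Fin (N - 1) ⊕ Fin (N - 2) ⊕ Fin 2 :=
    (Fintype.equivFinOfCardEq (by
      simp only [Fintype.card_sum, Fintype.card_fin]; omega)).symm
  have cC := fun S => hD.casimirO_commute_ham S
  have hind : AlgIndep fun i => scalarFam ħ (D.ham ħ) R (e i) := by
    refine AlgIndep.of_map (sc ι) ?_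
    simp only [sc_scalarFam]
    refine algIndep_comp_of_sEig (ħ := ħ) e (famDeg 2 d) fun p hp => ?_
    obtain ⟨x, hx, ξ, l, hl, hc, hne⟩ := hD.exists_ham hN hm hn j (fun l => c / l)
      (fun l => -(σ * c / l)) (fun l hl => div_ne_zero hc0 hl)
      (fun l hl => neg_ne_zero.mpr (div_ne_zero (mul_ne_zero hσ0 hc0) hl)) hp
    obtain ⟨v, hv0, hv⟩ := exists_angSym_eigenvector γ hħ hx hl hc
    exact ⟨x, hx, ξ, v, hv0, _, sEig_famO hħ hx (sEig_sc (hD.hasSym_ham hħ hx hc) v)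
      (sEig_sc (sR x hx ξ l hl hc) v), hne⟩
  refine ⟨fun i => scalarFam ħ (D.ham ħ) R (e i), fun i => ?_, fun i => ?_, fun i => ?_, hind,
    (commutingIndices N).map e.symm.toEmbedding, ?_, ?_, ?_⟩
  · obtain ⟨x, hx⟩ := Ω.nonempty
    obtain ⟨d', hd'⟩ := scalarFam_induction (ħ := ħ) (F := D.ham ħ) (G := R)
      (p := fun P => ∃ d, OrdLE d P)
      (fun S => ⟨2, (hasSym_casimirO (ξ := 0) hħ hx S).ord⟩) ⟨2, hD.ham_ord⟩ ⟨d, oR⟩ (e i)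
    exact ⟨d', hasOrderLE_iff.mpr hd'⟩
  · exact (scalarFam_induction (ħ := ħ) (F := D.ham ħ) (G := R) (p := fun P => Adj wt P P) hcas
      (hD.ham_adj (hD.LSq_adj γ)) aR (e i)).isFormalAdjoint
  · exact scalarFam_induction (ħ := ħ) (F := D.ham ħ) (G := R)
      (p := fun P => Commute P (D.ham ħ)) cC (Commute.refl _) cR (e i)
  · rw [Finset.card_map, card_commutingIndices hN]
  · refine ⟨e.symm (.inr (.inr 0)), Finset.mem_map_of_mem _ (Finset.mem_insert_self _ _), ?_⟩
    exact congrArg (scalarFam ħ (D.ham ħ) R) (e.apply_symm_apply (.inr (.inr 0)))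
  · intro i hi i' hi'
    rw [Finset.mem_map_equiv, Equiv.symm_symm] at hi hi'
    exact scalarFam_commute cC hi hi'

/-- Only β² enters the Hamiltonians, so a negative β is replaced by its absolute value, which is a
quotient m/n of positive integers. -/
theorem abs_ratCast (β : ℚ) : |(β : ℝ)| = (β.num.natAbs : ℝ) / β.den := by
  conv_lhs => rw [Rat.cast_def]
  rw [abs_div, Nat.abs_cast, Nat.cast_natAbs, Int.cast_abs]

theorem ofReal_abs_sq (β : ℝ) : ((|β| : ℝ) : ℂ) ^ 2 = (β : ℂ) ^ 2 := by
  rw [← Complex.ofReal_pow, sq_abs, Complex.ofReal_pow]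

theorem hamiltonian_abs (ħ k μ β : ℝ) :
    hamiltonian ħ k μ |β| Ω = hamiltonian ħ k μ β Ω := by
  simp only [hamiltonian, ofReal_abs_sq]

theorem hatHamiltonian_abs (ħ k μ' δ β : ℝ) (hΩ : Admissible k δ Ω) :
    hatHamiltonian ħ k μ' δ |β| Ω hΩ = hatHamiltonian ħ k μ' δ β Ω hΩ := by
  simp only [hatHamiltonian, ofReal_abs_sq]

theorem div_natCast_ne_zero {m n : ℕ} (hm : 0 < m) (hn : 0 < n) : (m : ℝ) / n ≠ 0 :=
  div_ne_zero (Nat.cast_ne_zero.mpr hm.ne') (Nat.cast_ne_zero.mpr hn.ne')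

theorem isMaximallySuperintegrable_hamiltonian (hN : 2 ≤ N) {ħ : ℝ} (hħ : ħ ≠ 0) (k μ : ℝ)
    (Ω : Region N) {β : ℚ} (hβ : β ≠ 0) :
    IsMaximallySuperintegrable (weight k) (hamiltonian ħ k μ (β : ℝ) Ω) := by
  -- The statement is about scalar operators; any choice of gamma matrices serves to construct the
  -- scalar integral R.
  obtain ⟨d, hd, ⟨γ⟩⟩ := GammaMatrices.exists N
  have : Nonempty (Fin d) := ⟨⟨0, hd⟩⟩
  have hm := Int.natAbs_pos.mpr (Rat.num_ne_zero.mpr hβ)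
  rw [← hamiltonian_abs, abs_ratCast]
  exact (coulombModel_isLadder hħ μ (div_natCast_ne_zero hm β.pos)).isMaximallySuperintegrable γ hN
    hħ hm β.pos (fun S => adj_casimirO_weight ħ k S) (hamiltonian_eq ħ k μ _ Ω)

theorem isMaximallySuperintegrable_hatHamiltonian (hN : 2 ≤ N) {ħ : ℝ} (hħ : ħ ≠ 0)
    {k δ : ℝ} (μ' : ℝ) (hΩ : Admissible k δ Ω) {β : ℚ} (hβ : β ≠ 0) :
    IsMaximallySuperintegrable (hatWeight k δ) (hatHamiltonian ħ k μ' δ (β : ℝ) Ω hΩ) := by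
  obtain ⟨d, hd, ⟨γ⟩⟩ := GammaMatrices.exists N
  have : Nonempty (Fin d) := ⟨⟨0, hd⟩⟩
  have hm := Int.natAbs_pos.mpr (Rat.num_ne_zero.mpr hβ)
  rw [← hatHamiltonian_abs, abs_ratCast]
  exact (hatModel_isLadder hħ μ' (div_natCast_ne_zero hm β.pos) hΩ).isMaximallySuperintegrable γ hN
    hħ hm β.pos (fun S => adj_casimirO_hatWeight ħ hΩ S) (hatHamiltonian_eq ħ k μ' δ _ hΩ)

end maximal

end CurvedCoulomb

end

theorem mainTheorem2 {N : ℕ} (hN : 2 ≤ N) (ħ k μ μ' δ : ℝ) (hħ : 0 < ħ)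
    (Ω : CurvedCoulomb.Region N) {ι : Type*} [Fintype ι] [DecidableEq ι] [Nonempty ι]
    (γ : CurvedCoulomb.GammaMatrices N ι) :
    (∀ m n : ℕ, 0 < m → 0 < n → ∀ j : Fin N,
      CurvedCoulomb.GenerateIntegrals ħ γ Ω (CurvedCoulomb.weight k)
        (CurvedCoulomb.hamiltonian ħ k μ ((m : ℝ) / n) Ω)
        (CurvedCoulomb.raisingIntegral ħ k μ γ Ω m n j)
        (CurvedCoulomb.loweringIntegral ħ k μ γ Ω m n j) (m + 2 * n)) ∧
    (∀ β : ℚ, β ≠ 0 →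
      CurvedCoulomb.IsMaximallySuperintegrable (CurvedCoulomb.weight k)
        (CurvedCoulomb.hamiltonian ħ k μ (β : ℝ) Ω)) ∧
    ∀ hΩ : CurvedCoulomb.Admissible k δ Ω,
      (∀ m n : ℕ, 0 < m → 0 < n → ∀ j : Fin N,
        CurvedCoulomb.GenerateIntegrals ħ γ Ω (CurvedCoulomb.hatWeight k δ)
          (CurvedCoulomb.hatHamiltonian ħ k μ' δ ((m : ℝ) / n) Ω hΩ)
          (CurvedCoulomb.hatRaisingIntegral ħ k μ' δ γ Ω hΩ m n j)
          (CurvedCoulomb.hatLoweringIntegral ħ k μ' δ γ Ω hΩ m n j) (m + 2 * n)) ∧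
      (∀ β : ℚ, β ≠ 0 →
        CurvedCoulomb.IsMaximallySuperintegrable (CurvedCoulomb.hatWeight k δ)
          (CurvedCoulomb.hatHamiltonian ħ k μ' δ (β : ℝ) Ω hΩ)) := by
  open CurvedCoulomb in
  exact ⟨fun m n hm hn j =>
      (coulombModel_isLadder hħ.ne' μ (div_natCast_ne_zero hm hn)).generateIntegrals γ hN hħ.ne'
        hm hn j (hamiltonian_eq ħ k μ _ Ω) (raisingIntegral_eq ħ k μ γ m n j)
        (loweringIntegral_eq ħ k μ γ m n j),
    fun _ hβ => isMaximallySuperintegrable_hamiltonian hN hħ.ne' k μ Ω hβ,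
    fun hΩ => ⟨fun m n hm hn j =>
      (hatModel_isLadder hħ.ne' μ' (div_natCast_ne_zero hm hn) hΩ).generateIntegrals γ hN hħ.ne'
        hm hn j (hatHamiltonian_eq ħ k μ' δ _ hΩ) (hatRaisingIntegral_eq ħ k μ' δ γ hΩ m n j)
        (hatLoweringIntegral_eq ħ k μ' δ γ hΩ m n j),
    fun _ hβ => isMaximallySuperintegrable_hatHamiltonian hN hħ.ne' μ' hΩ hβ⟩⟩
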